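/- For $a>0$ and $\gamma\in\mathbb R$ let $\theta(x)=0$ for $x<0$, $\theta(x)=-\pi$ for $x>0$, and consider the driven $0$-$\pi$ sine-Gordon equation with lattice correction, for $x\ne0$, $$\phi_{xx}=\phi_{tt}+\sin(\phi+\theta)-\gamma-\frac{a^2}{12}\Big(2\phi_{xxtt}+2\phi_{xx}\cos(\phi+\theta)-\phi_x^2\sin(\phi+\theta)-\phi_{tttt}-\phi_{tt}\cos(\phi+\theta)+\phi_t^2\sin(\phi+\theta)-\cos(\phi+\theta)\big(\phi_{tt}+\sin(\phi+\theta)-\gamma\big)\Big).\qquad(\ast)$$ For $|\gamma|<1$, a *$\pi$-kink* is a static solution $\phi\in C^1(\mathbb R)$ of $(\ast)$ with $\phi_x\in H^1(\mathbb R)$, $\phi(-\infty)=\arcsin\gamma$ and $\phi(+\infty)=\pi+\arcsin\gamma$. Let $\gamma_{cr}(a)$ be the supremum of the $\gamma$ for which a $\pi$-kink exists. The *type 1* kink is the strictly increasing $\pi$-kink whose junction point $(\phi(0),\phi_x(0))$ comes first along the orbit of the $x<0$ phase plane that leaves $(\arcsin\gamma,0)$; that is, for every $\pi$-kink $\psi$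 for the same $a,\gamma$ there is $s\ge0$ with $\phi(x)=\psi(x-s)$ for all $x\le0$. A real number $\Lambda$ is an *eigenvalue* of the linearization about a $\pi$-kink $\phi$ if there is a nonzero real function $v\in H^2(\mathbb R)$ such that $e^{\lambda t}v(x)$, $\lambda^2=\Lambda$, solves the linearization of $(\ast)$ about $\phi$ for $x\neq0$, i.e. with $\widetilde\phi=\phi+\theta$ $$v_{xx}-\cos\widetilde\phi\,v+\frac{a^2}{12}\Big[2\Lambda v_{xx}+2\cos\widetilde\phi\,v_{xx}-2\phi_x\sin\widetilde\phi\,v_x-2\phi_{xx}\sin\widetilde\phi\,v-\phi_x^2\cos\widetilde\phi\,v-\Lambda^2v-2\Lambda\cos\widetilde\phi\,v-\big(\cos^2\widetilde\phi-\sin^2\widetilde\phi+\gamma\sin\widetilde\phi\big)v\Big]=\Lambda v .$$ **Lemma 4.5.** There is $a_0>0$ such that for all $0<a<a_0$ one has $\gamma_{cr}(a)>0$, for every $0\le\gamma\le\gamma_{cr}(a)$ there is exactly one type 1 kink, and: 1. for $0\le\gamma<\gamma_{cr}(a)$ the linearization about the type 1 kink has a largest eigenvalue, and it is strictly negative; 2.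 for $\gamma=\gamma_{cr}(a)$ the largest eigenvalue is $0$; 3. for $\gamma=0$ the largest eigenvalue $\Lambda(a)$ is strictly decreasing in $a\in(0,a_0)$, and there is a constant $C$ with $$\Big|\Lambda(a)-\Big(-\frac{\sqrt5+1}{4}+\Lambda_1a^2\Big)\Big|\le C a^4\quad(0<a<a_0),\qquad \Lambda_1=\frac{3584\,\big(70\sqrt2(1+\sqrt5)-99(1+\sqrt5)\big)}{24576\,\big(-70\sqrt{10}-350\sqrt2+495+99\sqrt5\big)},$$ where $|\Lambda_1+0.0652|<0.00005$. -/

import Mathlib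

open Real Set Filter Topology MeasureTheory

noncomputable section

namespace PiKink

/-- The phase jump: `0` on the left of the discontinuity point `x = 0` and `-π` on its right.
(The value at `x = 0` itself is never used.) -/
def theta (x : ℝ) : ℝ := if x < 0 then 0 else -π

/-- The lattice-corrected driven `0`-`π` sine-Gordon equation, as a function of the values of `θ`,
`φ`, `φ_x`, `φ_t`, `φ_xx`, `φ_tt`, `φ_xxtt`, `φ_tttt` at one point: the equation is
`residual = 0`, that is
`φ_xx = φ_tt + sin (φ + θ) - γ - a² / 12 * (2 φ_xxtt + 2 φ_xx cos (φ + θ) - φ_x² sin (φ + θ)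
  - φ_tttt - φ_tt cos (φ + θ) + φ_t² sin (φ + θ) - cos (φ + θ) (φ_tt + sin (φ + θ) - γ))`. -/
def residual (a γ θ u ux ut uxx utt uxxtt utttt : ℝ) : ℝ :=
  uxx - (utt + sin (u + θ) - γ
    - a ^ 2 / 12 * (2 * uxxtt + 2 * uxx * cos (u + θ) - ux ^ 2 * sin (u + θ) - utttt
      - utt * cos (u + θ) + ut ^ 2 * sin (u + θ)
      - cos (u + θ) * (utt + sin (u + θ) - γ)))

/-- Static `π`-kinks: continuously differentiable functions with spatial derivative in `H¹(ℝ)`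
that solve the static equation for `x ≠ 0` and connect the equilibria `arcsin γ` (at `-∞`) and
`π + arcsin γ` (at `+∞`). -/
structure IsPiKink (a γ : ℝ) (φ : ℝ → ℝ) : Prop where
  abs_lt_one : |γ| < 1
  contDiff : ContDiff ℝ 1 φ
  differentiableAt_deriv : ∀ x : ℝ, x ≠ 0 → DifferentiableAt ℝ (deriv φ) x
  static : ∀ x : ℝ, x ≠ 0 →
    residual a γ (theta x) (φ x) (deriv φ x) 0 (deriv (deriv φ) x) 0 0 0 = 0
  memLp_deriv : MemLp (deriv φ) 2
  memLp_deriv_deriv : MemLp (deriv (deriv φ)) 2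
  tendsto_atBot : Tendsto φ atBot (𝓝 (arcsin γ))
  tendsto_atTop : Tendsto φ atTop (𝓝 (π + arcsin γ))

/-- The critical forcing: no static `π`-kink exists for larger `γ`. The set is bounded, since
`π`-kinks have `|γ| < 1`. -/
def gammaCr (a : ℝ) : ℝ := sSup {γ : ℝ | ∃ φ : ℝ → ℝ, IsPiKink a γ φ}

/-- The type 1 `π`-kink: the increasing `π`-kink whose junction point `(φ 0, φ' 0)` comes first
along the orbit of the `x < 0` phase plane that leaves the saddle point `(arcsin γ, 0)`; the left
part of any other `π`-kink `ψ` follows the same orbit for longer (by an amount `s`) before it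
reaches the junction. -/
structure IsType1Kink (a γ : ℝ) (φ : ℝ → ℝ) : Prop where
  isPiKink : IsPiKink a γ φ
  strictMono : StrictMono φ
  first : ∀ ψ : ℝ → ℝ, IsPiKink a γ ψ → ∃ s : ℝ, 0 ≤ s ∧ ∀ x : ℝ, x ≤ 0 → φ x = ψ (x - s)

/-- The linearization of `residual` about a static solution with values `u`, `ux`, `uxx`,
in the direction of a perturbation `exp (λ t) v (x)` with `λ² = Λ`, divided by `exp (λ t)`. -/
def linearized (a γ θ u ux uxx Λ v vx vxx : ℝ) : ℝ :=
  vxx - cos (u + θ) * v - Λ * v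
    + a ^ 2 / 12 * (2 * Λ * vxx + 2 * cos (u + θ) * vxx - 2 * ux * sin (u + θ) * vx
      - 2 * uxx * sin (u + θ) * v - ux ^ 2 * cos (u + θ) * v - Λ ^ 2 * v
      - 2 * Λ * cos (u + θ) * v
      - (cos (u + θ) ^ 2 - sin (u + θ) ^ 2 + γ * sin (u + θ)) * v)

/-- `linearized` is the directional derivative of `residual` at a static state. Here `w` is the
value of the time derivative of the perturbation, which enters only quadratically. -/
theorem hasDerivAt_residual (a γ θ u ux uxx Λ v vx vxx w : ℝ) :
    HasDerivAt (fun ε : ℝ => residual a γ θ (u + ε * v) (ux + ε * vx) (ε * w) (uxx + ε * vxx)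
      (ε * (Λ * v)) (ε * (Λ * vxx)) (ε * (Λ ^ 2 * v)))
      (linearized a γ θ u ux uxx Λ v vx vxx) 0 := by
  have lin : ∀ p q : ℝ, HasDerivAt (fun ε : ℝ => p + ε * q) q 0 := fun p q => by
    simpa using ((hasDerivAt_id (0 : ℝ)).mul_const q).const_add p
  have lin0 : ∀ q : ℝ, HasDerivAt (fun ε : ℝ => ε * q) q 0 := fun q => by
    simpa using (hasDerivAt_id (0 : ℝ)).mul_const q
  have hu := (lin u v).add_const θ
  have hs := hu.sin
  have hc := hu.cos
  have h := (lin uxx vxx).sub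
    ((((lin0 (Λ * v)).add hs).sub_const γ).sub
      (((((((((lin0 (Λ * vxx)).const_mul 2).add (((lin uxx vxx).const_mul 2).mul hc)).sub
        (((lin ux vx).pow 2).mul hs)).sub (lin0 (Λ ^ 2 * v))).sub
        ((lin0 (Λ * v)).mul hc)).add (((lin0 w).pow 2).mul hs)).sub
        (hc.mul (((lin0 (Λ * v)).add hs).sub_const γ))).const_mul (a ^ 2 / 12)))
  refine (h.congr_deriv ?_)
  simp only [linearized, Pi.add_apply, Pi.pow_apply]
  norm_num
  ring

/-- `v` is an eigenfunction of the linearization about `φ` for the spectral parameter `Λ = λ²`: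
a nonzero, continuously differentiable function in `H²(ℝ)` that solves the linearized equation
for `x ≠ 0`. -/
structure IsEigenfunction (a γ : ℝ) (φ : ℝ → ℝ) (Λ : ℝ) (v : ℝ → ℝ) : Prop where
  ne_zero : v ≠ 0
  contDiff : ContDiff ℝ 1 v
  differentiableAt_deriv : ∀ x : ℝ, x ≠ 0 → DifferentiableAt ℝ (deriv v) x
  memLp : MemLp v 2
  memLp_deriv : MemLp (deriv v) 2
  memLp_deriv_deriv : MemLp (deriv (deriv v)) 2
  eqn : ∀ x : ℝ, x ≠ 0 →
    linearized a γ (theta x) (φ x) (deriv φ x) (deriv (deriv φ) x)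
      Λ (v x) (deriv v x) (deriv (deriv v) x) = 0

/-- The set of (real) eigenvalues `Λ = λ²` of the linearization about `φ`. -/
def eigenvalues (a γ : ℝ) (φ : ℝ → ℝ) : Set ℝ :=
  {Λ : ℝ | ∃ v : ℝ → ℝ, IsEigenfunction a γ φ Λ v}

/-- The coefficient of `a²` in the largest eigenvalue at `γ = 0`. -/
def Lambda1 : ℝ :=
  3584 * (70 * √2 * (1 + √5) - 99 * (1 + √5)) /
    (24576 * (-70 * √10 - 350 * √2 + 495 + 99 * √5))

end PiKink

end

noncomputable section
-- Uniqueness by Grönwall, and linear Volterra systems with a parameter.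
namespace PiKink

/-- A nonnegative function whose derivative is controlled by the function itself vanishes
identically on an interval as soon as it vanishes at one point. -/
theorem eq_zero_of_abs_deriv_le {E E' : ℝ → ℝ} {s : Set ℝ} (hs : Convex ℝ s) {C : ℝ}
    (hc : ContinuousOn E s) (hd : ∀ x ∈ interior s, HasDerivAt E (E' x) x)
    (hE : ∀ x ∈ s, 0 ≤ E x) (hb : ∀ x ∈ interior s, |E' x| ≤ C * E x)
    {x₀ : ℝ} (hx₀ : x₀ ∈ s) (h0 : E x₀ = 0) : ∀ x ∈ s, E x = 0 := by
  have key : ∀ k : ℝ, ∀ x, x ∈ interior s → HasDerivAt (fun x => Real.exp (k * x) * E x)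
      (Real.exp (k * x) * (k * E x + E' x)) x := by
    intro k x hx
    have h1 : HasDerivAt (fun x : ℝ => Real.exp (k * x)) (Real.exp (k * x) * k) x := by
      simpa using ((hasDerivAt_id x).const_mul k).exp
    exact (h1.mul (hd x hx)).congr_deriv (by ring)
  have kc : ∀ k : ℝ, ContinuousOn (fun x => Real.exp (k * x) * E x) s := fun k =>
    (by fun_prop : ContinuousOn (fun x => Real.exp (k * x)) s).mul hc
  -- The two integrating factors act in opposite directions: `exp (C x) E` increases, which gives `E
  -- ≤ 0` to the left of the zero, and `exp (-C x) E` decreases, which gives it to the right.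
  have mono : MonotoneOn (fun x => Real.exp (C * x) * E x) s := by
    apply monotoneOn_of_deriv_nonneg hs (kc C)
    · exact fun x hx => (key C x hx).differentiableAt.differentiableWithinAt
    · intro x hx
      rw [(key C x hx).deriv]
      have := (abs_le.1 (hb x hx)).1
      exact mul_nonneg (Real.exp_pos _).le (by linarith)
  have anti : AntitoneOn (fun x => Real.exp (-C * x) * E x) s := by
    apply antitoneOn_of_deriv_nonpos hs (kc (-C))
    · exact fun x hx => (key (-C) x hx).differentiableAt.differentiableWithinAt
    · intro x hx
      rw [(key (-C) x hx).deriv]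
      have := (abs_le.1 (hb x hx)).2
      exact mul_nonpos_of_nonneg_of_nonpos (Real.exp_pos _).le (by linarith)
  intro x hx
  refine le_antisymm ?_ (hE x hx)
  rcases le_total x x₀ with h | h
  · have := mono hx hx₀ h
    simp only [h0, mul_zero] at this
    exact nonpos_of_mul_nonpos_right this (Real.exp_pos _)
  · have := anti hx₀ hx h
    simp only [h0, mul_zero] at this
    exact nonpos_of_mul_nonpos_right this (Real.exp_pos _)

section Volterra

variable {X : Type*} [TopologicalSpace X]

/-- Evaluation of a function on `[0, 1] × X` at a real first argument clamped to `[0, 1]`. -/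
def clampEval (G : C(unitInterval × X, ℝ)) (t : ℝ) (y : X) : ℝ :=
  G (projIcc 0 1 zero_le_one t, y)

theorem continuous_clampEval (G : C(unitInterval × X, ℝ)) :
    Continuous fun q : ℝ × X => clampEval G q.1 q.2 :=
  G.continuous.comp ((continuous_projIcc.comp continuous_fst).prodMk continuous_snd)

theorem abs_clampEval_le [CompactSpace X] (G : C(unitInterval × X, ℝ)) (t : ℝ) (y : X) :
    |clampEval G t y| ≤ ‖G‖ := G.norm_coe_le_norm _

/-- The Volterra-type integral `t ∫₀¹ κ(y, θ) exp (-N t (1 - θ)) G (t θ, y) dθ`. -/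
def volterra (κ : C(X × ℝ, ℝ)) (N : ℝ) (G : C(unitInterval × X, ℝ)) : C(unitInterval × X, ℝ) where
  toFun z := (z.1 : ℝ) * ∫ θ in (0 : ℝ)..1,
    κ (z.2, θ) * Real.exp (-N * z.1 * (1 - θ)) * clampEval G (z.1 * θ) z.2
  continuous_toFun := by
    refine (continuous_subtype_val.comp continuous_fst).mul ?_
    refine intervalIntegral.continuous_parametric_intervalIntegral_of_continuous' ?_ 0 1
    have h1 : Continuous fun q : (unitInterval × X) × ℝ => κ (q.1.2, q.2) :=
      κ.continuous.comp (by fun_prop)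
    have h2 : Continuous fun q : (unitInterval × X) × ℝ =>
        clampEval G ((q.1.1 : ℝ) * q.2) q.1.2 :=
      (continuous_clampEval G).comp
        (f := fun q : (unitInterval × X) × ℝ => (((q.1.1 : ℝ) * q.2), q.1.2)) (by fun_prop)
    have h3 : Continuous fun q : (unitInterval × X) × ℝ =>
        Real.exp (-N * q.1.1 * (1 - q.2)) := by fun_prop
    exact (h1.mul h3).mul h2

theorem continuous_volterra_integrand (κ : C(X × ℝ, ℝ)) (N : ℝ) (G : C(unitInterval × X, ℝ))
    (t : ℝ) (y : X) : Continuous fun θ : ℝ =>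
      κ (y, θ) * Real.exp (-N * t * (1 - θ)) * clampEval G (t * θ) y := by
  have h2 : Continuous fun θ : ℝ => clampEval G (t * θ) y :=
    (continuous_clampEval G).comp (f := fun θ : ℝ => (t * θ, y)) (by fun_prop)
  have h3 : Continuous fun θ : ℝ => κ (y, θ) := κ.continuous.comp (by fun_prop)
  fun_prop

/-- The left side equals `(1 - exp (-N t)) / N`. This gain of `1 / N` is the reason for the
exponential weight in `volterra`. -/
theorem integral_exp_weight_le {N t : ℝ} (hN : 0 < N) (ht : 0 ≤ t) :
    t * ∫ θ in (0 : ℝ)..1, Real.exp (-N * t * (1 - θ)) ≤ 1 / N := by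
  rcases ht.eq_or_lt with rfl | ht
  · simp [hN.le]
  have hder : ∀ θ ∈ uIcc (0 : ℝ) 1, HasDerivAt
      (fun θ => Real.exp (-N * t * (1 - θ)) / (N * t)) (Real.exp (-N * t * (1 - θ))) θ := by
    intro θ _
    have h : HasDerivAt (fun θ : ℝ => -N * t * (1 - θ)) (N * t) θ := by
      have := ((hasDerivAt_id θ).const_sub 1).const_mul (-N * t)
      exact this.congr_deriv (by ring)
    refine (h.exp.div_const (N * t)).congr_deriv ?_
    field_simp
  rw [intervalIntegral.integral_eq_sub_of_hasDerivAt hder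
    (Continuous.intervalIntegrable (by fun_prop) _ _)]
  have : 0 < Real.exp (-N * t * (1 - 0)) := Real.exp_pos _
  have e : t * (Real.exp (-N * t * (1 - 1)) / (N * t) - Real.exp (-N * t * (1 - 0)) / (N * t))
    = (1 - Real.exp (-N * t * (1 - 0))) / N := by
    simp only [sub_self, mul_zero, Real.exp_zero]
    field_simp
  rw [e]
  gcongr
  linarith

/-- In the weighted form the Lipschitz constant is `1 / N`, so a large `N` turns any bounded linear
Volterra system into a contraction on the whole interval, uniformly in the parameter. -/
theorem norm_volterra_sub_le [CompactSpace X] (κ : C(X × ℝ, ℝ)) (hκ : ∀ y, ∀ θ ∈ Icc (0 : ℝ) 1, |κ (y, θ)| ≤ 1)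
    {N : ℝ} (hN : 0 < N) (G H : C(unitInterval × X, ℝ)) :
    dist (volterra κ N G) (volterra κ N H) ≤ dist G H / N := by
  rw [ContinuousMap.dist_le (by positivity)]
  rintro ⟨t, y⟩
  rw [Real.dist_eq]
  change |(t : ℝ) * _ - (t : ℝ) * _| ≤ _
  rw [← mul_sub, ← intervalIntegral.integral_sub
    ((continuous_volterra_integrand κ N G t y).intervalIntegrable _ _)
    ((continuous_volterra_integrand κ N H t y).intervalIntegrable _ _), abs_mul,
    abs_of_nonneg t.2.1]
  have hb : |∫ θ in (0 : ℝ)..1, (κ (y, θ) * Real.exp (-N * t * (1 - θ)) * clampEval G (t * θ) y -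
      κ (y, θ) * Real.exp (-N * t * (1 - θ)) * clampEval H (t * θ) y)| ≤
      ∫ θ in (0 : ℝ)..1, dist G H * Real.exp (-N * t * (1 - θ)) := by
    have hc : Continuous fun θ : ℝ => dist G H * Real.exp (-N * t * (1 - θ)) := by fun_prop
    rw [← Real.norm_eq_abs]
    refine intervalIntegral.norm_integral_le_of_norm_le (μ := volume) zero_le_one
      (.of_forall fun θ hθ => ?_) (hc.intervalIntegrable _ _)
    rw [← mul_sub, Real.norm_eq_abs, abs_mul, abs_mul, abs_of_pos (Real.exp_pos _)]
    have h1 := hκ y θ ⟨hθ.1.le, hθ.2⟩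
    have h2 : |clampEval G (t * θ) y - clampEval H (t * θ) y| ≤ dist G H := by
      rw [← Real.dist_eq]
      exact ContinuousMap.dist_apply_le_dist (f := G) (g := H) _
    calc |κ (y, θ)| * Real.exp (-N * t * (1 - θ)) * |clampEval G (t * θ) y - clampEval H (t * θ) y|
        ≤ 1 * Real.exp (-N * t * (1 - θ)) * dist G H := by gcongr
      _ = _ := by ring
  calc (t : ℝ) * |_| ≤ t * ∫ θ in (0 : ℝ)..1, dist G H * Real.exp (-N * t * (1 - θ)) :=
        mul_le_mul_of_nonneg_left hb t.2.1
    _ = dist G H * (t * ∫ θ in (0 : ℝ)..1, Real.exp (-N * t * (1 - θ))) := by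
        rw [intervalIntegral.integral_const_mul]; ring
    _ ≤ dist G H * (1 / N) := by
        gcongr
        exact integral_exp_weight_le hN t.2.1
    _ = _ := by ring

/-- Solvability of a linear Volterra system depending continuously on a parameter. -/
theorem exists_volterra_solution [CompactSpace X] (a₁ a₂ a₃ a₄ : C(unitInterval × X, ℝ)) (κ₁ κ₂ : C(X × ℝ, ℝ))
    (h₁ : ∀ y, ∀ θ ∈ Icc (0 : ℝ) 1, |κ₁ (y, θ)| ≤ 1)
    (h₂ : ∀ y, ∀ θ ∈ Icc (0 : ℝ) 1, |κ₂ (y, θ)| ≤ 1) :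
    ∃ A B : C(unitInterval × X, ℝ), (∀ z, A z = 1 + volterra κ₁ 0 (a₁ * A + a₂ * B) z) ∧
      ∀ z, B z = volterra κ₂ 0 (a₃ * A + a₄ * B) z := by
  -- Each component of the map has Lipschitz constant at most half of `N` before the division by
  -- `N`, hence contraction constant `1/2`; the summand `1` keeps `N` positive.
  set N : ℝ := 2 * (‖a₁‖ + ‖a₂‖ + ‖a₃‖ + ‖a₄‖) + 1 with hNdef
  have hN : 0 < N := by positivity
  let ex : ℝ → C(unitInterval × X, ℝ) := fun m =>
    ⟨fun z => Real.exp (m * z.1), by fun_prop⟩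
  let Φ : C(unitInterval × X, ℝ) × C(unitInterval × X, ℝ) →
      C(unitInterval × X, ℝ) × C(unitInterval × X, ℝ) := fun U =>
    (ex (-N) + volterra κ₁ N (a₁ * U.1 + a₂ * U.2), volterra κ₂ N (a₃ * U.1 + a₄ * U.2))
  have lin : ∀ (c d : C(unitInterval × X, ℝ)) (U V : C(unitInterval × X, ℝ) × C(unitInterval × X, ℝ)),
      ‖c‖ + ‖d‖ ≤ N / 2 → dist (c * U.1 + d * U.2) (c * V.1 + d * V.2) / N ≤ 1 / 2 * dist U V := by
    intro c d U V hcd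
    have e : c * U.1 + d * U.2 - (c * V.1 + d * V.2) = c * (U.1 - V.1) + d * (U.2 - V.2) := by ring
    rw [div_le_iff₀ hN, dist_eq_norm, e]
    have hU1 : ‖U.1 - V.1‖ ≤ dist U V := by rw [← dist_eq_norm]; exact le_max_left _ _
    have hU2 : ‖U.2 - V.2‖ ≤ dist U V := by rw [← dist_eq_norm]; exact le_max_right _ _
    calc _ ≤ ‖c‖ * ‖U.1 - V.1‖ + ‖d‖ * ‖U.2 - V.2‖ :=
          (norm_add_le _ _).trans (add_le_add (norm_mul_le _ _) (norm_mul_le _ _))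
      _ ≤ ‖c‖ * dist U V + ‖d‖ * dist U V := by gcongr
      _ = (‖c‖ + ‖d‖) * dist U V := by ring
      _ ≤ N / 2 * dist U V := by gcongr
      _ = _ := by ring
  have hΦ : ContractingWith (1 / 2) Φ := by
    refine ⟨by rw [← NNReal.coe_lt_coe]; norm_num, LipschitzWith.of_dist_le_mul fun U V => ?_⟩
    have n1 := norm_nonneg a₁
    have n2 := norm_nonneg a₂
    have n3 := norm_nonneg a₃
    have n4 := norm_nonneg a₄
    rw [Prod.dist_eq]
    refine max_le ?_ ?_
    · simp only [Φ, dist_add_left]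
      refine (norm_volterra_sub_le κ₁ h₁ hN _ _).trans ?_
      simpa using lin a₁ a₂ U V (by rw [hNdef]; linarith)
    · refine (norm_volterra_sub_le κ₂ h₂ hN _ _).trans ?_
      simpa using lin a₃ a₄ U V (by rw [hNdef]; linarith)
  obtain ⟨U, hU⟩ : ∃ U, Φ U = U := ⟨_, hΦ.fixedPoint_isFixedPt⟩
  have hU1 : ∀ z, U.1 z = (ex (-N) + volterra κ₁ N (a₁ * U.1 + a₂ * U.2)) z := fun z => by
    conv_lhs => rw [← hU]
  have hU2 : ∀ z, U.2 z = volterra κ₂ N (a₃ * U.1 + a₄ * U.2) z := fun z => by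
    conv_lhs => rw [← hU]
  -- The fixed point is the solution multiplied by `exp (-N t)`. Multiplication by `exp (N t)`
  -- removes the weight because `exp (N t) exp (-N t (1 - θ)) = exp (N t θ)`.
  have scale : ∀ (κ : C(X × ℝ, ℝ)) (c d : C(unitInterval × X, ℝ)) (z),
      Real.exp (N * z.1) * volterra κ N (c * U.1 + d * U.2) z =
        volterra κ 0 (c * (ex N * U.1) + d * (ex N * U.2)) z := by
    rintro κ c d ⟨t, y⟩
    change Real.exp (N * t) * ((t : ℝ) * _) = (t : ℝ) * _
    rw [mul_left_comm, ← intervalIntegral.integral_const_mul]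
    congr 1
    refine intervalIntegral.integral_congr fun θ hθ => ?_
    rw [uIcc_of_le zero_le_one] at hθ
    have hm : (t : ℝ) * θ ∈ Icc (0 : ℝ) 1 :=
      ⟨mul_nonneg t.2.1 hθ.1, mul_le_one₀ t.2.2 hθ.1 hθ.2⟩
    simp only [clampEval, projIcc_of_mem zero_le_one hm, ContinuousMap.add_apply,
      ContinuousMap.mul_apply, ex, ContinuousMap.coe_mk]
    have : Real.exp (N * t) * Real.exp (-N * t * (1 - θ)) = Real.exp (N * (t * θ)) := by
      rw [← Real.exp_add]; ring_nf
    have e0 : Real.exp (-0 * t * (1 - θ)) = 1 := by simp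
    rw [e0, ← this]
    ring
  refine ⟨ex N * U.1, ex N * U.2, fun z => ?_, fun z => ?_⟩
  · rw [← scale, ContinuousMap.mul_apply, hU1 z, ContinuousMap.add_apply, mul_add]
    congr 1
    simp only [ex, ContinuousMap.coe_mk]
    rw [← Real.exp_add]; simp
  · rw [← scale, ContinuousMap.mul_apply, hU2 z]; rfl

end Volterra
end PiKink
end

/-! ### Decaying solutions of linear systems, continuous up to `x = -∞` and in a parameter. -/

noncomputable section
namespace PiKink

section DecayingFamily

variable {X : Type*} [TopologicalSpace X]

/-- An exponentially small remainder, rewritten in the variable `exp (η x)`. -/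
theorem exists_remainder {e : ℝ → X → ℝ} {C η : ℝ} (hη : 0 < η)
    (he : ContinuousOn (fun z : ℝ × X => e z.1 z.2) (Iic 0 ×ˢ univ))
    (hb : ∀ x ≤ 0, ∀ y, |e x y| ≤ C * Real.exp (2 * η * x)) :
    ∃ ε : C(unitInterval × X, ℝ), ∀ x ≤ 0, ∀ y,
      e x y = Real.exp (η * x) * clampEval ε (Real.exp (η * x)) y := by
  -- With `t = exp (η x)` the hypothesis reads `|e| ≤ C t²`. One power of `t` is factored out, and
  -- the other makes the quotient tend to `0`, so the value `0` at `t = 0` (that is, `x = -∞`) is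
  -- the continuous one.
  let f : unitInterval × X → ℝ := fun z =>
    if (z.1 : ℝ) = 0 then 0 else e (Real.log z.1 / η) z.2 / z.1
  have hlog : ∀ t : unitInterval, Real.log t / η ≤ 0 := fun t =>
    div_nonpos_of_nonpos_of_nonneg (Real.log_nonpos t.2.1 t.2.2) hη.le
  have hfb : ∀ z, |f z| ≤ C * z.1 := by
    rintro ⟨t, y⟩
    by_cases h : (t : ℝ) = 0
    · simp [f, h]
    · have ht : 0 < (t : ℝ) := lt_of_le_of_ne t.2.1 (Ne.symm h)
      simp only [f, h, if_false]
      rw [abs_div, abs_of_pos ht, div_le_iff₀ ht]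
      refine (hb _ (hlog t) y).trans (le_of_eq ?_)
      have : Real.exp (2 * η * (Real.log t / η)) = t * t := by
        rw [show 2 * η * (Real.log t / η) = Real.log t + Real.log t by field_simp; ring,
          Real.exp_add, Real.exp_log ht]
      rw [this]; ring
  have hf : Continuous f := by
    rw [continuous_iff_continuousAt]
    rintro ⟨t, y⟩
    by_cases h : (t : ℝ) = 0
    · have h0 : f (t, y) = 0 := by simp [f, h]
      rw [ContinuousAt, h0]
      refine squeeze_zero_norm (fun z => hfb z) ?_
      have : Tendsto (fun z : unitInterval × X => C * (z.1 : ℝ)) (𝓝 (t, y)) (𝓝 (C * t)) :=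
        (Continuous.continuousAt (by fun_prop))
      simpa [h] using this
    · have hev : ∀ᶠ z in 𝓝 (t, y), (z.1 : ℝ) ≠ 0 :=
        (Continuous.continuousAt (f := fun z : unitInterval × X => (z.1 : ℝ))
          (by fun_prop)).eventually_ne h
      have hc : ContinuousAt
          (fun z : unitInterval × X => e (Real.log z.1 / η) z.2 / z.1) (t, y) := by
        refine ContinuousAt.div ?_ (Continuous.continuousAt (by fun_prop)) h
        have hg : ContinuousAt (fun z : unitInterval × X => (Real.log z.1 / η, z.2)) (t, y) := by
          have hl : ContinuousAt (fun z : unitInterval × X => Real.log (z.1 : ℝ)) (t, y) :=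
            ContinuousAt.log (Continuous.continuousAt (by fun_prop)) h
          exact (hl.div_const η).prodMk continuousAt_snd
        have he' := he (Real.log t / η, y) ⟨hlog t, mem_univ _⟩
        exact he'.tendsto.comp (tendsto_nhdsWithin_of_tendsto_nhds_of_eventually_within _ hg
          (Eventually.of_forall fun z => ⟨hlog z.1, mem_univ _⟩))
      refine hc.congr ?_
      filter_upwards [hev] with z hz
      simp only [f, hz, if_false]
  refine ⟨⟨f, hf⟩, fun x hx y => ?_⟩
  have hm : Real.exp (η * x) ∈ Icc (0 : ℝ) 1 :=
    ⟨(Real.exp_pos _).le, Real.exp_le_one_iff.2 (mul_nonpos_of_nonneg_of_nonpos hη.le hx)⟩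
  simp only [clampEval, projIcc_of_mem zero_le_one hm, ContinuousMap.coe_mk, f,
    (Real.exp_pos (η * x)).ne', if_false, Real.log_exp]
  rw [mul_div_cancel_left₀ _ hη.ne', mul_div_cancel₀ _ (Real.exp_pos _).ne']

/-- For `κ = θ ^ r` the substitution `u = t θ` turns the Volterra term into `t ^ (-r) ∫₀ᵗ u ^ r G(u)
du`. Hence the integral equation selects the solution of `t A' = t G - r (A - c)` that is continuous
at the singular point `t = 0`. -/
theorem hasDerivAt_of_eq_volterra {A G : C(unitInterval × X, ℝ)} {κ : C(X × ℝ, ℝ)} {c : ℝ}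
    {r : ℝ} {y : X} (hr : 0 ≤ r) (hκ : ∀ θ ∈ Icc (0 : ℝ) 1, κ (y, θ) = θ ^ r)
    (hA : ∀ z, A z = c + volterra κ 0 G z) {t : ℝ} (ht : t ∈ Ioo (0 : ℝ) 1) :
    HasDerivAt (fun t => clampEval A t y)
      (clampEval G t y - r / t * (clampEval A t y - c)) t := by
  -- The truncation `max s 0` gives a continuous integrand on all of `ℝ` that agrees with `s ^ r G`
  -- on the interval of interest.
  have cG : Continuous fun s : ℝ => max s 0 ^ r * clampEval G s y := by
    have h1 : Continuous fun s : ℝ => clampEval G s y :=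
      (continuous_clampEval G).comp (f := fun s : ℝ => (s, y)) (by fun_prop)
    exact ((Continuous.rpow_const (by fun_prop) (fun _ => Or.inr hr))).mul h1
  have hI : HasDerivAt (fun t => ∫ s in (0 : ℝ)..t, max s 0 ^ r * clampEval G s y)
      (max t 0 ^ r * clampEval G t y) t :=
    intervalIntegral.integral_hasDerivAt_right (cG.intervalIntegrable _ _)
      (cG.stronglyMeasurableAtFilter _ _) cG.continuousAt
  have hp : HasDerivAt (fun t : ℝ => t ^ (-r)) (-r * t ^ (-r - 1)) t :=
    Real.hasDerivAt_rpow_const (Or.inl ht.1.ne')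
  have eqn : ∀ s ∈ Ioo (0 : ℝ) 1, clampEval A s y =
      c + s ^ (-r) * ∫ u in (0 : ℝ)..s, max u 0 ^ r * clampEval G u y := by
    intro s hs
    have hm : s ∈ Icc (0 : ℝ) 1 := ⟨hs.1.le, hs.2.le⟩
    have hcl : clampEval A s y = A (⟨s, hm⟩, y) := by
      simp only [clampEval, projIcc_of_mem zero_le_one hm]
    rw [hcl, hA]
    congr 1
    change s * _ = _
    have := intervalIntegral.mul_integral_comp_mul_left (a := 0) (b := 1)
      (f := fun u => max u 0 ^ r * clampEval G u y) (c := s)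
    rw [mul_zero, mul_one] at this
    rw [← this, mul_left_comm]
    congr 1
    rw [← intervalIntegral.integral_const_mul]
    refine intervalIntegral.integral_congr fun θ hθ => ?_
    rw [uIcc_of_le zero_le_one] at hθ
    simp only
    rw [hκ θ hθ, max_eq_left (mul_nonneg hs.1.le hθ.1), Real.mul_rpow hs.1.le hθ.1,
      Real.rpow_neg hs.1.le]
    have : s ^ r ≠ 0 := (Real.rpow_pos_of_pos hs.1 r).ne'
    simp only [neg_zero, zero_mul, Real.exp_zero]
    field_simp
  have hd := ((hp.mul hI).const_add c).congr_of_eventuallyEq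
    (Filter.eventuallyEq_of_mem (Ioo_mem_nhds ht.1 ht.2) eqn)
  refine hd.congr_deriv ?_
  rw [eqn t ht, max_eq_left ht.1.le, Real.rpow_sub_one ht.1.ne', Real.rpow_neg ht.1.le]
  have : t ^ r ≠ 0 := (Real.rpow_pos_of_pos ht.1 r).ne'
  have ht' := ht.1.ne'
  field_simp
  ring

/-- A linear system `v' = σ y`, `y' = q v` on `(-∞, 0]` whose coefficients converge exponentially
to positive constants has a solution that decays exponentially at `-∞`, continuously in a
compact parameter. -/
theorem exists_decaying_family [CompactSpace X] {σ q : ℝ → X → ℝ} {σ₀ q₀ : C(X, ℝ)} {C η : ℝ}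
    (hη : 0 < η)
    (hσ : ContinuousOn (fun z : ℝ × X => σ z.1 z.2) (Iic 0 ×ˢ univ))
    (hq : ContinuousOn (fun z : ℝ × X => q z.1 z.2) (Iic 0 ×ˢ univ))
    (hσ₀ : ∀ y, 0 < σ₀ y) (hq₀ : ∀ y, 0 < q₀ y)
    (hσb : ∀ x ≤ 0, ∀ y, |σ x y - σ₀ y| ≤ C * Real.exp (2 * η * x))
    (hqb : ∀ x ≤ 0, ∀ y, |q x y - q₀ y| ≤ C * Real.exp (2 * η * x)) :
    ∃ (k : C(X, ℝ)) (V Y : C(unitInterval × X, ℝ)), (∀ y, 0 < k y) ∧ (∀ y, V (0, y) = 1) ∧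
      ∀ y, ∀ x < 0,
        HasDerivAt (fun x => Real.exp (k y * x) * clampEval V (Real.exp (η * x)) y)
          (σ x y * (Real.exp (k y * x) * clampEval Y (Real.exp (η * x)) y)) x ∧
        HasDerivAt (fun x => Real.exp (k y * x) * clampEval Y (Real.exp (η * x)) y)
          (q x y * (Real.exp (k y * x) * clampEval V (Real.exp (η * x)) y)) x := by
  -- The limit system has eigenvalues `±k` with eigenvectors `(1, ±l)`. The solution is sought as `v
  -- = exp (k x) (A + B)`, `y = exp (k x) l (A - B)`, where `A` is the amplitude of the mode `k` and
  -- `B` that of the mode `-k`.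
  let k : C(X, ℝ) := ⟨fun y => √(σ₀ y * q₀ y), by fun_prop⟩
  let l : C(X, ℝ) := ⟨fun y => √(q₀ y / σ₀ y), by
    have : Continuous fun y => q₀ y / σ₀ y :=
      q₀.continuous.div σ₀.continuous fun y => (hσ₀ y).ne'
    fun_prop⟩
  let l' : C(X, ℝ) := ⟨fun y => √(σ₀ y / q₀ y), by
    have : Continuous fun y => σ₀ y / q₀ y :=
      σ₀.continuous.div q₀.continuous fun y => (hq₀ y).ne'
    fun_prop⟩
  have kpos : ∀ y, 0 < k y := fun y => Real.sqrt_pos.2 (mul_pos (hσ₀ y) (hq₀ y))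
  have lpos : ∀ y, 0 < l y := fun y => Real.sqrt_pos.2 (div_pos (hq₀ y) (hσ₀ y))
  have ll' : ∀ y, l' y = (l y)⁻¹ := fun y => by
    simp only [l, l', ContinuousMap.coe_mk]
    rw [← Real.sqrt_inv, inv_div]
  have hk1 : ∀ y, σ₀ y * l y = k y := fun y => by
    simp only [l, k, ContinuousMap.coe_mk]
    rw [show σ₀ y * q₀ y = (σ₀ y) ^ 2 * (q₀ y / σ₀ y) by field_simp [(hσ₀ y).ne'],
      Real.sqrt_mul (sq_nonneg _), Real.sqrt_sq (hσ₀ y).le]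
  have hk2 : ∀ y, q₀ y = k y * l y := fun y => by
    rw [← hk1, mul_assoc]
    simp only [l, ContinuousMap.coe_mk]
    rw [Real.mul_self_sqrt (div_pos (hq₀ y) (hσ₀ y)).le]
    field_simp [(hσ₀ y).ne']
  obtain ⟨L, hL⟩ : ∃ L : ℝ, ∀ y, l y ≤ L ∧ l' y ≤ L :=
    ⟨max ‖l‖ ‖l'‖, fun y => ⟨(le_abs_self _).trans ((l.norm_coe_le_norm y).trans (le_max_left _ _)),
      (le_abs_self _).trans ((l'.norm_coe_le_norm y).trans (le_max_right _ _))⟩⟩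
  have rem : ∀ (g : ℝ → X → ℝ) (g₀ m : C(X, ℝ)),
      ContinuousOn (fun z : ℝ × X => g z.1 z.2) (Iic 0 ×ˢ univ) →
      (∀ x ≤ 0, ∀ y, |g x y - g₀ y| ≤ C * Real.exp (2 * η * x)) → (∀ y, 0 ≤ m y) →
      (∀ y, m y ≤ L) → ∃ ε : C(unitInterval × X, ℝ), ∀ x ≤ 0, ∀ y,
      (g x y - g₀ y) * m y = Real.exp (η * x) * clampEval ε (Real.exp (η * x)) y := by
    intro g g₀ m hg hgb hm0 hmL
    refine exists_remainder (C := C * L) hη ?_ fun x hx y => ?_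
    · exact (hg.sub (by fun_prop : Continuous fun z : ℝ × X => g₀ z.2).continuousOn).mul
        (by fun_prop : Continuous fun z : ℝ × X => m z.2).continuousOn
    · rw [abs_mul, abs_of_nonneg (hm0 y)]
      have h1 := hgb x hx y
      have h2 : 0 ≤ C * Real.exp (2 * η * x) := (abs_nonneg _).trans h1
      calc _ ≤ C * Real.exp (2 * η * x) * L := mul_le_mul h1 (hmL y) (hm0 y) h2
        _ = _ := by ring
  obtain ⟨ε₁, hε₁⟩ := rem σ σ₀ l hσ hσb (fun y => (lpos y).le) (fun y => (hL y).1)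
  obtain ⟨ε₂, hε₂⟩ := rem q q₀ l' hq hqb (fun y => Real.sqrt_nonneg _) (fun y => (hL y).2)
  -- After division by `exp (k x)` the free equations are `A' = 0` and `B' = -2 k B`. In the
  -- variable `t = exp (η x)` these have exponents `0` and `2 k / η`, hence the two kernels. The
  -- clamping in `κ₂` only serves continuity off `[0, 1]`.
  let κ₁ : C(X × ℝ, ℝ) := ⟨fun _ => 1, continuous_const⟩
  let κ₂ : C(X × ℝ, ℝ) := ⟨fun z => (min (max z.2 0) 1) ^ (2 * k z.1 / η), by
    refine Continuous.rpow (by fun_prop) (by fun_prop) fun z => Or.inr ?_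
    have := kpos z.1
    positivity⟩
  let d : C(unitInterval × X, ℝ) := ContinuousMap.const _ (1 / (2 * η))
  obtain ⟨A, B, hA, hB⟩ := exists_volterra_solution (d * (ε₁ + ε₂)) (d * (ε₂ - ε₁))
    (d * (ε₁ - ε₂)) (-d * (ε₁ + ε₂)) κ₁ κ₂ (fun y θ _ => by simp [κ₁])
    (fun y θ _ => by
      have h0 : 0 ≤ min (max θ 0) 1 := by positivity
      have hk := kpos y
      simp only [κ₂, ContinuousMap.coe_mk]
      rw [abs_of_nonneg (Real.rpow_nonneg h0 _)]
      exact Real.rpow_le_one h0 (min_le_right _ _) (by positivity))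
  let lE : C(unitInterval × X, ℝ) := l.comp ContinuousMap.snd
  refine ⟨k, A + B, lE * (A - B), kpos, fun y => ?_, fun y x hx => ?_⟩
  · have h1 := hA (0, y)
    have h2 := hB (0, y)
    simp only [volterra, ContinuousMap.coe_mk, unitInterval, Set.Icc.coe_zero, zero_mul] at h1 h2
    simp [h1, h2]
  · have hτ : Real.exp (η * x) ∈ Ioo (0 : ℝ) 1 :=
      ⟨Real.exp_pos _, by simpa using Real.exp_lt_exp.2 (mul_neg_of_pos_of_neg hη hx)⟩
    have hexp : ∀ c : ℝ, HasDerivAt (fun x => Real.exp (c * x)) (Real.exp (c * x) * c) x :=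
      fun c => by simpa using ((hasDerivAt_id x).const_mul c).exp
    have dA := (hasDerivAt_of_eq_volterra (κ := κ₁) (c := 1) (r := 0) (y := y) le_rfl
      (fun θ _ => by simp [κ₁]) hA hτ).comp x (hexp η)
    have dB := (hasDerivAt_of_eq_volterra (κ := κ₂) (c := 0) (r := 2 * k y / η) (y := y)
      (by have := kpos y; positivity)
      (fun θ hθ => by simp [κ₂, max_eq_left hθ.1, min_eq_left hθ.2])
      (fun z => (hB z).trans (zero_add _).symm) hτ).comp x (hexp η)
    have e1 := hε₁ x hx.le y
    have e2 := hε₂ x hx.le y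
    have hl := (lpos y).ne'
    have hlE : ∀ t, clampEval lE t y = l y := fun t => rfl
    have s1 : σ x y = k y / l y + Real.exp (η * x) * clampEval ε₁ (Real.exp (η * x)) y / l y := by
      rw [← e1, ← hk1]; field_simp; simp
    have s2 : q x y = k y * l y + Real.exp (η * x) * clampEval ε₂ (Real.exp (η * x)) y * l y := by
      rw [← e2, ← hk2, ll']; field_simp; simp
    have hη' := hη.ne'
    have hE := (Real.exp_pos (η * x)).ne'
    constructor
    · refine ((hexp (k y)).mul (dA.add dB)).congr_deriv ?_
      rw [s1]
      simp only [clampEval, Function.comp, Pi.add_apply, ContinuousMap.add_apply, ContinuousMap.mul_apply,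
        ContinuousMap.sub_apply, ContinuousMap.neg_apply, d, ContinuousMap.const_apply, lE,
        ContinuousMap.comp_apply, ContinuousMap.snd_apply]
      field_simp
      ring
    · refine ((hexp (k y)).mul ((dA.sub dB).const_mul (l y))).congr_deriv ?_
      rw [s2]
      simp only [clampEval, Function.comp, Pi.sub_apply, ContinuousMap.add_apply, ContinuousMap.mul_apply,
        ContinuousMap.sub_apply, ContinuousMap.neg_apply, d, ContinuousMap.const_apply]
      field_simp
      ring

end DecayingFamily
end PiKink
end

/-! ### Sturm-Liouville equations on a half line: Picone's identity and Riccati comparison. -/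

noncomputable section
namespace PiKink

/-- `v`, with derivative `w`, is a solution of `(S v')' = q v` on `(-∞, 0)` that tends to zero
at `-∞` together with its derivative. -/
structure Decaying (S q v w : ℝ → ℝ) : Prop where
  contOn : ContinuousOn v (Iic 0)
  contOn_deriv : ContinuousOn w (Iic 0)
  hasDeriv : ∀ x < 0, HasDerivAt v (w x) x
  hasDeriv_flux : ∀ x < 0, HasDerivAt (fun x => S x * w x) (q x * v x) x
  tendsto : Tendsto v atBot (𝓝 0)
  tendsto_deriv : Tendsto w atBot (𝓝 0)

/-- A coefficient of a Sturm-Liouville equation on the half line: positive, bounded, continuous. -/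
structure Stiffness (S : ℝ → ℝ) : Prop where
  contOn : ContinuousOn S (Iic 0)
  pos : ∀ x ≤ 0, 0 < S x
  bounded : ∃ B, ∀ x ≤ 0, S x ≤ B

section HalfLine

variable {S q v w : ℝ → ℝ}

/-- A quadratic expression in functions that tend to zero. -/
theorem tendsto_flux_zero {f g F G : ℝ → ℝ} {K : ℝ} (hS : Stiffness S)
    (hf : Tendsto f atBot (𝓝 0)) (hg : Tendsto g atBot (𝓝 0)) (hF : ∀ x ≤ 0, |F x| ≤ K)
    (hG : ∀ x ≤ 0, |G x| ≤ K) :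
    Tendsto (fun x => S x * (F x * f x - G x * g x)) atBot (𝓝 0) := by
  obtain ⟨B, hB⟩ := hS.bounded
  have hB0 : 0 ≤ B := (hS.pos 0 le_rfl).le.trans (hB 0 le_rfl)
  have h0 : Tendsto (fun x => B * (K * |f x| + K * |g x|)) atBot (𝓝 0) := by
    have := ((hf.abs.const_mul K).add (hg.abs.const_mul K)).const_mul B
    simpa using this
  refine squeeze_zero_norm' ?_ h0
  filter_upwards [eventually_le_atBot 0] with x hx
  rw [Real.norm_eq_abs, abs_mul, abs_of_pos (hS.pos x hx)]
  have hK : 0 ≤ K := (abs_nonneg _).trans (hF x hx)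
  refine mul_le_mul (hB x hx) ?_ (abs_nonneg _) hB0
  refine (abs_sub _ _).trans (add_le_add ?_ ?_)
  · rw [abs_mul]; gcongr; exact hF x hx
  · rw [abs_mul]; gcongr; exact hG x hx

theorem eq_of_hasDerivAt_zero {D : ℝ → ℝ} (hc : ContinuousOn D (Iic 0))
    (hd : ∀ x < 0, HasDerivAt D 0 x) : ∀ x ≤ 0, D x = D 0 := by
  have hi : interior (Iic (0 : ℝ)) = Iio 0 := interior_Iic
  have mono : MonotoneOn D (Iic 0) := by
    apply monotoneOn_of_deriv_nonneg (convex_Iic 0) hc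
    · rw [hi]; exact fun x hx => (hd x hx).differentiableAt.differentiableWithinAt
    · rw [hi]; intro x hx; rw [(hd x hx).deriv]
  have anti : AntitoneOn D (Iic 0) := by
    apply antitoneOn_of_deriv_nonpos (convex_Iic 0) hc
    · rw [hi]; exact fun x hx => (hd x hx).differentiableAt.differentiableWithinAt
    · rw [hi]; intro x hx; rw [(hd x hx).deriv]
  exact fun x hx => le_antisymm (mono hx (mem_Iic.2 le_rfl) hx) (anti hx (mem_Iic.2 le_rfl) hx)

theorem eq_zero_of_hasDerivAt_zero_tendsto {D : ℝ → ℝ} (hc : ContinuousOn D (Iic 0))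
    (hd : ∀ x < 0, HasDerivAt D 0 x) (ht : Tendsto D atBot (𝓝 0)) : ∀ x ≤ 0, D x = 0 := by
  have hconst := eq_of_hasDerivAt_zero hc hd
  have h0 : D 0 = 0 := by
    refine tendsto_nhds_unique (Tendsto.congr' ?_ tendsto_const_nhds) ht
    filter_upwards [eventually_le_atBot 0] with y hy
    exact (hconst y hy).symm
  exact fun x hx => (hconst x hx).trans h0

/-- Picone's identity with a Riccati supersolution `M`. -/
theorem Decaying.picone (hv : Decaying S q v w) (hS : Stiffness S) {M d : ℝ → ℝ} {K : ℝ}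
    (hM : ContinuousOn M (Iic 0)) (hMb : ∀ x ≤ 0, |M x| ≤ K)
    (hd : ∀ x < 0, HasDerivAt (fun x => S x * M x) (d x) x)
    (hres : ∀ x < 0, d x + S x * M x ^ 2 ≤ q x) :
    0 ≤ v 0 * (w 0 - M 0 * v 0) ∧ (v 0 * (w 0 - M 0 * v 0) = 0 →
      (∀ x < 0, d x + S x * M x ^ 2 < q x) → ∀ x ≤ 0, v x = 0) := by
  -- The derivative of `E` is `S (w - M v)² + (q - (S M)' - S M²) v² ≥ 0`, and `E` tends to zero at
  -- `-∞`, so `E 0 ≥ 0`.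
  set E : ℝ → ℝ := fun x => v x * (S x * w x) - (S x * M x) * v x ^ 2 with hE
  have hEd : ∀ x < 0, HasDerivAt E
      (S x * (w x - M x * v x) ^ 2 + (q x - (d x + S x * M x ^ 2)) * v x ^ 2) x := by
    intro x hx
    refine (((hv.hasDeriv x hx).mul (hv.hasDeriv_flux x hx)).sub
      ((hd x hx).mul ((hv.hasDeriv x hx).pow 2))).congr_deriv ?_
    simp only [Pi.pow_apply]
    ring
  have hEc : ContinuousOn E (Iic 0) :=
    (hv.contOn.mul (hS.contOn.mul hv.contOn_deriv)).sub ((hS.contOn.mul hM).mul (hv.contOn.pow 2))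
  have hi : interior (Iic (0 : ℝ)) = Iio 0 := interior_Iic
  have mono : MonotoneOn E (Iic 0) := by
    apply monotoneOn_of_deriv_nonneg (convex_Iic 0) hEc
    · rw [hi]; exact fun x hx => (hEd x hx).differentiableAt.differentiableWithinAt
    · rw [hi]; intro x hx; rw [(hEd x hx).deriv]
      have := hS.pos x (le_of_lt hx)
      have := sub_nonneg.2 (hres x hx)
      positivity
  have ht : Tendsto E atBot (𝓝 0) := by
    have h1 : Tendsto (fun x => v x * w x) atBot (𝓝 0) := by
      simpa using hv.tendsto.mul hv.tendsto_deriv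
    have h2 : Tendsto (fun x => v x ^ 2) atBot (𝓝 0) := by simpa using hv.tendsto.pow 2
    have := tendsto_flux_zero (K := max 1 K) hS (F := fun _ => 1) (G := M) h1 h2
      (fun x _ => by simp) (fun x hx => (hMb x hx).trans (le_max_right _ _))
    refine this.congr fun x => ?_
    simp only [hE]; ring
  have hnn : ∀ x ≤ 0, 0 ≤ E x := fun x hx => by
    refine le_of_tendsto ht ?_
    filter_upwards [eventually_le_atBot x] with y hy
    exact mono (hy.trans hx) hx hy
  have hE0 : E 0 = S 0 * (v 0 * (w 0 - M 0 * v 0)) := by simp only [hE]; ring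
  have hS0 := hS.pos 0 le_rfl
  refine ⟨?_, fun hz hst => ?_⟩
  · have := hnn 0 le_rfl
    rw [hE0] at this
    exact nonneg_of_mul_nonneg_right this hS0
  -- If `E 0 = 0`, the nonnegative increasing function `E` vanishes identically, and so does its
  -- derivative; strictness of the Riccati inequality then forces `v = 0`.
  · have hall : ∀ x ≤ 0, E x = 0 := fun x hx => by
      refine le_antisymm ?_ (hnn x hx)
      have := mono hx (mem_Iic.2 le_rfl) hx
      rwa [hE0, hz, mul_zero] at this
    have hneg : ∀ x < 0, v x = 0 := by
      intro x hx
      have hev : E =ᶠ[𝓝 x] fun _ => 0 :=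
        Filter.eventuallyEq_of_mem (Iio_mem_nhds hx) fun y hy => hall y (le_of_lt hy)
      have h1 := (hEd x hx).unique ((hasDerivAt_const x (0 : ℝ)).congr_of_eventuallyEq hev)
      have h2 : 0 ≤ S x * (w x - M x * v x) ^ 2 := by
        have := hS.pos x hx.le; positivity
      have h3 := sub_pos.2 (hst x hx)
      by_contra hne
      have : 0 < (q x - (d x + S x * M x ^ 2)) * v x ^ 2 := by positivity
      linarith
    intro x hx
    rcases hx.lt_or_eq with h | rfl
    · exact hneg x h
    · have h1 : Tendsto v (𝓝[<] 0) (𝓝 (v 0)) :=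
        (hv.contOn 0 (mem_Iic.2 le_rfl)).tendsto.mono_left (nhdsWithin_mono _ Iio_subset_Iic_self)
      refine tendsto_nhds_unique h1 (Tendsto.congr' ?_ tendsto_const_nhds)
      filter_upwards [self_mem_nhdsWithin] with y hy
      exact (hneg y hy).symm

/-- The derivative of the weighted Wronskian is `(r - q W) v`, so it has the sign of the defect of
`W` in the equation satisfied by `v`. -/
theorem Decaying.wronskian_monotoneOn (hv : Decaying S q v w) (hS : Stiffness S)
    {W W' r : ℝ → ℝ} (hv0 : ∀ x ≤ 0, 0 ≤ v x)
    (hW : ContinuousOn W (Iic 0)) (hW' : ContinuousOn W' (Iic 0))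
    (hd : ∀ x < 0, HasDerivAt W (W' x) x)
    (hr : ∀ x < 0, HasDerivAt (fun x => S x * W' x) (r x) x) (hle : ∀ x < 0, q x * W x ≤ r x) :
    MonotoneOn (fun x => S x * (W' x * v x - W x * w x)) (Iic 0) := by
  have hD : ∀ x < 0, HasDerivAt (fun x => S x * (W' x * v x - W x * w x))
      ((r x - q x * W x) * v x) x := by
    intro x hx
    have := ((hr x hx).mul (hv.hasDeriv x hx)).sub ((hd x hx).mul (hv.hasDeriv_flux x hx))
    refine (this.congr_deriv (by ring)).congr_of_eventuallyEq (.of_forall fun y => ?_)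
    simp only [Pi.sub_apply, Pi.mul_apply]; ring
  have hi : interior (Iic (0 : ℝ)) = Iio 0 := interior_Iic
  have hc : ContinuousOn (fun x => S x * (W' x * v x - W x * w x)) (Iic 0) :=
    hS.contOn.mul ((hW'.mul hv.contOn).sub (hW.mul hv.contOn_deriv))
  apply monotoneOn_of_deriv_nonneg (convex_Iic 0) hc
  · rw [hi]; exact fun x hx => (hD x hx).differentiableAt.differentiableWithinAt
  · rw [hi]; intro x hx; rw [(hD x hx).deriv]
    exact mul_nonneg (sub_nonneg.2 (hle x hx)) (hv0 x (le_of_lt hx))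

theorem Decaying.wronskian_antitoneOn (hv : Decaying S q v w) (hS : Stiffness S)
    {W W' r : ℝ → ℝ} (hv0 : ∀ x ≤ 0, 0 ≤ v x)
    (hW : ContinuousOn W (Iic 0)) (hW' : ContinuousOn W' (Iic 0))
    (hd : ∀ x < 0, HasDerivAt W (W' x) x)
    (hr : ∀ x < 0, HasDerivAt (fun x => S x * W' x) (r x) x) (hle : ∀ x < 0, r x ≤ q x * W x) :
    AntitoneOn (fun x => S x * (W' x * v x - W x * w x)) (Iic 0) := by
  have := hv.wronskian_monotoneOn hS (W := -W) (W' := -W') (r := -r) hv0 hW.neg hW'.neg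
    (fun x hx => (hd x hx).neg) (fun x hx => by
      refine (hr x hx).neg.congr_of_eventuallyEq (.of_forall fun y => ?_)
      simp only [Pi.neg_apply]; ring) (fun x hx => by
      have := hle x hx
      simp only [Pi.neg_apply]; linarith)
  intro x hx y hy hxy
  have := this hx hy hxy
  simp only [Pi.neg_apply] at this ⊢
  nlinarith

/-- The exponential of a primitive of `M`, normalized at `0`. -/
def expPrimitive (M : ℝ → ℝ) (x : ℝ) : ℝ := Real.exp (∫ t in (0 : ℝ)..x, M t)

theorem hasDerivAt_expPrimitive {M : ℝ → ℝ} (hM : Continuous M) (x : ℝ) :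
    HasDerivAt (expPrimitive M) (M x * expPrimitive M x) x := by
  have := (intervalIntegral.integral_hasDerivAt_right (hM.intervalIntegrable 0 x)
    (hM.stronglyMeasurableAtFilter _ _) hM.continuousAt).exp
  exact this.congr_deriv (mul_comm _ _)

theorem continuous_expPrimitive {M : ℝ → ℝ} (hM : Continuous M) : Continuous (expPrimitive M) :=
  continuous_iff_continuousAt.2 fun x => (hasDerivAt_expPrimitive hM x).continuousAt

/-- To the left of `a` the integrand is nonnegative, so moving `x` further left can only decrease
the exponent. This boundedness is what makes the Wronskian with a decaying solution vanish at `-∞`.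
-/
theorem expPrimitive_le {M : ℝ → ℝ} (hM : Continuous M) {K a : ℝ} (ha : a ≤ 0)
    (hMb : ∀ x ≤ 0, |M x| ≤ K) (hpos : ∀ x ≤ a, 0 ≤ M x) {x : ℝ} (hx : x ≤ 0) :
    expPrimitive M x ≤ Real.exp (K * -a) := by
  have hK : 0 ≤ K := (abs_nonneg _).trans (hMb 0 le_rfl)
  have bound : ∀ y, a ≤ y → y ≤ 0 → |∫ t in (0 : ℝ)..y, M t| ≤ K * -a := by
    intro y hay hy
    have := intervalIntegral.norm_integral_le_of_norm_le_const (a := 0) (b := y) (f := M) (C := K)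
      (fun t ht => by
        rw [uIoc_of_ge hy] at ht
        exact hMb t ht.2)
    rw [Real.norm_eq_abs, sub_zero, abs_of_nonpos hy] at this
    exact this.trans (by gcongr)
  refine Real.exp_le_exp.2 ?_
  rcases le_total a x with h | h
  · exact (le_abs_self _).trans (bound x h hx)
  · have hsplit := intervalIntegral.integral_add_adjacent_intervals
      (hM.intervalIntegrable (μ := volume) 0 a) (hM.intervalIntegrable (μ := volume) a x)
    have h1 : 0 ≤ ∫ t in x..a, M t := intervalIntegral.integral_nonneg h fun t ht => hpos t ht.2
    rw [intervalIntegral.integral_symm] at h1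
    have := (le_abs_self _).trans (bound a le_rfl ha)
    linarith

section RiccatiComparison

variable (hv : Decaying S q v w) (hS : Stiffness S) (hv0 : ∀ x ≤ 0, 0 ≤ v x)
  {M d : ℝ → ℝ} {K a : ℝ} (hM : Continuous M) (ha : a ≤ 0) (hMb : ∀ x ≤ 0, |M x| ≤ K)
  (hpos : ∀ x ≤ a, 0 ≤ M x) (hd : ∀ x < 0, HasDerivAt (fun x => S x * M x) (d x) x)

/-- The exponential of `∫ M` linearizes the Riccati expression: `(S W')' = ((S M)' + S M²) W`. A
Riccati inequality for `M` thus becomes a linear differential inequality for `W`. -/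
theorem riccati_flux {M d : ℝ → ℝ} (hM : Continuous M)
    (hd : ∀ x < 0, HasDerivAt (fun x => S x * M x) (d x) x) :
    ∀ x < 0, HasDerivAt (fun x => S x * (M x * expPrimitive M x))
      ((d x + S x * M x ^ 2) * expPrimitive M x) x := fun x hx => by
  refine (((hd x hx).mul (hasDerivAt_expPrimitive hM x)).congr_deriv (by ring)
    ).congr_of_eventuallyEq (.of_forall fun y => ?_)
  simp only [Pi.mul_apply]; ring

include hM ha hMb hpos hv hS in
theorem tendsto_riccati_wronskian :
    Tendsto (fun x => S x * (M x * expPrimitive M x * v x - expPrimitive M x * w x)) atBot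
      (𝓝 0) := by
  have hK : 0 ≤ K := (abs_nonneg _).trans (hMb 0 le_rfl)
  have hb : ∀ x ≤ 0, |expPrimitive M x| ≤ Real.exp (K * -a) := fun x hx => by
    rw [expPrimitive, abs_of_pos (Real.exp_pos _)]
    exact expPrimitive_le hM ha hMb hpos hx
  refine tendsto_flux_zero (K := (1 + K) * Real.exp (K * -a)) hS hv.tendsto hv.tendsto_deriv
    (fun x hx => ?_) (fun x hx => ?_)
  · rw [abs_mul]
    exact mul_le_mul ((hMb x hx).trans (by linarith)) (hb x hx) (abs_nonneg _) (by linarith)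
  · refine (hb x hx).trans ?_
    have := Real.exp_pos (K * -a)
    nlinarith

include hv hS hv0 hM ha hMb hpos hd in
/-- A Riccati subsolution bounds the logarithmic derivative from above. -/
theorem Decaying.le_of_riccati (hres : ∀ x < 0, q x ≤ d x + S x * M x ^ 2) :
    ∀ x ≤ 0, w x ≤ M x * v x := by
  -- The Wronskian of `exp ∫ M` and `v` is increasing and tends to zero at `-∞`, hence is
  -- nonnegative; dividing by the positive factors leaves `M v - w ≥ 0`.
  have mono := hv.wronskian_monotoneOn hS hv0 (continuous_expPrimitive hM).continuousOn
    (hM.mul (continuous_expPrimitive hM)).continuousOn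
    (fun x _ => hasDerivAt_expPrimitive hM x) (riccati_flux hM hd)
    (fun x hx => mul_le_mul_of_nonneg_right (hres x hx) (Real.exp_pos _).le)
  intro x hx
  have h0 : 0 ≤ S x * (M x * expPrimitive M x * v x - expPrimitive M x * w x) := by
    refine le_of_tendsto (tendsto_riccati_wronskian hv hS hM ha hMb hpos) ?_
    filter_upwards [eventually_le_atBot x] with y hy
    exact mono (hy.trans hx) hx hy
  have h1 := nonneg_of_mul_nonneg_right h0 (hS.pos x hx)
  have h2 : 0 < expPrimitive M x := Real.exp_pos _
  have h3 : 0 ≤ expPrimitive M x * (M x * v x - w x) := by linarith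
  linarith [nonneg_of_mul_nonneg_right h3 h2]

include hv hS hv0 hM ha hMb hpos hd in
/-- A Riccati supersolution bounds the logarithmic derivative from below. -/
theorem Decaying.ge_of_riccati (hres : ∀ x < 0, d x + S x * M x ^ 2 ≤ q x) :
    ∀ x ≤ 0, M x * v x ≤ w x := by
  have anti := hv.wronskian_antitoneOn hS hv0 (continuous_expPrimitive hM).continuousOn
    (hM.mul (continuous_expPrimitive hM)).continuousOn
    (fun x _ => hasDerivAt_expPrimitive hM x) (riccati_flux hM hd)
    (fun x hx => mul_le_mul_of_nonneg_right (hres x hx) (Real.exp_pos _).le)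
  intro x hx
  have h0 : S x * (M x * expPrimitive M x * v x - expPrimitive M x * w x) ≤ 0 := by
    refine ge_of_tendsto (tendsto_riccati_wronskian hv hS hM ha hMb hpos) ?_
    filter_upwards [eventually_le_atBot x] with y hy
    exact anti (hy.trans hx) hx hy
  have h1 := nonpos_of_mul_nonpos_right h0 (hS.pos x hx)
  have h2 : 0 < expPrimitive M x := Real.exp_pos _
  have h3 : 0 ≤ expPrimitive M x * (w x - M x * v x) := by linarith
  linarith [nonneg_of_mul_nonneg_right h3 h2]

end RiccatiComparison

/-- A lower bound for the logarithmic derivative at `0` propagates to the half line. -/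
theorem Decaying.neg_le_of_zero (hv : Decaying S q v w) (hS : Stiffness S)
    (hv0 : ∀ x ≤ 0, 0 ≤ v x) {K : ℝ} {s : ℝ → ℝ} (hs : ∀ x < 0, HasDerivAt S (s x) x)
    (hres : ∀ x < 0, q x ≤ S x * K ^ 2 - s x * K) (h0 : -K * v 0 ≤ w 0) :
    ∀ x ≤ 0, -K * v x ≤ w x := by
  have hd : ∀ x < 0, HasDerivAt (fun x => S x * (fun _ : ℝ => -K) x) (s x * -K) x :=
    fun x hx => (hs x hx).mul_const _
  have hM : Continuous fun _ : ℝ => -K := continuous_const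
  have mono := hv.wronskian_monotoneOn hS hv0 (continuous_expPrimitive hM).continuousOn
    (hM.mul (continuous_expPrimitive hM)).continuousOn
    (fun x _ => hasDerivAt_expPrimitive hM x) (riccati_flux hM hd)
    (fun x hx => mul_le_mul_of_nonneg_right (by have := hres x hx; linarith) (Real.exp_pos _).le)
  intro x hx
  -- Here the information sits at the right end: the increasing Wronskian with `exp (-K x)` is
  -- nonpositive at `0`, hence everywhere to the left.
  have h1 := mono hx (mem_Iic.2 le_rfl) hx
  have e0 : expPrimitive (fun _ : ℝ => -K) 0 = 1 := by simp [expPrimitive]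
  simp only [e0, one_mul, mul_one, Pi.mul_apply] at h1
  have h2 := hS.pos x hx
  have h3 := hS.pos 0 le_rfl
  have h4 : 0 < expPrimitive (fun _ : ℝ => -K) x := Real.exp_pos _
  have h5 : S 0 * (-K * v 0 - w 0) ≤ 0 := mul_nonpos_of_nonneg_of_nonpos h3.le (by linarith)
  have h6 : S x * expPrimitive (fun _ : ℝ => -K) x * (-K * v x - w x) ≤ 0 := by
    have e : S x * expPrimitive (fun _ : ℝ => -K) x * (-K * v x - w x) =
      S x * (-K * expPrimitive (fun _ => -K) x * v x - expPrimitive (fun _ => -K) x * w x) := by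
      ring
    rw [e]; linarith
  have h7 := nonpos_of_mul_nonpos_right h6 (mul_pos h2 h4)
  linarith

/-- Two decaying solutions are proportional. -/
theorem Decaying.exists_smul (hv : Decaying S q v w) (hS : Stiffness S) {v₂ w₂ : ℝ → ℝ}
    (hv₂ : Decaying S q v₂ w₂) (hpos : ∀ x ≤ 0, 0 < v₂ x) :
    ∃ c : ℝ, ∀ x ≤ 0, v x = c * v₂ x ∧ w x = c * w₂ x := by
  -- The weighted Wronskian of two solutions is constant, and decay at `-∞` makes the constant zero,
  -- so `v / v₂` has zero derivative.
  have hwr : ∀ x ≤ 0, S x * (w x * v₂ x - v x * w₂ x) = 0 := by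
    apply eq_zero_of_hasDerivAt_zero_tendsto
    · exact hS.contOn.mul ((hv.contOn_deriv.mul hv₂.contOn).sub (hv.contOn.mul hv₂.contOn_deriv))
    · intro x hx
      have := ((hv.hasDeriv_flux x hx).mul (hv₂.hasDeriv x hx)).sub
        ((hv.hasDeriv x hx).mul (hv₂.hasDeriv_flux x hx))
      refine (this.congr_deriv (by ring)).congr_of_eventuallyEq (.of_forall fun y => ?_)
      simp only [Pi.sub_apply, Pi.mul_apply]; ring
    · have h1 : Tendsto (fun x => w x * v₂ x) atBot (𝓝 0) := by
        simpa using hv.tendsto_deriv.mul hv₂.tendsto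
      have h2 : Tendsto (fun x => v x * w₂ x) atBot (𝓝 0) := by
        simpa using hv.tendsto.mul hv₂.tendsto_deriv
      have := tendsto_flux_zero (K := 1) hS (F := fun _ => 1) (G := fun _ => 1) h1 h2
        (fun x _ => by simp) (fun x _ => by simp)
      simpa using this
  have hcross : ∀ x ≤ 0, w x * v₂ x = v x * w₂ x := fun x hx => by
    have := (mul_eq_zero.1 (hwr x hx)).resolve_left (hS.pos x hx).ne'
    linarith
  have hquot : ∀ x ≤ 0, v x / v₂ x = v 0 / v₂ 0 := by
    refine eq_of_hasDerivAt_zero (D := fun x => v x / v₂ x)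
      (hv.contOn.div hv₂.contOn fun z hz => (hpos z hz).ne') fun x hx => ?_
    refine ((hv.hasDeriv x hx).div (hv₂.hasDeriv x hx) (hpos x hx.le).ne').congr_deriv ?_
    rw [hcross x hx.le, sub_self, zero_div]
  refine ⟨v 0 / v₂ 0, fun x hx => ?_⟩
  have h1 := (hpos x hx).ne'
  have h2 : v x = v 0 / v₂ 0 * v₂ x := by rw [← hquot x hx]; field_simp
  refine ⟨h2, ?_⟩
  have h3 := hcross x hx
  rw [h2] at h3
  exact mul_right_cancel₀ h1 (by rw [h3]; ring)

/-- A decaying solution with a double zero vanishes. -/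
theorem Decaying.eq_zero_of_double_zero (hv : Decaying S q v w) (hS : Stiffness S) {s Q : ℝ}
    (hs : 0 < s) (hSs : ∀ x ≤ 0, s ≤ S x) (hq : ∀ x ≤ 0, |q x| ≤ Q) {x₀ : ℝ} (hx₀ : x₀ ≤ 0)
    (h1 : v x₀ = 0) (h2 : w x₀ = 0) : ∀ x ≤ 0, v x = 0 := by
  have hQ : 0 ≤ Q := (abs_nonneg _).trans (hq 0 le_rfl)
  have hi : interior (Iic (0 : ℝ)) = Iio 0 := interior_Iic
  -- The flux `S w` is used instead of `w` because it is the flux whose derivative the equation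
  -- supplies; `1 / s + Q` is then a Grönwall constant.
  have key := eq_zero_of_abs_deriv_le (E := fun x => v x ^ 2 + (S x * w x) ^ 2)
    (E' := fun x => 2 * v x * w x + 2 * (S x * w x) * (q x * v x)) (convex_Iic 0) (C := 1 / s + Q)
    ((hv.contOn.pow 2).add ((hS.contOn.mul hv.contOn_deriv).pow 2))
    (by
      rw [hi]
      intro x hx
      refine (((hv.hasDeriv x hx).pow 2).add ((hv.hasDeriv_flux x hx).pow 2)).congr_deriv ?_
      simp)
    (fun x _ => by positivity)
    (by
      rw [hi]
      intro x hx
      have hx' : x ≤ 0 := le_of_lt hx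
      have hsx := hSs x hx'
      have hSx := hS.pos x hx'
      have ha : |w x| ≤ 1 / s * |S x * w x| := by
        rw [abs_mul, abs_of_pos hSx, one_div, ← div_eq_inv_mul, le_div_iff₀ hs]
        nlinarith [abs_nonneg (w x)]
      have hb := hq x hx'
      set A := |v x|
      set B := |S x * w x|
      have hA : 0 ≤ A := abs_nonneg _
      have hB : 0 ≤ B := abs_nonneg _
      have e1 : |2 * v x * w x| ≤ 2 * A * (1 / s * B) := by
        rw [abs_mul, abs_mul, abs_two]; gcongr
      have e2 : |2 * (S x * w x) * (q x * v x)| ≤ 2 * B * (Q * A) := by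
        rw [abs_mul, abs_mul, abs_two, abs_mul (q x)]; gcongr
      have e3 : v x ^ 2 + (S x * w x) ^ 2 = A ^ 2 + B ^ 2 := by rw [sq_abs, sq_abs]
      rw [e3]
      refine (abs_add_le _ _).trans ((add_le_add e1 e2).trans ?_)
      have h4 : 2 * A * B ≤ A ^ 2 + B ^ 2 := by nlinarith [sq_nonneg (A - B)]
      have h5 : 0 ≤ 1 / s + Q := by positivity
      calc 2 * A * (1 / s * B) + 2 * B * (Q * A) = (1 / s + Q) * (2 * A * B) := by ring
        _ ≤ _ := by gcongr)
    hx₀ (by simp [h1, h2])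
  intro x hx
  have := key x hx
  have h3 : v x ^ 2 = 0 := by nlinarith [sq_nonneg (v x), sq_nonneg (S x * w x)]
  exact pow_eq_zero_iff (two_ne_zero) |>.1 h3

end HalfLine
end PiKink
end

/-! ### Families of half-line problems depending on the spectral parameter. -/

noncomputable section
namespace PiKink

/-- A family of Sturm-Liouville equations on the half line, with parameter in `[Λ₁, 0]`, whose
coefficients converge exponentially to positive limits at `-∞`. -/
structure HalfFamily (Λ₁ : ℝ) (S q : ℝ → ℝ → ℝ) : Prop where
  contS : ContinuousOn (fun z : ℝ × ℝ => S z.2 z.1) (Iic 0 ×ˢ Icc Λ₁ 0)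
  contq : ContinuousOn (fun z : ℝ × ℝ => q z.2 z.1) (Iic 0 ×ˢ Icc Λ₁ 0)
  bounds : ∀ Λ ∈ Icc Λ₁ 0, ∀ x ≤ 0, 1 / 2 ≤ S Λ x ∧ S Λ x ≤ 2 ∧ |q Λ x| ≤ 4
  limits : ∃ (S₀ q₀ : ℝ → ℝ) (C η : ℝ), 0 < η ∧ ContinuousOn S₀ (Icc Λ₁ 0) ∧
    ContinuousOn q₀ (Icc Λ₁ 0) ∧ (∀ Λ ∈ Icc Λ₁ 0, 1 / 2 ≤ S₀ Λ) ∧ (∀ Λ ∈ Icc Λ₁ 0, 0 < q₀ Λ) ∧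
    ∀ Λ ∈ Icc Λ₁ 0, ∀ x ≤ 0, |S Λ x - S₀ Λ| ≤ C * Real.exp (2 * η * x) ∧
      |q Λ x - q₀ Λ| ≤ C * Real.exp (2 * η * x)

theorem HalfFamily.stiffness {Λ₁ : ℝ} {S q : ℝ → ℝ → ℝ} (h : HalfFamily Λ₁ S q) {Λ : ℝ}
    (hΛ : Λ ∈ Icc Λ₁ 0) : Stiffness (S Λ) where
  contOn := h.contS.comp (f := fun x : ℝ => (x, Λ)) (by fun_prop) fun _ hx => ⟨hx, hΛ⟩
  pos x hx := by linarith [(h.bounds Λ hΛ x hx).1]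
  bounded := ⟨2, fun x hx => (h.bounds Λ hΛ x hx).2.1⟩

theorem tendsto_exp_mul_atBot {k : ℝ} (hk : 0 < k) :
    Tendsto (fun x => Real.exp (k * x)) atBot (𝓝 0) :=
  Real.tendsto_exp_atBot.comp (tendsto_id.const_mul_atBot hk)

/-- In first-order form the unknowns are `v` and the flux `S v'`, with `σ = 1 / S`. The solutions
are normalized at `-∞`, and after removal of the factor `exp (k x)` they are jointly continuous on a
compact set that includes `x = -∞`; the later choice of an extremal parameter relies on this
compactness. -/
theorem HalfFamily.exists_decaying {Λ₁ : ℝ} {S q : ℝ → ℝ → ℝ} (h : HalfFamily Λ₁ S q) :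
    ∃ (η : ℝ) (k : C(Icc Λ₁ 0, ℝ)) (V Y : C(unitInterval × Icc Λ₁ 0, ℝ)), 0 < η ∧
      (∀ y, 0 < k y) ∧ (∀ y, V (0, y) = 1) ∧ ∀ y : Icc Λ₁ (0 : ℝ),
        Decaying (S y) (q y) (fun x => Real.exp (k y * x) * clampEval V (Real.exp (η * x)) y)
          (fun x => (S y x)⁻¹ * (Real.exp (k y * x) * clampEval Y (Real.exp (η * x)) y)) := by
  obtain ⟨S₀, q₀, C, η, hη, cS₀, cq₀, hS₀, hq₀, hlim⟩ := h.limits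
  have pS : ∀ (y : Icc Λ₁ (0 : ℝ)) (x : ℝ), x ≤ 0 → 0 < S y x := fun y x hx => by
    linarith [(h.bounds y y.2 x hx).1]
  have pS₀ : ∀ (y : Icc Λ₁ (0 : ℝ)), 0 < S₀ y := fun y => by linarith [hS₀ y y.2]
  let σ₀ : C(Icc Λ₁ (0 : ℝ), ℝ) := ⟨fun y => (S₀ y)⁻¹,
    (continuousOn_iff_continuous_domRestrict.1 cS₀).inv₀ fun y => (pS₀ y).ne'⟩
  let Q₀ : C(Icc Λ₁ (0 : ℝ), ℝ) := ⟨fun y => q₀ y, continuousOn_iff_continuous_domRestrict.1 cq₀⟩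
  have cmap : ContinuousOn (fun z : ℝ × Icc Λ₁ (0 : ℝ) => (z.1, (z.2 : ℝ))) (Iic 0 ×ˢ univ) := by
    fun_prop
  have maps : MapsTo (fun z : ℝ × Icc Λ₁ (0 : ℝ) => (z.1, (z.2 : ℝ))) (Iic 0 ×ˢ univ)
      (Iic 0 ×ˢ Icc Λ₁ 0) := fun z hz => ⟨hz.1, z.2.2⟩
  -- The factor `4` comes from `1/S - 1/S₀ = -(S - S₀) / (S S₀)` with both `S` and `S₀` at least
  -- `1/2`.
  obtain ⟨k, V, Y, hk, hV, hd⟩ := exists_decaying_family (σ := fun x (y : Icc Λ₁ (0 : ℝ)) => (S y x)⁻¹)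
    (q := fun x y => q y x) (σ₀ := σ₀) (q₀ := Q₀) (C := 4 * C) hη
    ((h.contS.comp cmap maps).inv₀ fun z hz => (pS z.2 z.1 hz.1).ne') (h.contq.comp cmap maps)
    (fun y => inv_pos.2 (pS₀ y)) (fun y => hq₀ y y.2)
    (fun x hx y => by
      have h1 := (hlim y y.2 x hx).1
      have h2 := (h.bounds y y.2 x hx).1
      have h3 := hS₀ y y.2
      have e : (S y x)⁻¹ - (S₀ y)⁻¹ = -(S y x - S₀ y) * ((S y x)⁻¹ * (S₀ y)⁻¹) := by
        have := (pS y x hx).ne'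
        have := (pS₀ y).ne'
        field_simp; ring
      change |(S y x)⁻¹ - (S₀ y)⁻¹| ≤ _
      have i1 : (S y x)⁻¹ ≤ 2 := by
        rw [inv_le_comm₀ (pS y x hx) (by norm_num)]; linarith
      have i2 : (S₀ y)⁻¹ ≤ 2 := by
        rw [inv_le_comm₀ (pS₀ y) (by norm_num)]; linarith
      have p1 := inv_pos.2 (pS y x hx)
      have p2 := inv_pos.2 (pS₀ y)
      rw [e, abs_mul, abs_neg, abs_of_pos (mul_pos p1 p2)]
      calc _ ≤ C * Real.exp (2 * η * x) * (2 * 2) :=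
            mul_le_mul h1 (mul_le_mul i1 i2 p2.le (by norm_num)) (mul_pos p1 p2).le
              ((abs_nonneg _).trans h1)
        _ = _ := by ring)
    (fun x hx y => by
      have h1 := (hlim y y.2 x hx).2
      exact h1.trans (by linarith [(abs_nonneg _).trans h1]))
  have cE : ∀ (G : C(unitInterval × Icc Λ₁ (0 : ℝ), ℝ)) y,
      Continuous fun x => Real.exp (k y * x) * clampEval G (Real.exp (η * x)) y := fun G y => by
    have : Continuous fun x : ℝ => clampEval G (Real.exp (η * x)) y :=
      (continuous_clampEval G).comp (f := fun x : ℝ => (Real.exp (η * x), y)) (by fun_prop)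
    fun_prop
  have tE : ∀ (G : C(unitInterval × Icc Λ₁ (0 : ℝ), ℝ)) y,
      Tendsto (fun x => Real.exp (k y * x) * clampEval G (Real.exp (η * x)) y) atBot (𝓝 0) := by
    intro G y
    have := (tendsto_exp_mul_atBot (hk y)).mul_const ‖G‖
    rw [zero_mul] at this
    refine squeeze_zero_norm (fun x => ?_) this
    rw [Real.norm_eq_abs, abs_mul, abs_of_pos (Real.exp_pos _)]
    gcongr
    exact abs_clampEval_le G _ _
  refine ⟨η, k, V, Y, hη, hk, hV, fun y => ⟨(cE V y).continuousOn, ?_, fun x hx => ?_,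
    fun x hx => ?_, tE V y, ?_⟩⟩
  · exact ((h.stiffness y.2).contOn.inv₀ fun x hx => (pS y x hx).ne').mul (cE Y y).continuousOn
  · exact (hd y x hx).1
  · refine (hd y x hx).2.congr_of_eventuallyEq ?_
    filter_upwards [Iio_mem_nhds hx] with z hz
    rw [mul_inv_cancel_left₀ (pS y z (le_of_lt hz)).ne']
  · have := (tE Y y).abs.const_mul 2
    rw [abs_zero, mul_zero] at this
    refine squeeze_zero_norm' ?_ this
    filter_upwards [eventually_le_atBot 0] with x hx
    rw [Real.norm_eq_abs, abs_mul]
    gcongr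
    rw [abs_of_pos (inv_pos.2 (pS y x hx)), inv_le_comm₀ (pS y x hx) (by norm_num)]
    linarith [(h.bounds y y.2 x hx).1]

/-- The set of bad parameters is the union of a closed set and the projection of a closed set along
the compact interval `[0, 1]`. Hence it is compact and has a greatest element. -/
theorem exists_max_of_isCompact_cover {Λ₁ : ℝ} {F G : C(unitInterval × Icc Λ₁ (0 : ℝ), ℝ)}
    {D : Icc Λ₁ (0 : ℝ) → ℝ} (hD : Continuous D)
    (hne : ∃ y, D y ≤ 0 ∨ ∃ t, F (t, y) ≤ 0 ∨ G (t, y) ≤ 0) :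
    ∃ y, (D y ≤ 0 ∨ ∃ t, F (t, y) ≤ 0 ∨ G (t, y) ≤ 0) ∧
      ∀ z, y < z → 0 < D z ∧ ∀ t, 0 < F (t, z) ∧ 0 < G (t, z) := by
  let Z : Set (Icc Λ₁ (0 : ℝ)) := {y | D y ≤ 0} ∪
    Prod.snd '' {p : unitInterval × Icc Λ₁ (0 : ℝ) | F p ≤ 0 ∨ G p ≤ 0}
  have hZ : ∀ y, y ∈ Z ↔ (D y ≤ 0 ∨ ∃ t, F (t, y) ≤ 0 ∨ G (t, y) ≤ 0) := by
    intro y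
    simp only [Z, mem_union, mem_ofPred_eq, mem_image, Prod.exists, exists_eq_right]
  have hcomp : IsCompact Z := by
    refine IsCompact.union (isClosed_le hD continuous_const).isCompact (IsCompact.image ?_
      continuous_snd)
    exact ((isClosed_le F.continuous continuous_const).union
      (isClosed_le G.continuous continuous_const)).isCompact
  obtain ⟨y₀, hy₀⟩ := hne
  obtain ⟨y, hy, hmax⟩ := hcomp.exists_isGreatest ⟨y₀, (hZ y₀).2 hy₀⟩
  refine ⟨y, (hZ y).1 hy, fun z hz => ?_⟩
  have hn : z ∉ Z := fun hzZ => absurd (hmax hzZ) (not_le.2 hz)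
  rw [hZ] at hn
  push Not at hn
  exact ⟨hn.1, hn.2⟩

end PiKink
end

/-! ### Existence of a positive eigenfunction by continuation in the spectral parameter. -/

noncomputable section
namespace PiKink

section GroundState

variable {X : Type*} [TopologicalSpace X]

theorem clampEval_one (G : C(unitInterval × X, ℝ)) (y : X) : clampEval G 1 y = G (1, y) := by
  simp only [clampEval, projIcc_right]; rfl

theorem clampEval_coe (G : C(unitInterval × X, ℝ)) (t : unitInterval) (y : X) :
    clampEval G t y = G (t, y) := by
  simp only [clampEval, projIcc_val]

/-- Every point of `(0, 1]` is of the form `exp (η x)` with `x ≤ 0`. -/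
theorem exists_exp_eq {η : ℝ} (hη : 0 < η) {t : unitInterval} (ht : t ≠ 0) :
    ∃ x ≤ 0, Real.exp (η * x) = t := by
  have ht' : 0 < (t : ℝ) := lt_of_le_of_ne t.2.1 fun h => ht (Subtype.ext h.symm)
  refine ⟨Real.log t / η,
    div_nonpos_of_nonpos_of_nonneg (Real.log_nonpos t.2.1 t.2.2) hη.le, ?_⟩
  rw [mul_div_cancel₀ _ hη.ne', Real.exp_log ht']

/-- A nonnegative decaying solution is positive, except possibly at the end point `0`, where its
derivative is then negative. -/
theorem pos_or_of_nonneg {S q w : ℝ → ℝ} {V : C(unitInterval × X, ℝ)} {y : X} {k η : ℝ}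
    (hη : 0 < η) (hV : V (0, y) = 1) (hS : Stiffness S) (hS2 : ∀ x ≤ 0, 1 / 2 ≤ S x)
    (hq : ∀ x ≤ 0, |q x| ≤ 4)
    (hd : Decaying S q (fun x => Real.exp (k * x) * clampEval V (Real.exp (η * x)) y) w)
    (hnn : ∀ t, 0 ≤ V (t, y)) : (∀ t, 0 < V (t, y)) ∨ (V (1, y) = 0 ∧ w 0 < 0) := by
  set v : ℝ → ℝ := fun x => Real.exp (k * x) * clampEval V (Real.exp (η * x)) y with hv
  have hv0 : ∀ x, 0 ≤ v x := fun x => mul_nonneg (Real.exp_pos _).le (hnn _)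
  have hne : ¬ ∀ x ≤ 0, v x = 0 := by
    intro h
    have h1 : Tendsto (fun x => clampEval V (Real.exp (η * x)) y) atBot (𝓝 (clampEval V 0 y)) := by
      have hc : Continuous fun s : ℝ => clampEval V s y :=
        (continuous_clampEval V).comp (f := fun s : ℝ => (s, y)) (by fun_prop)
      exact (hc.tendsto 0).comp (tendsto_exp_mul_atBot hη)
    have h2 : clampEval V 0 y = 1 := by
      have := clampEval_coe V 0 y
      rw [← hV, ← this]; rfl
    have h3 : Tendsto (fun x => clampEval V (Real.exp (η * x)) y) atBot (𝓝 0) := by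
      refine Tendsto.congr' ?_ tendsto_const_nhds
      filter_upwards [eventually_le_atBot 0] with x hx
      exact ((mul_eq_zero.1 (h x hx)).resolve_left (Real.exp_pos _).ne').symm
    rw [h2] at h1
    exact one_ne_zero (tendsto_nhds_unique h1 h3)
  have hdz : ∀ x ≤ 0, v x = 0 → w x ≠ 0 := fun x hx h1 h2 =>
    hne (hd.eq_zero_of_double_zero hS (by norm_num) hS2 hq hx h1 h2)
  by_cases hall : ∀ t, 0 < V (t, y)
  · exact Or.inl hall
  push Not at hall
  obtain ⟨t, ht⟩ := hall
  have ht0 : V (t, y) = 0 := le_antisymm ht (hnn t)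
  have htne : t ≠ 0 := by rintro rfl; rw [hV] at ht0; exact one_ne_zero ht0
  obtain ⟨x, hx, hxt⟩ := exists_exp_eq hη htne
  have hvx : v x = 0 := by simp only [hv, hxt, clampEval_coe, ht0, mul_zero]
  rcases hx.lt_or_eq with hlt | rfl
  · exfalso
    -- An interior zero of a nonnegative solution is a minimum, hence a double zero, and the
    -- solution would vanish identically, against the normalization `V (0, y) = 1`.
    refine hdz x hx hvx (IsLocalMin.hasDerivAt_eq_zero ?_ (hd.hasDeriv x hlt))
    exact .of_forall fun z => by rw [hvx]; exact hv0 z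
  · right
    have hV1 : V (1, y) = 0 := by
      have : v 0 = V (1, y) := by simp [hv, clampEval_one]
      rw [← this, hvx]
    -- At the end point a positive derivative would make the solution negative just to the left, and
    -- a zero derivative would again give a double zero.
    refine ⟨hV1, lt_of_le_of_ne ?_ (hdz 0 le_rfl hvx)⟩
    by_contra hpos
    push Not at hpos
    have hcw := hd.contOn_deriv 0 (mem_Iic.2 le_rfl)
    obtain ⟨δ, hδ, hball⟩ := Metric.mem_nhdsWithin_iff.1 (hcw.eventually (lt_mem_nhds hpos))
    have hmono : StrictMonoOn v (Icc (-(δ / 2)) 0) := by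
      apply strictMonoOn_of_deriv_pos (convex_Icc _ _)
        (hd.contOn.mono fun z hz => hz.2)
      rw [interior_Icc]
      intro z hz
      rw [(hd.hasDeriv z hz.2).deriv]
      refine hball ⟨?_, hz.2.le⟩
      rw [Metric.mem_ball, Real.dist_eq, sub_zero, abs_of_neg hz.2]
      linarith [hz.1]
    have := hmono ⟨le_rfl, by linarith⟩ ⟨by linarith, le_rfl⟩ (by linarith : -(δ / 2) < 0)
    rw [hvx] at this
    exact absurd (hv0 _) (not_le.2 this)

end GroundState

/-- Existence of a positive eigenfunction: the two half-line problems are glued at the largest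
parameter value for which the Wronskian of the decaying solutions vanishes. -/
theorem exists_ground_state {Λ₁ : ℝ} (hΛ₁ : Λ₁ < 0) {S q S' q' : ℝ → ℝ → ℝ}
    (hL : HalfFamily Λ₁ S q) (hR : HalfFamily Λ₁ S' q') {v₀ w₀ v₀' w₀' : ℝ → ℝ}
    (d₀ : Decaying (S 0) (q 0) v₀ w₀) (d₀' : Decaying (S' 0) (q' 0) v₀' w₀')
    (p₀ : ∀ x ≤ 0, 0 < v₀ x) (p₀' : ∀ x ≤ 0, 0 < v₀' x) (hw : 0 < w₀ 0 * v₀' 0 + w₀' 0 * v₀ 0)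
    {m m' : ℝ} (hm : m + m' ≤ 0)
    (h₁ : ∀ v w, Decaying (S Λ₁) (q Λ₁) v w → (∀ x ≤ 0, 0 ≤ v x) → w 0 ≤ m * v 0)
    (h₁' : ∀ v w, Decaying (S' Λ₁) (q' Λ₁) v w → (∀ x ≤ 0, 0 ≤ v x) → w 0 ≤ m' * v 0) :
    ∃ Λ ∈ Ico Λ₁ 0, ∃ v w v' w' : ℝ → ℝ, Decaying (S Λ) (q Λ) v w ∧
      Decaying (S' Λ) (q' Λ) v' w' ∧ (∀ x ≤ 0, 0 < v x) ∧ (∀ x ≤ 0, 0 < v' x) ∧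
      (∃ C k : ℝ, 0 < k ∧ ∀ x ≤ 0, |v x| ≤ C * Real.exp (k * x) ∧ |w x| ≤ C * Real.exp (k * x) ∧
        |v' x| ≤ C * Real.exp (k * x) ∧ |w' x| ≤ C * Real.exp (k * x)) ∧
      v 0 = v' 0 ∧ w 0 + w' 0 = 0 := by
  obtain ⟨η, k, V, Y, hη, hk, hV, hd⟩ := hL.exists_decaying
  obtain ⟨η', k', V', Y', hη', hk', hV', hd'⟩ := hR.exists_decaying
  set v : Icc Λ₁ (0 : ℝ) → ℝ → ℝ := fun y x =>
    Real.exp (k y * x) * clampEval V (Real.exp (η * x)) y with hv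
  set w : Icc Λ₁ (0 : ℝ) → ℝ → ℝ := fun y x =>
    (S y x)⁻¹ * (Real.exp (k y * x) * clampEval Y (Real.exp (η * x)) y) with hwdef
  set v' : Icc Λ₁ (0 : ℝ) → ℝ → ℝ := fun y x =>
    Real.exp (k' y * x) * clampEval V' (Real.exp (η' * x)) y with hv'
  set w' : Icc Λ₁ (0 : ℝ) → ℝ → ℝ := fun y x =>
    (S' y x)⁻¹ * (Real.exp (k' y * x) * clampEval Y' (Real.exp (η' * x)) y) with hwdef'
  have ev : ∀ y, v y 0 = V (1, y) := fun y => by simp [hv, clampEval_one]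
  have ev' : ∀ y, v' y 0 = V' (1, y) := fun y => by simp [hv', clampEval_one]
  have ew : ∀ y, w y 0 = (S y 0)⁻¹ * Y (1, y) := fun y => by simp [hwdef, clampEval_one]
  have ew' : ∀ y, w' y 0 = (S' y 0)⁻¹ * Y' (1, y) := fun y => by simp [hwdef', clampEval_one]
  have cS : ∀ {T p : ℝ → ℝ → ℝ}, HalfFamily Λ₁ T p →
      Continuous fun y : Icc Λ₁ (0 : ℝ) => (T y 0)⁻¹ := fun {T p} h => by
    have : Continuous fun y : Icc Λ₁ (0 : ℝ) => T y 0 :=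
      continuousOn_univ.1 (h.contS.comp (f := fun y : Icc Λ₁ (0 : ℝ) => ((0 : ℝ), (y : ℝ)))
        (by fun_prop) fun y _ => ⟨mem_Iic.2 le_rfl, y.2⟩)
    exact this.inv₀ fun y => ((h.stiffness y.2).pos 0 le_rfl).ne'
  have cw : Continuous fun y => w y 0 := by
    simp only [ew]; exact (cS hL).mul (Y.continuous.comp (by fun_prop))
  have cw' : Continuous fun y => w' y 0 := by
    simp only [ew']; exact (cS hR).mul (Y'.continuous.comp (by fun_prop))
  have cv : Continuous fun y => v y 0 := by
    simp only [ev]; exact V.continuous.comp (by fun_prop)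
  have cv' : Continuous fun y => v' y 0 := by
    simp only [ev']; exact V'.continuous.comp (by fun_prop)
  set D : Icc Λ₁ (0 : ℝ) → ℝ := fun y => w y 0 * v' y 0 + w' y 0 * v y 0 with hD
  have cD : Continuous D := (cw.mul cv').add (cw'.mul cv)
  have vpos : ∀ y, (∀ t, 0 < V (t, y)) → ∀ x, 0 < v y x := fun y h x =>
    mul_pos (Real.exp_pos _) (h _)
  have vpos' : ∀ y, (∀ t, 0 < V' (t, y)) → ∀ x, 0 < v' y x := fun y h x =>
    mul_pos (Real.exp_pos _) (h _)
  let bot : Icc Λ₁ (0 : ℝ) := ⟨Λ₁, le_rfl, hΛ₁.le⟩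
  let top : Icc Λ₁ (0 : ℝ) := ⟨0, hΛ₁.le, le_rfl⟩
  -- The lower end `Λ₁` is bad: if both solutions were positive there, the barriers would bound the
  -- Wronskian by `(m + m') v(0) v'(0) ≤ 0`.
  obtain ⟨y, hbad, hgood⟩ := exists_max_of_isCompact_cover (F := V) (G := V') cD (by
    refine ⟨bot, ?_⟩
    by_contra hcon
    push Not at hcon
    obtain ⟨hDpos, hpos⟩ := hcon
    have h1 := h₁ _ _ (hd bot) fun x _ => (vpos bot (fun t => (hpos t).1) x).le
    have h2 := h₁' _ _ (hd' bot) fun x _ => (vpos' bot (fun t => (hpos t).2) x).le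
    change w bot 0 ≤ m * v bot 0 at h1
    change w' bot 0 ≤ m' * v' bot 0 at h2
    have p1 := vpos bot (fun t => (hpos t).1) 0
    have p2 := vpos' bot (fun t => (hpos t).2) 0
    have : D bot ≤ (m + m') * (v bot 0 * v' bot 0) := by
      simp only [hD]; nlinarith
    have : (m + m') * (v bot 0 * v' bot 0) ≤ 0 :=
      mul_nonpos_of_nonpos_of_nonneg hm (mul_pos p1 p2).le
    linarith)
  -- At `Λ = 0` the constructed solution is a positive multiple of the given positive one, so the
  -- upper end is good and the extremal parameter lies strictly below `0`.
  have propor : ∀ {T p : ℝ → ℝ → ℝ} {u z : ℝ → ℝ} {η : ℝ} {k : C(Icc Λ₁ (0 : ℝ), ℝ)}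
      {V : C(unitInterval × Icc Λ₁ (0 : ℝ), ℝ)} {r : ℝ → ℝ}, HalfFamily Λ₁ T p → 0 < η →
      V (0, top) = 1 →
      Decaying (T 0) (p 0) (fun x => Real.exp (k top * x) * clampEval V (Real.exp (η * x)) top) r →
      Decaying (T 0) (p 0) u z → (∀ x ≤ 0, 0 < u x) →
      (∀ t, 0 < V (t, top)) ∧ ∃ c, 0 < c ∧ V (1, top) = c * u 0 ∧ r 0 = c * z 0 := by
    intro T p u z η k V r hT hη hV1 hdec hdec0 hu
    obtain ⟨c, hc⟩ := hdec.exists_smul (hT.stiffness top.2) hdec0 hu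
    have hcpos : 0 < c := by
      have h1 : Tendsto (fun x => clampEval V (Real.exp (η * x)) top) atBot (𝓝 1) := by
        have hcc : Continuous fun s : ℝ => clampEval V s top :=
          (continuous_clampEval V).comp (f := fun s : ℝ => (s, top)) (by fun_prop)
        have := (hcc.tendsto 0).comp (tendsto_exp_mul_atBot hη)
        have h2 : clampEval V 0 top = 1 := by
          have := clampEval_coe V 0 top
          rw [← hV1, ← this]; rfl
        rwa [h2] at this
      obtain ⟨x, hx1, hx2⟩ := ((h1.eventually (lt_mem_nhds one_pos)).and
        (eventually_le_atBot 0)).exists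
      have h3 := (hc x hx2).1
      have h4 : 0 < c * u x := by rw [← h3]; exact mul_pos (Real.exp_pos _) hx1
      exact pos_of_mul_pos_left h4 (hu x hx2).le
    refine ⟨fun t => ?_, c, hcpos, ?_, (hc 0 le_rfl).2⟩
    · by_cases ht : t = 0
      · rw [ht, hV1]; exact one_pos
      · obtain ⟨x, hx, hxt⟩ := exists_exp_eq hη ht
        have h3 := (hc x hx).1
        have h4 := mul_pos hcpos (hu x hx)
        rw [← h3, hxt, clampEval_coe] at h4
        exact (pos_iff_pos_of_mul_pos h4).1 (Real.exp_pos _)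
    · have := (hc 0 le_rfl).1
      simpa [clampEval_one] using this
  obtain ⟨tV, c, hc, hc1, hc2⟩ := propor hL hη (hV top) (hd top) d₀ p₀
  obtain ⟨tV', c', hc', hc1', hc2'⟩ := propor hR hη' (hV' top) (hd' top) d₀' p₀'
  have hytop : y < top := by
    refine lt_of_le_of_ne y.2.2 fun h => ?_
    rw [h] at hbad
    rcases hbad with h | ⟨t, h | h⟩
    · have : D top = c * c' * (w₀ 0 * v₀' 0 + w₀' 0 * v₀ 0) := by
        simp only [hD]
        change w top 0 = _ at hc2
        change w' top 0 = _ at hc2'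
        rw [ev, ev', hc1, hc1', hc2, hc2']; ring
      rw [this] at h
      have := mul_pos (mul_pos hc hc') hw
      linarith
    · exact absurd (tV t) (not_lt.2 h)
    · exact absurd (tV' t) (not_lt.2 h)
  have hne : (𝓝[>] y).NeBot := nhdsGT_neBot_of_exists_gt ⟨top, hytop⟩
  have limV : ∀ G : C(unitInterval × Icc Λ₁ (0 : ℝ), ℝ), (∀ z, y < z → ∀ t, 0 < G (t, z)) →
      ∀ t, 0 ≤ G (t, y) := by
    intro G hG t
    have hcG : Continuous fun z => G (t, z) := G.continuous.comp (by fun_prop)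
    refine ge_of_tendsto (hcG.continuousAt.tendsto.mono_left (nhdsWithin_le_nhds (s := Ioi y))) ?_
    filter_upwards [self_mem_nhdsWithin] with z hz
    exact (hG z hz t).le
  have nV := limV V fun z hz t => ((hgood z hz).2 t).1
  have nV' := limV V' fun z hz t => ((hgood z hz).2 t).2
  have nD : 0 ≤ D y := by
    refine ge_of_tendsto (cD.continuousAt.tendsto.mono_left (nhdsWithin_le_nhds (s := Ioi y))) ?_
    filter_upwards [self_mem_nhdsWithin] with z hz
    exact (hgood z hz).1.le
  have hS2 : ∀ {T p : ℝ → ℝ → ℝ}, HalfFamily Λ₁ T p → ∀ x ≤ 0, 1 / 2 ≤ T y x :=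
    fun h x hx => (h.bounds y y.2 x hx).1
  have hq4 : ∀ {T p : ℝ → ℝ → ℝ}, HalfFamily Λ₁ T p → ∀ x ≤ 0, |p y x| ≤ 4 :=
    fun h x hx => (h.bounds y y.2 x hx).2.2
  have alt := pos_or_of_nonneg hη (hV y) (hL.stiffness y.2) (hS2 hL) (hq4 hL) (hd y) nV
  have alt' := pos_or_of_nonneg hη' (hV' y) (hR.stiffness y.2) (hS2 hR) (hq4 hR) (hd' y) nV'
  change _ ∨ (_ ∧ w y 0 < 0) at alt
  change _ ∨ (_ ∧ w' y 0 < 0) at alt'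
  have hDy : D y = w y 0 * V' (1, y) + w' y 0 * V (1, y) := by simp only [hD, ev, ev']
  -- At the extremal parameter both solutions and the Wronskian are nonnegative by passage to the
  -- limit. A loss of positivity could only occur at `x = 0`, with negative slope. If one side loses
  -- it, the Wronskian is negative there. If both do, the Wronskian is negative for slightly larger
  -- parameters, where it should be positive. So the defect of the extremal parameter can only be a
  -- vanishing Wronskian.
  have both : (∀ t, 0 < V (t, y)) ∧ ∀ t, 0 < V' (t, y) := by
    rcases alt with a | ⟨a, b⟩
    · rcases alt' with a' | ⟨a', b'⟩
      · exact ⟨a, a'⟩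
      · exfalso
        rw [a', mul_zero, zero_add] at hDy
        nlinarith [a 1]
    · rcases alt' with a' | ⟨a', b'⟩
      · exfalso
        rw [a, mul_zero, add_zero] at hDy
        nlinarith [a' 1]
      · exfalso
        have e1 : ∀ᶠ z in 𝓝[>] y, w z 0 < 0 :=
          (cw.continuousAt.tendsto.mono_left nhdsWithin_le_nhds).eventually (gt_mem_nhds b)
        have e2 : ∀ᶠ z in 𝓝[>] y, w' z 0 < 0 :=
          (cw'.continuousAt.tendsto.mono_left nhdsWithin_le_nhds).eventually (gt_mem_nhds b')
        obtain ⟨z, hz1, hz2, hz3⟩ := (e1.and (e2.and self_mem_nhdsWithin)).exists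
        have hg := hgood z hz3
        have h1 := (hg.2 1).1
        have h2 := (hg.2 1).2
        have h3 := hg.1
        simp only [hD, ev, ev'] at h3
        nlinarith
  have hD0 : D y = 0 := by
    refine le_antisymm ?_ nD
    rcases hbad with h | ⟨t, h | h⟩
    · exact h
    · exact absurd (both.1 t) (not_lt.2 h)
    · exact absurd (both.2 t) (not_lt.2 h)
  have q1 : 0 < v y 0 := vpos y both.1 0
  have q2 : 0 < v' y 0 := vpos' y both.2 0
  have smul : ∀ {T p u z : ℝ → ℝ} (c : ℝ), Decaying T p u z →
      Decaying T p (fun x => c * u x) (fun x => c * z x) := fun {T p u z} c h =>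
    ⟨h.contOn.const_smul c, h.contOn_deriv.const_smul c, fun x hx => (h.hasDeriv x hx).const_mul c,
      fun x hx => (((h.hasDeriv_flux x hx).const_mul c).congr_deriv (by ring)
        ).congr_of_eventuallyEq (.of_forall fun z => by ring),
      by simpa using h.tendsto.const_mul c, by simpa using h.tendsto_deriv.const_mul c⟩
  -- Scaling each side by the other's value at `0` matches the values; the sum of the slopes is then
  -- the Wronskian, which is zero.
  refine ⟨y, ⟨y.2.1, hytop⟩, fun x => v' y 0 * v y x, fun x => v' y 0 * w y x,
    fun x => v y 0 * v' y x, fun x => v y 0 * w' y x, smul _ (hd y), smul _ (hd' y),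
    fun x _ => mul_pos q2 (vpos y both.1 x), fun x _ => mul_pos q1 (vpos' y both.2 x), ?_,
    mul_comm _ _, ?_⟩
  · have hbd : ∀ {T p : ℝ → ℝ → ℝ} (κ η c : ℝ) (F G : C(unitInterval × Icc Λ₁ (0 : ℝ), ℝ)),
        HalfFamily Λ₁ T p → 0 < c → ∃ C, ∀ x ≤ 0,
        |c * (Real.exp (κ * x) * clampEval F (Real.exp (η * x)) y)| ≤ C * Real.exp (κ * x) ∧
        |c * ((T y x)⁻¹ * (Real.exp (κ * x) * clampEval G (Real.exp (η * x)) y))| ≤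
          C * Real.exp (κ * x) := by
      intro T p κ η c F G hT hc
      refine ⟨c * (‖F‖ + 2 * ‖G‖), fun x hx => ⟨?_, ?_⟩⟩
      · rw [abs_mul, abs_mul, abs_of_pos hc, abs_of_pos (Real.exp_pos _)]
        have h1 := abs_clampEval_le F (Real.exp (η * x)) y
        have h2 := norm_nonneg G
        have h3 := Real.exp_pos (κ * x)
        calc _ ≤ c * (Real.exp (κ * x) * (‖F‖ + 2 * ‖G‖)) := by gcongr; linarith
          _ = _ := by ring
      · have hTx := hS2 hT x hx
        have hTp : 0 < T y x := by linarith
        rw [abs_mul, abs_mul, abs_mul, abs_of_pos hc, abs_of_pos (Real.exp_pos _),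
          abs_of_pos (inv_pos.2 hTp)]
        have h0 : (T y x)⁻¹ ≤ 2 := by
          rw [inv_le_comm₀ hTp (by norm_num)]; linarith
        have h1 := abs_clampEval_le G (Real.exp (η * x)) y
        have h2 := norm_nonneg F
        calc _ ≤ c * (2 * (Real.exp (κ * x) * ‖G‖)) := by gcongr
          _ = c * (2 * ‖G‖) * Real.exp (κ * x) := by ring
          _ ≤ _ := by gcongr; linarith
    obtain ⟨C, hC⟩ := hbd (k y) η (v' y 0) V Y hL q2
    obtain ⟨C', hC'⟩ := hbd (k' y) η' (v y 0) V' Y' hR q1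
    have hC0 : 0 ≤ C := by
      have := (abs_nonneg _).trans (hC 0 le_rfl).1
      simpa using this
    have hC0' : 0 ≤ C' := by
      have := (abs_nonneg _).trans (hC' 0 le_rfl).1
      simpa using this
    refine ⟨C + C', min (k y) (k' y), lt_min (hk y) (hk' y), fun x hx => ?_⟩
    have m1 : Real.exp (k y * x) ≤ Real.exp (min (k y) (k' y) * x) :=
      Real.exp_le_exp.2 (mul_le_mul_of_nonpos_right (min_le_left _ _) hx)
    have m2 : Real.exp (k' y * x) ≤ Real.exp (min (k y) (k' y) * x) :=
      Real.exp_le_exp.2 (mul_le_mul_of_nonpos_right (min_le_right _ _) hx)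
    have l1 : C * Real.exp (k y * x) ≤ (C + C') * Real.exp (min (k y) (k' y) * x) := by
      gcongr; linarith
    have l2 : C' * Real.exp (k' y * x) ≤ (C + C') * Real.exp (min (k y) (k' y) * x) := by
      gcongr; linarith
    exact ⟨(hC x hx).1.trans l1, (hC x hx).2.trans l1, (hC' x hx).1.trans l2,
      (hC' x hx).2.trans l2⟩
  · simp only [hD] at hD0
    change v' y 0 * w y 0 + v y 0 * w' y 0 = 0
    linarith

end PiKink
end

/-! ### The static equation in the phase plane. -/

noncomputable section
namespace PiKink

/-- The acceleration `φ''` prescribed by the static equation; `u = φ + θ`, `p = φ'`, `b = a²/12`. -/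
def accel (b γ u p : ℝ) : ℝ :=
  (sin u - γ + b * p ^ 2 * sin u + b * cos u * (sin u - γ)) / (1 + 2 * b * cos u)

/-- The potential of the static equation, normalized to vanish at `arcsin γ`. -/
def excess (b γ u : ℝ) : ℝ :=
  cos (arcsin γ) - cos u - γ * (u - arcsin γ) + b / 2 * (sin u - γ) ^ 2

theorem stiff_pos {b : ℝ} (hb : 0 < b) (hb' : b ≤ 1 / 1000) (u : ℝ) : 9 / 10 < 1 + 2 * b * cos u := by
  nlinarith [neg_one_le_cos u, cos_le_one u]

theorem stiff_lt {b : ℝ} (hb : 0 < b) (hb' : b ≤ 1 / 1000) (u : ℝ) : 1 + 2 * b * cos u < 11 / 10 := by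
  nlinarith [neg_one_le_cos u, cos_le_one u]

theorem accel_neg (b γ u p : ℝ) : accel b γ u (-p) = accel b γ u p := by
  simp [accel]

theorem residual_eq_zero_iff {a γ θ u p r : ℝ} (hb : 0 < a ^ 2 / 12) (hb' : a ^ 2 / 12 ≤ 1 / 1000) :
    residual a γ θ u p 0 r 0 0 0 = 0 ↔ r = accel (a ^ 2 / 12) γ (u + θ) p := by
  have h := stiff_pos hb hb' (u + θ)
  rw [accel, eq_div_iff (by linarith), residual]
  constructor <;> intro h <;> linarith

theorem hasDerivAt_excess (b γ u : ℝ) :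
    HasDerivAt (excess b γ) ((sin u - γ) * (1 + b * cos u)) u := by
  have h := (((hasDerivAt_cos u).const_sub (cos (arcsin γ))).sub
    (((hasDerivAt_id u).sub_const (arcsin γ)).const_mul γ)).add
    ((((hasDerivAt_sin u).sub_const γ).pow 2).const_mul (b / 2))
  refine h.congr_deriv ?_
  simp only [Nat.cast_ofNat, Nat.add_one_sub_one, pow_one]
  ring

theorem continuous_excess (b γ : ℝ) : Continuous (excess b γ) := by
  unfold excess; fun_prop

theorem excess_arcsin (b : ℝ) {γ : ℝ} (h0 : -1 ≤ γ) (h1 : γ ≤ 1) : excess b γ (arcsin γ) = 0 := by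
  simp [excess, sin_arcsin h0 h1]

theorem excess_add (b : ℝ) {γ : ℝ} (h0 : -1 ≤ γ) (h1 : γ ≤ 1) (t : ℝ) :
    excess b γ (arcsin γ + t) = cos (arcsin γ) * (1 - cos t) - γ * (t - sin t) +
      b / 2 * (sin (arcsin γ + t) - γ) ^ 2 := by
  rw [excess, cos_add, sin_arcsin h0 h1]; ring

theorem cos_arcsin_pos {γ : ℝ} (h0 : 0 ≤ γ) (h1 : γ < 1) : 0 < cos (arcsin γ) := by
  rw [cos_arcsin]
  exact Real.sqrt_pos.2 (by nlinarith)

theorem sin_le_of_nonneg {t : ℝ} (ht : t ≤ 0) : t ≤ sin t := by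
  have := sin_le (neg_nonneg.2 ht)
  rw [sin_neg] at this; linarith

/-- With `u = arcsin γ + t` and `t ≤ 0`, each of the three contributions in `excess_add` is
nonnegative. If they sum to zero, the lattice term vanishes, and it is a positive multiple of `(sin
u - γ)²`. -/
theorem excess_nonneg_of_le {b γ : ℝ} (hb : 0 < b) (h0 : 0 ≤ γ) (h1 : γ < 1) {u : ℝ}
    (hu : u ≤ arcsin γ) : 0 ≤ excess b γ u ∧
      (excess b γ u = 0 → sin u = γ) := by
  obtain ⟨t, rfl⟩ : ∃ t, u = arcsin γ + t := ⟨u - arcsin γ, by ring⟩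
  have ht : t ≤ 0 := by linarith
  rw [excess_add b (by linarith) h1.le]
  have e1 : 0 ≤ cos (arcsin γ) * (1 - cos t) :=
    mul_nonneg (cos_arcsin_pos h0 h1).le (by linarith [cos_le_one t])
  have e2 : γ * (t - sin t) ≤ 0 :=
    mul_nonpos_of_nonneg_of_nonpos h0 (by linarith [sin_le_of_nonneg ht])
  have e3 : 0 ≤ b / 2 * (sin (arcsin γ + t) - γ) ^ 2 := by positivity
  refine ⟨by linarith, fun h => ?_⟩
  have e4 : b / 2 * (sin (arcsin γ + t) - γ) ^ 2 = 0 := by linarith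
  have e5 := (mul_eq_zero.1 e4).resolve_left (by positivity)
  linarith [pow_eq_zero_iff (two_ne_zero) |>.1 e5]

/-- The half of a static solution on `(-∞, 0]`; `p` is the derivative of `u`. -/
structure Orbit (b γ : ℝ) (u p : ℝ → ℝ) : Prop where
  cont_u : Continuous u
  cont_p : Continuous p
  deriv_u : ∀ x < 0, HasDerivAt u (p x) x
  deriv_p : ∀ x < 0, HasDerivAt p (accel b γ (u x) (p x)) x
  lim_u : Tendsto u atBot (𝓝 (arcsin γ))
  lim_p : Tendsto p atBot (𝓝 0)

/-- Both `f²` and its derivative `2 f g` are integrable, so `f²` tends to zero. This converts the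
`H¹` and `H²` conditions into limits at `-∞`. -/
theorem tendsto_zero_of_memLp {f g : ℝ → ℝ} (hd : ∀ x < 0, HasDerivAt f (g x) x)
    (hf : MemLp f 2) (hg : MemLp g 2) : Tendsto f atBot (𝓝 0) := by
  have h1 : Tendsto (fun x => f x ^ 2) atBot (𝓝 0) := by
    refine tendsto_zero_of_hasDerivAt_of_integrableOn_Iic (a := -1)
      (f' := fun x => 2 * (f x * g x)) (fun x hx => ?_) ?_ hf.integrable_sq.integrableOn
    · refine ((hd x (by linarith [mem_Iic.1 hx])).pow 2).congr_deriv ?_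
      simp only [Nat.cast_ofNat, Nat.add_one_sub_one, pow_one]; ring
    · exact ((hf.integrable_mul hg).const_mul 2).integrableOn
  rw [tendsto_zero_iff_abs_tendsto_zero]
  have := h1.sqrt
  simpa [Function.comp_def, Real.sqrt_sq_eq_abs] using this

theorem MemLp.comp_neg_real {f : ℝ → ℝ} (hf : MemLp f 2) : MemLp (fun x => f (-x)) 2 :=
  hf.comp_measurePreserving (Measure.measurePreserving_neg volume)

section Kink

variable {a γ : ℝ} {φ : ℝ → ℝ}

theorem IsPiKink.hasDerivAt (h : IsPiKink a γ φ) (x : ℝ) : HasDerivAt φ (deriv φ x) x :=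
  ((h.contDiff.differentiable one_ne_zero) x).hasDerivAt

theorem IsPiKink.continuous_deriv (h : IsPiKink a γ φ) : Continuous (deriv φ) :=
  h.contDiff.continuous_deriv le_rfl

theorem IsPiKink.orbit_left (hb : 0 < a ^ 2 / 12) (hb' : a ^ 2 / 12 ≤ 1 / 1000)
    (h : IsPiKink a γ φ) : Orbit (a ^ 2 / 12) γ φ (deriv φ) where
  cont_u := h.contDiff.continuous
  cont_p := h.continuous_deriv
  deriv_u x _ := h.hasDerivAt x
  deriv_p x hx := by
    have h1 := (h.differentiableAt_deriv x hx.ne).hasDerivAt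
    have h2 := (residual_eq_zero_iff hb hb').1 (h.static x hx.ne)
    rwa [h2, theta, if_pos hx, add_zero] at h1
  lim_u := h.tendsto_atBot
  lim_p := tendsto_zero_of_memLp
    (fun x hx => (h.differentiableAt_deriv x hx.ne).hasDerivAt) h.memLp_deriv h.memLp_deriv_deriv

/-- The shift by `π` absorbs `θ`, and the reflection reverses the slope, on which `accel` depends
evenly. So the right half is an orbit leaving the same saddle point. -/
theorem IsPiKink.orbit_right (hb : 0 < a ^ 2 / 12) (hb' : a ^ 2 / 12 ≤ 1 / 1000)
    (h : IsPiKink a γ φ) :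
    Orbit (a ^ 2 / 12) γ (fun x => φ (-x) - π) (fun x => -deriv φ (-x)) where
  cont_u := by have := h.contDiff.continuous; fun_prop
  cont_p := by have := h.continuous_deriv; fun_prop
  deriv_u x _ := by
    have := ((h.hasDerivAt (-x)).comp x (hasDerivAt_neg x)).sub_const π
    exact this.congr_deriv (by ring)
  deriv_p x hx := by
    have hx' : 0 < -x := by linarith
    have h1 := (h.differentiableAt_deriv (-x) hx'.ne').hasDerivAt
    have h2 := (residual_eq_zero_iff hb hb').1 (h.static (-x) hx'.ne')
    rw [h2, theta, if_neg (not_lt.2 hx'.le)] at h1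
    have h3 := (h1.comp x (hasDerivAt_neg x)).neg
    refine h3.congr_deriv ?_
    rw [accel_neg]; simp only [sub_eq_add_neg]; ring
  lim_u := by
    have := (h.tendsto_atTop.comp tendsto_neg_atBot_atTop).sub_const π
    simpa [Function.comp_def] using this
  lim_p := by
    refine tendsto_zero_of_memLp (g := fun x => deriv (deriv φ) (-x)) (fun x hx => ?_)
      (MemLp.comp_neg_real h.memLp_deriv).neg (MemLp.comp_neg_real h.memLp_deriv_deriv)
    have hx' : 0 < -x := by linarith
    have h1 := (h.differentiableAt_deriv (-x) hx'.ne').hasDerivAt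
    have h3 := (h1.comp x (hasDerivAt_neg x)).neg
    exact h3.congr_deriv (by ring)

end Kink

/-- An explicit Lipschitz bound with a generous constant. It serves the uniqueness theorem and, with
the saddle point as second argument, the exponential decay of `φ''`. -/
theorem abs_accel_sub_le {b γ B : ℝ} (hb : 0 < b) (hb' : b ≤ 1 / 1000) (h0 : 0 ≤ γ) (h1 : γ < 1)
    {u u' p p' : ℝ} (hp : |p| ≤ B) (hp' : |p'| ≤ B) :
    |accel b γ u p - accel b γ u' p'| ≤ (30 + 10 * B ^ 2 + 10 * B) * (|u - u'| + |p - p'|) := by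
  have hB : 0 ≤ B := (abs_nonneg p).trans hp
  set δ := |u - u'| with hδ
  set ε := |p - p'| with hε
  have hδ0 : 0 ≤ δ := abs_nonneg _
  have hε0 : 0 ≤ ε := abs_nonneg _
  have hs : |sin u - sin u'| ≤ δ := abs_sin_sub_sin_le u u'
  have hc : |cos u - cos u'| ≤ δ := abs_cos_sub_cos_le u u'
  have s1 := abs_sin_le_one u
  have s2 := abs_sin_le_one u'
  have c1 := abs_cos_le_one u
  have c2 := abs_cos_le_one u'
  have D1 := stiff_pos hb hb' u
  have D2 := stiff_pos hb hb' u'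
  have hp2 : p ^ 2 ≤ B ^ 2 := by rw [← sq_abs]; gcongr
  have hp2' : p' ^ 2 ≤ B ^ 2 := by rw [← sq_abs]; gcongr
  set n' := sin u' - γ + b * p' ^ 2 * sin u' + b * cos u' * (sin u' - γ) with hn'
  have hbd : |n'| ≤ 5 + B ^ 2 := by
    have t1 : |b * p' ^ 2 * sin u'| ≤ 1 * B ^ 2 * 1 := by
      rw [abs_mul, abs_mul, abs_of_pos hb, abs_of_nonneg (sq_nonneg p')]
      gcongr; linarith
    have t0 : |sin u' - γ| ≤ 2 := by
      refine (abs_sub _ _).trans ?_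
      rw [abs_of_nonneg h0]; linarith
    have t2 : |b * cos u' * (sin u' - γ)| ≤ 1 * 1 * 2 := by
      rw [abs_mul, abs_mul, abs_of_pos hb]
      gcongr; linarith
    calc |n'| ≤ |sin u' - γ| + |b * p' ^ 2 * sin u'| + |b * cos u' * (sin u' - γ)| :=
          abs_add_three _ _ _
      _ ≤ _ := by linarith
  have hnum : |sin u - γ + b * p ^ 2 * sin u + b * cos u * (sin u - γ) - n'| ≤
      (4 + B ^ 2) * δ + 2 * B * ε := by
    have e : sin u - γ + b * p ^ 2 * sin u + b * cos u * (sin u - γ) - n' =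
        (sin u - sin u') + b * (p ^ 2 * (sin u - sin u') + (p - p') * (p + p') * sin u') +
        b * (cos u * (sin u - sin u') + (sin u' - γ) * (cos u - cos u')) := by
      rw [hn']; ring
    have t1 : |p ^ 2 * (sin u - sin u') + (p - p') * (p + p') * sin u'| ≤
        B ^ 2 * δ + ε * (B + B) * 1 := by
      refine (abs_add_le _ _).trans (add_le_add ?_ ?_)
      · rw [abs_mul, abs_of_nonneg (sq_nonneg p)]; gcongr
      · rw [abs_mul, abs_mul]
        gcongr
        exact (abs_add_le _ _).trans (add_le_add hp hp')
    have t2 : |cos u * (sin u - sin u') + (sin u' - γ) * (cos u - cos u')| ≤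
        1 * δ + 2 * δ := by
      refine (abs_add_le _ _).trans (add_le_add ?_ ?_)
      · rw [abs_mul]; gcongr
      · rw [abs_mul]; gcongr
        refine (abs_sub _ _).trans ?_
        rw [abs_of_nonneg h0]; linarith
    rw [e]
    refine (abs_add_three _ _ _).trans ?_
    rw [abs_mul b, abs_mul b, abs_of_pos hb]
    have t1' := mul_le_mul (show b ≤ 1 by linarith) t1 (abs_nonneg _) zero_le_one
    have t2' := mul_le_mul (show b ≤ 1 by linarith) t2 (abs_nonneg _) zero_le_one
    linarith
  have hden : |(1 + 2 * b * cos u') - (1 + 2 * b * cos u)| ≤ δ := by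
    have : (1 + 2 * b * cos u') - (1 + 2 * b * cos u) = 2 * b * -(cos u - cos u') := by ring
    rw [this, abs_mul, abs_neg, abs_of_pos (by linarith : 0 < 2 * b)]
    nlinarith
  have hsplit : accel b γ u p - accel b γ u' p' =
      ((sin u - γ + b * p ^ 2 * sin u + b * cos u * (sin u - γ) - n') * (1 + 2 * b * cos u') +
        n' * ((1 + 2 * b * cos u') - (1 + 2 * b * cos u))) /
        ((1 + 2 * b * cos u) * (1 + 2 * b * cos u')) := by
    rw [accel, accel, ← hn', div_sub_div _ _ (by linarith) (by linarith)]
    congr 1; ring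
  rw [hsplit, abs_div, abs_of_pos (mul_pos (by linarith) (by linarith) :
    0 < (1 + 2 * b * cos u) * (1 + 2 * b * cos u')), div_le_iff₀ (mul_pos (by linarith) (by linarith))]
  have D2' := stiff_lt hb hb' u'
  have hN : |(sin u - γ + b * p ^ 2 * sin u + b * cos u * (sin u - γ) - n') * (1 + 2 * b * cos u') +
        n' * ((1 + 2 * b * cos u') - (1 + 2 * b * cos u))| ≤
        ((4 + B ^ 2) * δ + 2 * B * ε) * 2 + (5 + B ^ 2) * δ := by
    refine (abs_add_le _ _).trans (add_le_add ?_ ?_)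
    · rw [abs_mul, abs_of_pos (by linarith : 0 < 1 + 2 * b * cos u')]
      gcongr; linarith
    · rw [abs_mul]; gcongr
  refine hN.trans ?_
  have hDD : 1 / 2 ≤ (1 + 2 * b * cos u) * (1 + 2 * b * cos u') := by nlinarith
  have hX : 0 ≤ (30 + 10 * B ^ 2 + 10 * B) * (δ + ε) := by positivity
  have : (30 + 10 * B ^ 2 + 10 * B) * (δ + ε) * (1 / 2) ≤ (30 + 10 * B ^ 2 + 10 * B) * (δ + ε) *
      ((1 + 2 * b * cos u) * (1 + 2 * b * cos u')) := by gcongr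
  refine le_trans ?_ this
  have i1 : 0 ≤ B ^ 2 * δ := by positivity
  have i2 : 0 ≤ B ^ 2 * ε := by positivity
  have i3 : 0 ≤ B * δ := by positivity
  have i4 : 0 ≤ B * ε := by positivity
  nlinarith

/-- Uniqueness for the static equation. -/
theorem static_unique {b γ : ℝ} (hb : 0 < b) (hb' : b ≤ 1 / 1000) (h0 : 0 ≤ γ) (h1 : γ < 1)
    {u p u' p' : ℝ → ℝ} {B : ℝ} (cu : ContinuousOn u (Iic 0)) (cp : ContinuousOn p (Iic 0))
    (cu' : ContinuousOn u' (Iic 0)) (cp' : ContinuousOn p' (Iic 0))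
    (du : ∀ x < 0, HasDerivAt u (p x) x) (dp : ∀ x < 0, HasDerivAt p (accel b γ (u x) (p x)) x)
    (du' : ∀ x < 0, HasDerivAt u' (p' x) x)
    (dp' : ∀ x < 0, HasDerivAt p' (accel b γ (u' x) (p' x)) x)
    (bp : ∀ x ≤ 0, |p x| ≤ B) (bp' : ∀ x ≤ 0, |p' x| ≤ B) {x₀ : ℝ} (hx₀ : x₀ ≤ 0)
    (hu : u x₀ = u' x₀) (hp : p x₀ = p' x₀) : ∀ x ≤ 0, u x = u' x ∧ p x = p' x := by
  have hi : interior (Iic (0 : ℝ)) = Iio 0 := interior_Iic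
  have hB : 0 ≤ B := (abs_nonneg _).trans (bp 0 le_rfl)
  set L := 30 + 10 * B ^ 2 + 10 * B with hL
  have key := eq_zero_of_abs_deriv_le (E := fun x => (u x - u' x) ^ 2 + (p x - p' x) ^ 2)
    (E' := fun x => 2 * (u x - u' x) * (p x - p' x) +
      2 * (p x - p' x) * (accel b γ (u x) (p x) - accel b γ (u' x) (p' x))) (convex_Iic 0)
    (C := 1 + 4 * L) (((cu.sub cu').pow 2).add ((cp.sub cp').pow 2))
    (by
      rw [hi]
      intro x hx
      refine ((((du x hx).sub (du' x hx)).pow 2).add (((dp x hx).sub (dp' x hx)).pow 2)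
        ).congr_deriv ?_
      simp)
    (fun x _ => by positivity)
    (by
      rw [hi]
      intro x hx
      have hx' : x ≤ 0 := le_of_lt hx
      have hl := abs_accel_sub_le hb hb' h0 h1 (u := u x) (u' := u' x) (bp x hx') (bp' x hx')
      rw [← hL] at hl
      set A := |u x - u' x|
      set P := |p x - p' x|
      have hA : 0 ≤ A := abs_nonneg _
      have hP : 0 ≤ P := abs_nonneg _
      have hL0 : 0 ≤ L := by positivity
      have e3 : (u x - u' x) ^ 2 + (p x - p' x) ^ 2 = A ^ 2 + P ^ 2 := by rw [sq_abs, sq_abs]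
      rw [e3]
      refine (abs_add_le _ _).trans ?_
      rw [abs_mul, abs_mul, abs_mul, abs_mul, abs_two]
      have h4 : 2 * A * P ≤ A ^ 2 + P ^ 2 := by nlinarith [sq_nonneg (A - P)]
      calc 2 * A * P + 2 * P * |accel b γ (u x) (p x) - accel b γ (u' x) (p' x)|
          ≤ 2 * A * P + 2 * P * (L * (A + P)) := by gcongr
        _ = 2 * A * P + L * (2 * A * P) + 2 * L * P ^ 2 := by ring
        _ ≤ (A ^ 2 + P ^ 2) + L * (A ^ 2 + P ^ 2) + 2 * L * (A ^ 2 + P ^ 2) := by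
          gcongr
          nlinarith [sq_nonneg A]
        _ ≤ _ := by nlinarith [mul_nonneg hL0 (sq_nonneg A), mul_nonneg hL0 (sq_nonneg P)])
    hx₀ (by simp [hu, hp])
  intro x hx
  have hk := key x hx
  have h3 : (u x - u' x) ^ 2 = 0 := by
    nlinarith [sq_nonneg (u x - u' x), sq_nonneg (p x - p' x)]
  have h4 : (p x - p' x) ^ 2 = 0 := by
    nlinarith [sq_nonneg (u x - u' x), sq_nonneg (p x - p' x)]
  exact ⟨sub_eq_zero.1 (pow_eq_zero_iff two_ne_zero |>.1 h3),
    sub_eq_zero.1 (pow_eq_zero_iff two_ne_zero |>.1 h4)⟩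

theorem exists_bound_of_tendsto {f : ℝ → ℝ} {l : ℝ} (hf : Continuous f)
    (hl : Tendsto f atBot (𝓝 l)) : ∃ B, ∀ x ≤ 0, |f x| ≤ B := by
  obtain ⟨X, hX⟩ := eventually_atBot.1 (hl.abs.eventually (gt_mem_nhds (lt_add_one |l|)))
  obtain ⟨M, hM⟩ := (isCompact_Icc (a := X) (b := 0)).exists_bound_of_continuousOn hf.continuousOn
  refine ⟨max M (|l| + 1), fun x hx => ?_⟩
  rcases le_total x X with h | h
  · exact (hX x h).le.trans (le_max_right _ _)
  · exact (hM x ⟨h, hx⟩).trans (le_max_left _ _)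

section OrbitFacts

variable {b γ : ℝ} {u p : ℝ → ℝ}

/-- Conservation of energy. -/
theorem Orbit.energy (hb : 0 < b) (hb' : b ≤ 1 / 1000) (h0 : -1 ≤ γ) (h1 : γ ≤ 1)
    (h : Orbit b γ u p) :
    ∀ x ≤ 0, (1 + 2 * b * cos (u x)) * p x ^ 2 = 2 * excess b γ (u x) := by
  have hz := eq_zero_of_hasDerivAt_zero_tendsto
    (D := fun x => (1 + 2 * b * cos (u x)) * p x ^ 2 - 2 * excess b γ (u x))
    (by
      have := h.cont_u; have := h.cont_p; have := continuous_excess b γ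
      exact Continuous.continuousOn (by fun_prop))
    (by
      intro x hx
      have hu := h.deriv_u x hx
      have hp := h.deriv_p x hx
      have hS := stiff_pos hb hb' (u x)
      have hd := (((hu.cos.const_mul (2 * b)).const_add 1).mul (hp.pow 2)).sub
        (((hasDerivAt_excess b γ (u x)).comp x hu).const_mul 2)
      refine hd.congr_deriv ?_
      have ha : (1 + 2 * b * cos (u x)) * accel b γ (u x) (p x) =
          sin (u x) - γ + b * p x ^ 2 * sin (u x) + b * cos (u x) * (sin (u x) - γ) := by
        rw [accel, mul_div_cancel₀ _ (by linarith)]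
      simp only [Nat.cast_ofNat, Nat.add_one_sub_one, pow_one, Pi.pow_apply]
      linear_combination (2 * p x) * ha)
    (by
      have hc : Tendsto (fun x => (1 + 2 * b * cos (u x))) atBot
          (𝓝 (1 + 2 * b * cos (arcsin γ))) :=
        ((continuous_cos.tendsto _).comp h.lim_u |>.const_mul (2 * b)).const_add 1
      have he := ((continuous_excess b γ).tendsto _).comp h.lim_u
      rw [excess_arcsin b h0 h1] at he
      have := (hc.mul (h.lim_p.pow 2)).sub (he.const_mul 2)
      simpa using this)
  intro x hx
  linarith [hz x hx]

/-- An orbit at rest at or below the saddle point is the saddle point. -/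
theorem Orbit.const_of_rest (hb : 0 < b) (hb' : b ≤ 1 / 1000) (h0 : 0 ≤ γ) (h1 : γ < 1)
    (h : Orbit b γ u p) {x₁ : ℝ} (hx₁ : x₁ ≤ 0) (hu : u x₁ ≤ arcsin γ) (hp : p x₁ = 0) :
    ∀ x ≤ 0, u x = arcsin γ ∧ p x = 0 := by
  have he := h.energy hb hb' (by linarith) h1.le x₁ hx₁
  rw [hp] at he
  -- Zero slope means zero excess, which below the saddle point forces `sin u = γ`, an equilibrium.
  -- By uniqueness the orbit is constant, and its limit identifies the constant.
  have hsin := (excess_nonneg_of_le hb h0 h1 hu).2 (by linarith)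
  obtain ⟨B, hB⟩ := exists_bound_of_tendsto h.cont_p h.lim_p
  have huniq := static_unique hb hb' h0 h1 (u' := fun _ => u x₁) (p' := fun _ => 0) (B := B)
    h.cont_u.continuousOn h.cont_p.continuousOn continuousOn_const continuousOn_const
    h.deriv_u h.deriv_p (fun x _ => hasDerivAt_const x _)
    (fun x _ => (hasDerivAt_const x _).congr_deriv (by simp [accel, hsin])) hB
    (fun x hx => by simpa using (abs_nonneg _).trans (hB x hx)) hx₁ rfl hp
  have hlim : u x₁ = arcsin γ := by
    refine tendsto_nhds_unique (Tendsto.congr' ?_ tendsto_const_nhds) h.lim_u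
    filter_upwards [eventually_le_atBot 0] with x hx
    exact (huniq x hx).1.symm
  exact fun x hx => ⟨(huniq x hx).1.trans hlim, (huniq x hx).2⟩

theorem exists_last_nonpos {p : ℝ → ℝ} (hp : Continuous p) {x x₁ : ℝ} (hx : x ≤ x₁)
    (h : p x ≤ 0) (h1 : 0 < p x₁) :
    ∃ y, x ≤ y ∧ y < x₁ ∧ p y = 0 ∧ ∀ z, y < z → z ≤ x₁ → 0 < p z := by
  have hcomp : IsCompact (Icc x x₁ ∩ {z | p z ≤ 0}) :=
    isCompact_Icc.inter_right (isClosed_le hp continuous_const)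
  obtain ⟨y, ⟨hy1, hy2⟩, hmax⟩ := hcomp.exists_isGreatest ⟨x, ⟨le_rfl, hx⟩, h⟩
  have hpos : ∀ z, y < z → z ≤ x₁ → 0 < p z := fun z hz hz1 => by
    by_contra hcon
    push Not at hcon
    exact absurd (hmax ⟨⟨hy1.1.trans hz.le, hz1⟩, hcon⟩) (not_le.2 hz)
  have hlt : y < x₁ := lt_of_le_of_ne hy1.2 fun he => by
    rw [he] at hy2; exact absurd hy2 (not_le.2 h1)
  refine ⟨y, hy1.1, hlt, le_antisymm hy2 ?_, hpos⟩
  have ht : Tendsto p (𝓝[>] y) (𝓝 (p y)) := hp.continuousAt.tendsto.mono_left nhdsWithin_le_nhds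
  refine ge_of_tendsto ht ?_
  filter_upwards [Ioo_mem_nhdsGT hlt] with z hz
  exact (hpos z hz.1 hz.2.le).le

/-- An orbit that leaves the saddle point cannot move upwards below the saddle point. -/
theorem Orbit.not_pos (hb : 0 < b) (hb' : b ≤ 1 / 1000) (h0 : 0 ≤ γ) (h1 : γ < 1)
    (h : Orbit b γ u p) {x₁ : ℝ} (hx₁ : x₁ ≤ 0) (hu : u x₁ ≤ arcsin γ) : p x₁ ≤ 0 := by
  by_contra hp
  push Not at hp
  have mono : ∀ y, y < x₁ → (∀ z, y < z → z ≤ x₁ → 0 < p z) → u y < u x₁ := by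
    intro y hy hpos
    have : StrictMonoOn u (Icc y x₁) := by
      apply strictMonoOn_of_deriv_pos (convex_Icc _ _) h.cont_u.continuousOn
      rw [interior_Icc]
      intro z hz
      rw [(h.deriv_u z (by linarith [hz.2])).deriv]
      exact hpos z hz.1 hz.2.le
    exact this ⟨le_rfl, hy.le⟩ ⟨hy.le, le_rfl⟩ hy
  -- Going backwards from `x₁`, a first point of zero slope would lie below the saddle point and
  -- make the orbit constant. So the orbit rises all the way from `-∞`, starting at height `arcsin
  -- γ`, and cannot be at or below that height at `x₁`.
  have hall : ∀ x ≤ x₁, 0 < p x := by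
    intro x hx
    by_contra hcon
    push Not at hcon
    obtain ⟨y, _, hy2, hy3, hy4⟩ := exists_last_nonpos h.cont_p hx hcon hp
    have hyu := mono y hy2 hy4
    have := (h.const_of_rest hb hb' h0 h1 (by linarith) (by linarith) hy3 x₁ hx₁).2
    linarith
  have hlt := mono (x₁ - 1) (by linarith) fun z _ hz => hall z hz
  have hle : arcsin γ ≤ u (x₁ - 1) := by
    refine le_of_tendsto h.lim_u ?_
    filter_upwards [eventually_le_atBot (x₁ - 1)] with x hx
    rcases hx.lt_or_eq with hx' | rfl
    · have : StrictMonoOn u (Icc x (x₁ - 1)) := by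
        apply strictMonoOn_of_deriv_pos (convex_Icc _ _) h.cont_u.continuousOn
        rw [interior_Icc]
        intro z hz
        rw [(h.deriv_u z (by linarith [hz.2])).deriv]
        exact hall z (by linarith [hz.2])
      exact (this ⟨le_rfl, hx⟩ ⟨hx, le_rfl⟩ hx').le
    · exact le_rfl
  linarith

/-- A nonconstant orbit below the saddle point keeps moving downwards. -/
theorem Orbit.neg_of_le (hb : 0 < b) (hb' : b ≤ 1 / 1000) (h0 : 0 ≤ γ) (h1 : γ < 1)
    (h : Orbit b γ u p) {x₁ : ℝ} (hx₁ : x₁ ≤ 0) (hu : u x₁ ≤ arcsin γ) (hp : p x₁ ≠ 0) :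
    u 0 ≤ arcsin γ ∧ p 0 < 0 := by
  have hneg : ∀ x ≤ 0, u x ≤ arcsin γ → p x < 0 := fun x hx hux =>
    lt_of_le_of_ne (h.not_pos hb hb' h0 h1 hx hux) fun hz =>
      hp (h.const_of_rest hb hb' h0 h1 hx hux hz x₁ hx₁).2
  -- The level `arcsin γ` cannot be crossed upwards, since the slope is negative whenever the orbit
  -- is at that level.
  have hle := image_le_of_deriv_right_lt_deriv_boundary (f := u) (f' := p) (a := x₁) (b := 0)
    (B := fun _ => arcsin γ) (B' := fun _ => 0) h.cont_u.continuousOn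
    (fun x hx => (h.deriv_u x hx.2).hasDerivWithinAt) hu (fun x => hasDerivAt_const x _)
    (fun x hx he => hneg x hx.2.le he.le)
  have h2 := hle ⟨hx₁, le_rfl⟩
  exact ⟨h2, hneg 0 le_rfl h2⟩

end OrbitFacts

end PiKink
end

/-! ### The junction function and the set of admissible forcings. -/

noncomputable section
namespace PiKink

/-- The squared slope at a junction point `d`. -/
def psq (b γ d : ℝ) : ℝ :=
  γ * π - 2 * γ * d + 2 * cos (arcsin γ) + 2 * γ * arcsin γ + b * γ ^ 2 + b * sin d ^ 2

/-- The junction function: its zeros are the possible values `φ 0` of `π`-kinks. -/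
def junction (b γ d : ℝ) : ℝ :=
  -cos d * (1 + b * psq b γ d) - b * γ * sin d - γ * π / 2

/-- Adding the energy identities of the two halves at a common slope `p` cancels the terms with `cos
d` and leaves `2 p² = 2 (excess d + excess (d - π))`. -/
theorem psq_eq (b γ d : ℝ) : psq b γ d = excess b γ d + excess b γ (d - π) := by
  rw [psq, excess, excess, cos_sub_pi, sin_sub_pi]; ring

/-- This is the cross-multiplied difference of the squared slopes that the two energy identities
assign to the height `d`; it vanishes exactly when these agree. -/
theorem junction_eq (b γ d : ℝ) : junction b γ d =
    ((1 - 2 * b * cos d) * excess b γ d - (1 + 2 * b * cos d) * excess b γ (d - π)) / 2 := by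
  rw [junction, psq_eq, excess, excess, cos_sub_pi, sin_sub_pi]; ring

section Kink

variable {a γ : ℝ} {φ : ℝ → ℝ} (hb : 0 < a ^ 2 / 12) (hb' : a ^ 2 / 12 ≤ 1 / 1000)
  (h : IsPiKink a γ φ)

include h in
theorem IsPiKink.lt_one : γ < 1 := (abs_lt.1 h.abs_lt_one).2

-- If the left half reached the saddle level, it would either be constant or arrive at the junction
-- at or below that level with negative slope. In the reflected picture the right half then sits
-- below the saddle point at rest or moving upwards, and neither leads to a kink.
include hb hb' h in
theorem IsPiKink.arcsin_lt (h0 : 0 ≤ γ) : ∀ x ≤ 0, arcsin γ < φ x := by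
  intro x₁ hx₁
  by_contra hcon
  push Not at hcon
  have h1 := h.lt_one
  have hL := h.orbit_left hb hb'
  have hR := h.orbit_right hb hb'
  by_cases hp : deriv φ x₁ = 0
  · have hc := hL.const_of_rest hb hb' h0 h1 hx₁ hcon hp 0 le_rfl
    have := (hR.const_of_rest hb hb' h0 h1 le_rfl (by simp [hc.1, pi_pos.le])
      (by simp [hc.2]) 0 le_rfl).1
    simp only [neg_zero, hc.1] at this
    linarith [pi_pos]
  · have hc := hL.neg_of_le hb hb' h0 h1 hx₁ hcon hp
    have := hR.not_pos hb hb' h0 h1 le_rfl (by simp only [neg_zero]; linarith [pi_pos])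
    simp only [neg_zero] at this
    linarith

include hb hb' h in
theorem IsPiKink.junction_zero :
    junction (a ^ 2 / 12) γ (φ 0) = 0 := by
  have h1 := abs_lt.1 h.abs_lt_one
  have eL := (h.orbit_left hb hb').energy hb hb' h1.1.le h1.2.le 0 le_rfl
  have eR := (h.orbit_right hb hb').energy hb hb' h1.1.le h1.2.le 0 le_rfl
  simp only [neg_zero, cos_sub_pi, neg_sq] at eR
  rw [junction_eq]
  linear_combination (-(1 - 2 * (a ^ 2 / 12) * cos (φ 0)) / 4) * eL +
    ((1 + 2 * (a ^ 2 / 12) * cos (φ 0)) / 4) * eR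

theorem excess_two_pi_neg {b γ : ℝ} (hb' : b ≤ 1 / 1000) (h0 : 0 < γ) (h1 : γ < 1) :
    excess b γ (2 * π) < 0 := by
  rw [excess, cos_two_pi, sin_two_pi]
  have h2 := arcsin_le_pi_div_two γ
  have h3 := cos_le_one (arcsin γ)
  have h4 := pi_gt_three
  nlinarith [mul_pos h0 h0]

-- For `γ > 0` the potential is negative at `2π`, so by conservation of energy the left half never
-- reaches that height.
include hb hb' h in
theorem IsPiKink.zero_lt_two_pi (h0 : 0 < γ) : φ 0 < 2 * π := by
  by_contra hcon
  push Not at hcon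
  have h1 := h.lt_one
  have hlim : ∀ᶠ x in atBot, φ x < 2 * π :=
    h.tendsto_atBot.eventually (gt_mem_nhds (by linarith [arcsin_le_pi_div_two γ, pi_pos]))
  obtain ⟨x, hx1, hx2⟩ := (hlim.and (eventually_le_atBot 0)).exists
  obtain ⟨y, hy, hy2⟩ := intermediate_value_Icc hx2 h.contDiff.continuous.continuousOn
    ⟨hx1.le, hcon⟩
  have he := (h.orbit_left hb hb').energy hb hb' (by linarith) h1.le y hy.2
  rw [hy2] at he
  have := excess_two_pi_neg hb' h0 h1
  have hS := stiff_pos hb hb' (2 * π)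
  have : 0 ≤ (1 + 2 * (a ^ 2 / 12) * cos (2 * π)) * deriv φ y ^ 2 := by
    have : 0 < 1 + 2 * (a ^ 2 / 12) * cos (2 * π) := by linarith
    positivity
  linarith

end Kink

section Junction

variable {b γ : ℝ}

theorem psq_bounds (hb : 0 < b) (hb' : b ≤ 1 / 1000) (h0 : 0 ≤ γ) (h1 : γ < 1) {d : ℝ}
    (hd : 0 ≤ d) (hd' : d ≤ 2 * π) : -10 ≤ psq b γ d ∧ psq b γ d ≤ 9 := by
  have p3 := pi_gt_three
  have p4 := pi_lt_d2
  have hs0 := arcsin_nonneg.2 h0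
  have hs1 := arcsin_le_pi_div_two γ
  have hc := cos_le_one (arcsin γ)
  have hc0 := cos_arcsin_nonneg γ
  have hsd := sin_sq_le_one d
  have hsd0 := sq_nonneg (sin d)
  have g1 : 0 ≤ γ * d := mul_nonneg h0 hd
  have g2 : γ * d ≤ 1 * (2 * π) := mul_le_mul h1.le hd' hd zero_le_one
  have g2' : γ * d ≤ γ * (2 * π) := by gcongr
  have g3 : 0 ≤ γ * arcsin γ := mul_nonneg h0 hs0
  have g4 : γ * arcsin γ ≤ 1 * (π / 2) := mul_le_mul h1.le hs1 hs0 zero_le_one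
  have g5 : γ * π ≤ 1 * π := by gcongr
  have g6 : 0 ≤ γ * π := by positivity
  have g7 : 0 ≤ b * γ ^ 2 := by positivity
  have g8 : b * γ ^ 2 ≤ 1 / 1000 * 1 := by
    gcongr; nlinarith
  have g9 : 0 ≤ b * sin d ^ 2 := by positivity
  have g10 : b * sin d ^ 2 ≤ 1 / 1000 * 1 := by gcongr
  unfold psq
  constructor <;> linarith

theorem psq_factor (hb : 0 < b) (hb' : b ≤ 1 / 1000) (h0 : 0 ≤ γ) (h1 : γ < 1) {d : ℝ}
    (hd : 0 ≤ d) (hd' : d ≤ 2 * π) : 99 / 100 ≤ 1 + b * psq b γ d ∧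
      1 + b * psq b γ d ≤ 1009 / 1000 := by
  obtain ⟨l, r⟩ := psq_bounds hb hb' h0 h1 hd hd'
  constructor <;> nlinarith

theorem continuous_junction (b γ : ℝ) : Continuous (junction b γ) := by
  unfold junction psq; fun_prop

/-- The derivative of the junction function. -/
def junctionDeriv (b γ d : ℝ) : ℝ :=
  sin d * (1 + b * psq b γ d - 2 * b ^ 2 * cos d ^ 2) + b * γ * cos d

theorem hasDerivAt_junction (b γ d : ℝ) :
    HasDerivAt (junction b γ) (junctionDeriv b γ d) d := by
  have hp : HasDerivAt (psq b γ) (-(2 * γ) + b * (2 * sin d * cos d)) d := by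
    have h := ((((((hasDerivAt_id d).const_mul (2 * γ)).const_sub (γ * π)).add_const
      (2 * cos (arcsin γ))).add_const (2 * γ * arcsin γ)).add_const (b * γ ^ 2)).add
      (((hasDerivAt_sin d).pow 2).const_mul b)
    exact h.congr_deriv (by simp)
  have h := ((((hasDerivAt_cos d).neg).mul ((hp.const_mul b).const_add 1)).sub
    ((hasDerivAt_sin d).const_mul (b * γ))).sub_const (γ * π / 2)
  refine h.congr_deriv ?_
  rw [junctionDeriv]
  simp only [Pi.neg_apply]
  ring

theorem junction_neg_of_lt (hb : 0 < b) (hb' : b ≤ 1 / 1000) (h0 : 0 ≤ γ) (h1 : γ < 1) {d : ℝ}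
    (hd : 0 ≤ d) (hd' : d < π / 2) : junction b γ d < 0 := by
  have hf := (psq_factor hb hb' h0 h1 hd (by linarith [pi_pos])).1
  have hc : 0 < cos d := cos_pos_of_mem_Ioo ⟨by linarith [pi_pos], hd'⟩
  have hs : 0 ≤ sin d := sin_nonneg_of_nonneg_of_le_pi hd (by linarith [pi_pos])
  have t1 : 0 < cos d * (1 + b * psq b γ d) := mul_pos hc (by linarith)
  have t2 : 0 ≤ b * γ * sin d := by positivity
  have t3 : 0 ≤ γ * π := by positivity
  unfold junction; linarith

theorem junction_pi_div_two_nonpos (hb : 0 < b) (h0 : 0 ≤ γ) : junction b γ (π / 2) ≤ 0 := by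
  have t2 : 0 ≤ b * γ := by positivity
  have t3 : 0 ≤ γ * π := by positivity
  rw [junction, cos_pi_div_two, sin_pi_div_two]
  linarith

theorem exists_zero_of_nonneg (hb : 0 < b) (h0 : 0 ≤ γ) {d : ℝ} (hd : π / 2 ≤ d)
    (hj : 0 ≤ junction b γ d) : ∃ e ∈ Icc (π / 2) d, junction b γ e = 0 :=
  intermediate_value_Icc hd (continuous_junction b γ).continuousOn
    ⟨junction_pi_div_two_nonpos hb h0, hj⟩

theorem junction_antitoneOn (hb : 0 < b) (hb' : b ≤ 1 / 1000) (h0 : 0 ≤ γ) (h1 : γ < 1) :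
    AntitoneOn (junction b γ) (Icc π (3 * π / 2)) := by
  apply antitoneOn_of_deriv_nonpos (convex_Icc _ _) (continuous_junction b γ).continuousOn
  · exact fun x _ => (hasDerivAt_junction b γ x).differentiableAt.differentiableWithinAt
  · rw [interior_Icc]
    intro x hx
    rw [(hasDerivAt_junction b γ x).deriv, junctionDeriv]
    have hf := (psq_factor hb hb' h0 h1 (d := x) (by linarith [hx.1, pi_pos])
      (by linarith [hx.2, pi_pos])).1
    have hs : sin x ≤ 0 := by
      have := sin_nonneg_of_nonneg_of_le_pi (x := x - π) (by linarith [hx.1])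
        (by linarith [hx.2, pi_pos])
      rw [sin_sub_pi] at this; linarith
    have hc : cos x ≤ 0 := by
      have := cos_nonneg_of_mem_Icc (x := x - π) ⟨by linarith [hx.1, pi_pos],
        by linarith [hx.2]⟩
      rw [cos_sub_pi] at this; linarith
    have hc2 := cos_sq_le_one x
    have hfac : 0 ≤ 1 + b * psq b γ x - 2 * b ^ 2 * cos x ^ 2 := by
      have : b ^ 2 * cos x ^ 2 ≤ (1 / 1000) ^ 2 * 1 := by gcongr
      linarith
    have t1 := mul_nonpos_of_nonpos_of_nonneg hs hfac
    have t2 : b * γ * cos x ≤ 0 := mul_nonpos_of_nonneg_of_nonpos (by positivity) hc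
    linarith

/-- A zero of the junction function anywhere on the orbit forces one in `[π/2, π]`. -/
theorem exists_zero_of_zero (hb : 0 < b) (hb' : b ≤ 1 / 1000) (h0 : 0 < γ) (h1 : γ < 1) {d : ℝ}
    (hd : 0 ≤ d) (hd' : d < 2 * π) (hz : junction b γ d = 0) :
    ∃ e ∈ Icc (π / 2) π, junction b γ e = 0 := by
  have hp := pi_pos
  by_cases c1 : d < π / 2
  · linarith [junction_neg_of_lt hb hb' h0.le h1 hd c1]
  push Not at c1
  by_cases c2 : d ≤ π
  · exact ⟨d, ⟨c1, c2⟩, hz⟩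
  push Not at c2
  -- On `[π, 3π/2]` the junction function decreases, so a zero there makes its value at `π`
  -- nonnegative and the intermediate value theorem applies on `[π/2, π]`. Beyond `3π/2` it is
  -- negative, because `γ π / 2` dominates `b γ`.
  by_cases c3 : d ≤ 3 * π / 2
  · have := junction_antitoneOn hb hb' h0.le h1 ⟨le_rfl, by linarith⟩ ⟨c2.le, c3⟩ c2.le
    exact exists_zero_of_nonneg hb h0.le (by linarith) (by linarith)
  · push Not at c3
    exfalso
    have hf := (psq_factor hb hb' h0.le h1 hd hd'.le).1
    have hc : 0 ≤ cos d := by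
      have := cos_nonneg_of_mem_Icc (x := d - 2 * π) ⟨by linarith, by linarith⟩
      rwa [cos_sub_two_pi] at this
    have t1 : 0 ≤ cos d * (1 + b * psq b γ d) := mul_nonneg hc (by linarith)
    have t2 : -(b * γ) ≤ b * γ * sin d := by nlinarith [neg_one_le_sin d, mul_pos hb h0]
    have t3 : b * γ < γ * π / 2 := by nlinarith [pi_gt_three]
    unfold junction at hz; linarith

/-- The minimal property of the potential, without lattice correction. -/
theorem cos_arcsin_add_le {γ s : ℝ} (h0 : 0 ≤ γ) (h1 : γ < 1) (hs : arcsin γ ≤ s)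
    (hs' : s ≤ π / 2) : cos s + γ * s ≤ cos (arcsin γ) + γ * arcsin γ := by
  have anti : AntitoneOn (fun s => cos s + γ * s) (Icc (arcsin γ) (π / 2)) := by
    apply antitoneOn_of_deriv_nonpos (convex_Icc _ _) (by fun_prop) (by fun_prop)
    rw [interior_Icc]
    intro x hx
    have hd : HasDerivAt (fun s => cos s + γ * s) (-sin x + γ) x := by
      exact ((hasDerivAt_cos x).add ((hasDerivAt_id x).const_mul γ)).congr_deriv (by simp)
    rw [hd.deriv]
    have := sin_le_sin_of_le_of_le_pi_div_two (neg_pi_div_two_le_arcsin γ) hx.2.le hx.1.le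
    rw [sin_arcsin (by linarith) h1.le] at this
    linarith
  exact anti ⟨le_rfl, arcsin_le_pi_div_two γ⟩ ⟨hs, hs'⟩ hs

/-- The term `-γ π / 2` dominates, since `psq` enters with the factor `b`. Only an upper bound for
the growth of `psq` in `γ` is needed, and `cos_arcsin_add_le` provides it without differentiating
`arcsin`. -/
theorem junction_strictAnti_gamma (hb : 0 < b) (hb' : b ≤ 1 / 1000) {γ' : ℝ} (h0 : 0 ≤ γ')
    (hlt : γ' < γ) (h1 : γ < 1) {d : ℝ} (hd : π / 2 ≤ d) (hd' : d ≤ π) :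
    junction b γ d < junction b γ' d := by
  have p3 := pi_gt_three
  have p4 := pi_lt_d2
  have hs := arcsin_le_arcsin hlt.le
  have hm := cos_arcsin_add_le h0 (by linarith) hs (arcsin_le_pi_div_two γ)
  have hs1 := arcsin_le_pi_div_two γ
  have hs0 : 0 ≤ arcsin γ := arcsin_nonneg.2 (by linarith)
  have hdel : 0 < γ - γ' := by linarith
  have hc0 : cos d ≤ 0 := cos_nonpos_of_pi_div_two_le_of_le hd (by linarith)
  have hc1 := neg_one_le_cos d
  have hsd := sin_nonneg_of_nonneg_of_le_pi (by linarith : 0 ≤ d) hd'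
  have hdiff : psq b γ d - psq b γ' d ≤ 5 * (γ - γ') := by
    have e : psq b γ d - psq b γ' d = (γ - γ') * (π - 2 * d) + 2 * ((cos (arcsin γ) + γ' * arcsin γ)
        - (cos (arcsin γ') + γ' * arcsin γ')) + 2 * (γ - γ') * arcsin γ +
        b * (γ - γ') * (γ + γ') := by unfold psq; ring
    rw [e]
    have i1 : (γ - γ') * (π - 2 * d) ≤ 0 := mul_nonpos_of_nonneg_of_nonpos hdel.le (by linarith)
    have i2 : (γ - γ') * arcsin γ ≤ (γ - γ') * (π / 2) := by gcongr
    have i3 : b * (γ - γ') * (γ + γ') ≤ 1 / 1000 * (γ - γ') * 2 := by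
      gcongr <;> linarith
    nlinarith
  have e : junction b γ d - junction b γ' d = -cos d * b * (psq b γ d - psq b γ' d) -
      b * (γ - γ') * sin d - (γ - γ') * π / 2 := by unfold junction; ring
  have i1 : -cos d * b * (psq b γ d - psq b γ' d) ≤ -cos d * b * (5 * (γ - γ')) := by
    have : 0 ≤ -cos d * b := mul_nonneg (by linarith) hb.le
    gcongr
  have i2 : -cos d * b * (5 * (γ - γ')) ≤ 1 * (1 / 1000) * (5 * (γ - γ')) := by
    gcongr; linarith
  have i3 : 0 ≤ b * (γ - γ') * sin d := by positivity
  nlinarith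

theorem gamma_le_of_zero (hb : 0 < b) (hb' : b ≤ 1 / 1000) (h0 : 0 ≤ γ) (h1 : γ < 1) {d : ℝ}
    (hd : d ∈ Icc (π / 2) π) (hz : junction b γ d = 0) :
    γ * (π / 2) ≤ -cos d * (1009 / 1000) := by
  have p := pi_pos
  have hf := psq_factor hb hb' h0 h1 (d := d) (by linarith [hd.1]) (by linarith [hd.2])
  have hc0 : cos d ≤ 0 := cos_nonpos_of_pi_div_two_le_of_le hd.1 (by linarith [hd.2])
  have hsd := sin_nonneg_of_nonneg_of_le_pi (by linarith [hd.1] : 0 ≤ d) hd.2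
  have t1 : -cos d * (1 + b * psq b γ d) ≤ -cos d * (1009 / 1000) := by
    have : 0 ≤ -cos d := by linarith
    gcongr; exact hf.2
  have t2 : 0 ≤ b * γ * sin d := by positivity
  unfold junction at hz; linarith

theorem gamma_le_of_zero' (hb : 0 < b) (hb' : b ≤ 1 / 1000) (h0 : 0 ≤ γ) (h1 : γ < 1) {d : ℝ}
    (hd : d ∈ Icc (π / 2) π) (hz : junction b γ d = 0) : γ ≤ 643 / 1000 := by
  have h := gamma_le_of_zero hb hb' h0 h1 hd hz
  have := neg_one_le_cos d
  nlinarith [pi_gt_d4]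

/-- Since `1009/1000` is less than `π/2`, a zero forces `γ ≤ -cos d = sin (d - π/2)`. The left half
therefore climbs at least `π/2` above the saddle point, which the left barrier uses. -/
theorem arcsin_le_of_zero (hb : 0 < b) (hb' : b ≤ 1 / 1000) (h0 : 0 ≤ γ) (h1 : γ < 1) {d : ℝ}
    (hd : d ∈ Icc (π / 2) π) (hz : junction b γ d = 0) : arcsin γ ≤ d - π / 2 := by
  have h := gamma_le_of_zero hb hb' h0 h1 hd hz
  have h2 : γ ≤ sin (d - π / 2) := by
    rw [sin_sub_pi_div_two]
    nlinarith [pi_gt_d4]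
  have h3 := arcsin_le_arcsin h2
  rwa [arcsin_sin (by linarith [hd.1, pi_pos]) (by linarith [hd.2])] at h3

/-- The set of forcings for which the junction function has a zero in `[π/2, π]`. -/
def forcings (b : ℝ) : Set ℝ := {γ | 0 ≤ γ ∧ γ < 1 ∧ ∃ d ∈ Icc (π / 2) π, junction b γ d = 0}

theorem isCompact_forcings (hb : 0 < b) (hb' : b ≤ 1 / 1000) : IsCompact (forcings b) := by
  -- The bound `γ ≤ 643/1000` replaces the open condition `γ < 1`; the number is just above `2 ·
  -- 1.009 / π`.
  have he : forcings b = Prod.fst '' ((Icc 0 (643 / 1000) ×ˢ Icc (π / 2) π) ∩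
      {z : ℝ × ℝ | junction b z.1 z.2 = 0}) := by
    ext γ
    simp only [forcings, mem_ofPred_eq, mem_image, mem_inter_iff, mem_prod, Prod.exists,
      exists_and_right, exists_eq_right]
    constructor
    · rintro ⟨h0, h1, d, hd, hz⟩
      exact ⟨d, ⟨⟨h0, gamma_le_of_zero' hb hb' h0 h1 hd hz⟩, hd⟩, hz⟩
    · rintro ⟨d, ⟨hγ, hd⟩, hz⟩
      exact ⟨hγ.1, by linarith [hγ.2], d, hd, hz⟩
  rw [he]
  refine IsCompact.image ((isCompact_Icc.prod isCompact_Icc).inter_right ?_) continuous_fst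
  refine isClosed_eq ?_ continuous_const
  unfold junction psq
  fun_prop

theorem mem_forcings_of_le (hb : 0 < b) (hb' : b ≤ 1 / 1000) (hγ : γ ∈ forcings b) {γ' : ℝ}
    (h0 : 0 ≤ γ') (hle : γ' ≤ γ) : γ' ∈ forcings b := by
  rcases hle.eq_or_lt with rfl | hlt
  · exact hγ
  obtain ⟨_, h1, d, hd, hz⟩ := hγ
  have := junction_strictAnti_gamma hb hb' h0 hlt h1 hd.1 hd.2
  obtain ⟨e, he, hz'⟩ := exists_zero_of_nonneg hb h0 hd.1 (by linarith : 0 ≤ junction b γ' d)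
  exact ⟨h0, by linarith, e, ⟨he.1, he.2.trans hd.2⟩, hz'⟩

/-- At `d = π` the main term is about `1` and beats `γ π / 2`. Any positive forcing would do; it
shows that the critical one is positive. -/
theorem tenth_mem_forcings (hb : 0 < b) (hb' : b ≤ 1 / 1000) : (1 / 10 : ℝ) ∈ forcings b := by
  refine ⟨by norm_num, by norm_num, ?_⟩
  have hf := (psq_factor hb hb' (γ := 1 / 10) (by norm_num) (by norm_num) pi_pos.le
    (by linarith [pi_pos])).1
  refine exists_zero_of_nonneg hb (by norm_num) (by linarith [pi_pos]) ?_
  rw [junction, cos_pi, sin_pi]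
  nlinarith [pi_lt_d2]

/-- `d` is the first junction point on the orbit that leaves the saddle point. -/
structure IsFirstZero (b γ d : ℝ) : Prop where
  mem : d ∈ Icc (π / 2) π
  zero : junction b γ d = 0
  neg : ∀ e, 0 ≤ e → e < d → junction b γ e < 0

theorem exists_isFirstZero (hb : 0 < b) (hb' : b ≤ 1 / 1000) (hγ : γ ∈ forcings b) :
    ∃ d, IsFirstZero b γ d := by
  obtain ⟨h0, h1, d, hd, hz⟩ := hγ
  have hcomp : IsCompact (Icc (π / 2) π ∩ {d | junction b γ d = 0}) :=
    isCompact_Icc.inter_right (isClosed_eq (continuous_junction b γ) continuous_const)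
  obtain ⟨d₁, ⟨hd1, hd2⟩, hmin⟩ := hcomp.exists_isLeast ⟨d, hd, hz⟩
  refine ⟨d₁, hd1, hd2, fun e he hlt => ?_⟩
  by_cases c : e < π / 2
  · exact junction_neg_of_lt hb hb' h0 h1 he c
  push Not at c
  by_contra hcon
  push Not at hcon
  obtain ⟨f, hf, hfz⟩ := exists_zero_of_nonneg hb h0 c hcon
  have := hmin ⟨⟨hf.1, hf.2.trans (hlt.le.trans hd1.2)⟩, hfz⟩
  linarith [hf.2]

theorem IsFirstZero.deriv_nonneg {d : ℝ} (h : IsFirstZero b γ d) :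
    0 ≤ junctionDeriv b γ d := by
  have hs := (hasDerivAt_junction b γ d).hasDerivWithinAt (s := Iio d)
  rw [hasDerivWithinAt_iff_tendsto_slope' (by simp)] at hs
  refine ge_of_tendsto hs ?_
  have hd : 0 < d := by linarith [h.mem.1, pi_pos]
  filter_upwards [Ioo_mem_nhdsLT hd] with e he
  rw [slope_def_field, h.zero]
  exact div_nonneg_of_nonpos (by linarith [h.neg e he.1.le he.2]) (by linarith [he.2])

/-- At `d = π` the derivative is `-b γ`, which is nonnegative only for `γ = 0`; but then `π/2` is
already a zero. -/
theorem IsFirstZero.sin_pos {d : ℝ} (h : IsFirstZero b γ d) (hb : 0 < b) (hb' : b ≤ 1 / 1000)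
    (h0 : 0 ≤ γ) (h1 : γ < 1) : 0 < sin d := by
  refine sin_pos_of_pos_of_lt_pi (by linarith [h.mem.1, pi_pos]) (lt_of_le_of_ne h.mem.2 ?_)
  rintro rfl
  have hn := h.deriv_nonneg
  rw [junctionDeriv, sin_pi, cos_pi] at hn
  have hγ : γ = 0 := by
    rcases h0.eq_or_lt with e | e
    · exact e.symm
    · have := mul_pos hb e; linarith
  have hz := gamma_le_of_zero hb hb' h0 h1 h.mem h.zero
  have := h.neg (π / 2) (by linarith [pi_pos]) (by linarith [pi_pos])
  rw [hγ, junction, cos_pi_div_two] at this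
  simp at this

/-- Strictly below the critical forcing the junction is transversal. -/
theorem IsFirstZero.deriv_pos {d γ' : ℝ} (h : IsFirstZero b γ d) (hb : 0 < b)
    (hb' : b ≤ 1 / 1000) (h0 : 0 ≤ γ) (hlt : γ < γ') (hγ' : γ' ∈ forcings b) :
    0 < junctionDeriv b γ d := by
  obtain ⟨_, h1', d', hd', hz'⟩ := hγ'
  have h1 : γ < 1 := hlt.trans h1'
  have p := pi_pos
  have hpos := junction_strictAnti_gamma hb hb' h0 hlt h1' hd'.1 hd'.2
  rw [hz'] at hpos
  -- If the derivative vanished at `d`, it would be nonpositive on `(d, π)`, so the junction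
  -- function would be at most `0` up to `π`. But at the zero `d'` belonging to the larger forcing
  -- it is positive.
  refine lt_of_le_of_ne h.deriv_nonneg fun hne => ?_
  have hs := h.sin_pos hb hb' h0 h1
  set A := 1 + b * psq b γ d - 2 * b ^ 2 * cos d ^ 2 with hA
  have hAe : sin d * A = -(b * γ * cos d) := by
    rw [junctionDeriv] at hne; linarith
  have hAneg : ∀ x ∈ Ioo d π, junctionDeriv b γ x ≤ 0 := by
    intro x hx
    have hxs : 0 < sin x := sin_pos_of_pos_of_lt_pi (by linarith [hx.1, h.mem.1]) hx.2
    have hsle : sin x ≤ sin d := by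
      have := sin_le_sin_of_le_of_le_pi_div_two (x := π - x) (y := π - d)
        (by linarith [hx.2]) (by linarith [h.mem.1]) (by linarith [hx.1])
      rwa [sin_pi_sub, sin_pi_sub] at this
    have hs2 : sin x ^ 2 ≤ sin d ^ 2 := by gcongr
    have hc2 : cos d ^ 2 ≤ cos x ^ 2 := by
      have := sin_sq_add_cos_sq x
      have := sin_sq_add_cos_sq d
      linarith
    have hle : 1 + b * psq b γ x - 2 * b ^ 2 * cos x ^ 2 ≤ A := by
      have i1 : psq b γ x ≤ psq b γ d := by
        unfold psq
        have : 0 ≤ γ * (x - d) := mul_nonneg h0 (by linarith [hx.1])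
        have : b * sin x ^ 2 ≤ b * sin d ^ 2 := by gcongr
        linarith
      have i2 : b * psq b γ x ≤ b * psq b γ d := by gcongr
      have i3 : 2 * b ^ 2 * cos d ^ 2 ≤ 2 * b ^ 2 * cos x ^ 2 := by gcongr
      rw [hA]; linarith
    have i4 : junctionDeriv b γ x ≤ sin x * A + b * γ * cos x := by
      rw [junctionDeriv]
      have := mul_le_mul_of_nonneg_left hle hxs.le
      linarith
    have hsub : 0 ≤ sin (x - d) := sin_nonneg_of_nonneg_of_le_pi (by linarith [hx.1])
      (by linarith [hx.2, h.mem.1])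
    rw [sin_sub] at hsub
    -- The vanishing derivative at `d` eliminates `A`, and the product becomes `-b γ sin (x - d)`.
    have i5 : sin d * (sin x * A + b * γ * cos x) ≤ 0 := by
      have : sin d * (sin x * A + b * γ * cos x) =
          -(b * γ) * (sin x * cos d - cos x * sin d) := by
        linear_combination sin x * hAe
      rw [this]
      have : 0 ≤ b * γ * (sin x * cos d - cos x * sin d) := by positivity
      linarith
    have := nonpos_of_mul_nonpos_right i5 hs
    linarith
  have anti : AntitoneOn (junction b γ) (Icc d π) := by
    apply antitoneOn_of_deriv_nonpos (convex_Icc _ _) (continuous_junction b γ).continuousOn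
    · exact fun x _ => (hasDerivAt_junction b γ x).differentiableAt.differentiableWithinAt
    · rw [interior_Icc]
      intro x hx
      rw [(hasDerivAt_junction b γ x).deriv]
      exact hAneg x hx
  rcases lt_or_ge d' d with hc | hc
  · linarith [h.neg d' (by linarith [hd'.1]) hc]
  · have := anti ⟨le_rfl, h.mem.2⟩ ⟨hc, hd'.2⟩ hc
    rw [h.zero] at this
    linarith

/-- At the critical forcing the junction is tangential. -/
theorem IsFirstZero.deriv_eq_zero {d : ℝ} (h : IsFirstZero b γ d) (hb : 0 < b)
    (hb' : b ≤ 1 / 1000) (hγ : IsGreatest (forcings b) γ) : junctionDeriv b γ d = 0 := by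
  obtain ⟨h0, h1, -⟩ := hγ.1
  refine le_antisymm ?_ h.deriv_nonneg
  by_contra hcon
  push Not at hcon
  have hs := h.sin_pos hb hb' h0 h1
  have hdpi : d < π := lt_of_le_of_ne h.mem.2 fun he => by rw [he, sin_pi] at hs; exact lt_irrefl _ hs
  -- A positive derivative yields a point `e` with positive junction value. That persists for
  -- slightly larger forcings and gives them a zero, against maximality.
  have hder := (hasDerivAt_junction b γ d).hasDerivWithinAt (s := Ioi d)
  rw [hasDerivWithinAt_iff_tendsto_slope' (by simp)] at hder
  obtain ⟨e, he1, he2⟩ := ((hder.eventually (lt_mem_nhds hcon)).and (Ioo_mem_nhdsGT hdpi)).exists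
  rw [slope_def_field, h.zero, sub_zero] at he1
  have hepos : 0 < junction b γ e := (div_pos_iff_of_pos_right (by linarith [he2.1])).1 he1
  have hc : Continuous fun g => junction b g e := by unfold junction psq; fun_prop
  have hev : ∀ᶠ g in 𝓝[>] γ, 0 < junction b g e :=
    (hc.continuousAt.tendsto.mono_left nhdsWithin_le_nhds).eventually (lt_mem_nhds hepos)
  obtain ⟨g, hg1, hg2⟩ := (hev.and (Ioo_mem_nhdsGT h1)).exists
  obtain ⟨f, hf, hfz⟩ := exists_zero_of_nonneg hb (h0.trans hg2.1.le)
    (h.mem.1.trans he2.1.le) hg1.le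
  have := hγ.2 (⟨h0.trans hg2.1.le, hg2.2, f, ⟨hf.1, hf.2.trans he2.2.le⟩, hfz⟩ : g ∈ forcings b)
  linarith [hg2.1]

end Junction

end PiKink
end

/-! ### Construction of half orbits by separation of variables. -/

noncomputable section
namespace PiKink

/-- Scalar autonomous equations with a continuous right-hand side bounded away from zero. -/
theorem exists_autonomous {g : ℝ → ℝ} (hg : Continuous g) {c C : ℝ} (hc : 0 < c)
    (hcg : ∀ y, c ≤ g y) (hC : ∀ y, g y ≤ C) (y₀ : ℝ) :
    ∃ y : ℝ → ℝ, y 0 = y₀ ∧ ∀ x, HasDerivAt y (g (y x)) x := by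
  have gpos : ∀ y, 0 < g y := fun y => hc.trans_le (hcg y)
  have Cpos : 0 < C := (gpos 0).trans_le (hC 0)
  have hinv : Continuous fun y => (g y)⁻¹ := hg.inv₀ fun y => (gpos y).ne'
  -- Separation of variables: `H` is an increasing bijection of `ℝ`, and its inverse is the
  -- solution. The bound `g ≤ C` makes `H` unbounded in both directions.
  set H : ℝ → ℝ := fun y => ∫ s in y₀..y, (g s)⁻¹ with hH
  have dH : ∀ y, HasDerivAt H ((g y)⁻¹) y := fun y =>
    intervalIntegral.integral_hasDerivAt_right (hinv.intervalIntegrable _ _)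
      hinv.stronglyMeasurable.stronglyMeasurableAtFilter hinv.continuousAt
  have cH : Continuous H := continuous_iff_continuousAt.2 fun y => (dH y).continuousAt
  have mono : StrictMono H := strictMono_of_deriv_pos fun y => by
    rw [(dH y).deriv]; exact inv_pos.2 (gpos y)
  have H0 : H y₀ = 0 := by simp [hH]
  have lower : Monotone fun y => H y - C⁻¹ * y := by
    apply monotone_of_deriv_nonneg
    · exact fun y => ((dH y).sub ((hasDerivAt_id y).const_mul C⁻¹)).differentiableAt
    · intro y
      have hd := (dH y).sub ((hasDerivAt_id y).const_mul C⁻¹)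
      have e : deriv (fun y => H y - C⁻¹ * y) y = (g y)⁻¹ - C⁻¹ * 1 := hd.deriv
      rw [e, mul_one, sub_nonneg]
      exact inv_anti₀ (gpos y) (hC y)
  have top : Tendsto H atTop atTop := by
    refine tendsto_atTop_mono' (f₁ := fun y => C⁻¹ * y + -(C⁻¹ * y₀)) atTop ?_ ?_
    · filter_upwards [eventually_ge_atTop y₀] with y hy
      have h := lower hy
      simp only [H0] at h; linarith
    · exact tendsto_atTop_add_const_right _ _ (tendsto_id.const_mul_atTop (inv_pos.2 Cpos))
  have bot : Tendsto H atBot atBot := by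
    refine tendsto_atBot_mono' (f₁ := fun y => C⁻¹ * y + -(C⁻¹ * y₀)) atBot ?_ ?_
    · filter_upwards [eventually_le_atBot y₀] with y hy
      have h := lower hy
      simp only [H0] at h; linarith
    · exact tendsto_atBot_add_const_right _ _ (tendsto_id.const_mul_atBot (inv_pos.2 Cpos))
  set e := mono.orderIsoOfSurjective H (cH.surjective top bot) with he
  have e1 : ∀ x, H (e.symm x) = x := fun x => e.apply_symm_apply x
  refine ⟨e.symm, ?_, fun x => ?_⟩
  · rw [← H0]; exact e.symm_apply_apply y₀
  · have := HasDerivAt.of_local_left_inverse (f := H) (g := e.symm) (a := x)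
      e.symm.continuous.continuousAt (dH _) (inv_pos.2 (gpos _)).ne' (.of_forall e1)
    rwa [inv_inv] at this

/-- Continuous functions with linear bounds generate flows on `(0, T]` that decay backwards. -/
theorem exists_escape {f : ℝ → ℝ} (hf : Continuous f) {T c C : ℝ} (hT : 0 < T) (hc : 0 < c)
    (hcf : ∀ t, 0 < t → t ≤ T → c * t ≤ f t) (hC : ∀ t, 0 < t → t ≤ T → f t ≤ C * t) :
    ∃ t p : ℝ → ℝ, Continuous t ∧ Continuous p ∧ t 0 = T ∧ StrictMono t ∧ (∀ x, 0 < t x) ∧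
      (∀ x ≤ 0, p x = f (t x)) ∧ (∀ x < 0, HasDerivAt t (f (t x)) x) ∧
      ∀ x ≤ 0, t x ≤ T * Real.exp (c * x) := by
  -- The equation is solved for `y = log t`, where the right-hand side `f(t) / t` lies between `c`
  -- and `C`. The minimum extends it beyond `t = T`, a region that is not entered for `x ≤ 0`.
  set m : ℝ → ℝ := fun y => Real.exp (min y (Real.log T)) with hm
  have mpos : ∀ y, 0 < m y := fun y => Real.exp_pos _
  have mle : ∀ y, m y ≤ T := fun y => by
    rw [hm, ← Real.exp_log hT]
    exact Real.exp_le_exp.2 ((min_le_right _ _).trans (by rw [Real.exp_log hT]))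
  have mcont : Continuous m := by fun_prop
  set g : ℝ → ℝ := fun y => f (m y) / m y with hg
  have gcont : Continuous g := (hf.comp mcont).div mcont fun y => (mpos y).ne'
  have cg : ∀ y, c ≤ g y := fun y => (le_div_iff₀ (mpos y)).2 (hcf _ (mpos y) (mle y))
  have gC : ∀ y, g y ≤ C := fun y => (div_le_iff₀ (mpos y)).2 (hC _ (mpos y) (mle y))
  obtain ⟨y, y0, dy⟩ := exists_autonomous gcont hc cg gC (Real.log T)
  have cy : Continuous y := continuous_iff_continuousAt.2 fun x => (dy x).continuousAt
  have ymono : StrictMono y := strictMono_of_deriv_pos fun x => by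
    rw [(dy x).deriv]; exact hc.trans_le (cg _)
  have my : ∀ x ≤ 0, m (y x) = Real.exp (y x) := fun x hx => by
    simp only [hm]; rw [min_eq_left]; rw [← y0]; exact ymono.monotone hx
  refine ⟨fun x => Real.exp (y x), fun x => Real.exp (y x) * g (y x), by fun_prop, by fun_prop,
    by simp [y0, Real.exp_log hT], fun a b hab => Real.exp_lt_exp.2 (ymono hab),
    fun x => Real.exp_pos _, fun x hx => ?_, fun x hx => ?_, fun x hx => ?_⟩
  · simp only [hg]; rw [my x hx, mul_div_cancel₀ _ (Real.exp_pos _).ne']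
  · refine (dy x).exp.congr_deriv ?_
    simp only [hg]; rw [my x hx.le, mul_div_cancel₀ _ (Real.exp_pos _).ne']
  · have hmono : Monotone fun x => y x - c * x := by
      apply monotone_of_deriv_nonneg
      · exact fun x => ((dy x).sub ((hasDerivAt_id x).const_mul c)).differentiableAt
      · intro x
        have e : deriv (fun x => y x - c * x) x = g (y x) - c * 1 :=
          ((dy x).sub ((hasDerivAt_id x).const_mul c)).deriv
        rw [e]; linarith [cg (y x)]
    have h := hmono hx
    simp only [y0] at h
    calc Real.exp (y x) ≤ Real.exp (Real.log T + c * x) := Real.exp_le_exp.2 (by linarith)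
      _ = T * Real.exp (c * x) := by rw [Real.exp_add, Real.exp_log hT]

/-- A positive function with a quadratic lower bound near zero has one on the whole interval. -/
theorem exists_quadratic_lower {E : ℝ → ℝ} (hE : Continuous E) {T κ t₁ : ℝ} (hκ : 0 < κ)
    (ht₁ : 0 < t₁) (h1 : ∀ t, 0 < t → t ≤ t₁ → κ * t ^ 2 ≤ E t)
    (hpos : ∀ t, 0 < t → t ≤ T → 0 < E t) :
    ∃ c, 0 < c ∧ ∀ t, 0 < t → t ≤ T → c * t ^ 2 ≤ E t := by
  by_cases hT : T ≤ t₁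
  · exact ⟨κ, hκ, fun t ht ht' => h1 t ht (ht'.trans hT)⟩
  push Not at hT
  obtain ⟨x, hx, hmin⟩ := (isCompact_Icc (a := t₁) (b := T)).exists_isMinOn
    ⟨t₁, le_rfl, hT.le⟩ hE.continuousOn
  have hEx := hpos x (ht₁.trans_le hx.1) hx.2
  have hT0 : 0 < T := ht₁.trans hT
  refine ⟨min κ (E x / T ^ 2), lt_min hκ (by positivity), fun t ht ht' => ?_⟩
  rcases le_total t t₁ with h | h
  · exact (mul_le_mul_of_nonneg_right (min_le_left _ _) (sq_nonneg t)).trans (h1 t ht h)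
  · refine (mul_le_mul_of_nonneg_right (min_le_right _ _) (sq_nonneg t)).trans ?_
    have h2 : E x ≤ E t := hmin ⟨h, ht'⟩
    refine le_trans ?_ h2
    rw [div_mul_eq_mul_div, div_le_iff₀ (by positivity)]
    gcongr

/-- A nonconstant half orbit that leaves the saddle point in the direction `σ = ±1`. -/
structure Departure (b γ σ : ℝ) (u p : ℝ → ℝ) : Prop extends Orbit b γ u p where
  pos : ∀ x ≤ 0, 0 < σ * (u x - arcsin γ)
  deriv_pos : ∀ x ≤ 0, 0 < σ * p x
  abs_deriv_le : ∀ x ≤ 0, |p x| ≤ 3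
  decay : ∃ C k : ℝ, 0 < k ∧ ∀ x ≤ 0,
    |u x - arcsin γ| ≤ C * Real.exp (k * x) ∧ |p x| ≤ C * Real.exp (k * x)

variable {b γ : ℝ}

theorem excess_add_sign (b : ℝ) {γ σ : ℝ} (h0 : -1 ≤ γ) (h1 : γ ≤ 1) (hσ : σ = 1 ∨ σ = -1) (t : ℝ) :
    excess b γ (arcsin γ + σ * t) = cos (arcsin γ) * (1 - cos t) - σ * γ * (t - sin t) +
      b / 2 * (sin (arcsin γ + σ * t) - γ) ^ 2 := by
  rw [excess_add b h0 h1]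
  rcases hσ with rfl | rfl
  · simp
  · simp only [neg_mul, one_mul, cos_neg, sin_neg]; ring

/-- The energy identity is a first-order equation `t' = f(t)` for the distance `t = σ (u - arcsin
γ)`. As the excess is comparable to `t²`, `f` is comparable to `t`, and the distance decays
exponentially backwards. The second-order equation follows by differentiating the square root. -/
theorem exists_departure (hb : 0 < b) (hb' : b ≤ 1 / 1000) (h0 : 0 ≤ γ) (h1 : γ < 1) {σ T : ℝ}
    (hσ : σ = 1 ∨ σ = -1) (hT : 0 < T) (hT' : T ≤ π)
    (hpos : ∀ t, 0 < t → t ≤ T → 0 < excess b γ (arcsin γ + σ * t))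
    (hsmall : ∀ t, 0 < t → t ≤ T → excess b γ (arcsin γ + σ * t) ≤ 4) :
    ∃ u p, Departure b γ σ u p ∧ u 0 = arcsin γ + σ * T ∧ ∀ x < 0, σ * (u x - arcsin γ) < T := by
  have hσ2 : σ * σ = 1 := by rcases hσ with rfl | rfl <;> norm_num
  have hσa : |σ| = 1 := by rcases hσ with rfl | rfl <;> norm_num
  set s₀ := arcsin γ with hs₀
  set c₀ := cos s₀ with hc₀
  have c₀pos : 0 < c₀ := cos_arcsin_pos h0 h1
  have c₀le : c₀ ≤ 1 := cos_le_one _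
  have hsin : sin s₀ = γ := sin_arcsin (by linarith) h1.le
  set E : ℝ → ℝ := fun t => excess b γ (s₀ + σ * t) with hE
  have cE : Continuous E := (continuous_excess b γ).comp (by fun_prop)
  have eE : ∀ t, E t = c₀ * (1 - cos t) - σ * γ * (t - sin t) +
      b / 2 * (sin (s₀ + σ * t) - γ) ^ 2 := excess_add_sign b (by linarith) h1.le hσ
  have sq_le : ∀ t, b / 2 * (sin (s₀ + σ * t) - γ) ^ 2 ≤ t ^ 2 := fun t => by
    have h := abs_sin_sub_sin_le (s₀ + σ * t) s₀
    rw [hsin, add_sub_cancel_left, abs_mul, hσa, one_mul] at h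
    have := sq_le_sq.2 h
    nlinarith [sq_nonneg (sin (s₀ + σ * t) - γ)]
  have gsin : ∀ t, 0 < t → 0 ≤ t - sin t ∧ t - sin t ≤ t ^ 3 / 6 := fun t ht =>
    ⟨by linarith [sin_le ht.le], by linarith [Real.sin_gt_sub_cube ht]⟩
  have σγ : |σ * γ| ≤ 1 := by rw [abs_mul, hσa, one_mul, abs_of_nonneg h0]; exact h1.le
  have up : ∀ t, 0 < t → t ≤ T → E t ≤ 4 * t ^ 2 := fun t ht ht' => by
    rw [eE]
    have i1 : 1 - cos t ≤ t ^ 2 / 2 := by linarith [one_sub_sq_div_two_le_cos (x := t)]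
    have i2 : c₀ * (1 - cos t) ≤ 1 * (t ^ 2 / 2) :=
      mul_le_mul c₀le i1 (by linarith [cos_le_one t]) zero_le_one
    have i3 : -(σ * γ * (t - sin t)) ≤ t ^ 3 / 6 := by
      have := (abs_le.1 σγ).1
      nlinarith [(gsin t ht).1, (gsin t ht).2]
    have i4 : t ^ 3 ≤ t ^ 2 * 4 := by nlinarith [pi_lt_d2, sq_nonneg t]
    linarith [sq_le t, sq_nonneg t]
  -- For `t ≤ c₀ / 2` the term `c₀ (1 - cos t) ≥ c₀ t² / 5` loses at most `t³ / 6 ≤ c₀ t² / 12` to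
  -- the forcing, which leaves more than `c₀ t² / 10`. Away from zero compactness suffices.
  obtain ⟨κ, hκ, low⟩ := exists_quadratic_lower (T := T) (κ := c₀ / 10) (t₁ := c₀ / 2) cE
    (by positivity) (by positivity) (fun t ht ht' => by
      rw [eE]
      have i1 := Real.cos_le_one_sub_mul_cos_sq (x := t) (by
        rw [abs_of_pos ht]; linarith [pi_gt_three])
      have i2 : 1 / 5 * t ^ 2 ≤ 1 - cos t := by
        have : 1 / 5 ≤ 2 / π ^ 2 := by
          rw [div_le_div_iff₀ (by norm_num) (by positivity)]
          nlinarith [pi_lt_d2, pi_pos]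
        nlinarith [sq_nonneg t]
      have i3 : c₀ * (1 / 5 * t ^ 2) ≤ c₀ * (1 - cos t) := by gcongr
      have i4 : σ * γ * (t - sin t) ≤ t ^ 3 / 6 := by
        have := (abs_le.1 σγ).2
        nlinarith [(gsin t ht).1, (gsin t ht).2]
      have i5 : t ^ 3 ≤ t ^ 2 * (c₀ / 2) := by nlinarith [sq_nonneg t]
      have i6 : 0 ≤ b / 2 * (sin (s₀ + σ * t) - γ) ^ 2 := by positivity
      nlinarith [mul_pos c₀pos (pow_pos ht 2)]) hpos
  have hS : ∀ u, 9 / 10 < 1 + 2 * b * cos u := stiff_pos hb hb'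
  have hS' : ∀ u, 1 + 2 * b * cos u < 11 / 10 := stiff_lt hb hb'
  set f : ℝ → ℝ := fun t => √(2 * E t / (1 + 2 * b * cos (s₀ + σ * t))) with hf
  have cf : Continuous f := by
    refine Real.continuous_sqrt.comp ((continuous_const.mul cE).div (by fun_prop) fun t => ?_)
    linarith [hS (s₀ + σ * t)]
  have fsq : ∀ t, 0 < t → t ≤ T → f t ^ 2 = 2 * E t / (1 + 2 * b * cos (s₀ + σ * t)) :=
    fun t ht ht' => Real.sq_sqrt (div_nonneg (by linarith [hpos t ht ht'])
      (by linarith [hS (s₀ + σ * t)]))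
  have fpos : ∀ t, 0 < t → t ≤ T → 0 < f t := fun t ht ht' =>
    Real.sqrt_pos.2 (div_pos (by linarith [hpos t ht ht']) (by linarith [hS (s₀ + σ * t)]))
  -- The constant `3` comes from `2 · 4 t² / (9/10) ≤ 9 t²`.
  obtain ⟨t, p, ct, cp, t0, tmono, tpos, pf, dt, tle⟩ := exists_escape cf hT (c := √κ) (C := 3)
    (Real.sqrt_pos.2 hκ) (fun t ht ht' => by
      refine Real.le_sqrt_of_sq_le ?_
      rw [mul_pow, Real.sq_sqrt hκ.le, le_div_iff₀ (by linarith [hS (s₀ + σ * t)])]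
      have h2 := low t ht ht'
      have h3 := hS' (s₀ + σ * t)
      have : 0 ≤ κ * t ^ 2 := by positivity
      nlinarith)
    (fun t ht ht' => by
      refine Real.sqrt_le_iff.2 ⟨by positivity, ?_⟩
      rw [div_le_iff₀ (by linarith [hS (s₀ + σ * t)])]
      have h2 := up t ht ht'
      have h3 := hS (s₀ + σ * t)
      nlinarith [sq_nonneg t])
  have tT : ∀ x ≤ 0, t x ≤ T := fun x hx => t0 ▸ tmono.monotone hx
  have ple : ∀ x ≤ 0, |σ * p x| ≤ 3 * t x := fun x hx => by
    rw [abs_mul, hσa, one_mul, pf x hx, abs_of_pos (fpos _ (tpos x) (tT x hx))]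
    refine Real.sqrt_le_iff.2 ⟨by linarith [tpos x], ?_⟩
    rw [div_le_iff₀ (by linarith [hS (s₀ + σ * t x)])]
    have h2 := up (t x) (tpos x) (tT x hx)
    have h3 := hS (s₀ + σ * t x)
    nlinarith [sq_nonneg (t x)]
  have tlim : Tendsto t atBot (𝓝 0) := by
    refine tendsto_of_tendsto_of_tendsto_of_le_of_le' tendsto_const_nhds
      ((tendsto_exp_mul_atBot (Real.sqrt_pos.2 hκ)).const_mul T |>.trans (by simp))
      (.of_forall fun x => (tpos x).le) ?_
    filter_upwards [eventually_le_atBot 0] with x hx using tle x hx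
  have hs : ∀ x, σ * (s₀ + σ * t x - s₀) = t x := fun x => by
    rw [add_sub_cancel_left, ← mul_assoc, hσ2, one_mul]
  refine ⟨fun x => s₀ + σ * t x, fun x => σ * p x, ⟨⟨by fun_prop, by fun_prop, fun x hx => ?_,
    fun x hx => ?_, ?_, ?_⟩, fun x hx => ?_, fun x hx => ?_, fun x hx => ?_, 3 * T, √κ,
    Real.sqrt_pos.2 hκ, fun x hx => ⟨?_, ?_⟩⟩, by simp only [t0], fun x hx => ?_⟩
  · rw [pf x hx.le]
    exact ((dt x hx).const_mul σ).const_add s₀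
  · have hx0 := hx.le
    have hE' : 0 < E (t x) := hpos _ (tpos x) (tT x hx0)
    have hSx := hS (s₀ + σ * t x)
    have hp : HasDerivAt p (((2 * (((sin (s₀ + σ * t x) - γ) * (1 + b * cos (s₀ + σ * t x))) *
        (σ * f (t x)))) * (1 + 2 * b * cos (s₀ + σ * t x)) - 2 * E (t x) *
        (2 * b * (-sin (s₀ + σ * t x) * (σ * f (t x))))) / (1 + 2 * b * cos (s₀ + σ * t x)) ^ 2 /
        (2 * f (t x))) x := by
      have hu := ((dt x hx).const_mul σ).const_add s₀
      have hq := (((hasDerivAt_excess b γ _).comp x hu).const_mul 2).div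
        ((hu.cos.const_mul (2 * b)).const_add 1) (by linarith)
      have hr := hq.sqrt (by
        simp only [Function.comp_apply]
        exact (div_pos (by linarith [hE']) (by linarith)).ne')
      refine hr.congr_of_eventuallyEq ?_
      filter_upwards [Iio_mem_nhds hx] with y hy
      rw [pf y (le_of_lt hy)]
      rfl
    refine (hp.const_mul σ).congr_deriv ?_
    have hfp := fpos _ (tpos x) (tT x hx0)
    have hfs := fsq _ (tpos x) (tT x hx0)
    rw [pf x hx0, accel, mul_pow, sq σ, hσ2, one_mul, hfs]
    have hS0 : (1 + 2 * b * cos (s₀ + σ * t x)) ≠ 0 := by linarith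
    field_simp
    linear_combination ((sin (s₀ + σ * t x) - γ) * (1 + b * cos (s₀ + σ * t x)) * (1 + 2 * b * cos (s₀ + σ * t x)) + 2 * E (t x) * b * sin (s₀ + σ * t x)) * hσ2
  · simpa using (tlim.const_mul σ).const_add s₀
  · rw [tendsto_zero_iff_abs_tendsto_zero]
    refine tendsto_of_tendsto_of_tendsto_of_le_of_le' tendsto_const_nhds
      (by simpa using tlim.const_mul 3) (.of_forall fun x => abs_nonneg _) ?_
    filter_upwards [eventually_le_atBot 0] with x hx using ple x hx
  · rw [hs x]; exact tpos x
  · rw [← mul_assoc, hσ2, one_mul, pf x hx]; exact fpos _ (tpos x) (tT x hx)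
  · rw [abs_mul, hσa, one_mul, pf x hx, abs_of_pos (fpos _ (tpos x) (tT x hx))]
    refine Real.sqrt_le_iff.2 ⟨by norm_num, ?_⟩
    rw [div_le_iff₀ (by linarith [hS (s₀ + σ * t x)])]
    linarith [hsmall _ (tpos x) (tT x hx), hS (s₀ + σ * t x)]
  · change |s₀ + σ * t x - s₀| ≤ _
    rw [add_sub_cancel_left, abs_mul, hσa, one_mul, abs_of_pos (tpos x)]
    have := tle x hx
    have : 0 < T * Real.exp (√κ * x) := by positivity
    linarith
  · have := ple x hx
    have := tle x hx
    linarith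
  · rw [hs x, ← t0]; exact tmono hx

end PiKink
end

/-! ### Gluing two half orbits to a kink. -/

noncomputable section
namespace PiKink

/-- The function that equals `f` on the left half line and the reflection of `g` on the right. -/
def glue (f g : ℝ → ℝ) (x : ℝ) : ℝ := if x ≤ 0 then f x else g (-x)

section Glue

variable {f g f' g' : ℝ → ℝ}

theorem glue_of_le {x : ℝ} (hx : x ≤ 0) : glue f g x = f x := if_pos hx

theorem glue_of_pos {x : ℝ} (hx : 0 < x) : glue f g x = g (-x) := if_neg (not_le.2 hx)

theorem glue_of_nonneg (h0 : f 0 = g 0) {x : ℝ} (hx : 0 ≤ x) : glue f g x = g (-x) := by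
  rcases hx.eq_or_lt with rfl | hx
  · rw [glue_of_le le_rfl, neg_zero, h0]
  · exact glue_of_pos hx

theorem continuous_glue (hf : ContinuousOn f (Iic 0)) (hg : ContinuousOn g (Iic 0))
    (h0 : f 0 = g 0) : Continuous (glue f g) := by
  have e : glue f g = fun x => f (min x 0) + g (min (-x) 0) - f 0 := by
    funext x
    rcases le_total x 0 with h | h
    · rw [glue_of_le h, min_eq_left h, min_eq_right (by linarith), h0]; ring
    · rw [glue_of_nonneg h0 h, min_eq_right h, min_eq_left (by linarith)]; ring
  rw [e]
  have h1 : Continuous fun x : ℝ => f (min x 0) :=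
    hf.comp_continuous (by fun_prop) fun x => mem_Iic.2 (min_le_right _ _)
  have h2 : Continuous fun x : ℝ => g (min (-x) 0) :=
    hg.comp_continuous (by fun_prop) fun x => mem_Iic.2 (min_le_right _ _)
  exact (h1.add h2).sub continuous_const

theorem hasDerivAt_glue_neg {x f'x : ℝ} (hx : x < 0) (hf : HasDerivAt f f'x x) :
    HasDerivAt (glue f g) f'x x :=
  hf.congr_of_eventuallyEq (by
    filter_upwards [Iio_mem_nhds hx] with y hy using glue_of_le (le_of_lt hy))

theorem hasDerivAt_glue_pos {x g'x : ℝ} (hx : 0 < x) (hg : HasDerivAt g g'x (-x)) :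
    HasDerivAt (glue f g) (-g'x) x := by
  refine ((hg.comp x (hasDerivAt_neg x)).congr_deriv (by ring)).congr_of_eventuallyEq ?_
  filter_upwards [Ioi_mem_nhds hx] with y hy using glue_of_pos hy

/-- Differentiability at the junction is not assumed on either side; it follows because the
derivative off `0` extends continuously, which is the role of `f' 0 + g' 0 = 0`. -/
theorem hasDerivAt_glue (hf : ContinuousOn f (Iic 0)) (hg : ContinuousOn g (Iic 0))
    (hf' : ContinuousOn f' (Iic 0)) (hg' : ContinuousOn g' (Iic 0)) (h0 : f 0 = g 0)
    (h0' : f' 0 + g' 0 = 0) (df : ∀ x < 0, HasDerivAt f (f' x) x)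
    (dg : ∀ x < 0, HasDerivAt g (g' x) x) (x : ℝ) :
    HasDerivAt (glue f g) (glue f' (fun x => -g' x) x) x := by
  refine hasDerivAt_of_hasDerivAt_of_ne' (x := 0) (fun y hy => ?_)
    (continuous_glue hf hg h0).continuousAt
    (continuous_glue hf' hg'.neg (by simp only [Pi.neg_apply]; linarith)).continuousAt x
  rcases lt_or_gt_of_ne hy with h | h
  · rw [glue_of_le h.le]; exact hasDerivAt_glue_neg h (df y h)
  · rw [glue_of_pos h]; exact hasDerivAt_glue_pos h (dg (-y) (by linarith))

theorem contDiff_one_of_hasDerivAt {F G : ℝ → ℝ} (h : ∀ x, HasDerivAt F (G x) x)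
    (hG : Continuous G) : ContDiff ℝ 1 F := by
  rw [contDiff_one_iff_deriv]
  have e : deriv F = G := funext fun x => (h x).deriv
  exact ⟨fun x => (h x).differentiableAt, e ▸ hG⟩

end Glue

theorem integrable_exp_neg_mul_abs {k : ℝ} (hk : 0 < k) :
    Integrable fun x : ℝ => Real.exp (-(k * |x|)) := by
  have h1 : IntegrableOn (fun x : ℝ => Real.exp (-(k * |x|))) (Iic 0) := by
    refine (integrableOn_exp_mul_Iic hk 0).congr_fun (fun x hx => ?_) measurableSet_Iic
    simp only
    rw [abs_of_nonpos (mem_Iic.1 hx)]; congr 1; ring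
  have h2 : IntegrableOn (fun x : ℝ => Real.exp (-(k * |x|))) (Ioi 0) := by
    have := integrableOn_exp_mul_Ioi (a := -k) (by linarith) 0
    refine this.congr_fun (fun x hx => ?_) measurableSet_Ioi
    simp only
    rw [abs_of_pos (mem_Ioi.1 hx)]; congr 1; ring
  rw [← integrableOn_univ, ← Iic_union_Ioi (a := (0 : ℝ))]
  exact h1.union h2

theorem memLp_two_of_exp_bound {f : ℝ → ℝ} (hf : Measurable f) {C k : ℝ} (hk : 0 < k)
    (h : ∀ x ≠ 0, |f x| ≤ C * Real.exp (-(k * |x|))) : MemLp f 2 := by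
  rw [memLp_two_iff_integrable_sq hf.aestronglyMeasurable]
  refine ((integrable_exp_neg_mul_abs (k := 2 * k) (by positivity)).const_mul (C ^ 2)).mono'
    (hf.pow_const 2).aestronglyMeasurable ?_
  have h0 : ∀ᵐ x : ℝ, x ≠ 0 := by
    simp [ae_iff]
  filter_upwards [h0] with x hx
  have h2 := h x hx
  rw [Real.norm_of_nonneg (sq_nonneg _), ← sq_abs]
  calc |f x| ^ 2 ≤ (C * Real.exp (-(k * |x|))) ^ 2 := by gcongr
    _ = C ^ 2 * Real.exp (-(2 * k * |x|)) := by
      rw [mul_pow, ← Real.exp_nat_mul]; congr 2; push_cast; ring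

theorem tendsto_comp_neg_atTop {f : ℝ → ℝ} {l : ℝ} (h : Tendsto f atBot (𝓝 l)) :
    Tendsto (fun x => f (-x)) atTop (𝓝 l) :=
  h.comp tendsto_neg_atTop_atBot

section Kink

variable {a γ d : ℝ}

theorem abs_accel_le {b γ u p : ℝ} (hb : 0 < b) (hb' : b ≤ 1 / 1000) (h0 : 0 ≤ γ) (h1 : γ < 1)
    (hp : |p| ≤ 3) : |accel b γ u p| ≤ 150 * (|u - arcsin γ| + |p|) := by
  have h := abs_accel_sub_le hb hb' h0 h1 (u := u) (u' := arcsin γ) (B := 3) hp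
    (p' := 0) (by simp)
  have e : accel b γ (arcsin γ) 0 = 0 := by simp [accel, sin_arcsin (by linarith : -1 ≤ γ) h1.le]
  rw [e, sub_zero, sub_zero] at h
  norm_num at h
  exact h

/-- The potential rises from zero on `[arcsin γ, π - arcsin γ]` and falls on `[π - arcsin γ, π]`, so
positivity at `d` implies positivity on the whole way to `d`. -/
theorem excess_pos_of_mem {b : ℝ} (hb : 0 < b) (hb' : b ≤ 1 / 1000) (h0 : 0 ≤ γ) (h1 : γ < 1)
    (hd : d ≤ π) (hpos : 0 < excess b γ d) {u : ℝ} (hu : arcsin γ < u)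
    (hud : u ≤ d) : 0 < excess b γ u := by
  have hfac : ∀ x, 0 < 1 + b * cos x := fun x => by nlinarith [neg_one_le_cos x]
  have hs := arcsin_le_pi_div_two γ
  have hsin : sin (arcsin γ) = γ := sin_arcsin (by linarith) h1.le
  have hs0 : 0 ≤ arcsin γ := arcsin_nonneg.2 h0
  have hcs := cos_arcsin_pos h0 h1
  rcases le_total u (π - arcsin γ) with h | h
  · have : StrictMonoOn (excess b γ) (Icc (arcsin γ) (π - arcsin γ)) := by
      apply strictMonoOn_of_deriv_pos (convex_Icc _ _) (continuous_excess b γ).continuousOn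
      rw [interior_Icc]
      intro x hx
      rw [(hasDerivAt_excess b γ x).deriv]
      refine mul_pos ?_ (hfac x)
      have hlt : arcsin γ < π / 2 := arcsin_lt_pi_div_two.2 h1
      rcases le_total x (π / 2) with hx2 | hx2
      · have := sin_lt_sin_of_lt_of_le_pi_div_two (neg_pi_div_two_le_arcsin γ) hx2 hx.1
        linarith
      · have := sin_lt_sin_of_lt_of_le_pi_div_two (x := arcsin γ) (y := π - x)
          (neg_pi_div_two_le_arcsin γ) (by linarith) (by linarith [hx.2])
        rw [sin_pi_sub] at this
        linarith
    have h2 := this ⟨le_rfl, by linarith⟩ ⟨hu.le, h⟩ hu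
    rwa [excess_arcsin b (by linarith) h1.le] at h2
  · have : AntitoneOn (excess b γ) (Icc (π - arcsin γ) π) := by
      apply antitoneOn_of_deriv_nonpos (convex_Icc _ _) (continuous_excess b γ).continuousOn
      · exact fun x _ => (hasDerivAt_excess b γ x).differentiableAt.differentiableWithinAt
      rw [interior_Icc]
      intro x hx
      rw [(hasDerivAt_excess b γ x).deriv]
      refine mul_nonpos_of_nonpos_of_nonneg ?_ (hfac x).le
      have := sin_le_sin_of_le_of_le_pi_div_two (x := π - x) (y := arcsin γ)
        (by linarith [hx.2, pi_pos]) hs (by linarith [hx.1])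
      rw [sin_pi_sub] at this
      linarith
    exact hpos.trans_le (this ⟨h, hud.trans hd⟩ ⟨h.trans hud, hd⟩ hud)

theorem excess_neg_pos {b : ℝ} (hb : 0 < b) (h0 : 0 ≤ γ) (h1 : γ < 1) {t : ℝ} (ht : 0 < t)
    (ht' : t ≤ π) : 0 < excess b γ (arcsin γ + -1 * t) := by
  rw [excess_add_sign b (by linarith) h1.le (Or.inr rfl)]
  have i1 : cos t < 1 := by
    have := cos_lt_cos_of_nonneg_of_le_pi le_rfl ht' ht
    rwa [cos_zero] at this
  have i2 := mul_pos (cos_arcsin_pos h0 h1) (by linarith : 0 < 1 - cos t)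
  have i3 : 0 ≤ γ * (t - sin t) := mul_nonneg h0 (by linarith [sin_le ht.le])
  have i4 : 0 ≤ b / 2 * (sin (arcsin γ + -1 * t) - γ) ^ 2 := by positivity
  linarith

theorem excess_le_four {b : ℝ} (hb : 0 < b) (hb' : b ≤ 1 / 1000) (h0 : 0 ≤ γ) (h1 : γ < 1) {σ t : ℝ}
    (hσ : σ = 1 ∨ σ = -1) (ht : 0 < t) (ht' : σ = -1 → t ≤ π / 2) :
    excess b γ (arcsin γ + σ * t) ≤ 4 := by
  rw [excess_add_sign b (by linarith) h1.le hσ]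
  have i1 : cos (arcsin γ) * (1 - cos t) ≤ 1 * 2 :=
    mul_le_mul (cos_le_one _) (by linarith [neg_one_le_cos t]) (by linarith [cos_le_one t])
      zero_le_one
  have i2 : 0 ≤ t - sin t := by linarith [sin_le ht.le]
  have i4 : b / 2 * (sin (arcsin γ + σ * t) - γ) ^ 2 ≤ 1 / 2000 * 4 := by
    have h2 := neg_one_le_sin (arcsin γ + σ * t)
    have h3 := sin_le_one (arcsin γ + σ * t)
    have h4 : (sin (arcsin γ + σ * t) - γ) ^ 2 ≤ 4 := by nlinarith
    calc b / 2 * (sin (arcsin γ + σ * t) - γ) ^ 2 ≤ b / 2 * 4 := by gcongr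
      _ ≤ _ := by linarith
  have i3 : -(σ * γ * (t - sin t)) ≤ π / 2 := by
    rcases hσ with rfl | rfl
    · have := mul_nonneg h0 i2
      linarith [pi_pos]
    · have h2 := ht' rfl
      have h3 : 0 ≤ sin t := sin_nonneg_of_nonneg_of_le_pi ht.le (by linarith [pi_pos])
      nlinarith
  linarith [pi_lt_d2]

/-- The kink through a first zero of the junction function. -/
structure IsKinkThrough (a γ d : ℝ) (φ : ℝ → ℝ) : Prop where
  isPiKink : IsPiKink a γ φ
  zero : φ 0 = d
  strictMono : StrictMono φ
  left : Departure (a ^ 2 / 12) γ 1 φ (deriv φ)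
  right : Departure (a ^ 2 / 12) γ (-1) (fun x => φ (-x) - π) (fun x => -deriv φ (-x))

theorem arcsin_add_pi_div_two_le {b : ℝ} (hb : 0 < b) (hb' : b ≤ 1 / 1000) (h0 : 0 ≤ γ)
    (h1 : γ < 1) (h : IsFirstZero b γ d) : arcsin γ + π / 2 ≤ d := by
  linarith [arcsin_le_of_zero hb hb' h0 h1 h.mem h.zero]

/-- The left half leaves the saddle point upwards and ends at `d`; the reflected right half leaves
it downwards and ends at `d - π`. The potential is automatically positive in the downward direction,
and the zero of the junction function transfers the positivity at `d - π` to `d`. -/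
theorem exists_isKinkThrough (hb : 0 < a ^ 2 / 12) (hb' : a ^ 2 / 12 ≤ 1 / 1000) (h0 : 0 ≤ γ)
    (h1 : γ < 1) (h : IsFirstZero (a ^ 2 / 12) γ d) : ∃ φ, IsKinkThrough a γ d φ := by
  set b := a ^ 2 / 12 with hbdef
  have hp := pi_pos
  have hs0 : 0 ≤ arcsin γ := arcsin_nonneg.2 h0
  have hsd := arcsin_add_pi_div_two_le hb hb' h0 h1 h
  have hd := h.mem
  have hsl : arcsin γ < π / 2 := arcsin_lt_pi_div_two.2 h1
  have hT' : 0 < arcsin γ + π - d := by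
    rcases hd.2.lt_or_eq with hlt | heq
    · linarith
    · have hs := h.sin_pos hb hb' h0 h1
      rw [heq, sin_pi] at hs
      exact absurd hs (lt_irrefl 0)
  have hER : 0 < excess b γ (d - π) := by
    have := excess_neg_pos hb h0 h1 hT' (by linarith)
    convert this using 2; ring
  have hEL : 0 < excess b γ d := by
    have hz := h.zero
    rw [junction_eq] at hz
    have hc1 := neg_one_le_cos d
    have hc2 := cos_le_one d
    have e1 : 0 < (1 + 2 * b * cos d) * excess b γ (d - π) :=
      mul_pos (by linarith [stiff_pos hb hb' d]) hER
    have e2 : 0 < 1 - 2 * b * cos d := by nlinarith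
    exact pos_of_mul_pos_right (by linarith : 0 < (1 - 2 * b * cos d) * excess b γ d) e2.le
  obtain ⟨u, p, dL, u0, -⟩ := exists_departure hb hb' h0 h1 (σ := 1) (T := d - arcsin γ)
    (Or.inl rfl) (by linarith) (by linarith [hd.2])
    (fun t ht ht' => excess_pos_of_mem hb hb' h0 h1 hd.2 hEL (by linarith) (by linarith))
    (fun t ht ht' => excess_le_four hb hb' h0 h1 (Or.inl rfl) ht (by norm_num))
  obtain ⟨u', p', dR, u0', -⟩ := exists_departure hb hb' h0 h1 (σ := -1)
    (T := arcsin γ + π - d) (Or.inr rfl) hT' (by linarith)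
    (fun t ht ht' => excess_neg_pos hb h0 h1 ht (by linarith))
    (fun t ht ht' => excess_le_four hb hb' h0 h1 (Or.inr rfl) ht fun _ => by linarith)
  have v0 : u 0 = d := by rw [u0]; ring
  have v0' : u' 0 = d - π := by rw [u0']; ring
  have hpos : ∀ x ≤ 0, 0 < p x := fun x hx => by have := dL.deriv_pos x hx; linarith
  have hneg : ∀ x ≤ 0, p' x < 0 := fun x hx => by have := dR.deriv_pos x hx; linarith
  -- The junction equation gives equal squares, and the signs are opposite because `p'` is a slope
  -- in the reflected variable.
  have hp0 : p 0 + p' 0 = 0 := by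
    have eL := dL.energy hb hb' (by linarith) h1.le 0 le_rfl
    have eR := dR.energy hb hb' (by linarith) h1.le 0 le_rfl
    have hz := h.zero
    rw [v0] at eL
    rw [v0', cos_sub_pi] at eR
    rw [junction_eq] at hz
    have hc1 := neg_one_le_cos d
    have hc2 := cos_le_one d
    have e1 := stiff_pos hb hb' d
    have e2 : 0 < 1 - 2 * b * cos d := by nlinarith
    have : (1 - 2 * b * cos d) * (1 + 2 * b * cos d) * (p 0 ^ 2 - p' 0 ^ 2) = 0 := by
      linear_combination (1 - 2 * b * cos d) * eL - (1 + 2 * b * cos d) * eR + 4 * hz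
    have h3 : p 0 ^ 2 - p' 0 ^ 2 = 0 :=
      (mul_eq_zero.1 this).resolve_left (mul_pos e2 (by linarith)).ne'
    have h4 : (p 0 - p' 0) * (p 0 + p' 0) = 0 := by linear_combination h3
    exact (mul_eq_zero.1 h4).resolve_left (by linarith [hpos 0 le_rfl, hneg 0 le_rfl])
  set φ : ℝ → ℝ := glue u fun x => u' x + π with hφ
  set ψ : ℝ → ℝ := glue p fun x => -p' x with hψ
  have dφ : ∀ x, HasDerivAt φ (ψ x) x := hasDerivAt_glue dL.cont_u.continuousOn
    (dR.cont_u.add continuous_const).continuousOn dL.cont_p.continuousOn dR.cont_p.continuousOn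
    (by rw [v0, v0']; ring) hp0 dL.deriv_u (fun x hx => (dR.deriv_u x hx).add_const π)
  have cψ : Continuous ψ := continuous_glue dL.cont_p.continuousOn dR.cont_p.neg.continuousOn
    (by linarith)
  have eψ : deriv φ = ψ := funext fun x => (dφ x).deriv
  have dψn : ∀ x < 0, HasDerivAt ψ (accel b γ (u x) (p x)) x := fun x hx =>
    hasDerivAt_glue_neg hx (dL.deriv_p x hx)
  have dψp : ∀ x, 0 < x → HasDerivAt ψ (accel b γ (u' (-x)) (p' (-x))) x := fun x hx => by
    have := hasDerivAt_glue_pos (f := p) hx (dR.deriv_p (-x) (by linarith)).neg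
    rwa [neg_neg] at this
  obtain ⟨C, k, hk, hdec⟩ := dL.decay
  obtain ⟨C', k', hk', hdec'⟩ := dR.decay
  have hC : 0 ≤ C := by simpa using (abs_nonneg _).trans (hdec 0 le_rfl).1
  have hC' : 0 ≤ C' := by simpa using (abs_nonneg _).trans (hdec' 0 le_rfl).1
  have key : ∀ x ≤ 0, C * Real.exp (k * x) ≤ (C + C') * Real.exp (-(min k k' * |x|)) := by
    intro x hx
    rw [abs_of_nonpos hx]
    have : k * x ≤ -(min k k' * -x) := by nlinarith [min_le_left k k']
    have := Real.exp_le_exp.2 this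
    have := Real.exp_pos (k * x)
    have : C * Real.exp (k * x) ≤ (C + C') * Real.exp (k * x) := by gcongr; linarith
    refine this.trans ?_
    gcongr
  have key' : ∀ x, 0 < x → C' * Real.exp (k' * -x) ≤ (C + C') * Real.exp (-(min k k' * |x|)) := by
    intro x hx
    rw [abs_of_pos hx]
    have : k' * -x ≤ -(min k k' * x) := by nlinarith [min_le_right k k']
    have := Real.exp_le_exp.2 this
    have : C' * Real.exp (k' * -x) ≤ (C + C') * Real.exp (k' * -x) := by gcongr; linarith
    refine this.trans ?_
    gcongr
  have hmin : 0 < min k k' := lt_min hk hk'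
  have hmono : StrictMono φ := strictMono_of_deriv_pos fun x => by
    rw [eψ]
    rcases le_or_gt x 0 with hx | hx
    · rw [hψ, glue_of_le hx]; exact hpos x hx
    · rw [hψ, glue_of_pos hx]; linarith [hneg (-x) (by linarith)]
  have hkink : IsPiKink a γ φ := by
    refine ⟨abs_lt.2 ⟨by linarith, h1⟩, contDiff_one_of_hasDerivAt dφ cψ, fun x hx => ?_,
      fun x hx => ?_, ?_, ?_, ?_, ?_⟩
    · rw [eψ]
      rcases lt_or_gt_of_ne hx with hx | hx
      · exact (dψn x hx).differentiableAt
      · exact (dψp x hx).differentiableAt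
    · rw [residual_eq_zero_iff hb hb', eψ]
      rcases lt_or_gt_of_ne hx with hx | hx
      · rw [(dψn x hx).deriv, theta, if_pos hx, hφ, hψ, glue_of_le hx.le, glue_of_le hx.le,
          add_zero]
      · rw [(dψp x hx).deriv, theta, if_neg (by linarith), hφ, hψ, glue_of_pos hx, glue_of_pos hx,
          accel_neg, add_neg_cancel_right]
    · rw [eψ]
      refine memLp_two_of_exp_bound cψ.measurable (C := C + C') hmin fun x _ => ?_
      rcases le_or_gt x 0 with hx | hx
      · rw [hψ, glue_of_le hx]; exact (hdec x hx).2.trans (key x hx)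
      · rw [hψ, glue_of_pos hx, abs_neg]; exact (hdec' (-x) (by linarith)).2.trans (key' x hx)
    · refine memLp_two_of_exp_bound (measurable_deriv _) (C := 150 * (2 * (C + C'))) hmin
        fun x hx => ?_
      rw [eψ]
      rcases lt_or_gt_of_ne hx with hx | hx
      · rw [(dψn x hx).deriv]
        have := abs_accel_le hb hb' h0 h1 (u := u x) (dL.abs_deriv_le x hx.le)
        have := (hdec x hx.le).1
        have := (hdec x hx.le).2
        have := key x hx.le
        linarith
      · rw [(dψp x hx).deriv]
        have hx' : -x ≤ 0 := by linarith
        have := abs_accel_le hb hb' h0 h1 (u := u' (-x)) (dR.abs_deriv_le (-x) hx')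
        have := (hdec' (-x) hx').1
        have := (hdec' (-x) hx').2
        have := key' x hx
        linarith
    · refine dL.lim_u.congr' ?_
      filter_upwards [eventually_le_atBot 0] with x hx using (glue_of_le hx).symm
    · rw [add_comm π]
      refine (tendsto_comp_neg_atTop (dR.lim_u.add_const π)).congr' ?_
      filter_upwards [eventually_gt_atTop 0] with x hx using
        (glue_of_pos (g := fun x => u' x + π) hx).symm
  refine ⟨φ, hkink, by rw [hφ, glue_of_le le_rfl, v0], hmono, ?_, ?_⟩
  · have eu : ∀ x ≤ 0, φ x = u x := fun x hx => glue_of_le hx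
    have ep : ∀ x ≤ 0, deriv φ x = p x := fun x hx => by rw [eψ]; exact glue_of_le hx
    refine ⟨hkink.orbit_left hb hb', fun x hx => ?_, fun x hx => ?_, fun x hx => ?_, C, k, hk,
      fun x hx => ?_⟩
    · rw [eu x hx]; exact dL.pos x hx
    · rw [ep x hx]; exact dL.deriv_pos x hx
    · rw [ep x hx]; exact dL.abs_deriv_le x hx
    · rw [eu x hx, ep x hx]; exact hdec x hx
  · have eu : ∀ x ≤ 0, φ (-x) - π = u' x := fun x hx => by
      rw [hφ, glue_of_nonneg (by rw [v0, v0']; ring) (by linarith), neg_neg]; ring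
    have ep : ∀ x ≤ 0, -deriv φ (-x) = p' x := fun x hx => by
      rw [eψ, hψ, glue_of_nonneg (by linarith) (by linarith), neg_neg, neg_neg]
    refine ⟨hkink.orbit_right hb hb', fun x hx => ?_, fun x hx => ?_, fun x hx => ?_, C', k', hk',
      fun x hx => ?_⟩
    · rw [eu x hx]; exact dR.pos x hx
    · rw [ep x hx]; exact dR.deriv_pos x hx
    · rw [ep x hx]; exact dR.abs_deriv_le x hx
    · rw [eu x hx, ep x hx]; exact hdec' x hx

end Kink

end PiKink
end

/-! ### Existence and uniqueness of the type 1 kink, and the critical forcing. -/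

noncomputable section
namespace PiKink

variable {a γ d : ℝ} {φ ψ : ℝ → ℝ}

theorem IsPiKink.exists_deriv_pos (hb : 0 < a ^ 2 / 12) (hb' : a ^ 2 / 12 ≤ 1 / 1000) (h0 : 0 ≤ γ)
    (h : IsPiKink a γ ψ) (hd : arcsin γ < d) : ∃ x ≤ 0, ψ x < d ∧ 0 < deriv ψ x := by
  obtain ⟨X, hX⟩ := eventually_atBot.1 (h.tendsto_atBot.eventually (gt_mem_nhds hd))
  by_contra hcon
  push Not at hcon
  set Y := min X 0 with hY
  have anti : AntitoneOn ψ (Iic Y) := by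
    apply antitoneOn_of_deriv_nonpos (convex_Iic _) h.contDiff.continuous.continuousOn
    · exact fun x _ => (h.hasDerivAt x).differentiableAt.differentiableWithinAt
    · rw [interior_Iic]
      intro x hx
      have hx' : x < Y := hx
      exact hcon x (hx'.le.trans (min_le_right _ _)) (hX x (hx'.le.trans (min_le_left _ _)))
  have h1 : ψ Y ≤ arcsin γ := by
    refine ge_of_tendsto h.tendsto_atBot ?_
    filter_upwards [eventually_le_atBot Y] with x hx using anti hx (mem_Iic.2 le_rfl) hx
  have := h.arcsin_lt hb hb' h0 Y (min_le_right _ _)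
  linarith

/-- Two half orbits that meet at points with equal heights and positive slopes coincide up to a
translation. -/
theorem Orbit.eq_of_meet {b : ℝ} (hb : 0 < b) (hb' : b ≤ 1 / 1000) (h0 : 0 ≤ γ) (h1 : γ < 1)
    {u p u' p' : ℝ → ℝ} (h : Orbit b γ u p) (h' : Orbit b γ u' p') {x₁ x₂ : ℝ} (hx₁ : x₁ ≤ 0)
    (hx : x₂ ≤ x₁) (hu : u x₁ = u' x₂) (hp : p x₁ = p' x₂) :
    ∀ x ≤ 0, u x = u' (x - (x₁ - x₂)) := by
  obtain ⟨B, hB⟩ := exists_bound_of_tendsto h.cont_p h.lim_p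
  obtain ⟨B', hB'⟩ := exists_bound_of_tendsto h'.cont_p h'.lim_p
  have hsub : ∀ x, HasDerivAt (fun x : ℝ => x - (x₁ - x₂)) 1 x := fun x =>
    (hasDerivAt_id x).sub_const _
  have huniq := static_unique hb hb' h0 h1 (u' := fun x => u' (x - (x₁ - x₂)))
    (p' := fun x => p' (x - (x₁ - x₂))) (B := max B B') h.cont_u.continuousOn h.cont_p.continuousOn
    (h'.cont_u.comp (by fun_prop)).continuousOn (h'.cont_p.comp (by fun_prop)).continuousOn
    h.deriv_u h.deriv_p
    (fun x hx0 => ((h'.deriv_u _ (by linarith)).comp x (hsub x)).congr_deriv (mul_one _))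
    (fun x hx0 => ((h'.deriv_p _ (by linarith)).comp x (hsub x)).congr_deriv (mul_one _))
    (fun x hx0 => (hB x hx0).trans (le_max_left _ _))
    (fun x hx0 => (hB' _ (by linarith)).trans (le_max_right _ _)) hx₁
    (by rw [hu]; congr 1; ring) (by rw [hp]; congr 1; ring)
  exact fun x hx0 => (huniq x hx0).1

/-- Any kink `ψ` passes some height between `arcsin γ` and `d` with positive slope, where by energy
it has the same slope as `φ`; uniqueness makes the left halves translates of each other. A shift in
the wrong direction would place `ψ 0` below `d`, producing a zero of the junction function before
the first one. -/
theorem IsKinkThrough.isType1Kink (hb : 0 < a ^ 2 / 12) (hb' : a ^ 2 / 12 ≤ 1 / 1000) (h0 : 0 ≤ γ)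
    (hφ : IsKinkThrough a γ d φ) (hd : IsFirstZero (a ^ 2 / 12) γ d) : IsType1Kink a γ φ := by
  refine ⟨hφ.isPiKink, hφ.strictMono, fun ψ hψ => ?_⟩
  have h1 := hψ.lt_one
  have hsd : arcsin γ < d := by
    linarith [arcsin_add_pi_div_two_le hb hb' h0 h1 hd, pi_pos]
  obtain ⟨x₂, hx₂, hlt, hder⟩ := hψ.exists_deriv_pos hb hb' h0 hsd
  have hgt := hψ.arcsin_lt hb hb' h0 x₂ hx₂
  have hex : ∃ x₁ ≤ 0, φ x₁ = ψ x₂ := by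
    obtain ⟨X, hX, hX0⟩ := ((hφ.isPiKink.tendsto_atBot.eventually (gt_mem_nhds hgt)).and
      (eventually_le_atBot 0)).exists
    obtain ⟨y, hy, hy2⟩ := intermediate_value_Icc hX0
      hφ.isPiKink.contDiff.continuous.continuousOn ⟨hX.le, by rw [hφ.zero]; exact hlt.le⟩
    exact ⟨y, hy.2, hy2⟩
  obtain ⟨x₁, hx₁, he⟩ := hex
  have oψ := hψ.orbit_left hb hb'
  have oφ := hφ.isPiKink.orbit_left hb hb'
  have hderφ : 0 < deriv φ x₁ := by have := hφ.left.deriv_pos x₁ hx₁; linarith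
  have hp : deriv φ x₁ = deriv ψ x₂ := by
    have e1 := oψ.energy hb hb' (by linarith) h1.le x₂ hx₂
    have e2 := oφ.energy hb hb' (by linarith) h1.le x₁ hx₁
    rw [he] at e2
    have hS := stiff_pos hb hb' (ψ x₂)
    have : (1 + 2 * (a ^ 2 / 12) * cos (ψ x₂)) * (deriv φ x₁ ^ 2 - deriv ψ x₂ ^ 2) = 0 := by
      linear_combination e2 - e1
    have h3 := (mul_eq_zero.1 this).resolve_left (by linarith)
    have h4 : (deriv φ x₁ - deriv ψ x₂) * (deriv φ x₁ + deriv ψ x₂) = 0 := by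
      linear_combination h3
    linarith [(mul_eq_zero.1 h4).resolve_right (by linarith)]
  rcases le_or_gt x₂ x₁ with hx | hx
  · exact ⟨x₁ - x₂, by linarith, oφ.eq_of_meet hb hb' h0 h1 oψ hx₁ hx he hp⟩
  · exfalso
    have hs := oψ.eq_of_meet hb hb' h0 h1 oφ hx₂ hx.le he.symm hp.symm 0 le_rfl
    have hlt2 : ψ 0 < d := by
      rw [hs, ← hφ.zero]; exact hφ.strictMono (by linarith)
    have hge := hψ.arcsin_lt hb hb' h0 0 le_rfl
    have := hd.neg (ψ 0) (by linarith [arcsin_nonneg.2 h0]) hlt2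
    rw [hψ.junction_zero hb hb'] at this
    exact lt_irrefl _ this

/-- Each kink is a translate of the other on the left, by nonnegative amounts `s` and `t`.
Injectivity gives `s + t = 0`, so the left halves agree, and the common junction data determine the
right half. -/
theorem IsType1Kink.eq (hb : 0 < a ^ 2 / 12) (hb' : a ^ 2 / 12 ≤ 1 / 1000) (h0 : 0 ≤ γ)
    (hφ : IsType1Kink a γ φ) (hψ : IsType1Kink a γ ψ) : φ = ψ := by
  obtain ⟨s, hs, h1⟩ := hφ.first ψ hψ.isPiKink
  obtain ⟨t, ht, h2⟩ := hψ.first φ hφ.isPiKink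
  have hst : s = 0 := by
    have h3 := h1 0 le_rfl
    rw [h2 (0 - s) (by linarith)] at h3
    have := hφ.strictMono.injective h3
    linarith
  have hle : ∀ x ≤ 0, φ x = ψ x := fun x hx => by rw [h1 x hx, hst, sub_zero]
  have h00 := hle 0 le_rfl
  have hd0 : deriv φ 0 = deriv ψ 0 := by
    have e1 := hφ.isPiKink.hasDerivAt 0 |>.hasDerivWithinAt (s := Iic 0)
    have e2 := hψ.isPiKink.hasDerivAt 0 |>.hasDerivWithinAt (s := Iic 0)
    have e3 := e2.congr (f₁ := φ) (fun x hx => hle x hx) h00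
    exact (uniqueDiffOn_Iic (0 : ℝ) 0 (by simp)).eq_deriv _ e1 e3
  have oφ := hφ.isPiKink.orbit_right hb hb'
  have oψ := hψ.isPiKink.orbit_right hb hb'
  have hR := oφ.eq_of_meet hb hb' h0 hφ.isPiKink.lt_one oψ (x₁ := 0) (x₂ := 0) le_rfl le_rfl
    (by simp [h00]) (by simp [hd0])
  funext x
  rcases le_total x 0 with hx | hx
  · exact hle x hx
  · have := hR (-x) (by linarith)
    simp only [sub_zero, neg_neg] at this
    linarith

/-- The compact set `forcings` has a maximum, at which a kink is constructed. Conversely the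
junction point of any kink with `γ > 0` is a zero in `(0, 2π)`, which forces one in `[π/2, π]`. -/
theorem isGreatest_gammaCr (hb : 0 < a ^ 2 / 12) (hb' : a ^ 2 / 12 ≤ 1 / 1000) :
    IsGreatest (forcings (a ^ 2 / 12)) (gammaCr a) := by
  obtain ⟨g, hg⟩ := (isCompact_forcings hb hb').exists_isGreatest ⟨_, tenth_mem_forcings hb hb'⟩
  have hg0 : (1 / 10 : ℝ) ≤ g := hg.2 (tenth_mem_forcings hb hb')
  have : IsGreatest {γ : ℝ | ∃ φ : ℝ → ℝ, IsPiKink a γ φ} g := by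
    constructor
    · obtain ⟨d, hd⟩ := exists_isFirstZero hb hb' hg.1
      obtain ⟨φ, hφ⟩ := exists_isKinkThrough hb hb' hg.1.1 hg.1.2.1 hd
      exact ⟨φ, hφ.isPiKink⟩
    · rintro γ ⟨φ, hφ⟩
      rcases le_or_gt γ 0 with h | h
      · linarith
      · have h0 := arcsin_nonneg.2 h.le
        have h2 := hφ.arcsin_lt hb hb' h.le 0 le_rfl
        exact hg.2 ⟨h.le, hφ.lt_one, exists_zero_of_zero hb hb' h hφ.lt_one (by linarith)
          (hφ.zero_lt_two_pi hb hb' h) (hφ.junction_zero hb hb')⟩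
  rw [gammaCr, this.csSup_eq]
  exact hg

theorem gammaCr_pos (hb : 0 < a ^ 2 / 12) (hb' : a ^ 2 / 12 ≤ 1 / 1000) : 0 < gammaCr a := by
  linarith [(isGreatest_gammaCr hb hb').2 (tenth_mem_forcings hb hb')]

theorem mem_forcings_of_mem_Icc (hb : 0 < a ^ 2 / 12) (hb' : a ^ 2 / 12 ≤ 1 / 1000)
    (h : γ ∈ Icc 0 (gammaCr a)) : γ ∈ forcings (a ^ 2 / 12) :=
  mem_forcings_of_le hb hb' (isGreatest_gammaCr hb hb').1 h.1 h.2

theorem existsUnique_isType1Kink (hb : 0 < a ^ 2 / 12) (hb' : a ^ 2 / 12 ≤ 1 / 1000)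
    (h : γ ∈ Icc 0 (gammaCr a)) : ∃! φ : ℝ → ℝ, IsType1Kink a γ φ := by
  have hf := mem_forcings_of_mem_Icc hb hb' h
  obtain ⟨d, hd⟩ := exists_isFirstZero hb hb' hf
  obtain ⟨φ, hφ⟩ := exists_isKinkThrough hb hb' h.1 hf.2.1 hd
  exact ⟨φ, hφ.isType1Kink hb hb' h.1 hd, fun ψ hψ =>
    hψ.eq hb hb' h.1 (hφ.isType1Kink hb hb' h.1 hd)⟩

theorem IsType1Kink.exists_isKinkThrough (hb : 0 < a ^ 2 / 12) (hb' : a ^ 2 / 12 ≤ 1 / 1000)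
    (h : γ ∈ Icc 0 (gammaCr a)) (hφ : IsType1Kink a γ φ) :
    ∃ d, IsFirstZero (a ^ 2 / 12) γ d ∧ IsKinkThrough a γ d φ := by
  have hf := mem_forcings_of_mem_Icc hb hb' h
  obtain ⟨d, hd⟩ := exists_isFirstZero hb hb' hf
  obtain ⟨ψ, hψ⟩ := PiKink.exists_isKinkThrough hb hb' h.1 hf.2.1 hd
  exact ⟨d, hd, hφ.eq hb hb' h.1 (hψ.isType1Kink hb hb' h.1 hd) ▸ hψ⟩

end PiKink
end

/-! ### The linearization in self-adjoint form. -/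

noncomputable section
namespace PiKink

/-- The leading coefficient of the linearization, as a function of the height `u` of the orbit. -/
def stiff (b Λ u : ℝ) : ℝ := 1 + 2 * b * cos u + 2 * b * Λ

/-- The potential of the linearization `(stiff · v')' = pot · v`. -/
def pot (b γ Λ u p : ℝ) : ℝ :=
  cos u + Λ + b * (2 * accel b γ u p * sin u + p ^ 2 * cos u + (Λ + cos u) ^ 2 - sin u ^ 2 +
    γ * sin u)

theorem pot_neg (b γ Λ u p : ℝ) : pot b γ Λ u (-p) = pot b γ Λ u p := by simp [pot, accel_neg]

theorem pot_zero (b γ u p : ℝ) : pot b γ 0 u p = cos u + b * (2 * accel b γ u p * sin u +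
    p ^ 2 * cos u + cos u ^ 2 - sin u ^ 2 + γ * sin u) := by simp [pot]

/-- The coefficient of `v'` is the derivative of `stiff` along the orbit, so the linearized equation
has the divergence form `(stiff v')' = pot v`. -/
theorem linearized_eq_zero_iff {a γ θ u p r Λ v v' v'' : ℝ} (hr : r = accel (a ^ 2 / 12) γ (u + θ) p) :
    linearized a γ θ u p r Λ v v' v'' = 0 ↔
      stiff (a ^ 2 / 12) Λ (u + θ) * v'' + -(2 * (a ^ 2 / 12) * sin (u + θ) * p) * v' =
        pot (a ^ 2 / 12) γ Λ (u + θ) p * v := by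
  rw [← sub_eq_zero (a := _ + _), hr]
  refine Eq.congr_left ?_
  rw [linearized, stiff, pot]
  ring

theorem hasDerivAt_stiff {u : ℝ → ℝ} {b Λ x p : ℝ} (hu : HasDerivAt u p x) :
    HasDerivAt (fun x => stiff b Λ (u x)) (-(2 * b * sin (u x) * p)) x :=
  (((hu.cos.const_mul (2 * b)).const_add 1).add_const _).congr_deriv (by ring)

variable {a b γ Λ : ℝ} {u p v w : ℝ → ℝ}

theorem abs_accel_le_three (hb : 0 < b) (hb' : b ≤ 1 / 1000) (h0 : 0 ≤ γ) (h1 : γ < 1) {u p : ℝ}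
    (hp : |p| ≤ 3) : |accel b γ u p| ≤ 3 := by
  have hS := stiff_pos hb hb' u
  have hp2 : p ^ 2 ≤ 3 ^ 2 := by rw [← sq_abs]; gcongr
  have s1 := abs_sin_le_one u
  have c1 := abs_cos_le_one u
  rw [accel, abs_div, abs_of_pos (by linarith : 0 < 1 + 2 * b * cos u), div_le_iff₀ (by linarith)]
  have t0 : |sin u - γ| ≤ 2 := by
    refine (abs_sub _ _).trans ?_
    rw [abs_of_nonneg h0]; linarith
  have t1 : |b * p ^ 2 * sin u| ≤ 1 / 1000 * 3 ^ 2 * 1 := by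
    rw [abs_mul, abs_mul, abs_of_pos hb, abs_of_nonneg (sq_nonneg p)]
    gcongr
  have t2 : |b * cos u * (sin u - γ)| ≤ 1 / 1000 * 1 * 2 := by
    rw [abs_mul, abs_mul, abs_of_pos hb]
    gcongr
  refine (abs_add_three _ _ _).trans ?_
  linarith

/-- The lattice correction of the potential is bounded. -/
theorem abs_pot_sub_le (hb : 0 < b) (hb' : b ≤ 1 / 1000) (h0 : 0 ≤ γ) (h1 : γ < 1) {u p : ℝ}
    (hp : |p| ≤ 3) (hΛ : Λ ∈ Icc (-1) 0) : |pot b γ Λ u p - (cos u + Λ)| ≤ 25 * b := by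
  have e : pot b γ Λ u p - (cos u + Λ) = b * (2 * accel b γ u p * sin u + p ^ 2 * cos u +
    (Λ + cos u) ^ 2 - sin u ^ 2 + γ * sin u) := by rw [pot]; ring
  have ha := abs_accel_le_three hb hb' h0 h1 (u := u) hp
  have hp2 : p ^ 2 ≤ 3 ^ 2 := by rw [← sq_abs]; gcongr
  have s1 := abs_sin_le_one u
  have c1 := abs_cos_le_one u
  obtain ⟨s2, s3⟩ := abs_le.1 s1
  obtain ⟨c2, c3⟩ := abs_le.1 c1
  have t1 : |2 * accel b γ u p * sin u| ≤ 2 * 3 * 1 := by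
    rw [abs_mul, abs_mul, abs_two]; gcongr
  have t2 : |p ^ 2 * cos u| ≤ 3 ^ 2 * 1 := by
    rw [abs_mul, abs_of_nonneg (sq_nonneg p)]; gcongr
  have t3 : (Λ + cos u) ^ 2 ≤ 4 := by nlinarith [hΛ.1, hΛ.2]
  have t4 : |γ * sin u| ≤ 1 * 1 := by
    rw [abs_mul, abs_of_nonneg h0]; gcongr
  have t5 := sin_sq_le_one u
  rw [e, abs_mul, abs_of_pos hb, mul_comm]
  refine mul_le_mul_of_nonneg_right ?_ hb.le
  rw [abs_le] at *
  constructor <;> nlinarith [sq_nonneg (Λ + cos u), sq_nonneg (sin u)]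

theorem abs_stiff_sub_one_le (hb : 0 < b) (hΛ : Λ ∈ Icc (-1) 0) (u : ℝ) :
    |stiff b Λ u - 1| ≤ 4 * b := by
  have c1 := neg_one_le_cos u
  have c2 := cos_le_one u
  rw [stiff, abs_le]
  constructor <;> nlinarith [hΛ.1, hΛ.2]

theorem stiffness_stiff (hb : 0 < b) (hb' : b ≤ 1 / 1000) (hu : Continuous u) (hΛ : -1 ≤ Λ) :
    Stiffness fun x => stiff b Λ (u x) where
  contOn := by unfold stiff; fun_prop
  pos x _ := by
    have := neg_one_le_cos (u x)
    rw [stiff]; nlinarith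
  bounded := ⟨1 + 2 * b + 2 * b * Λ, fun x _ => by
    have := cos_le_one (u x)
    rw [stiff]; nlinarith⟩

theorem IsEigenfunction.decaying_left (hb : 0 < a ^ 2 / 12) (hb' : a ^ 2 / 12 ≤ 1 / 1000)
    {φ : ℝ → ℝ} (hφ : IsPiKink a γ φ) (hv : IsEigenfunction a γ φ Λ v) :
    Decaying (fun x => stiff (a ^ 2 / 12) Λ (φ x)) (fun x => pot (a ^ 2 / 12) γ Λ (φ x) (deriv φ x))
      v (deriv v) where
  contOn := hv.contDiff.continuous.continuousOn
  contOn_deriv := (hv.contDiff.continuous_deriv le_rfl).continuousOn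
  hasDeriv x _ := ((hv.contDiff.differentiable one_ne_zero) x).hasDerivAt
  hasDeriv_flux x hx := by
    have o := hφ.orbit_left hb hb'
    have h1 := (hasDerivAt_stiff (b := a ^ 2 / 12) (Λ := Λ) (o.deriv_u x hx)).mul
      (hv.differentiableAt_deriv x hx.ne).hasDerivAt
    refine h1.congr_deriv ?_
    have h2 := hv.eqn x hx.ne
    rw [theta, if_pos hx, linearized_eq_zero_iff (by rw [(o.deriv_p x hx).deriv, add_zero]),
      add_zero] at h2
    rw [← h2]; ring
  tendsto := tendsto_zero_of_memLp
    (fun x _ => ((hv.contDiff.differentiable one_ne_zero) x).hasDerivAt) hv.memLp hv.memLp_deriv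
  tendsto_deriv := tendsto_zero_of_memLp
    (fun x hx => (hv.differentiableAt_deriv x hx.ne).hasDerivAt) hv.memLp_deriv
    hv.memLp_deriv_deriv

theorem IsEigenfunction.decaying_right (hb : 0 < a ^ 2 / 12) (hb' : a ^ 2 / 12 ≤ 1 / 1000)
    {φ : ℝ → ℝ} (hφ : IsPiKink a γ φ) (hv : IsEigenfunction a γ φ Λ v) :
    Decaying (fun x => stiff (a ^ 2 / 12) Λ (φ (-x) - π))
      (fun x => pot (a ^ 2 / 12) γ Λ (φ (-x) - π) (-deriv φ (-x)))
      (fun x => v (-x)) (fun x => -deriv v (-x)) := by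
  have dv : ∀ x, HasDerivAt (fun x => v (-x)) (-deriv v (-x)) x := fun x =>
    ((((hv.contDiff.differentiable one_ne_zero) (-x)).hasDerivAt).comp x
      (hasDerivAt_neg x)).congr_deriv (by ring)
  have dw : ∀ x < 0, HasDerivAt (fun x => -deriv v (-x)) (deriv (deriv v) (-x)) x := fun x hx => by
    have hx' : -x ≠ 0 := by linarith
    exact ((((hv.differentiableAt_deriv (-x) hx').hasDerivAt).comp x
      (hasDerivAt_neg x)).neg).congr_deriv (by ring)
  refine ⟨?_, ?_, fun x _ => dv x, fun x hx => ?_, ?_, ?_⟩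
  · have := hv.contDiff.continuous
    exact Continuous.continuousOn (by fun_prop)
  · have := hv.contDiff.continuous_deriv le_rfl
    exact Continuous.continuousOn (by fun_prop)
  · have o := hφ.orbit_right hb hb'
    have h1 := (hasDerivAt_stiff (b := a ^ 2 / 12) (Λ := Λ) (o.deriv_u x hx)).mul (dw x hx)
    refine h1.congr_deriv ?_
    have hx' : 0 < -x := by linarith
    have h2 := hv.eqn (-x) hx'.ne'
    have h3 := (residual_eq_zero_iff hb hb').1 (hφ.static (-x) hx'.ne')
    rw [linearized_eq_zero_iff h3, theta, if_neg (not_lt.2 hx'.le), ← sub_eq_add_neg] at h2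
    rw [pot_neg, ← h2]; ring
  · exact tendsto_zero_of_memLp (fun x _ => dv x) (MemLp.comp_neg_real hv.memLp)
      (MemLp.comp_neg_real hv.memLp_deriv).neg
  · exact tendsto_zero_of_memLp dw (MemLp.comp_neg_real hv.memLp_deriv).neg
      (MemLp.comp_neg_real hv.memLp_deriv_deriv)

/-- A Riccati supersolution on both half lines excludes an eigenvalue. -/
theorem not_mem_eigenvalues (hb : 0 < a ^ 2 / 12) (hb' : a ^ 2 / 12 ≤ 1 / 1000) {φ : ℝ → ℝ}
    (hφ : IsPiKink a γ φ) (hΛ : -1 ≤ Λ) {M M' d d' : ℝ → ℝ} {K : ℝ}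
    (cM : ContinuousOn M (Iic 0)) (cM' : ContinuousOn M' (Iic 0))
    (bM : ∀ x ≤ 0, |M x| ≤ K) (bM' : ∀ x ≤ 0, |M' x| ≤ K)
    (dM : ∀ x < 0, HasDerivAt (fun x => stiff (a ^ 2 / 12) Λ (φ x) * M x) (d x) x)
    (dM' : ∀ x < 0, HasDerivAt (fun x => stiff (a ^ 2 / 12) Λ (φ (-x) - π) * M' x) (d' x) x)
    (hM : ∀ x < 0, d x + stiff (a ^ 2 / 12) Λ (φ x) * M x ^ 2 <
      pot (a ^ 2 / 12) γ Λ (φ x) (deriv φ x))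
    (hM' : ∀ x < 0, d' x + stiff (a ^ 2 / 12) Λ (φ (-x) - π) * M' x ^ 2 <
      pot (a ^ 2 / 12) γ Λ (φ (-x) - π) (-deriv φ (-x)))
    (hsum : 0 ≤ M 0 + M' 0) : Λ ∉ eigenvalues a γ φ := by
  rintro ⟨v, hv⟩
  have oL := hφ.orbit_left hb hb'
  have oR := hφ.orbit_right hb hb'
  obtain ⟨l1, l2⟩ := (hv.decaying_left hb hb' hφ).picone (stiffness_stiff hb hb' oL.cont_u hΛ)
    cM bM dM fun x hx => (hM x hx).le
  obtain ⟨r1, r2⟩ := (hv.decaying_right hb hb' hφ).picone (stiffness_stiff hb hb' oR.cont_u hΛ)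
    cM' bM' dM' fun x hx => (hM' x hx).le
  simp only [neg_zero] at r1 r2
  -- The two nonnegative boundary terms from Picone's identity add up to `-(M 0 + M' 0) v(0)²`,
  -- since the slopes of `v` cancel. So both vanish, and strictness gives `v = 0` on both sides.
  have hs : 0 ≤ (M 0 + M' 0) * v 0 ^ 2 := by positivity
  have hL := l2 (by nlinarith) hM
  have hR := r2 (by nlinarith) hM'
  refine hv.ne_zero (funext fun x => ?_)
  rcases le_total x 0 with hx | hx
  · exact hL x hx
  · simpa using hR (-x) (by linarith)

/-- Decaying solutions on both half lines that match at the junction form an eigenfunction. -/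
theorem mem_eigenvalues (hb : 0 < a ^ 2 / 12) (hb' : a ^ 2 / 12 ≤ 1 / 1000) (h0 : 0 ≤ γ)
    (h1 : γ < 1) {φ : ℝ → ℝ} {d : ℝ} (hφ : IsKinkThrough a γ d φ) (hΛ : Λ ∈ Icc (-1) 0)
    {v w v' w' : ℝ → ℝ}
    (hv : Decaying (fun x => stiff (a ^ 2 / 12) Λ (φ x))
      (fun x => pot (a ^ 2 / 12) γ Λ (φ x) (deriv φ x)) v w)
    (hv' : Decaying (fun x => stiff (a ^ 2 / 12) Λ (φ (-x) - π))
      (fun x => pot (a ^ 2 / 12) γ Λ (φ (-x) - π) (-deriv φ (-x))) v' w')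
    (hpos : v 0 ≠ 0) (hbound : ∃ C k : ℝ, 0 < k ∧ ∀ x ≤ 0, |v x| ≤ C * Real.exp (k * x) ∧
      |w x| ≤ C * Real.exp (k * x) ∧ |v' x| ≤ C * Real.exp (k * x) ∧ |w' x| ≤ C * Real.exp (k * x))
    (he : v 0 = v' 0) (hw : w 0 + w' 0 = 0) : Λ ∈ eigenvalues a γ φ := by
  obtain ⟨C, k, hk, hC⟩ := hbound
  have oL := hφ.isPiKink.orbit_left hb hb'
  have oR := hφ.isPiKink.orbit_right hb hb'
  set b := a ^ 2 / 12 with hbdef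
  have key : ∀ {σ : ℝ} {u p v w : ℝ → ℝ}, Departure b γ σ u p →
      Decaying (fun x => stiff b Λ (u x)) (fun x => pot b γ Λ (u x) (p x)) v w →
      (∀ x ≤ 0, |v x| ≤ C * Real.exp (k * x) ∧ |w x| ≤ C * Real.exp (k * x)) →
      ∃ r : ℝ → ℝ, ∀ x < 0, HasDerivAt w (r x) x ∧ stiff b Λ (u x) * r x +
        -(2 * b * sin (u x) * p x) * w x = pot b γ Λ (u x) (p x) * v x ∧
        |r x| ≤ 100 * C * Real.exp (k * x) := by
    intro σ u p v w o hvw hbd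
    -- This is `v''` as solved from the divergence form; it inherits the exponential bound of `v`
    -- and `w`.
    refine ⟨fun x => (pot b γ Λ (u x) (p x) * v x - -(2 * b * sin (u x) * p x) * w x) /
      stiff b Λ (u x), fun x hx => ?_⟩
    have hS := (abs_le.1 (abs_stiff_sub_one_le hb hΛ (u x))).1
    have hS0 : 9 / 10 ≤ stiff b Λ (u x) := by linarith
    have hpot : |pot b γ Λ (u x) (p x)| ≤ 3 := by
      have := abs_pot_sub_le hb hb' h0 h1 (u := u x) (o.abs_deriv_le x hx.le) hΛ
      rw [abs_le] at *
      have := neg_one_le_cos (u x)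
      have := cos_le_one (u x)
      have := hΛ.1
      have := hΛ.2
      constructor <;> linarith
    refine ⟨?_, ?_, ?_⟩
    · have h1 := (hvw.hasDeriv_flux x hx).div (hasDerivAt_stiff (b := b) (Λ := Λ) (o.deriv_u x hx))
        (by linarith)
      refine (h1.congr_deriv ?_).congr_of_eventuallyEq ?_
      · field_simp
      · filter_upwards [Iio_mem_nhds hx] with y hy
        have hS := (abs_le.1 (abs_stiff_sub_one_le hb hΛ (u y))).1
        exact (mul_div_cancel_left₀ _ (by linarith)).symm
    · rw [mul_div_cancel₀ _ (by linarith)]; ring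
    · obtain ⟨bv, bw⟩ := hbd x hx.le
      rw [abs_div, abs_of_pos (by linarith : 0 < stiff b Λ (u x)), div_le_iff₀ (by linarith)]
      have t1 : |pot b γ Λ (u x) (p x) * v x| ≤ 3 * (C * Real.exp (k * x)) := by
        rw [abs_mul]; gcongr
      have t2 : |-(2 * b * sin (u x) * p x) * w x| ≤ 2 * 1 * 1 * 3 * (C * Real.exp (k * x)) := by
        rw [abs_mul, abs_neg, abs_mul, abs_mul, abs_mul, abs_two, abs_of_pos hb]
        have := o.abs_deriv_le x hx.le
        have := abs_sin_le_one (u x)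
        gcongr
        linarith
      have := (abs_sub _ _).trans (add_le_add t1 t2)
      have hCe : 0 ≤ C * Real.exp (k * x) := (abs_nonneg _).trans bv
      nlinarith
  obtain ⟨r, hr⟩ := key hφ.left hv fun x hx => ⟨(hC x hx).1, (hC x hx).2.1⟩
  obtain ⟨r', hr'⟩ := key hφ.right hv' fun x hx => ⟨(hC x hx).2.2.1, (hC x hx).2.2.2⟩
  set F := glue v v' with hF
  set G := glue w fun x => -w' x with hG
  have dF : ∀ x, HasDerivAt F (G x) x := hasDerivAt_glue hv.contOn hv'.contOn hv.contOn_deriv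
    hv'.contOn_deriv he hw hv.hasDeriv hv'.hasDeriv
  have cG : Continuous G := continuous_glue (g := fun x => -w' x) hv.contOn_deriv hv'.contOn_deriv.neg (by linarith)
  have eG : deriv F = G := funext fun x => (dF x).deriv
  have dGn : ∀ x < 0, HasDerivAt G (r x) x := fun x hx => hasDerivAt_glue_neg hx (hr x hx).1
  have dGp : ∀ x, 0 < x → HasDerivAt G (r' (-x)) x := fun x hx => by
    have := hasDerivAt_glue_pos (f := w) hx (hr' (-x) (by linarith)).1.neg
    rwa [neg_neg] at this
  have bd : ∀ x : ℝ, ∀ y ≤ 0, y = -|x| → Real.exp (k * y) = Real.exp (-(k * |x|)) := by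
    intro x y _ h; rw [h]; congr 1; ring
  have en : ∀ x ≤ 0, Real.exp (k * x) = Real.exp (-(k * |x|)) := fun x hx =>
    bd x x hx (by rw [abs_of_nonpos hx]; ring)
  have ep : ∀ x, 0 < x → Real.exp (k * -x) = Real.exp (-(k * |x|)) := fun x hx =>
    bd x (-x) (by linarith) (by rw [abs_of_pos hx])
  refine ⟨F, fun hz => ?_, contDiff_one_of_hasDerivAt dF cG, fun x hx => ?_, ?_, ?_, ?_,
    fun x hx => ?_⟩
  · apply hpos
    have : F 0 = 0 := by rw [hz]; rfl
    rwa [hF, glue_of_le le_rfl] at this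
  · rw [eG]
    rcases lt_or_gt_of_ne hx with hx | hx
    · exact (dGn x hx).differentiableAt
    · exact (dGp x hx).differentiableAt
  · refine memLp_two_of_exp_bound (continuous_iff_continuousAt.2 fun x =>
      (dF x).continuousAt).measurable (C := C) hk fun x _ => ?_
    rcases le_or_gt x 0 with hx | hx
    · rw [hF, glue_of_le hx, ← en x hx]; exact (hC x hx).1
    · rw [hF, glue_of_pos hx, ← ep x hx]; exact (hC (-x) (by linarith)).2.2.1
  · rw [eG]
    refine memLp_two_of_exp_bound cG.measurable (C := C) hk fun x _ => ?_
    rcases le_or_gt x 0 with hx | hx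
    · rw [hG, glue_of_le hx, ← en x hx]; exact (hC x hx).2.1
    · rw [hG, glue_of_pos hx, ← ep x hx, abs_neg]; exact (hC (-x) (by linarith)).2.2.2
  · refine memLp_two_of_exp_bound (measurable_deriv _) (C := 100 * C) hk fun x hx => ?_
    rw [eG]
    rcases lt_or_gt_of_ne hx with hx | hx
    · rw [(dGn x hx).deriv, ← en x hx.le]; exact (hr x hx).2.2
    · rw [(dGp x hx).deriv, ← ep x hx]; exact (hr' (-x) (by linarith)).2.2
  · rw [eG]
    rcases lt_or_gt_of_ne hx with hx | hx
    · rw [theta, if_pos hx, linearized_eq_zero_iff (by rw [(oL.deriv_p x hx).deriv, add_zero]),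
        add_zero, (dGn x hx).deriv, hF, hG, glue_of_le hx.le, glue_of_le hx.le]
      exact (hr x hx).2.1
    · have h3 := (residual_eq_zero_iff hb hb').1 (hφ.isPiKink.static x hx.ne')
      rw [linearized_eq_zero_iff h3, theta, if_neg (not_lt.2 hx.le), ← sub_eq_add_neg,
        (dGp x hx).deriv, hF, hG, glue_of_pos hx, glue_of_pos hx]
      have := (hr' (-x) (by linarith)).2.1
      simp only [neg_neg, pot_neg] at this
      rw [← hbdef]
      linarith

end PiKink
end

/-! ### Positive eigenfunctions, the largest eigenvalue, and the role of the junction derivative. -/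

noncomputable section
namespace PiKink

variable {a b γ Λ σ : ℝ} {u p v w : ℝ → ℝ}

section Departure

variable (hb : 0 < b) (hb' : b ≤ 1 / 1000) (h0 : 0 ≤ γ) (h1 : γ < 1)

include hb hb' in
theorem abs_stiff_deriv_le {u p : ℝ} (hp : |p| ≤ 3) :
    |-(2 * b * sin u * p)| ≤ 6 / 1000 := by
  rw [abs_neg, abs_mul, abs_mul, abs_mul, abs_two, abs_of_pos hb]
  have := abs_sin_le_one u
  calc 2 * b * |sin u| * |p| ≤ 2 * (1 / 1000) * 1 * 3 := by gcongr
    _ = _ := by norm_num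

include hb hb' in
theorem stiff_bounds (hΛ : Λ ∈ Icc (-1) 0) (u : ℝ) :
    99 / 100 ≤ stiff b Λ u ∧ stiff b Λ u ≤ 101 / 100 := by
  have h := abs_le.1 (abs_stiff_sub_one_le hb hΛ u)
  constructor <;> linarith [h.1, h.2]

include hb hb' h0 h1 in
theorem pot_bounds {u p : ℝ} (hp : |p| ≤ 3) (hΛ : Λ ∈ Icc (-1) 0) :
    -3 ≤ pot b γ Λ u p ∧ pot b γ Λ u p ≤ 11 / 10 := by
  have h := abs_le.1 (abs_pot_sub_le hb hb' h0 h1 (u := u) hp hΛ)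
  have := neg_one_le_cos u
  have := cos_le_one u
  obtain ⟨l, r⟩ := hΛ
  constructor <;> linarith [h.1, h.2]

-- The constant `2` is a Riccati subsolution because the potential stays below `11/10` while `4
-- stiff` is close to `4`.
include hb hb' h0 h1 in
theorem Departure.le_two_mul (o : Departure b γ σ u p) (hΛ : Λ ∈ Icc (-1) 0)
    (hv : Decaying (fun x => stiff b Λ (u x)) (fun x => pot b γ Λ (u x) (p x)) v w)
    (hpos : ∀ x ≤ 0, 0 ≤ v x) : ∀ x ≤ 0, w x ≤ 2 * v x := by
  refine hv.le_of_riccati (stiffness_stiff hb hb' o.cont_u hΛ.1) hpos (M := fun _ => 2) (K := 2)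
    (d := fun x => -(2 * b * sin (u x) * p x) * 2) (a := 0) continuous_const le_rfl (by simp)
    (by simp) (fun x hx => (hasDerivAt_stiff (o.deriv_u x hx)).mul_const 2) fun x hx => ?_
  have h2 := (pot_bounds hb hb' h0 h1 (u := u x) (o.abs_deriv_le x hx.le) hΛ).2
  have h3 := (stiff_bounds hb hb' hΛ (u x)).1
  have h4 := (abs_le.1 (abs_stiff_deriv_le hb hb' (u := u x) (o.abs_deriv_le x hx.le))).1
  linarith

include hb hb' h0 h1 in
theorem Departure.neg_two_mul_le (o : Departure b γ σ u p) (hΛ : Λ ∈ Icc (-1) 0)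
    (hv : Decaying (fun x => stiff b Λ (u x)) (fun x => pot b γ Λ (u x) (p x)) v w)
    (hpos : ∀ x ≤ 0, 0 ≤ v x) (hz : -2 * v 0 ≤ w 0) : ∀ x ≤ 0, -2 * v x ≤ w x := by
  refine hv.neg_le_of_zero (stiffness_stiff hb hb' o.cont_u hΛ.1) hpos
    (fun x hx => hasDerivAt_stiff (o.deriv_u x hx)) (fun x hx => ?_) hz
  have h2 := (pot_bounds hb hb' h0 h1 (u := u x) (o.abs_deriv_le x hx.le) hΛ).2
  have h3 := (stiff_bounds hb hb' hΛ (u x)).1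
  have h4 := (abs_le.1 (abs_stiff_deriv_le hb hb' (u := u x) (o.abs_deriv_le x hx.le))).2
  linarith

include hb hb' h0 h1 in
/-- The logarithmic derivative of a positive solution is a strict Riccati supersolution for larger
spectral parameters. -/
theorem Departure.log_deriv_super (o : Departure b γ σ u p) (hΛ : Λ ∈ Icc (-1) 0) {Λ' : ℝ}
    (hlt : Λ < Λ')
    (hv : Decaying (fun x => stiff b Λ (u x)) (fun x => pot b γ Λ (u x) (p x)) v w)
    (hpos : ∀ x ≤ 0, 0 < v x) (hl : ∀ x ≤ 0, -2 * v x ≤ w x) (hr : ∀ x ≤ 0, w x ≤ 2 * v x) :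
    ∃ d : ℝ → ℝ, ContinuousOn (fun x => w x / v x) (Iic 0) ∧ (∀ x ≤ 0, |w x / v x| ≤ 2) ∧
      (∀ x < 0, HasDerivAt (fun x => stiff b Λ' (u x) * (w x / v x)) (d x) x) ∧
      ∀ x < 0, d x + stiff b Λ' (u x) * (w x / v x) ^ 2 < pot b γ Λ' (u x) (p x) := by
  have hS : ∀ x, 0 < stiff b Λ (u x) := fun x => by
    linarith [(stiff_bounds hb hb' hΛ (u x)).1]
  have habs : ∀ x ≤ 0, |w x / v x| ≤ 2 := fun x hx => by
    rw [abs_le, le_div_iff₀ (hpos x hx), div_le_iff₀ (hpos x hx)]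
    exact ⟨hl x hx, hr x hx⟩
  -- The stiffness at `Λ'` is the one at `Λ` plus the constant `2 b (Λ' - Λ)`. The first summand is
  -- the derivative of the old flux, the second that of the added multiple of `w / v`.
  refine ⟨fun x => (pot b γ Λ (u x) (p x) - stiff b Λ (u x) * (w x / v x) ^ 2) +
    2 * b * (Λ' - Λ) * ((pot b γ Λ (u x) (p x) - stiff b Λ (u x) * (w x / v x) ^ 2 -
      -(2 * b * sin (u x) * p x) * (w x / v x)) / stiff b Λ (u x)),
    hv.contOn_deriv.div hv.contOn fun x hx => (hpos x hx).ne', habs, fun x hx => ?_, fun x hx => ?_⟩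
  · have hv0 := (hpos x hx.le).ne'
    have hS0 := (hS x).ne'
    have hF := (hv.hasDeriv_flux x hx).div (hv.hasDeriv x hx) hv0
    have hSd := hasDerivAt_stiff (b := b) (Λ := Λ) (o.deriv_u x hx)
    have h2 := hF.add ((hF.div hSd hS0).const_mul (2 * b * (Λ' - Λ)))
    refine (h2.congr_deriv ?_).congr_of_eventuallyEq (.of_forall fun y => ?_)
    · simp only [Pi.div_apply]
      field_simp
    · have := (hS y).ne'
      have e : stiff b Λ' (u y) = stiff b Λ (u y) + 2 * b * (Λ' - Λ) := by
        rw [stiff, stiff]; ring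
      simp only [Pi.add_apply, Pi.div_apply]
      rw [e]
      field_simp
  · have hS1 := stiff_bounds hb hb' hΛ (u x)
    have hq := pot_bounds hb hb' h0 h1 (u := u x) (o.abs_deriv_le x hx.le) hΛ
    have hs := abs_stiff_deriv_le hb hb' (u := u x) (o.abs_deriv_le x hx.le)
    set M := w x / v x with hM
    set s := -(2 * b * sin (u x) * p x) with hsdef
    have hsM : |s * M| ≤ 6 / 1000 * 2 := by
      rw [abs_mul]; exact mul_le_mul hs (habs x hx.le) (abs_nonneg _) (by norm_num)
    have e1 : stiff b Λ' (u x) = stiff b Λ (u x) + 2 * b * (Λ' - Λ) := by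
      rw [stiff, stiff]; ring
    have e2 : pot b γ Λ' (u x) (p x) = pot b γ Λ (u x) (p x) +
        (Λ' - Λ) * (1 + b * (Λ' + Λ + 2 * cos (u x))) := by rw [pot, pot]; ring
    have e3 : (pot b γ Λ (u x) (p x) - stiff b Λ (u x) * M ^ 2 - s * M) / stiff b Λ (u x) =
        (pot b γ Λ (u x) (p x) - s * M) / stiff b Λ (u x) - M ^ 2 := by
      have := (hS x).ne'
      field_simp; ring
    have h3 : (pot b γ Λ (u x) (p x) - s * M) / stiff b Λ (u x) ≤ 2 := by
      rw [div_le_iff₀ (hS x)]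
      linarith [(abs_le.1 hsM).1]
    have h4 : 2 * b * ((pot b γ Λ (u x) (p x) - s * M) / stiff b Λ (u x)) ≤ 2 * b * 2 := by gcongr
    -- Raising `Λ` raises the potential at rate about `1`, but the Riccati expression only at a rate
    -- of order `b`.
    have h5 : 2 * b * ((pot b γ Λ (u x) (p x) - s * M) / stiff b Λ (u x)) <
        1 + b * (Λ' + Λ + 2 * cos (u x)) := by
      have := neg_one_le_cos (u x)
      have := hΛ.1
      nlinarith
    beta_reduce
    rw [← hM, ← hsdef, e1, e2, e3]
    nlinarith [mul_lt_mul_of_pos_left h5 (sub_pos.2 hlt)]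

-- At the saddle point the potential tends to `(Λ + c₀) + b (Λ + c₀)²` with `c₀ = cos (arcsin γ)`;
-- it is positive exactly because `Λ₁` lies above `-c₀`.
include hb hb' h0 h1 in
theorem Departure.halfFamily (o : Departure b γ σ u p) {Λ₁ : ℝ} (hΛ₁ : -1 ≤ Λ₁)
    (hlt : 0 < Λ₁ + cos (arcsin γ)) :
    HalfFamily Λ₁ (fun Λ x => stiff b Λ (u x)) (fun Λ x => pot b γ Λ (u x) (p x)) := by
  have hmem : ∀ Λ ∈ Icc Λ₁ 0, Λ ∈ Icc (-1 : ℝ) 0 := fun Λ h => ⟨hΛ₁.trans h.1, h.2⟩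
  have cu := o.cont_u
  have cp := o.cont_p
  have hden : ∀ u, 1 + 2 * b * cos u ≠ 0 := fun u => by linarith [stiff_pos hb hb' u]
  have ca : Continuous fun z : ℝ × ℝ => accel b γ (u z.1) (p z.1) := by
    unfold accel
    exact Continuous.div (by fun_prop) (by fun_prop) fun z => hden _
  have hsin : sin (arcsin γ) = γ := sin_arcsin (by linarith) h1.le
  refine ⟨?_, ?_, fun Λ hΛ x hx => ?_, ?_⟩
  · unfold stiff
    exact Continuous.continuousOn (by fun_prop)
  · unfold pot
    exact Continuous.continuousOn (by fun_prop)
  · have h2 := stiff_bounds hb hb' (hmem Λ hΛ) (u x)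
    have h3 := pot_bounds hb hb' h0 h1 (u := u x) (o.abs_deriv_le x hx) (hmem Λ hΛ)
    exact ⟨by linarith, by linarith, abs_le.2 ⟨by linarith, by linarith⟩⟩
  · obtain ⟨C, k, hk, hdec⟩ := o.decay
    set c₀ := cos (arcsin γ) with hc₀
    have hC : 0 ≤ C := by simpa using (abs_nonneg _).trans (hdec 0 le_rfl).1
    -- The exponent is `k / 2` because `HalfFamily` measures convergence by `exp (2 η x)`.
    refine ⟨fun Λ => stiff b Λ (arcsin γ), fun Λ => (Λ + c₀) + b * (Λ + c₀) ^ 2, 800 * C, k / 2,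
      by positivity, ?_, ?_, fun Λ hΛ => ?_, fun Λ hΛ => ?_, fun Λ hΛ x hx => ?_⟩
    · unfold stiff
      exact Continuous.continuousOn (by fun_prop)
    · exact Continuous.continuousOn (by fun_prop)
    · linarith [(stiff_bounds hb hb' (hmem Λ hΛ) (arcsin γ)).1]
    · have : 0 < Λ + c₀ := by linarith [hΛ.1]
      positivity
    · obtain ⟨du, dp⟩ := hdec x hx
      have e : 2 * (k / 2) * x = k * x := by ring
      rw [e]
      set D := |u x - arcsin γ| with hD
      have hD0 : 0 ≤ D := abs_nonneg _
      have hP0 := abs_nonneg (p x)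
      have hcD : |cos (u x) - c₀| ≤ D := abs_cos_sub_cos_le _ _
      have hsD : |sin (u x) - γ| ≤ D := by
        have := abs_sin_sub_sin_le (u x) (arcsin γ)
        rwa [hsin] at this
      have hp3 := o.abs_deriv_le x hx
      have s1 := abs_sin_le_one (u x)
      have c1 := abs_cos_le_one (u x)
      have c2 : |c₀| ≤ 1 := abs_cos_le_one _
      have hCe : 0 ≤ C * Real.exp (k * x) := by positivity
      constructor
      · have e : stiff b Λ (u x) - stiff b Λ (arcsin γ) = 2 * b * (cos (u x) - c₀) := by
          rw [stiff, stiff]; ring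
        rw [e, abs_mul, abs_of_pos (by linarith : 0 < 2 * b)]
        have : 2 * b * |cos (u x) - c₀| ≤ 1 * D := by gcongr; linarith
        linarith
      · have e : pot b γ Λ (u x) (p x) - ((Λ + c₀) + b * (Λ + c₀) ^ 2) = (cos (u x) - c₀) +
            b * ((2 * accel b γ (u x) (p x) * sin (u x) + p x ^ 2 * cos (u x)) +
            (cos (u x) - c₀) * (2 * Λ + cos (u x) + c₀) - sin (u x) * (sin (u x) - γ)) := by
          rw [pot]; ring
        have t1 : |2 * accel b γ (u x) (p x) * sin (u x)| ≤ 2 * (150 * (D + |p x|)) * 1 := by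
          rw [abs_mul, abs_mul, abs_two]
          gcongr
          exact abs_accel_le hb hb' h0 h1 hp3
        have t2 : |p x ^ 2 * cos (u x)| ≤ 3 * |p x| * 1 := by
          rw [abs_mul, abs_of_nonneg (sq_nonneg (p x)), ← sq_abs]
          gcongr; nlinarith
        have t3 : |(cos (u x) - c₀) * (2 * Λ + cos (u x) + c₀)| ≤ D * 4 := by
          rw [abs_mul]
          gcongr
          rw [abs_le] at *
          have := (hmem Λ hΛ).1
          have := hΛ.2
          constructor <;> linarith
        have t4 : |sin (u x) * (sin (u x) - γ)| ≤ 1 * D := by rw [abs_mul]; gcongr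
        rw [e]
        have t5 : |(2 * accel b γ (u x) (p x) * sin (u x) + p x ^ 2 * cos (u x)) +
            (cos (u x) - c₀) * (2 * Λ + cos (u x) + c₀) - sin (u x) * (sin (u x) - γ)| ≤
            310 * (D + |p x|) := by
          rw [abs_le] at *
          constructor <;> linarith
        have t6 : |b * ((2 * accel b γ (u x) (p x) * sin (u x) + p x ^ 2 * cos (u x)) +
            (cos (u x) - c₀) * (2 * Λ + cos (u x) + c₀) - sin (u x) * (sin (u x) - γ))| ≤
            1 * (310 * (D + |p x|)) := by
          rw [abs_mul, abs_of_pos hb]; gcongr; linarith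
        refine (abs_add_le _ _).trans ?_
        linarith

include hb hb' h0 h1 in
/-- The derivative of the orbit solves the linearized equation for `Λ = 0`. -/
theorem Departure.decaying_deriv (o : Departure b γ σ u p) :
    Decaying (fun x => stiff b 0 (u x)) (fun x => pot b γ 0 (u x) (p x)) (fun x => σ * p x)
      (fun x => σ * accel b γ (u x) (p x)) := by
  have hden : ∀ u, 1 + 2 * b * cos u ≠ 0 := fun u => by linarith [stiff_pos hb hb' u]
  have cu := o.cont_u
  have cp := o.cont_p
  have ca : Continuous fun x => accel b γ (u x) (p x) := by
    unfold accel
    exact Continuous.div (by fun_prop) (by fun_prop) fun x => hden _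
  have hlim : Tendsto (fun x => accel b γ (u x) (p x)) atBot (𝓝 0) := by
    have hc : ContinuousAt (fun z : ℝ × ℝ => accel b γ z.1 z.2) (arcsin γ, 0) := by
      unfold accel
      exact ContinuousAt.div (by fun_prop) (by fun_prop) (hden _)
    have := hc.tendsto.comp (o.lim_u.prodMk_nhds o.lim_p)
    simpa [accel, sin_arcsin (by linarith : -1 ≤ γ) h1.le, Function.comp_def] using this
  refine ⟨Continuous.continuousOn (by fun_prop), Continuous.continuousOn (by fun_prop),
    fun x hx => (o.deriv_p x hx).const_mul σ, fun x hx => ?_, by simpa using o.lim_p.const_mul σ,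
    by simpa using hlim.const_mul σ⟩
  have hu := o.deriv_u x hx
  have hp := o.deriv_p x hx
  -- At `Λ = 0` the stiffness is the denominator of `accel`, so the flux of `p` is the numerator,
  -- and differentiating it is differentiating the static equation.
  have e : (fun x => stiff b 0 (u x) * (σ * accel b γ (u x) (p x))) = fun x =>
      σ * (sin (u x) - γ + b * p x ^ 2 * sin (u x) + b * cos (u x) * (sin (u x) - γ)) := by
    funext y
    have := hden (u y)
    rw [stiff, accel]; field_simp; ring
  rw [e]
  have h2 := ((((hu.sin.sub_const γ).add (((hp.pow 2).const_mul b).mul hu.sin)).add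
    ((hu.cos.const_mul b).mul (hu.sin.sub_const γ))).const_mul σ)
  refine h2.congr_deriv ?_
  rw [pot_zero]
  simp only [Nat.cast_ofNat, Nat.add_one_sub_one, pow_one, Pi.pow_apply]
  ring

end Departure

section Kink

variable {d : ℝ} {φ : ℝ → ℝ} (hb : 0 < a ^ 2 / 12) (hb' : a ^ 2 / 12 ≤ 1 / 1000) (h0 : 0 ≤ γ)
    (h1 : γ < 1) (hφ : IsKinkThrough a γ d φ)

include hb hb' h0 h1 hφ in
/-- A positive eigenfunction belongs to the largest eigenvalue. -/
theorem isGreatest_of_pos {v w v' w' : ℝ → ℝ} (hΛ : Λ ∈ Icc (-1) 0)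
    (hv : Decaying (fun x => stiff (a ^ 2 / 12) Λ (φ x))
      (fun x => pot (a ^ 2 / 12) γ Λ (φ x) (deriv φ x)) v w)
    (hv' : Decaying (fun x => stiff (a ^ 2 / 12) Λ (φ (-x) - π))
      (fun x => pot (a ^ 2 / 12) γ Λ (φ (-x) - π) (-deriv φ (-x))) v' w')
    (hpos : ∀ x ≤ 0, 0 < v x) (hpos' : ∀ x ≤ 0, 0 < v' x)
    (hbound : ∃ C k : ℝ, 0 < k ∧ ∀ x ≤ 0, |v x| ≤ C * Real.exp (k * x) ∧
      |w x| ≤ C * Real.exp (k * x) ∧ |v' x| ≤ C * Real.exp (k * x) ∧ |w' x| ≤ C * Real.exp (k * x))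
    (he : v 0 = v' 0) (hw : w 0 + w' 0 = 0) : IsGreatest (eigenvalues a γ φ) Λ := by
  refine ⟨mem_eigenvalues hb hb' h0 h1 hφ hΛ hv hv' (hpos 0 le_rfl).ne' hbound he hw,
    fun Λ' hΛ' => ?_⟩
  by_contra hlt
  push Not at hlt
  have r := hφ.left.le_two_mul hb hb' h0 h1 hΛ hv fun x hx => (hpos x hx).le
  have r' := hφ.right.le_two_mul hb hb' h0 h1 hΛ hv' fun x hx => (hpos' x hx).le
  -- The upper bound on one side gives, through `w 0 + w' 0 = 0` and `v 0 = v' 0`, the lower bound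
  -- at the junction on the other side, from where it propagates.
  have l := hφ.left.neg_two_mul_le hb hb' h0 h1 hΛ hv (fun x hx => (hpos x hx).le)
    (by linarith [r' 0 le_rfl])
  have l' := hφ.right.neg_two_mul_le hb hb' h0 h1 hΛ hv' (fun x hx => (hpos' x hx).le)
    (by linarith [r 0 le_rfl])
  obtain ⟨e, m1, m2, m3, m4⟩ := hφ.left.log_deriv_super hb hb' h0 h1 hΛ hlt hv hpos l r
  obtain ⟨e', m1', m2', m3', m4'⟩ := hφ.right.log_deriv_super hb hb' h0 h1 hΛ hlt hv' hpos' l' r'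
  refine not_mem_eigenvalues hb hb' hφ.isPiKink (hΛ.1.trans hlt.le) m1 m1' m2 m2' m3 m3' m4 m4' ?_
    hΛ'
  rw [← he, ← add_div, hw, zero_div]

include hb hb' h0 h1 hφ in
/-- The jump of the second derivative at the junction. -/
theorem IsKinkThrough.accel_sub : ∃ c, 0 < c ∧
    accel (a ^ 2 / 12) γ d (deriv φ 0) - accel (a ^ 2 / 12) γ (d - π) (deriv φ 0) =
      c * junctionDeriv (a ^ 2 / 12) γ d := by
  set b := a ^ 2 / 12 with hbdef
  have eL := hφ.left.energy hb hb' (by linarith) h1.le 0 le_rfl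
  have eR := hφ.right.energy hb hb' (by linarith) h1.le 0 le_rfl
  simp only [neg_zero, hφ.zero, cos_sub_pi, neg_sq] at eL eR
  have hP : deriv φ 0 ^ 2 = psq b γ d := by
    rw [psq_eq]; linear_combination (eL + eR) / 2
  have hS := stiff_pos hb hb' d
  have hS' := stiff_pos hb hb' (d - π)
  rw [cos_sub_pi] at hS'
  refine ⟨2 / ((1 + 2 * b * cos d) * (1 + 2 * b * -cos d)), div_pos two_pos
    (mul_pos (by linarith) (by linarith)), ?_⟩
  have n1 : 1 + 2 * b * cos d ≠ 0 := by linarith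
  have n2 : 1 + 2 * b * -cos d ≠ 0 := by linarith
  rw [accel, accel, cos_sub_pi, sin_sub_pi, hP, junctionDeriv, div_sub_div _ _ n1 n2,
    div_mul_eq_mul_div]
  ring

include hb hb' h0 h1 hφ in
/-- For a tangential junction the largest eigenvalue vanishes. -/
theorem isGreatest_zero (hz : junctionDeriv (a ^ 2 / 12) γ d = 0) :
    IsGreatest (eigenvalues a γ φ) 0 := by
  have dL := hφ.left.decaying_deriv hb hb' h0 h1
  have dR := hφ.right.decaying_deriv hb hb' h0 h1
  refine isGreatest_of_pos hb hb' h0 h1 hφ ⟨by norm_num, le_rfl⟩ dL dR hφ.left.deriv_pos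
    hφ.right.deriv_pos ?_ (by simp) ?_
  · obtain ⟨C, k, hk, hdec⟩ := hφ.left.decay
    obtain ⟨C', k', hk', hdec'⟩ := hφ.right.decay
    have hC : 0 ≤ C := by simpa using (abs_nonneg _).trans (hdec 0 le_rfl).1
    have hC' : 0 ≤ C' := by simpa using (abs_nonneg _).trans (hdec' 0 le_rfl).1
    refine ⟨300 * (C + C'), min k k', lt_min hk hk', fun x hx => ?_⟩
    have k1 : C * Real.exp (k * x) ≤ (C + C') * Real.exp (min k k' * x) := by
      have : k * x ≤ min k k' * x := mul_le_mul_of_nonpos_right (min_le_left _ _) hx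
      have := Real.exp_le_exp.2 this
      have : C ≤ C + C' := by linarith
      gcongr
    have k2 : C' * Real.exp (k' * x) ≤ (C + C') * Real.exp (min k k' * x) := by
      have : k' * x ≤ min k k' * x := mul_le_mul_of_nonpos_right (min_le_right _ _) hx
      have := Real.exp_le_exp.2 this
      have : C' ≤ C + C' := by linarith
      gcongr
    have hCe : 0 ≤ (C + C') * Real.exp (min k k' * x) := by positivity
    obtain ⟨i1, i2⟩ := hdec x hx
    obtain ⟨i3, i4⟩ := hdec' x hx
    have i5 := abs_accel_le hb hb' h0 h1 (u := φ x) (hφ.left.abs_deriv_le x hx)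
    have i6 := abs_accel_le hb hb' h0 h1 (u := φ (-x) - π) (hφ.right.abs_deriv_le x hx)
    simp only [one_mul, neg_mul, abs_neg] at *
    refine ⟨?_, ?_, ?_, ?_⟩ <;> linarith
  · obtain ⟨c, -, hc⟩ := hφ.accel_sub hb hb' h0 h1
    rw [hz, mul_zero] at hc
    simp only [neg_zero, hφ.zero, accel_neg]
    linarith

/-- A positive solution of the linearized equation on both half lines, matched at the junction. -/
structure GroundState (a γ Λ : ℝ) (φ v w v' w' : ℝ → ℝ) : Prop where
  left : Decaying (fun x => stiff (a ^ 2 / 12) Λ (φ x))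
    (fun x => pot (a ^ 2 / 12) γ Λ (φ x) (deriv φ x)) v w
  right : Decaying (fun x => stiff (a ^ 2 / 12) Λ (φ (-x) - π))
    (fun x => pot (a ^ 2 / 12) γ Λ (φ (-x) - π) (-deriv φ (-x))) v' w'
  pos_left : ∀ x ≤ 0, 0 < v x
  pos_right : ∀ x ≤ 0, 0 < v' x
  eq : v 0 = v' 0
  sum : w 0 + w' 0 = 0

include hb hb' h0 h1 hφ in
/-- For a transversal junction, a barrier at a lower value produces a negative largest eigenvalue. -/
theorem exists_isGreatest_of_barrier (hz : 0 < junctionDeriv (a ^ 2 / 12) γ d) {Λ₁ : ℝ}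
    (hΛ₁ : -1 ≤ Λ₁) (hneg : Λ₁ < 0) (hlt : 0 < Λ₁ + cos (arcsin γ)) {m m' : ℝ} (hm : m + m' ≤ 0)
    (hl : ∀ v w, Decaying (fun x => stiff (a ^ 2 / 12) Λ₁ (φ x))
      (fun x => pot (a ^ 2 / 12) γ Λ₁ (φ x) (deriv φ x)) v w → (∀ x ≤ 0, 0 ≤ v x) → w 0 ≤ m * v 0)
    (hr : ∀ v w, Decaying (fun x => stiff (a ^ 2 / 12) Λ₁ (φ (-x) - π))
      (fun x => pot (a ^ 2 / 12) γ Λ₁ (φ (-x) - π) (-deriv φ (-x))) v w → (∀ x ≤ 0, 0 ≤ v x) →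
      w 0 ≤ m' * v 0) :
    ∃ Λ ∈ Ico Λ₁ 0, IsGreatest (eigenvalues a γ φ) Λ ∧
      ∃ v w v' w' : ℝ → ℝ, GroundState a γ Λ φ v w v' w' := by
  have fL := hφ.left.halfFamily hb hb' h0 h1 hΛ₁ hlt
  have fR := hφ.right.halfFamily hb hb' h0 h1 hΛ₁ hlt
  have dL := hφ.left.decaying_deriv hb hb' h0 h1
  have dR := hφ.right.decaying_deriv hb hb' h0 h1
  obtain ⟨c, hc, hcj⟩ := hφ.accel_sub hb hb' h0 h1
  -- At `Λ = 0` the solutions are the slopes of the two half orbits. Their Wronskian is `φ'(0)`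
  -- times the jump of `φ''`, hence a positive multiple of `junctionDeriv`.
  obtain ⟨Λ, hΛ, v, w, v', w', hv, hv', pv, pv', hbd, he, hw⟩ := exists_ground_state hneg fL fR dL dR
    hφ.left.deriv_pos hφ.right.deriv_pos (by
      have hp := hφ.left.deriv_pos 0 le_rfl
      simp only [neg_zero, hφ.zero, accel_neg]
      have : 0 < c * junctionDeriv (a ^ 2 / 12) γ d := by positivity
      rw [← hcj] at this
      nlinarith) hm hl hr
  exact ⟨Λ, hΛ, isGreatest_of_pos hb hb' h0 h1 hφ ⟨hΛ₁.trans hΛ.1, hΛ.2.le⟩ hv hv' pv pv' hbd he hw,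
    v, w, v', w', hv, hv', pv, pv', he, hw⟩

end Kink

end PiKink
end

/-! ### Explicit barriers that give a negative largest eigenvalue below the critical forcing. -/

noncomputable section
namespace PiKink

variable {a b γ : ℝ} {u p v w : ℝ → ℝ}

section Barrier

variable (hb : 0 < b) (hb' : b ≤ 1 / 1000) (h0 : 0 ≤ γ)

theorem le_cos_arcsin (h0 : 0 ≤ γ) (h1 : γ ≤ 643 / 1000) : 7658 / 10000 ≤ cos (arcsin γ) := by
  rw [cos_arcsin]
  refine Real.le_sqrt_of_sq_le ?_
  nlinarith

include hb hb' h0 in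
/-- A constant barrier on the right half line. -/
theorem Departure.right_barrier (h1 : γ ≤ 643 / 1000) {σ : ℝ} (o : Departure b γ σ u p)
    (hv : Decaying (fun x => stiff b (1 / 10000 - cos (arcsin γ)) (u x))
      (fun x => pot b γ (1 / 10000 - cos (arcsin γ)) (u x) (p x)) v w)
    (hpos : ∀ x ≤ 0, 0 ≤ v x) : w 0 ≤ 517 / 1000 * v 0 := by
  have hc := le_cos_arcsin h0 h1
  have hc1 := cos_le_one (arcsin γ)
  have hΛ : 1 / 10000 - cos (arcsin γ) ∈ Icc (-1 : ℝ) 0 := ⟨by linarith, by linarith⟩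
  -- The potential is at most `1 + 0.0001 - 0.7658 + 0.025 < 0.26`, while `0.517² > 0.267` leaves
  -- room for the corrections of order `b`.
  refine hv.le_of_riccati (stiffness_stiff hb hb' o.cont_u hΛ.1) hpos (M := fun _ => 517 / 1000)
    (K := 1) (d := fun x => -(2 * b * sin (u x) * p x) * (517 / 1000)) (a := 0) continuous_const
    le_rfl (by norm_num [abs_of_pos]) (by norm_num)
    (fun x hx => (hasDerivAt_stiff (o.deriv_u x hx)).mul_const _) (fun x hx => ?_) 0 le_rfl
  have h2 := (abs_le.1 (abs_pot_sub_le hb hb' h0 (by linarith) (u := u x)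
    (o.abs_deriv_le x hx.le) hΛ)).2
  have h3 := (abs_le.1 (abs_stiff_sub_one_le hb hΛ (u x))).1
  have h4 := (abs_le.1 (abs_stiff_deriv_le hb hb' (u := u x) (o.abs_deriv_le x hx.le))).1
  have := cos_le_one (u x)
  linarith

/-- Estimates along the left half orbit in terms of the half angle `τ`. -/
theorem half_angle_estimates {s₀ τ : ℝ} (hs₀ : 0 ≤ s₀) (hτ : 0 ≤ τ) (h : s₀ + 2 * τ ≤ π) :
    0 ≤ sin τ ∧ sin τ ≤ sin (s₀ + τ) ∧ 0 ≤ cos τ ∧ 1 - cos τ ≤ sin τ ^ 2 ∧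
    cos (s₀ + 2 * τ) = cos s₀ - 2 * sin (s₀ + τ) * sin τ ∧
    sin (s₀ + 2 * τ) - sin s₀ = 2 * cos (s₀ + τ) * sin τ ∧
    0 ≤ sin (s₀ + 2 * τ) ∧ sin (s₀ + 2 * τ) ≤ 2 * sin (s₀ + τ) := by
  have hp := pi_pos
  have e1 : s₀ + 2 * τ = (s₀ + τ) + τ := by ring
  have e2 : s₀ = (s₀ + τ) - τ := by ring
  have k0 : 0 ≤ cos τ := cos_nonneg_of_mem_Icc ⟨by linarith, by linarith⟩
  have s0 : 0 ≤ sin τ := sin_nonneg_of_nonneg_of_le_pi hτ (by linarith)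
  have k1 := cos_le_one τ
  have sr : sin τ ≤ sin (s₀ + τ) := by
    rcases le_total (s₀ + τ) (π / 2) with h2 | h2
    · exact sin_le_sin_of_le_of_le_pi_div_two (by linarith) h2 (by linarith)
    · rw [← sin_pi_sub (s₀ + τ)]
      exact sin_le_sin_of_le_of_le_pi_div_two (by linarith) (by linarith) (by linarith)
  refine ⟨s0, sr, k0, ?_, ?_, ?_, sin_nonneg_of_nonneg_of_le_pi (by linarith) h, ?_⟩
  · nlinarith [sin_sq_add_cos_sq τ]
  · conv_rhs => rw [e2]
    rw [e1, cos_add, show s₀ + τ - τ + τ = s₀ + τ by ring, cos_sub]; ring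
  · conv_lhs => rw [e1]
    rw [sin_add]
    have : sin s₀ = sin (s₀ + τ) * cos τ - cos (s₀ + τ) * sin τ := by
      rw [← sin_sub, ← e2]
    rw [this]; ring
  · rw [e1, sin_add]
    have h1 := cos_le_one (s₀ + τ)
    have : sin (s₀ + τ) * cos τ ≤ sin (s₀ + τ) * 1 :=
      mul_le_mul_of_nonneg_left k1 (s0.trans sr)
    have : cos (s₀ + τ) * sin τ ≤ 1 * sin τ := mul_le_mul_of_nonneg_right h1 s0
    linarith

include hb hb' h0 in
/-- Estimates for the slope along the left half orbit in terms of the half angle `τ`. -/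
theorem half_angle_slope {τ p : ℝ} (h1 : γ ≤ 643 / 1000) (τ0 : 0 ≤ τ) (h : arcsin γ + 2 * τ ≤ π)
    (hp0 : 0 < p) (hen : (1 + 2 * b * cos (arcsin γ + 2 * τ)) * p ^ 2 =
      2 * excess b γ (arcsin γ + 2 * τ)) :
    p ^ 2 ≤ 21 / 10 * (2 * sin (arcsin γ + τ) * sin τ) ∧ p ≤ 3 * sin τ ∧
      sin τ * p ≤ 2 * sin (arcsin γ + τ) * sin τ * (1 + 2 * b) := by
  set s₀ := arcsin γ with hs₀
  set c₀ := cos s₀ with hc₀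
  have hc1 := cos_le_one s₀
  have hs0 : 0 ≤ s₀ := arcsin_nonneg.2 h0
  have hsin : sin s₀ = γ := sin_arcsin (by linarith) (by linarith)
  obtain ⟨S0, SR, K0, K1, ec, es, U0, U1⟩ := half_angle_estimates hs0 τ0 h
  rw [hsin] at es
  set u := s₀ + 2 * τ with eu
  set s := sin τ
  set r := sin (s₀ + τ)
  set κ := cos (s₀ + τ)
  have κ2 : κ ^ 2 ≤ 1 := cos_sq_le_one _
  set δ := 2 * r * s with hδ
  have δ0 : 0 ≤ δ := by have := S0.trans SR; positivity
  have ss : s ^ 2 ≤ δ / 2 := by rw [hδ]; nlinarith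
  have hT := stiff_pos hb hb' u
  have hT2 : 1 - 2 * b ≤ 1 + 2 * b * cos u := by nlinarith [neg_one_le_cos u]
  have ee : excess b γ u = δ - 2 * γ * τ + 2 * b * (κ * s) ^ 2 := by
    rw [excess, ec, es, hδ, eu]; ring
  have kss : (κ * s) ^ 2 ≤ s ^ 2 := by
    rw [mul_pow]; nlinarith [sq_nonneg s]
  have gτ : 0 ≤ γ * τ := mul_nonneg h0 τ0
  have bks : b * (κ * s) ^ 2 ≤ b * (δ / 2) := by gcongr; linarith
  have hp2 : (1 - 2 * b) * p ^ 2 ≤ 2 * δ * (1 + b) := by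
    have : (1 - 2 * b) * p ^ 2 ≤ (1 + 2 * b * cos u) * p ^ 2 := by gcongr
    rw [hen, ee] at this
    linarith
  have hp2' : p ^ 2 ≤ 2 * δ * (1 + 4 * b) := by
    have h5 : 2 * δ * (1 + b) ≤ (1 - 2 * b) * (2 * δ * (1 + 4 * b)) := by
      have : 0 ≤ δ * b * (1 - 8 * b) := mul_nonneg (mul_nonneg δ0 hb.le) (by linarith)
      linarith
    exact le_of_mul_le_mul_left (hp2.trans h5) (by linarith)
  refine ⟨?_, ?_, ?_⟩
  · have : δ * b ≤ δ * (1 / 1000) := by gcongr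
    linarith
  · have e2 : excess b γ u ≤ 2 * s ^ 2 + 2 * b * s ^ 2 := by
      have h3 := excess_add b (by linarith) (by linarith) (2 * τ) (γ := γ)
      rw [← hs₀, ← eu, ← hc₀, es] at h3
      rw [h3]
      have i1 : 1 - cos (2 * τ) = 2 * s ^ 2 := by
        rw [cos_two_mul, cos_sq']; ring
      have i2 : c₀ * (1 - cos (2 * τ)) ≤ 1 * (2 * s ^ 2) := by
        rw [i1]; gcongr
      have i3 : 0 ≤ γ * (2 * τ - sin (2 * τ)) :=
        mul_nonneg h0 (by linarith [sin_le (by linarith : 0 ≤ 2 * τ)])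
      have i4 : b * (κ * s) ^ 2 ≤ b * s ^ 2 := by gcongr
      have i5 : b / 2 * (2 * κ * s) ^ 2 = 2 * (b * (κ * s) ^ 2) := by ring
      linarith
    have h6 : (9 / 10) * p ^ 2 ≤ (1 + 2 * b * cos u) * p ^ 2 := by gcongr
    rw [hen] at h6
    have h7 : b * s ^ 2 ≤ 1 / 1000 * s ^ 2 := by gcongr
    refine abs_le_of_sq_le_sq' ?_ (by linarith) |>.2
    linarith [sq_nonneg s]
  · refine abs_le_of_sq_le_sq' ?_ (by positivity) |>.2
    calc (s * p) ^ 2 = s ^ 2 * p ^ 2 := by ring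
      _ ≤ δ / 2 * (2 * δ * (1 + 4 * b)) := by gcongr
      _ ≤ (δ * (1 + 2 * b)) ^ 2 := by
        have := sq_nonneg (δ * b)
        linarith

-- Put `δ = cos (arcsin γ) - cos u`. Up to terms of order `b δ`, the potential is `1/10000 - δ`, the
-- derivative of the barrier is at least `-(9/10) δ`, and `M² ≥ 1/10000 - (18/1000) δ`. So a margin
-- proportional to `δ` remains and absorbs the lattice corrections. The value `1/100` of `M` at the
-- saddle point is chosen as the square root of `1/10000`.
set_option maxHeartbeats 800000 in
include hb hb' h0 in
theorem left_barrier_residual {τ p M : ℝ} (h1 : γ ≤ 643 / 1000) (τ0 : 0 ≤ τ)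
    (h : arcsin γ + 2 * τ ≤ π) (hp0 : 0 < p)
    (hen : (1 + 2 * b * cos (arcsin γ + 2 * τ)) * p ^ 2 = 2 * excess b γ (arcsin γ + 2 * τ))
    (hM : M = 1 / 100 - 9 / 5 * (1 - cos τ)) :
    pot b γ (1 / 10000 - cos (arcsin γ)) (arcsin γ + 2 * τ) p ≤
      -(2 * b * sin (arcsin γ + 2 * τ) * p) * M +
      stiff b (1 / 10000 - cos (arcsin γ)) (arcsin γ + 2 * τ) * (-(9 / 10) * sin τ * p) +
      stiff b (1 / 10000 - cos (arcsin γ)) (arcsin γ + 2 * τ) * M ^ 2 := by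
  obtain ⟨hp4, hp3, hsp⟩ := half_angle_slope hb hb' h0 h1 τ0 h hp0 hen
  set s₀ := arcsin γ with hs₀
  set c₀ := cos s₀ with hc₀
  have hc1 := cos_le_one s₀
  have hs0 : 0 ≤ s₀ := arcsin_nonneg.2 h0
  have hsin : sin s₀ = γ := sin_arcsin (by linarith) (by linarith)
  obtain ⟨S0, SR, K0, K1, ec, es, U0, U1⟩ := half_angle_estimates hs0 τ0 h
  rw [hsin] at es
  set u := s₀ + 2 * τ with eu
  set s := sin τ
  set r := sin (s₀ + τ)
  set k := cos τ
  set κ := cos (s₀ + τ)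
  have s1 : s ≤ 1 := sin_le_one _
  have r1 : r ≤ 1 := sin_le_one _
  have k1 : k ≤ 1 := cos_le_one _
  set δ := 2 * r * s with hδ
  have δ0 : 0 ≤ δ := by have := S0.trans SR; positivity
  have δ2 : δ ≤ 2 := by
    have : r * s ≤ 1 * 1 := mul_le_mul r1 s1 S0 zero_le_one
    rw [hδ]; linarith
  have ss : s ^ 2 ≤ δ / 2 := by rw [hδ]; nlinarith
  have hT := stiff_pos hb hb' u
  have hsu : |sin u * (sin u - γ)| ≤ 2 * δ := by
    rw [es, abs_mul, abs_of_nonneg U0, abs_mul, abs_mul, abs_two, abs_of_nonneg S0]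
    have : |κ| ≤ 1 := abs_cos_le_one _
    have r0 : 0 ≤ r := S0.trans SR
    calc sin u * (2 * |κ| * s) ≤ 2 * r * (2 * 1 * s) := by gcongr
      _ = 2 * δ := by rw [hδ]; ring
  have hsu1 := sin_le_one u
  have hcu1 := cos_le_one u
  have hacc : accel b γ u p * sin u ≤ 23 / 10 * δ := by
    rw [accel, div_mul_eq_mul_div, div_le_iff₀ (by linarith)]
    have i1 : (sin u * (sin u - γ)) * (1 + b * cos u) ≤ 2 * δ * (1001 / 1000) := by
      have h2 : 0 ≤ 1 + b * cos u := by nlinarith [neg_one_le_cos u]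
      have h3 : 1 + b * cos u ≤ 1001 / 1000 := by nlinarith
      exact (mul_le_mul_of_nonneg_right (abs_le.1 hsu).2 h2).trans (by gcongr)
    have i2 : b * p ^ 2 * sin u * sin u ≤ 1 / 1000 * (21 / 10 * δ) * 1 * 1 := by
      gcongr
    have i3 : 23 / 10 * δ * (9 / 10) ≤ 23 / 10 * δ * (1 + 2 * b * cos u) := by gcongr
    linarith
  have hpc : p ^ 2 * cos u ≤ 21 / 10 * δ * 1 :=
    mul_le_mul_of_nonneg_left hcu1 (sq_nonneg _) |>.trans
      (mul_le_mul_of_nonneg_right hp4 zero_le_one)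
  have hq : pot b γ (1 / 10000 - c₀) u p ≤
      1 / 10000 - δ + b * (1 / 10000) ^ 2 + 11 * (b * δ) := by
    have e3 : 1 / 10000 - c₀ + cos u = 1 / 10000 - δ := by rw [ec]; ring
    have e4 : pot b γ (1 / 10000 - c₀) u p = (1 / 10000 - δ) +
        b * (2 * (accel b γ u p * sin u) + p ^ 2 * cos u +
          (1 / 10000 - δ) ^ 2 - sin u * (sin u - γ)) := by
      rw [pot, e3, ← e3]; ring
    have e5 : 2 * (accel b γ u p * sin u) + p ^ 2 * cos u +
          (1 / 10000 - δ) ^ 2 - sin u * (sin u - γ) ≤ (1 / 10000) ^ 2 + 11 * δ := by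
      have h3 : δ ^ 2 ≤ 2 * δ := by rw [sq]; gcongr
      linarith [(abs_le.1 hsu).1]
    have := mul_le_mul_of_nonneg_left e5 hb.le
    rw [e4]
    linarith
  have M1 : |M| ≤ 2 := by rw [hM, abs_le]; constructor <;> linarith
  have M2 : 1 / 10000 - 18 / 1000 * δ ≤ M ^ 2 := by
    rw [hM]
    have : 1 - k ≤ δ / 2 := K1.trans ss
    nlinarith [sq_nonneg (1 - k)]
  have M3 : M ^ 2 ≤ 4 := by
    have := abs_le.1 M1
    nlinarith
  have eS : stiff b (1 / 10000 - c₀) u = 1 + 2 * b * (1 / 10000 - δ) := by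
    rw [stiff, ec]; ring
  have hSM' : -(12 * (b * δ)) ≤ -(2 * b * sin u * p) * M := by
    have : |-(2 * b * sin u * p) * M| ≤ 2 * b * (2 * r) * (3 * s) * 2 := by
      rw [abs_mul, abs_neg, abs_mul, abs_mul, abs_mul, abs_two, abs_of_pos hb,
        abs_of_nonneg U0, abs_of_pos hp0]
      have := S0.trans SR
      gcongr
    have h3 := (abs_le.1 this).1
    rw [hδ]; linarith
  have hSM : -(9 / 10 * δ * (1 + 3 * b)) ≤
      (1 + 2 * b * (1 / 10000 - δ)) * (-(9 / 10) * s * p) := by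
    have i1 : (1 + 2 * b * (1 / 10000 - δ)) * (s * p) ≤
        (1 + 2 * b * (1 / 10000)) * (δ * (1 + 2 * b)) := by
      have : 0 ≤ s * p := by positivity
      have : 1 + 2 * b * (1 / 10000 - δ) ≤ 1 + 2 * b * (1 / 10000) := by
        have := mul_nonneg hb.le δ0; linarith
      gcongr
    have i2 : (1 + 2 * b * (1 / 10000)) * (1 + 2 * b) ≤ 1 + 3 * b := by nlinarith
    have i3 := mul_le_mul_of_nonneg_left i2 δ0
    linarith
  have hSM2 : 1 / 10000 - 18 / 1000 * δ + 2 * b * (1 / 10000) ^ 2 - 9 * (b * δ) ≤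
      (1 + 2 * b * (1 / 10000 - δ)) * M ^ 2 := by
    have i1 : b * (1 / 10000 - 18 / 1000 * δ) ≤ b * M ^ 2 := by gcongr
    have i2 : b * δ * M ^ 2 ≤ b * δ * 4 := by gcongr
    have i3 : 0 ≤ b * δ := mul_nonneg hb.le δ0
    linarith
  have bδ : b * δ ≤ 1 / 1000 * δ := by gcongr
  rw [eS]
  linarith [mul_pos hb (by norm_num : (0 : ℝ) < (1 / 10000) ^ 2)]

include hb hb' h0 in
/-- A barrier on the left half line. -/
theorem Departure.left_barrier (h1 : γ ≤ 643 / 1000) (o : Departure b γ 1 u p)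
    (hu : ∀ x ≤ 0, u x ≤ π) (hu0 : arcsin γ + π / 2 ≤ u 0)
    (hv : Decaying (fun x => stiff b (1 / 10000 - cos (arcsin γ)) (u x))
      (fun x => pot b γ (1 / 10000 - cos (arcsin γ)) (u x) (p x)) v w)
    (hpos : ∀ x ≤ 0, 0 ≤ v x) : w 0 ≤ -(517 / 1000) * v 0 := by
  set s₀ := arcsin γ with hs₀
  set c₀ := cos s₀ with hc₀
  have hc := le_cos_arcsin h0 h1
  have hc1 := cos_le_one s₀
  have hs0 : 0 ≤ s₀ := arcsin_nonneg.2 h0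
  have hsin : sin s₀ = γ := sin_arcsin (by linarith) (by linarith)
  have hΛ : 1 / 10000 - c₀ ∈ Icc (-1 : ℝ) 0 := ⟨by linarith, by linarith⟩
  -- `M` is positive near `-∞`, as the comparison requires. At the junction the half angle is at
  -- least `π/4`, so `M 0 ≤ 1/100 - (9/5)(1 - √2/2) < -0.517`, which offsets the right barrier.
  set M : ℝ → ℝ := fun x => 1 / 100 - 9 / 5 * (1 - cos ((u x - s₀) / 2)) with hM
  have cM : Continuous M := by have := o.cont_u; fun_prop
  have hlim : Tendsto M atBot (𝓝 (1 / 100)) := by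
    have h2 : ContinuousAt (fun y : ℝ => 1 / 100 - 9 / 5 * (1 - cos ((y - s₀) / 2))) s₀ := by
      fun_prop
    have := h2.tendsto.comp o.lim_u
    simpa [Function.comp_def, hM] using this
  obtain ⟨X, hX⟩ := eventually_atBot.1 (hlim.eventually (lt_mem_nhds (by norm_num : (0 : ℝ) < 1 / 100)))
  have hle := hv.le_of_riccati (stiffness_stiff hb hb' o.cont_u hΛ.1) hpos (M := M) (K := 4)
    (d := fun x => -(2 * b * sin (u x) * p x) * M x + stiff b (1 / 10000 - c₀) (u x) *
      (-(9 / 10) * sin ((u x - s₀) / 2) * p x)) (a := min X 0) cM (min_le_right _ _)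
    (fun x _ => by
      have := neg_one_le_cos ((u x - s₀) / 2)
      have := cos_le_one ((u x - s₀) / 2)
      rw [abs_le]; constructor <;> simp only [hM] <;> linarith)
    (fun x hx => (hX x (hx.trans (min_le_left _ _))).le)
    (fun x hx => by
      refine (hasDerivAt_stiff (o.deriv_u x hx)).mul ?_
      have := ((((((o.deriv_u x hx).sub_const s₀).div_const 2).cos).const_sub 1).const_mul
        (9 / 5)).const_sub (1 / 100)
      exact this.congr_deriv (by ring))
    (fun x hx => ?_) 0 le_rfl
  · refine hle.trans (mul_le_mul_of_nonneg_right ?_ (hpos 0 le_rfl))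
    have h2 : cos ((u 0 - s₀) / 2) ≤ cos (π / 4) :=
      cos_le_cos_of_nonneg_of_le_pi (by linarith [pi_pos]) (by linarith [hu 0 le_rfl, pi_pos])
        (by linarith)
    rw [cos_pi_div_four] at h2
    have h3 : √2 ≤ 14143 / 10000 := Real.sqrt_le_iff.2 ⟨by norm_num, by norm_num⟩
    simp only [hM]
    linarith
  · have hx0 := hx.le
    have eu : s₀ + 2 * ((u x - s₀) / 2) = u x := by ring
    have hres := left_barrier_residual hb hb' h0 h1 (τ := (u x - s₀) / 2) (p := p x)
      (by have := o.pos x hx0; linarith) (by rw [← hs₀, eu]; exact hu x hx0)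
      (by have := o.deriv_pos x hx0; linarith)
      (by rw [← hs₀, eu]; exact o.energy hb hb' (by linarith) (by linarith) x hx0) rfl
    rwa [← hs₀, eu] at hres

end Barrier

/-- Below the critical forcing the largest eigenvalue exists and is negative. -/
theorem exists_isGreatest_neg (hb : 0 < a ^ 2 / 12) (hb' : a ^ 2 / 12 ≤ 1 / 1000) {φ : ℝ → ℝ}
    (hγ : γ ∈ Ico 0 (gammaCr a)) (hφ : IsType1Kink a γ φ) :
    ∃ Λ : ℝ, IsGreatest (eigenvalues a γ φ) Λ ∧ Λ < 0 := by
  obtain ⟨d, hd, hk⟩ := hφ.exists_isKinkThrough hb hb' ⟨hγ.1, hγ.2.le⟩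
  have h1 := hφ.isPiKink.lt_one
  have h2 := gamma_le_of_zero' hb hb' hγ.1 h1 hd.mem hd.zero
  have hc := le_cos_arcsin hγ.1 h2
  have hj := hd.deriv_pos hb hb' hγ.1 hγ.2 (isGreatest_gammaCr hb hb').1
  -- The barrier parameter lies just above `-cos (arcsin γ)`, the value below which the limit of the
  -- potential stops being positive.
  obtain ⟨Λ, hΛ, hg, -⟩ := exists_isGreatest_of_barrier hb hb' hγ.1 h1 hk hj
    (Λ₁ := 1 / 10000 - cos (arcsin γ)) (by linarith [cos_le_one (arcsin γ)]) (by linarith)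
    (by linarith) (m := -(517 / 1000)) (m' := 517 / 1000) (by norm_num)
    (fun v w hv hpos => hk.left.left_barrier hb hb' hγ.1 h2
      (fun x hx => (hk.strictMono.monotone hx).trans (by rw [hk.zero]; exact hd.mem.2))
      (by rw [hk.zero]; exact arcsin_add_pi_div_two_le hb hb' hγ.1 h1 hd) hv hpos)
    (fun v w hv hpos => hk.right.right_barrier hb hb' hγ.1 h2 hv hpos)
  exact ⟨Λ, hg, hΛ.2⟩

/-- At the critical forcing the largest eigenvalue vanishes. -/
theorem isGreatest_zero_of_critical (hb : 0 < a ^ 2 / 12) (hb' : a ^ 2 / 12 ≤ 1 / 1000) {φ : ℝ → ℝ}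
    (hφ : IsType1Kink a (gammaCr a) φ) : IsGreatest (eigenvalues a (gammaCr a) φ) 0 := by
  have h0 := (gammaCr_pos hb hb').le
  obtain ⟨d, hd, hk⟩ := hφ.exists_isKinkThrough hb hb' ⟨h0, le_rfl⟩
  exact isGreatest_zero hb hb' h0 hφ.isPiKink.lt_one hk
    (hd.deriv_eq_zero hb hb' (isGreatest_gammaCr hb hb'))

end PiKink
end

/-! ### The unforced kink in the coordinate `z = cos (u / 2)`. -/

noncomputable section
namespace PiKink

/-! The unforced case in the coordinate `z = cos (u / 2)`. -/

/-- The leading coefficient of the static equation. -/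
def baseStiff (b z : ℝ) : ℝ := 1 + 2 * b * (2 * z ^ 2 - 1)

/-- The squared speed in the coordinate `z = tanh ξ`. -/
def speedSq (b z : ℝ) : ℝ := (1 + b * z ^ 2) * (baseStiff b z)⁻¹

/-- The derivative of `speedSq` along the flow `dz/dξ = -(1 - z²)`. -/
def speedSqFlow (b z : ℝ) : ℝ := (1 - z ^ 2) * (b * (z * (6 + 4 * b))) * (baseStiff b z)⁻¹ ^ 2

/-- The potential of the linearization in the coordinate `z`. -/
def zPot (b Λ z : ℝ) : ℝ :=
  (2 * z ^ 2 - 1) + Λ + b * (2 * (1 - (2 * z ^ 2 - 1) ^ 2) * (1 + b * (4 * (1 - z ^ 2)) * speedSq b z +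
    b * (2 * z ^ 2 - 1)) * (baseStiff b z)⁻¹ + 4 * (1 - z ^ 2) * speedSq b z * (2 * z ^ 2 - 1) +
    (Λ + (2 * z ^ 2 - 1)) ^ 2 - (1 - (2 * z ^ 2 - 1) ^ 2))

/-- The defect in the Riccati equation of the linearization, for the value `n` of the logarithmic
derivative and its derivative `η` along the flow. -/
def defect (b Λ z n η : ℝ) : ℝ :=
  (baseStiff b z + 2 * b * Λ) * speedSq b z * (η + n ^ 2) +
    (-(8 * (b * (z * (1 - z ^ 2)))) * speedSq b z +
      1 / 2 * (baseStiff b z + 2 * b * Λ) * speedSqFlow b z) * n - zPot b Λ z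

section Coeff

variable {b : ℝ} (hb : 0 ≤ b) (hb' : b ≤ 1 / 1000) {z : ℝ}

include hb hb' in
theorem baseStiff_bounds (hz : z ^ 2 ≤ 1) :
    99 / 100 ≤ baseStiff b z ∧ baseStiff b z ≤ 101 / 100 := by
  have := sq_nonneg z
  unfold baseStiff
  constructor <;> nlinarith

include hb hb' in
theorem speedSq_bounds (hz : z ^ 2 ≤ 1) : 9 / 10 ≤ speedSq b z ∧ speedSq b z ≤ 11 / 10 := by
  obtain ⟨l, r⟩ := baseStiff_bounds hb hb' hz
  have h0 : 0 ≤ b * z ^ 2 := by positivity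
  have h1 : b * z ^ 2 ≤ 1 / 1000 * 1 := by gcongr
  rw [speedSq, ← div_eq_mul_inv, le_div_iff₀ (by linarith), div_le_iff₀ (by linarith)]
  constructor <;> linarith

include hb hb' in
theorem hasDerivAt_speedSq (hz : z ^ 2 ≤ 1) :
    HasDerivAt (speedSq b) (-(b * (z * (6 + 4 * b))) * (baseStiff b z)⁻¹ ^ 2) z := by
  have hT : baseStiff b z ≠ 0 := by linarith [(baseStiff_bounds hb hb' hz).1]
  have h1 : HasDerivAt (baseStiff b) (2 * b * (2 * (2 * z))) z := by
    refine (((((hasDerivAt_id z).pow 2).const_mul 2).sub_const 1).const_mul (2 * b)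
      |>.const_add 1).congr_deriv ?_
    simp
  have h2 : HasDerivAt (fun z : ℝ => 1 + b * z ^ 2) (b * (2 * z)) z := by
    refine ((((hasDerivAt_id z).pow 2).const_mul b).const_add 1).congr_deriv ?_
    simp
  refine (h2.mul (h1.inv hT)).congr_deriv ?_
  simp only [Pi.inv_apply]
  field_simp
  unfold baseStiff
  ring

theorem continuousOn_baseStiff_inv (hb : 0 ≤ b) (hb' : b ≤ 1 / 1000) :
    ContinuousOn (fun z => (baseStiff b z)⁻¹) (Icc (-1) 1) := by
  have hc : Continuous (baseStiff b) := by unfold baseStiff; fun_prop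
  refine hc.continuousOn.inv₀ fun z hz => ?_
  have := (baseStiff_bounds hb hb' (z := z) (by nlinarith [hz.1, hz.2])).1
  linarith

theorem continuousOn_sqrt_speedSq (hb : 0 ≤ b) (hb' : b ≤ 1 / 1000) :
    ContinuousOn (fun z => √(speedSq b z)) (Icc (-1) 1) := by
  refine Real.continuous_sqrt.comp_continuousOn ?_
  exact ContinuousOn.mul (by fun_prop) (continuousOn_baseStiff_inv hb hb')

include hb hb' in
theorem sqrt_speedSq_bounds (hz : z ^ 2 ≤ 1) : 9 / 10 ≤ √(speedSq b z) ∧ √(speedSq b z) ≤ 11 / 10 := by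
  obtain ⟨l, r⟩ := speedSq_bounds hb hb' hz
  exact ⟨Real.le_sqrt_of_sq_le (by linarith), Real.sqrt_le_iff.2 ⟨by norm_num, by linarith⟩⟩

end Coeff

/-- One half of the unforced kink. -/
structure QuarterTurn (b σ : ℝ) (u p : ℝ → ℝ) : Prop extends Departure b 0 σ u p where
  sign : σ = 1 ∨ σ = -1
  zero : u 0 = σ * (π / 2)
  lt : ∀ x < 0, σ * u x < π / 2

section QuarterTurn

variable {b σ : ℝ} {u p : ℝ → ℝ} (hb : 0 < b) (hb' : b ≤ 1 / 1000) (o : QuarterTurn b σ u p)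

include o in
theorem QuarterTurn.half_angle {x : ℝ} (hx : x ≤ 0) : 0 < σ * u x / 2 ∧ σ * u x / 2 ≤ π / 4 ∧
    cos (u x / 2) = cos (σ * u x / 2) ∧ (x < 0 → σ * u x / 2 < π / 4) := by
  have h1 := o.pos x hx
  rw [arcsin_zero, sub_zero] at h1
  refine ⟨by linarith, ?_, ?_, fun h => by linarith [o.lt x h]⟩
  · rcases hx.lt_or_eq with h | rfl
    · linarith [o.lt x h]
    · rw [o.zero]
      rcases o.sign with rfl | rfl <;> linarith
  · rcases o.sign with rfl | rfl
    · simp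
    · rw [← cos_neg]; congr 1; ring

include o in
theorem QuarterTurn.mem_Ico {x : ℝ} (hx : x ≤ 0) : cos (u x / 2) ∈ Ico (√2 / 2) 1 := by
  obtain ⟨h1, h2, h3, -⟩ := o.half_angle hx
  rw [h3]
  constructor
  · rw [← cos_pi_div_four]
    exact cos_le_cos_of_nonneg_of_le_pi h1.le (by linarith [pi_pos]) h2
  · have := cos_lt_cos_of_nonneg_of_le_pi le_rfl (by linarith [pi_pos]) h1
    rwa [cos_zero] at this

include o in
theorem QuarterTurn.mem_Ioo {x : ℝ} (hx : x < 0) : cos (u x / 2) ∈ Ioo (√2 / 2) 1 := by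
  obtain ⟨h1, h2, h3, h4⟩ := o.half_angle hx.le
  refine ⟨?_, (o.mem_Ico hx.le).2⟩
  rw [h3, ← cos_pi_div_four]
  exact cos_lt_cos_of_nonneg_of_le_pi h1.le (by linarith [pi_pos]) (h4 hx)

include o in
theorem QuarterTurn.cos_zero : cos (u 0 / 2) = √2 / 2 := by
  rw [o.zero, ← cos_pi_div_four]
  rcases o.sign with rfl | rfl
  · congr 1; ring
  · rw [← cos_neg]; congr 1; ring

theorem half_sqrt_two : (√2 / 2) ^ 2 = 1 / 2 := by
  rw [div_pow, Real.sq_sqrt (by norm_num)]; norm_num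

theorem sq_le_one_of_mem {z : ℝ} (hz : z ∈ Ico (√2 / 2) 1) : z ^ 2 ≤ 1 := by
  have : 0 ≤ √2 / 2 := by positivity
  nlinarith [hz.1, hz.2]

include o in
theorem QuarterTurn.sq_le_one {x : ℝ} (hx : x ≤ 0) : cos (u x / 2) ^ 2 ≤ 1 :=
  sq_le_one_of_mem (o.mem_Ico hx)

theorem cos_eq_half (u : ℝ) : cos u = 2 * cos (u / 2) ^ 2 - 1 := by
  rw [← cos_two_mul]; congr 1; ring

theorem stiff_eq (b Λ u : ℝ) : stiff b Λ u = baseStiff b (cos (u / 2)) + 2 * b * Λ := by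
  rw [stiff, baseStiff, cos_eq_half]

-- For `γ = 0` the excess factors as `2 (1 - z²) (1 + b z²)`, so the energy identity gives the
-- squared slope as a function of `z` alone.
include hb hb' o in
theorem QuarterTurn.p_sq {x : ℝ} (hx : x ≤ 0) :
    p x ^ 2 = 4 * (1 - cos (u x / 2) ^ 2) * speedSq b (cos (u x / 2)) := by
  have he := o.energy hb hb' (by norm_num) (by norm_num) x hx
  have hT := (baseStiff_bounds hb.le hb' (o.sq_le_one hx)).1
  have e1 : 1 + 2 * b * cos (u x) = baseStiff b (cos (u x / 2)) := by
    rw [baseStiff, ← cos_eq_half]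
  have e2 : excess b 0 (u x) = (1 - cos (u x)) + b / 2 * (1 - cos (u x) ^ 2) := by
    rw [excess, arcsin_zero, Real.cos_zero, ← sin_sq]; ring
  rw [e1, e2, cos_eq_half (u x)] at he
  rw [speedSq, ← mul_assoc, ← div_eq_mul_inv, eq_div_iff (by linarith)]
  linear_combination he

-- The sign is the same for both halves: `u` and its slope have the same sign `σ`, so `sin (u / 2) *
-- p` is nonnegative. Thus both halves satisfy one autonomous equation in `z`, running from `1` down
-- to `√2/2`.
include hb hb' o in
theorem QuarterTurn.hasDerivAt {x : ℝ} (hx : x < 0) : HasDerivAt (fun x => cos (u x / 2))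
    (-((1 - cos (u x / 2) ^ 2) * √(speedSq b (cos (u x / 2))))) x := by
  have h1 := ((o.deriv_u x hx).div_const 2).cos
  refine h1.congr_deriv ?_
  have hsq := o.p_sq hb hb' hx.le
  have hG := (speedSq_bounds hb.le hb' (o.sq_le_one hx.le)).1
  have hs2 : sin (u x / 2) ^ 2 = 1 - cos (u x / 2) ^ 2 := sin_sq _
  have hpos : 0 ≤ sin (u x / 2) * p x := by
    obtain ⟨a1, a2, -, -⟩ := o.half_angle hx.le
    have a3 := sin_nonneg_of_nonneg_of_le_pi a1.le (by linarith [pi_pos])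
    have a4 := o.deriv_pos x hx.le
    rcases o.sign with rfl | rfl
    · rw [one_mul] at a3 a4; positivity
    · have e : -1 * u x / 2 = -(u x / 2) := by ring
      rw [e, sin_neg] at a3
      exact mul_nonneg_of_nonpos_of_nonpos (by linarith) (by linarith)
  have key : sin (u x / 2) * p x = 2 * (1 - cos (u x / 2) ^ 2) * √(speedSq b (cos (u x / 2))) := by
    have h3 : (sin (u x / 2) * p x) ^ 2 =
        (2 * (1 - cos (u x / 2) ^ 2) * √(speedSq b (cos (u x / 2)))) ^ 2 := by
      rw [mul_pow, mul_pow, hs2, hsq, Real.sq_sqrt (by linarith)]; ring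
    refine (sq_eq_sq₀ hpos ?_).1 h3
    have := o.sq_le_one hx.le
    have : 0 ≤ 1 - cos (u x / 2) ^ 2 := by linarith
    positivity
  linear_combination -(1 / 2) * key

include hb hb' o in
theorem QuarterTurn.pot_eq {x : ℝ} (hx : x ≤ 0) (Λ : ℝ) :
    pot b 0 Λ (u x) (p x) = zPot b Λ (cos (u x / 2)) := by
  have hsq := o.p_sq hb hb' hx
  have hT := (baseStiff_bounds hb.le hb' (o.sq_le_one hx)).1
  have e1 : 1 + 2 * b * cos (u x) = baseStiff b (cos (u x / 2)) := by
    rw [baseStiff, ← cos_eq_half]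
  have e2 : accel b 0 (u x) (p x) * sin (u x) = (1 - cos (u x) ^ 2) *
      (1 + b * p x ^ 2 + b * cos (u x)) * (baseStiff b (cos (u x / 2)))⁻¹ := by
    rw [accel, e1, ← sin_sq, div_eq_mul_inv]; ring
  have e3 : pot b 0 Λ (u x) (p x) = cos (u x) + Λ + b * (2 * (accel b 0 (u x) (p x) * sin (u x)) +
      p x ^ 2 * cos (u x) + (Λ + cos (u x)) ^ 2 - (1 - cos (u x) ^ 2)) := by
    rw [pot, ← sin_sq]; ring
  rw [e3, e2, hsq, cos_eq_half (u x), zPot]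
  ring

include o in
theorem QuarterTurn.continuous_cos : Continuous fun x => cos (u x / 2) := by
  have := o.cont_u
  fun_prop

include o in
theorem QuarterTurn.tendsto_cos : Tendsto (fun x => cos (u x / 2)) atBot (𝓝 1) := by
  have h : ContinuousAt (fun y : ℝ => cos (y / 2)) 0 := by fun_prop
  have h2 := o.lim_u
  rw [arcsin_zero] at h2
  simpa [Function.comp_def] using h.tendsto.comp h2

include hb hb' o in
/-- The Riccati expression of a trial function of the coordinate `z`. -/
theorem QuarterTurn.hasDerivAt_trial {x : ℝ} (hx : x < 0) (Λ : ℝ) {N : ℝ → ℝ} {n' : ℝ}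
    (hN : HasDerivAt N n' (cos (u x / 2))) : ∃ d,
    HasDerivAt (fun x => stiff b Λ (u x) * (√(speedSq b (cos (u x / 2))) * N (cos (u x / 2)))) d x ∧
    d + stiff b Λ (u x) * (√(speedSq b (cos (u x / 2))) * N (cos (u x / 2))) ^ 2 -
      pot b 0 Λ (u x) (p x) = defect b Λ (cos (u x / 2)) (N (cos (u x / 2)))
        (-((1 - cos (u x / 2) ^ 2) * n')) := by
  have hz := o.hasDerivAt hb hb' hx
  have hz2 := o.sq_le_one hx.le
  set z := cos (u x / 2) with hzdef
  have hG := (speedSq_bounds hb.le hb' hz2).1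
  have hT := (baseStiff_bounds hb.le hb' hz2).1
  have hsqrt := Real.sq_sqrt (by linarith : 0 ≤ speedSq b z)
  have hspos := Real.sqrt_pos.2 (by linarith : 0 < speedSq b z)
  have dG := ((hasDerivAt_speedSq hb.le hb' hz2).sqrt (by linarith)).comp x hz
  have dN := hN.comp x hz
  have dS : HasDerivAt (fun x => stiff b Λ (u x)) (8 * b * z * -((1 - z ^ 2) * √(speedSq b z))) x := by
    have h1 := ((((hz.pow 2).const_mul 2).sub_const 1).const_mul (2 * b)).const_add 1 |>.add_const
      (2 * b * Λ)
    refine (h1.congr_deriv ?_).congr_of_eventuallyEq (.of_forall fun y => ?_)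
    · simp only [Nat.cast_ofNat, Nat.add_one_sub_one, pow_one]
      rw [← hzdef]; ring
    · simp only [Pi.pow_apply]
      rw [stiff_eq, baseStiff]
  refine ⟨_, dS.mul (dG.mul dN), ?_⟩
  rw [o.pot_eq hb hb' hx.le, stiff_eq]
  simp only [Function.comp_apply]
  rw [← hzdef, defect, speedSqFlow]
  set g := √(speedSq b z) with hg
  have e : -(b * (z * (6 + 4 * b))) * (baseStiff b z)⁻¹ ^ 2 / (2 * g) * -((1 - z ^ 2) * g) =
      1 / 2 * ((1 - z ^ 2) * (b * (z * (6 + 4 * b))) * (baseStiff b z)⁻¹ ^ 2) := by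
    field_simp
  rw [e, ← hsqrt]
  ring

end QuarterTurn

end PiKink
end

/-! ### The unperturbed ground state and its first-order correction. -/

noncomputable section
namespace PiKink

/-- The coefficient of `b` in the defect. -/
def defectSlope (b Λ z n η : ℝ) : ℝ :=
  (z ^ 2 + 2 * Λ * (1 + b * z ^ 2) * (baseStiff b z)⁻¹) * (η + n ^ 2) +
    (-(8 * (z * (1 - z ^ 2))) * speedSq b z + 1 / 2 * (baseStiff b z + 2 * b * Λ) *
      ((1 - z ^ 2) * (z * (6 + 4 * b)) * (baseStiff b z)⁻¹ ^ 2)) * n -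
    (2 * (1 - (2 * z ^ 2 - 1) ^ 2) * (1 + b * (4 * (1 - z ^ 2)) * speedSq b z +
    b * (2 * z ^ 2 - 1)) * (baseStiff b z)⁻¹ + 4 * (1 - z ^ 2) * speedSq b z * (2 * z ^ 2 - 1) +
    (Λ + (2 * z ^ 2 - 1)) ^ 2 - (1 - (2 * z ^ 2 - 1) ^ 2))

/-- The part without the factor `b` is the Riccati equation of the unperturbed problem `v'' = (2 z²
- 1 + Λ) v`; everything else carries one factor `b`, exactly and not only to first order. -/
theorem defect_eq {b Λ z n η : ℝ} (h : baseStiff b z ≠ 0) :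
    defect b Λ z n η = η + n ^ 2 - (2 * z ^ 2 - 1) - Λ + b * defectSlope b Λ z n η := by
  have e : (baseStiff b z + 2 * b * Λ) * speedSq b z =
      1 + b * (z ^ 2 + 2 * Λ * (1 + b * z ^ 2) * (baseStiff b z)⁻¹) := by
    rw [speedSq]; field_simp; ring
  rw [defect, e, defectSlope, zPot, speedSqFlow]
  ring

/-- The box of parameters `(b, Λ, z, n, η)`. -/
def paramBox (B : ℝ) : Set (ℝ × ℝ × ℝ × ℝ × ℝ) :=
  Icc 0 (1 / 1000) ×ˢ Icc (-1) 0 ×ˢ Icc (√2 / 2) 1 ×ˢ Icc (-B) B ×ˢ Icc (-B) B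

theorem baseStiff_ne_zero {b z : ℝ} (hb : b ∈ Icc 0 (1 / 1000)) (hz : z ∈ Icc (√2 / 2) 1) :
    baseStiff b z ≠ 0 := by
  have h0 : 0 ≤ √2 / 2 := by positivity
  have := (baseStiff_bounds hb.1 hb.2 (z := z) (by nlinarith [hz.1, hz.2])).1
  linarith

/-- The slope is continuously differentiable on a compact convex box, hence bounded and Lipschitz
there. All perturbation constants come from this. -/
theorem exists_defectSlope_bounds (B : ℝ) : ∃ L : ℝ, 0 ≤ L ∧
    (∀ P ∈ paramBox B, |defectSlope P.1 P.2.1 P.2.2.1 P.2.2.2.1 P.2.2.2.2| ≤ L) ∧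
    ∀ P ∈ paramBox B, ∀ P' ∈ paramBox B,
      |defectSlope P.1 P.2.1 P.2.2.1 P.2.2.2.1 P.2.2.2.2 -
        defectSlope P'.1 P'.2.1 P'.2.2.1 P'.2.2.2.1 P'.2.2.2.2| ≤ L * dist P P' := by
  have hT : ∀ P ∈ paramBox B, baseStiff P.1 P.2.2.1 ≠ 0 := fun P hP =>
    baseStiff_ne_zero hP.1 hP.2.2.1
  have hinv : ContDiffOn ℝ 1 (fun P : ℝ × ℝ × ℝ × ℝ × ℝ => (baseStiff P.1 P.2.2.1)⁻¹) (paramBox B) := by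
    refine ContDiffOn.inv ?_ hT
    unfold baseStiff
    fun_prop
  have hC : ContDiffOn ℝ 1 (fun P : ℝ × ℝ × ℝ × ℝ × ℝ =>
      defectSlope P.1 P.2.1 P.2.2.1 P.2.2.2.1 P.2.2.2.2) (paramBox B) := by
    unfold defectSlope speedSq
    have hS : ContDiffOn ℝ 1 (fun P : ℝ × ℝ × ℝ × ℝ × ℝ => baseStiff P.1 P.2.2.1) (paramBox B) := by
      unfold baseStiff
      fun_prop
    fun_prop
  have hcomp : IsCompact (paramBox B) := isCompact_Icc.prod (isCompact_Icc.prod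
    (isCompact_Icc.prod (isCompact_Icc.prod isCompact_Icc)))
  have hconv : Convex ℝ (paramBox B) := (convex_Icc _ _).prod ((convex_Icc _ _).prod
    ((convex_Icc _ _).prod ((convex_Icc _ _).prod (convex_Icc _ _))))
  obtain ⟨K, hK⟩ := hC.exists_lipschitzOnWith one_ne_zero hconv hcomp
  obtain ⟨A, hA⟩ := hcomp.exists_bound_of_continuousOn hC.continuousOn
  refine ⟨max A K, K.2.trans (le_max_right _ _), fun P hP => (hA P hP).trans (le_max_left _ _),
    fun P hP P' hP' => ?_⟩
  have := hK.dist_le_mul P hP P' hP'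
  rw [Real.dist_eq] at this
  exact this.trans (mul_le_mul_of_nonneg_right (le_max_right _ _) dist_nonneg)

/-- The decay rate of the unperturbed ground state. -/
def rate : ℝ := (√5 - 1) / (2 * √2)

theorem rate_sq : rate ^ 2 = (3 - √5) / 4 := by
  have h2 : √2 ^ 2 = 2 := Real.sq_sqrt (by norm_num)
  have h5 : √5 ^ 2 = 5 := Real.sq_sqrt (by norm_num)
  rw [rate, div_pow, mul_pow, h2]
  linear_combination h5 / 8

theorem rate_quartic : 4 * rate ^ 4 - 6 * rate ^ 2 + 1 = 0 := by
  have h5 : √5 ^ 2 = 5 := Real.sq_sqrt (by norm_num)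
  have e : rate ^ 4 = (rate ^ 2) ^ 2 := by ring
  rw [e, rate_sq]
  linear_combination h5 / 4

theorem rate_pos : 0 < rate := by
  have h5 : 1 < √5 := by rw [Real.lt_sqrt] <;> norm_num
  exact div_pos (by linarith) (by positivity)

/-- This writes the junction coordinate as a polynomial in `rate`, so identities at the junction
reduce to polynomial identities modulo `rate_quartic`. -/
theorem rate_cubic : 2 * rate - 2 * rate ^ 3 = √2 / 2 := by
  have h2 : √2 ^ 2 = 2 := Real.sq_sqrt (by norm_num)
  have h5 : √5 ^ 2 = 5 := Real.sq_sqrt (by norm_num)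
  have hs : √2 ≠ 0 := by positivity
  have e : 2 * rate - 2 * rate ^ 3 = rate * (2 - 2 * rate ^ 2) := by ring
  rw [e, rate_sq, rate]
  field_simp
  linear_combination 2 * h5 - 4 * h2

theorem rate_lt : rate < 1 / 2 := by
  have h := rate_sq
  have h5 : 2 < √5 := by rw [Real.lt_sqrt] <;> norm_num
  nlinarith [rate_pos]

theorem half_sqrt_two_bounds : 7 / 10 < √2 / 2 ∧ √2 / 2 < 71 / 100 := by
  constructor
  · have : 7 / 5 < √2 := by rw [Real.lt_sqrt] <;> norm_num
    linarith
  · have : √2 < 142 / 100 := by rw [Real.sqrt_lt'] <;> norm_num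
    linarith

/-- The unperturbed largest eigenvalue. -/
def baseEigenvalue : ℝ := rate ^ 2 - 1

/-- The first-order coefficient of the largest eigenvalue. -/
def eigenvalueSlope : ℝ := 7 / 5 * rate ^ 2 - 21 / 20

/-- The logarithmic derivative of the unperturbed ground state. -/
def profile (z : ℝ) : ℝ := (z ^ 2 + rate * z + rate ^ 2 - 1) / (z + rate)

/-- The derivative of `profile` along the flow. -/
def profileFlow (z : ℝ) : ℝ := 2 * z ^ 2 - 1 + baseEigenvalue - profile z ^ 2

/-- The first-order correction of the logarithmic derivative of the ground state. -/
def corrector (z : ℝ) : ℝ :=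
  ((51 / 20 * rate ^ 3 - 57 / 20 * rate) + (39 / 10 * rate ^ 2 - 4 / 5) * z +
    (13 / 2 * rate - 1 / 2 * rate ^ 3) * z ^ 2 + (3 - 3 * rate ^ 2) * z ^ 3 - 6 * rate * z ^ 4 -
    3 * z ^ 5) / (z + rate) ^ 2

/-- The derivative of `corrector` along the flow. -/
def correctorFlow (z : ℝ) : ℝ :=
  eigenvalueSlope - defectSlope 0 baseEigenvalue z (profile z) (profileFlow z) -
    2 * profile z * corrector z

/-- `profile` equals `rate - (1 - z²) / (z + rate)`, the logarithmic derivative of `exp (rate x) (z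
+ rate)` along `z' = -(1 - z²)`. This is the decaying solution of the unperturbed equation at `Λ =
rate² - 1`. -/
theorem hasDerivAt_profile {z : ℝ} (hz : 0 < z) :
    ∃ n', HasDerivAt profile n' z ∧ -((1 - z ^ 2) * n') = profileFlow z := by
  have h0 : z + rate ≠ 0 := by linarith [rate_pos]
  have h := (((((hasDerivAt_id z).pow 2).add ((hasDerivAt_id z).const_mul rate)).add_const
    (rate ^ 2)).sub_const 1).div ((hasDerivAt_id z).add_const rate) h0
  refine ⟨_, h, ?_⟩
  simp only [Nat.cast_ofNat, Nat.add_one_sub_one, pow_one, Pi.pow_apply, Pi.add_apply, id]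
  rw [profileFlow, baseEigenvalue, profile]
  field_simp
  ring

theorem defectSlope_zero (Λ z n η : ℝ) : defectSlope 0 Λ z n η =
    (z ^ 2 + 2 * Λ) * (η + n ^ 2) - 5 * z * (1 - z ^ 2) * n -
      (2 * (1 - (2 * z ^ 2 - 1) ^ 2) + 4 * (1 - z ^ 2) * (2 * z ^ 2 - 1) +
        (Λ + (2 * z ^ 2 - 1)) ^ 2 - (1 - (2 * z ^ 2 - 1) ^ 2)) := by
  simp only [defectSlope, speedSq, baseStiff, mul_zero, zero_mul, add_zero, inv_one]
  ring

/-- `corrector` solves the Riccati equation linearized about `profile`, with the lattice term as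
source and the eigenvalue shifted at rate `eigenvalueSlope`. The verification is a rational identity
in `z` modulo the quartic equation for `rate`. -/
theorem hasDerivAt_corrector {z : ℝ} (hz : 0 < z) :
    ∃ n', HasDerivAt corrector n' z ∧ -((1 - z ^ 2) * n') = correctorFlow z := by
  have h0 : z + rate ≠ 0 := by linarith [rate_pos]
  have i := hasDerivAt_id z
  have h := ((((((i.const_mul (39 / 10 * rate ^ 2 - 4 / 5)).const_add
    (51 / 20 * rate ^ 3 - 57 / 20 * rate)).add
    ((i.pow 2).const_mul (13 / 2 * rate - 1 / 2 * rate ^ 3))).add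
    ((i.pow 3).const_mul (3 - 3 * rate ^ 2))).sub ((i.pow 4).const_mul (6 * rate))).sub
    ((i.pow 5).const_mul 3)).div ((i.add_const rate).pow 2) (pow_ne_zero 2 h0)
  refine ⟨_, h, ?_⟩
  simp only [Nat.cast_ofNat, Nat.add_one_sub_one, pow_one, Pi.pow_apply, Pi.add_apply, Pi.sub_apply,
    id]
  rw [correctorFlow, defectSlope_zero, profileFlow, corrector, profile, baseEigenvalue,
    eigenvalueSlope]
  field_simp
  have hq := rate_quartic
  grind

/-- By symmetry of the two halves the slopes match only if the logarithmic derivative vanishes at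
the junction. This condition determines `rate`. -/
theorem profile_half : profile (√2 / 2) = 0 := by
  rw [profile, half_sqrt_two, ← rate_cubic]
  have hq := rate_quartic
  rw [div_eq_zero_iff]
  left
  linear_combination -hq / 2

/-- The same matching condition at first order; it is what fixes `eigenvalueSlope`. -/
theorem corrector_half : corrector (√2 / 2) = 0 := by
  have h2 := half_sqrt_two
  rw [corrector, ← rate_cubic, div_eq_zero_iff]
  left
  have hq := rate_quartic
  grind

/-- The numerator of `profile` factors as `(z - √2/2) (z + rate + √2/2)`. The bound makes the
linearized Riccati operator positive on suitable test functions. -/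
theorem profile_ge {z : ℝ} (hz : z ∈ Icc (√2 / 2) 1) : z - √2 / 2 ≤ profile z := by
  have h := half_sqrt_two_bounds
  have h2 := half_sqrt_two
  have r0 := rate_pos
  have r1 := rate_lt
  have e : z ^ 2 + rate * z + rate ^ 2 - 1 = (z - √2 / 2) * (z + rate + √2 / 2) := by
    have := rate_quartic
    rw [← rate_cubic]
    linear_combination (rate ^ 2 - 1) * this
  rw [profile, e, le_div_iff₀ (by linarith [hz.1])]
  have : 0 ≤ z - √2 / 2 := by linarith [hz.1]
  exact mul_le_mul_of_nonneg_left (by linarith) this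

theorem eigenvalueSlope_neg : eigenvalueSlope < 0 := by
  have h5 : 2 < √5 := by rw [Real.lt_sqrt] <;> norm_num
  rw [eigenvalueSlope, rate_sq]; linarith

theorem continuousOn_profile : ContinuousOn profile (Icc (√2 / 2) 1) := fun z hz => by
  obtain ⟨n, h, -⟩ := hasDerivAt_profile (z := z) (by linarith [half_sqrt_two_bounds.1, hz.1])
  exact h.continuousAt.continuousWithinAt

theorem continuousOn_corrector : ContinuousOn corrector (Icc (√2 / 2) 1) := fun z hz => by
  obtain ⟨n, h, -⟩ := hasDerivAt_corrector (z := z) (by linarith [half_sqrt_two_bounds.1, hz.1])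
  exact h.continuousAt.continuousWithinAt

theorem exists_profile_bounds : ∃ B : ℝ, 1 ≤ B ∧ ∀ z ∈ Icc (√2 / 2) 1,
    |profile z| ≤ B ∧ |profileFlow z| ≤ B ∧ |corrector z| ≤ B ∧ |correctorFlow z| ≤ B := by
  have c1 := continuousOn_profile
  have c2 : ContinuousOn profileFlow (Icc (√2 / 2) 1) := by unfold profileFlow; fun_prop
  have c3 := continuousOn_corrector
  have c4 : ContinuousOn correctorFlow (Icc (√2 / 2) 1) := by
    unfold correctorFlow
    simp only [defectSlope_zero]
    fun_prop
  obtain ⟨B1, h1⟩ := isCompact_Icc.exists_bound_of_continuousOn c1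
  obtain ⟨B2, h2⟩ := isCompact_Icc.exists_bound_of_continuousOn c2
  obtain ⟨B3, h3⟩ := isCompact_Icc.exists_bound_of_continuousOn c3
  obtain ⟨B4, h4⟩ := isCompact_Icc.exists_bound_of_continuousOn c4
  refine ⟨max 1 (max (max B1 B2) (max B3 B4)), le_max_left _ _, fun z hz => ⟨?_, ?_, ?_, ?_⟩⟩
  · exact (h1 z hz).trans (by simp)
  · exact (h2 z hz).trans (by simp)
  · exact (h3 z hz).trans (by simp)
  · exact (h4 z hz).trans (by simp)

end PiKink
end

/-! ### Perturbation estimates for the Riccati defect. -/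

noncomputable section
namespace PiKink

theorem dist_param_le {b Λ z n η b' Λ' n' η' δ : ℝ} (h1 : |b - b'| ≤ δ) (h2 : |Λ - Λ'| ≤ δ)
    (h3 : |n - n'| ≤ δ) (h4 : |η - η'| ≤ δ) : dist (b, Λ, z, n, η) (b', Λ', z, n', η') ≤ δ := by
  simp only [Prod.dist_eq, Real.dist_eq, sub_self, abs_zero]
  exact max_le h1 (max_le h2 (max_le ((abs_nonneg _).trans h1) (max_le h3 h4)))

theorem mem_paramBox {B b Λ z n η : ℝ} (h1 : b ∈ Icc 0 (1 / 1000)) (h2 : Λ ∈ Icc (-1) 0)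
    (h3 : z ∈ Icc (√2 / 2) 1) (h4 : |n| ≤ B) (h5 : |η| ≤ B) : (b, Λ, z, n, η) ∈ paramBox B :=
  ⟨h1, h2, h3, abs_le.1 h4, abs_le.1 h5⟩

theorem baseEigenvalue_mem : baseEigenvalue ∈ Icc (-1) 0 := by
  have := rate_pos
  have := rate_lt
  rw [baseEigenvalue]
  constructor <;> nlinarith

theorem abs_add_mul_le {x y B s : ℝ} (hx : |x| ≤ B) (hs : |s| ≤ 1) (hy : |y| ≤ B) :
    |x + s * y| ≤ 2 * B := by
  have h : |s * y| ≤ 1 * B := by rw [abs_mul]; gcongr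
  exact (abs_add_le _ _).trans (by linarith)

/-- The defect of the first-order approximation is of second order. -/
theorem exists_defect_expansion : ∃ K b₀ : ℝ, 0 ≤ K ∧ 0 < b₀ ∧ b₀ ≤ 1 / 1000 ∧ ∀ b ∈ Ioo 0 b₀,
    ∀ Λ ∈ Icc (-1) 0, ∀ z ∈ Icc (√2 / 2) 1,
    |defect b Λ z (profile z + b * corrector z) (profileFlow z + b * correctorFlow z) +
      (Λ - baseEigenvalue - b * eigenvalueSlope)| ≤
      K * b ^ 2 + 1 / 2 * |Λ - baseEigenvalue - b * eigenvalueSlope| := by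
  obtain ⟨B, hB1, hB⟩ := exists_profile_bounds
  obtain ⟨L, hL, -, hLip⟩ := exists_defectSlope_bounds (2 * B)
  set s := |eigenvalueSlope| with hs
  refine ⟨B ^ 2 + L * (1 + B + s), 1 / (1000 + 2 * L), by positivity, by positivity, ?_,
    fun b hb Λ hΛ z hz => ?_⟩
  · rw [div_le_div_iff₀] <;> linarith
  have hbL : b * (1000 + 2 * L) ≤ 1 := ((lt_div_iff₀ (by positivity)).1 hb.2).le
  have hb0 := hb.1
  have hbL' : b * L ≤ 1 / 2 := by nlinarith
  have hb1 : b ≤ 1 / 1000 := by nlinarith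
  have hbI : b ∈ Icc (0 : ℝ) (1 / 1000) := ⟨hb0.le, hb1⟩
  have hb2 : |b| ≤ 1 := by rw [abs_of_pos hb0]; linarith
  obtain ⟨p1, p2, p3, p4⟩ := hB z hz
  set D := Λ - baseEigenvalue - b * eigenvalueSlope with hD
  have hlip := hLip _ (mem_paramBox hbI hΛ hz (abs_add_mul_le p1 hb2 p3) (abs_add_mul_le p2 hb2 p4))
    _ (mem_paramBox ⟨le_rfl, by norm_num⟩ baseEigenvalue_mem hz (p1.trans (by linarith))
    (p2.trans (by linarith)))
  have hdist := dist_param_le (z := z) (b := b) (b' := 0) (Λ := Λ) (Λ' := baseEigenvalue)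
    (n := profile z + b * corrector z) (n' := profile z)
    (η := profileFlow z + b * correctorFlow z) (η' := profileFlow z) (δ := b * (1 + B + s) + |D|)
    (by
      rw [sub_zero, abs_of_pos hb0]
      have := abs_nonneg D
      have : 0 ≤ b * (B + s) := by positivity
      linarith)
    (by
      have e : Λ - baseEigenvalue = b * eigenvalueSlope + D := by rw [hD]; ring
      rw [e]
      refine (abs_add_le _ _).trans ?_
      rw [abs_mul, abs_of_pos hb0, ← hs]
      have : 0 ≤ b * (1 + B) := by positivity
      linarith)
    (by
      rw [add_sub_cancel_left, abs_mul, abs_of_pos hb0]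
      have := mul_le_mul_of_nonneg_left p3 hb0.le
      have := abs_nonneg D
      have : 0 ≤ b * (1 + s) := by positivity
      linarith)
    (by
      rw [add_sub_cancel_left, abs_mul, abs_of_pos hb0]
      have := mul_le_mul_of_nonneg_left p4 hb0.le
      have := abs_nonneg D
      have : 0 ≤ b * (1 + s) := by positivity
      linarith)
  have hlip := hlip.trans (mul_le_mul_of_nonneg_left hdist hL)
  dsimp only at hlip
  set E := defectSlope b Λ z (profile z + b * corrector z) (profileFlow z + b * correctorFlow z)
  set E₀ := defectSlope 0 baseEigenvalue z (profile z) (profileFlow z) with hE₀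
  -- The orders `0` and `1` in `b` cancel by the equations of `profile` and `corrector`. The
  -- remainder is quadratic up to the Lipschitz error of `defectSlope`, whose dependence on `D` is
  -- absorbed by `b L ≤ 1/2`.
  have key : defect b Λ z (profile z + b * corrector z) (profileFlow z + b * correctorFlow z) + D =
      b ^ 2 * corrector z ^ 2 + b * (E - E₀) := by
    have hp : profileFlow z = 2 * z ^ 2 - 1 + baseEigenvalue - profile z ^ 2 := rfl
    have hc : correctorFlow z = eigenvalueSlope - E₀ - 2 * profile z * corrector z := rfl
    rw [defect_eq (baseStiff_ne_zero hbI hz)]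
    linear_combination hp + b * hc + hD
  rw [key]
  have h1 : |b ^ 2 * corrector z ^ 2| ≤ b ^ 2 * B ^ 2 := by
    rw [abs_mul, abs_of_nonneg (sq_nonneg b), abs_pow]; gcongr
  have h2 : |b * (E - E₀)| ≤ b * (L * (b * (1 + B + s) + |D|)) := by
    rw [abs_mul, abs_of_pos hb0]; gcongr
  have h3 : b * L * |D| ≤ 1 / 2 * |D| := mul_le_mul_of_nonneg_right hbL' (abs_nonneg D)
  refine (abs_add_le _ _).trans ?_
  nlinarith

/-- First-order barriers around the unperturbed profile. -/
theorem exists_defect_barriers (C : ℝ) (hC : 0 ≤ C) : ∃ K b₀ : ℝ, 0 ≤ K ∧ 0 < b₀ ∧ b₀ ≤ 1 / 1000 ∧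
    ∀ b ∈ Ioo 0 b₀, ∀ Λ ∈ Icc (-1) 0, |Λ - baseEigenvalue| ≤ C * b → ∀ z ∈ Icc (√2 / 2) 1,
    0 ≤ defect b Λ z (profile z + K * b * (2 - z)) (profileFlow z + K * b * (1 - z ^ 2)) ∧
    defect b Λ z (profile z + -(K * b) * (2 - z)) (profileFlow z + -(K * b) * (1 - z ^ 2)) ≤ 0 := by
  obtain ⟨B, hB1, hB⟩ := exists_profile_bounds
  obtain ⟨L, hL, hbd, -⟩ := exists_defectSlope_bounds (2 * B)
  -- The gain is at least `K b / 2`, and it has to dominate `C b` from the eigenvalue and `L b` from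
  -- the lattice term.
  set K := 4 * (L + C) + 1 with hK
  have hK1 : 1 ≤ K := by linarith
  refine ⟨K, 1 / (1000 * K), by linarith, by positivity, ?_, fun b hb Λ hΛ hC z hz => ?_⟩
  · rw [div_le_div_iff₀] <;> linarith
  have hbK : b * (1000 * K) < 1 := (lt_div_iff₀ (by positivity)).1 hb.2
  have hb0 := hb.1
  have hKb : 0 < K * b := by positivity
  have hb1 : b ≤ 1 / 1000 := by nlinarith
  have hbI : b ∈ Icc (0 : ℝ) (1 / 1000) := ⟨hb0.le, hb1⟩
  obtain ⟨p1, p2, -, -⟩ := hB z hz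
  have hpr := profile_ge hz
  have hz0 := half_sqrt_two_bounds
  have hz2 := half_sqrt_two
  obtain ⟨z1, z2⟩ := hz
  -- This is the reason for the test function `2 - z`: near `z = 1` the term with `profile` is
  -- large, near `√2/2` its flow derivative `1 - z²` is.
  have hr : 1 / 2 ≤ 2 * profile z * (2 - z) + (1 - z ^ 2) := by nlinarith
  have hr2 : (2 - z) ^ 2 ≤ 4 := by nlinarith
  have hq : |1 - z ^ 2| ≤ 1 := abs_le.2 ⟨by nlinarith, by nlinarith⟩
  have general : ∀ t : ℝ, |t| = K * b →
      |defectSlope b Λ z (profile z + t * (2 - z)) (profileFlow z + t * (1 - z ^ 2))| ≤ L ∧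
      defect b Λ z (profile z + t * (2 - z)) (profileFlow z + t * (1 - z ^ 2)) =
        t * (2 * profile z * (2 - z) + (1 - z ^ 2)) + t ^ 2 * (2 - z) ^ 2 - (Λ - baseEigenvalue) +
        b * defectSlope b Λ z (profile z + t * (2 - z)) (profileFlow z + t * (1 - z ^ 2)) := by
    intro t ht
    constructor
    · refine hbd _ (mem_paramBox hbI hΛ ⟨z1, z2⟩ ?_ ?_)
      · have : profile z + t * (2 - z) = profile z + t * 2 * ((2 - z) / 2) := by ring
        rw [this]
        refine abs_add_mul_le p1 ?_ ?_
        · rw [abs_mul, ht, abs_two]; linarith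
        · rw [abs_le]; constructor <;> linarith
      · refine abs_add_mul_le p2 ?_ (hq.trans hB1)
        rw [ht]; linarith
    · rw [defect_eq (baseStiff_ne_zero hbI ⟨z1, z2⟩), profileFlow]
      ring
  obtain ⟨C1, C2⟩ := abs_le.1 hC
  have hlow : (K * b) * (1 / 2) ≤ K * b * (2 * profile z * (2 - z) + (1 - z ^ 2)) :=
    mul_le_mul_of_nonneg_left hr hKb.le
  have hKe : K * b = 4 * (L * b + C * b) + b := by rw [hK]; ring
  constructor
  · obtain ⟨g1, g2⟩ := general (K * b) (abs_of_pos hKb)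
    rw [g2]
    have h1 : -(b * L) ≤ b * defectSlope b Λ z (profile z + K * b * (2 - z))
        (profileFlow z + K * b * (1 - z ^ 2)) := by
      have := mul_le_mul_of_nonneg_left (abs_le.1 g1).1 hb0.le
      linarith
    have h2 : 0 ≤ (K * b) ^ 2 * (2 - z) ^ 2 := by positivity
    linarith [mul_nonneg hL hb0.le]
  · obtain ⟨g1, g2⟩ := general (-(K * b)) (by rw [abs_neg, abs_of_pos hKb])
    rw [g2]
    have h1 : b * defectSlope b Λ z (profile z + -(K * b) * (2 - z))
        (profileFlow z + -(K * b) * (1 - z ^ 2)) ≤ b * L :=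
      mul_le_mul_of_nonneg_left (abs_le.1 g1).2 hb0.le
    have h2 : (-(K * b)) ^ 2 * (2 - z) ^ 2 ≤ (K * b) * (1 / 250) := by
      have : (K * b) ^ 2 * (2 - z) ^ 2 ≤ (K * b) ^ 2 * 4 := by gcongr
      have : (K * b) * (K * b) ≤ (K * b) * (1 / 1000) := mul_le_mul_of_nonneg_left (by linarith) hKb.le
      nlinarith
    linarith [mul_nonneg hL hb0.le]

/-- As the slope is affine in `η` with a bounded coefficient, for small `b` the equation `defect =
0` bounds `η` by the other variables, before any box for `η` is known. -/
theorem defectSlope_affine (b Λ z n η : ℝ) : defectSlope b Λ z n η = defectSlope b Λ z n 0 +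
    (z ^ 2 + 2 * Λ * (1 + b * z ^ 2) * (baseStiff b z)⁻¹) * η := by
  rw [defectSlope, defectSlope]; ring

theorem abs_slope_coeff_le {b Λ z : ℝ} (hb : b ∈ Icc 0 (1 / 1000)) (hΛ : Λ ∈ Icc (-1) 0)
    (hz : z ∈ Icc (√2 / 2) 1) : |z ^ 2 + 2 * Λ * (1 + b * z ^ 2) * (baseStiff b z)⁻¹| ≤ 4 := by
  have h0 := half_sqrt_two_bounds
  have hz1 : z ^ 2 ≤ 1 := by nlinarith [hz.1, hz.2]
  have hG := speedSq_bounds hb.1 hb.2 hz1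
  have e : z ^ 2 + 2 * Λ * (1 + b * z ^ 2) * (baseStiff b z)⁻¹ = z ^ 2 + 2 * (Λ * speedSq b z) := by
    rw [speedSq]; ring
  have h1 : |Λ * speedSq b z| ≤ 1 * (11 / 10) := by
    rw [abs_mul]
    exact mul_le_mul (abs_le.2 ⟨hΛ.1, hΛ.2.trans zero_le_one⟩)
      (abs_le.2 ⟨by linarith, hG.2⟩) (abs_nonneg _) zero_le_one
  have := sq_nonneg z
  rw [e]
  rw [abs_le] at *
  constructor <;> linarith

/-- The size of the flow derivative of a solution of the Riccati equation. -/
theorem abs_flow_le {b Λ z n η B L : ℝ} (hb : b ∈ Icc 0 (1 / 1000)) (hΛ : Λ ∈ Icc (-1) 0)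
    (hz : z ∈ Icc (√2 / 2) 1) (hn : |n| ≤ B) (he : |defectSlope b Λ z n 0| ≤ L)
    (hdef : η + n ^ 2 - (2 * z ^ 2 - 1) - Λ + b * defectSlope b Λ z n η = 0) :
    |η| ≤ 2 * (4 + B ^ 2 + L) := by
  have hk := abs_slope_coeff_le hb hΛ hz
  rw [defectSlope_affine] at hdef
  generalize z ^ 2 + 2 * Λ * (1 + b * z ^ 2) * (baseStiff b z)⁻¹ = k at *
  generalize defectSlope b Λ z n 0 = e at *
  have h0 := half_sqrt_two_bounds
  have hz1 : |2 * z ^ 2 - 1| ≤ 1 := abs_le.2 ⟨by nlinarith [hz.1, hz.2], by nlinarith [hz.1, hz.2]⟩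
  have hΛ1 : |Λ| ≤ 1 := abs_le.2 ⟨hΛ.1, hΛ.2.trans zero_le_one⟩
  have e1 : η = (2 * z ^ 2 - 1) + Λ - n ^ 2 - b * e - b * (k * η) := by linarith
  have e2 : |b * (k * η)| ≤ 1 / 1000 * (4 * |η|) := by
    rw [abs_mul, abs_mul, abs_of_nonneg hb.1]
    have := hb.2
    gcongr
  have e3 : |b * e| ≤ 1 * L := by
    rw [abs_mul, abs_of_nonneg hb.1]
    have := hb.2
    gcongr
    linarith
  have e4 : |n ^ 2| ≤ B ^ 2 := by rw [abs_pow]; gcongr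
  have e5 : |η| ≤ (4 + B ^ 2 + L) + 1 / 250 * |η| := by
    conv_lhs => rw [e1]
    have := abs_nonneg η
    generalize |η| = y at *
    rw [abs_le] at *
    constructor <;> linarith
  linarith [abs_nonneg η]

/-- Solutions of the Riccati equation that are close to the unperturbed profile have flow
derivatives close to those of the profile. -/
theorem exists_flow_bound (K C : ℝ) (hK : 0 ≤ K) (hC : 0 ≤ C) : ∃ A b₀ : ℝ, 0 ≤ A ∧ 0 < b₀ ∧
    b₀ ≤ 1 / 1000 ∧ ∀ b ∈ Ioo 0 b₀, ∀ Λ ∈ Icc (-1) 0, |Λ - baseEigenvalue| ≤ C * b →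
    ∀ z ∈ Icc (√2 / 2) 1, ∀ n η : ℝ, |n - profile z| ≤ K * b → defect b Λ z n η = 0 →
    |η - profileFlow z| ≤ A * b := by
  obtain ⟨B, hB1, hB⟩ := exists_profile_bounds
  obtain ⟨L, hL, hbd, -⟩ := exists_defectSlope_bounds (2 * B)
  -- Two boxes are needed: the first, used with `η = 0`, yields the bound `H` for `η`; the second is
  -- enlarged by `H` so that it contains the actual `η`.
  set H := 2 * (4 + 4 * B ^ 2 + L) with hH
  obtain ⟨L', hL', hbd', -⟩ := exists_defectSlope_bounds (2 * B + H)
  have hH0 : 0 ≤ H := by positivity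
  refine ⟨C + 3 * B * K + L', 1 / (1000 * (1 + K)), by positivity, by positivity, ?_,
    fun b hb Λ hΛ hΛC z hz n η hn hdef => ?_⟩
  · rw [div_le_div_iff₀] <;> linarith
  have hbK : b * (1000 * (1 + K)) < 1 := (lt_div_iff₀ (by positivity)).1 hb.2
  have hb0 := hb.1
  have hKb : 0 ≤ K * b := by positivity
  have hb1 : b ≤ 1 / 1000 := by nlinarith
  have hKb1 : K * b ≤ 1 := by nlinarith
  have hbI : b ∈ Icc (0 : ℝ) (1 / 1000) := ⟨hb0.le, hb1⟩
  obtain ⟨p1, p2, -, -⟩ := hB z hz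
  have hz0 := half_sqrt_two_bounds
  have hn2 : |n| ≤ 2 * B := by
    have : n = profile z + 1 * (n - profile z) := by ring
    rw [this]
    exact abs_add_mul_le p1 (by simp) (by linarith)
  rw [defect_eq (baseStiff_ne_zero hbI hz)] at hdef
  have hη : |η| ≤ H := by
    refine (abs_flow_le hbI hΛ hz hn2 (hbd _ (mem_paramBox hbI hΛ hz hn2 (η := 0) ?_)) hdef).trans ?_
    · rw [abs_zero]; positivity
    · rw [hH]; exact le_of_eq (by ring)
  have hE := hbd' _ (mem_paramBox hbI hΛ hz (hn2.trans (by linarith)) (hη.trans (by linarith)))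
  dsimp only at hE
  have e : η - profileFlow z = (Λ - baseEigenvalue) - (n - profile z) * (n + profile z) -
      b * defectSlope b Λ z n η := by
    rw [profileFlow]; linarith
  have h1 : |(n - profile z) * (n + profile z)| ≤ K * b * (3 * B) := by
    rw [abs_mul]
    exact mul_le_mul hn ((abs_add_le _ _).trans (by linarith)) (abs_nonneg _) hKb
  have h2 : |b * defectSlope b Λ z n η| ≤ b * L' := by
    rw [abs_mul, abs_of_pos hb0]; gcongr
  rw [e]
  rw [abs_le] at *
  constructor <;> linarith

/-- The correction of a solution of the Riccati equation by a multiple of `corrector` is a strict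
supersolution for larger parameters. -/
theorem exists_defect_neg (K C : ℝ) (hK : 0 ≤ K) (hC : 0 ≤ C) : ∃ b₀ : ℝ, 0 < b₀ ∧
    b₀ ≤ 1 / 1000 ∧ ∀ b₁ b₂ : ℝ, 0 < b₁ → b₁ < b₂ → b₂ < b₀ → ∀ Λ₁ ∈ Icc (-1) 0, ∀ Λ₂ ∈ Icc (-1) 0,
    |Λ₁ - baseEigenvalue| ≤ C * b₁ → |Λ₂ - baseEigenvalue| ≤ C * b₂ → Λ₁ ≤ Λ₂ →
    ∀ z ∈ Icc (√2 / 2) 1, ∀ n η : ℝ, |n - profile z| ≤ K * b₁ → defect b₁ Λ₁ z n η = 0 →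
    defect b₂ Λ₂ z (n + (b₂ - b₁) * corrector z) (η + (b₂ - b₁) * correctorFlow z) < 0 := by
  obtain ⟨B, hB1, hB⟩ := exists_profile_bounds
  obtain ⟨A, b₀, hA, hb₀, hb₀', hflow⟩ := exists_flow_bound K C hK hC
  obtain ⟨L, hL, -, hLip⟩ := exists_defectSlope_bounds (2 * (B + K + A))
  set m := -eigenvalueSlope with hm
  have hm0 : 0 < m := by rw [hm]; linarith [eigenvalueSlope_neg]
  set W := 2 * K * B + B ^ 2 + L * (1 + C + K + A + B) + L * (1 + B) with hW
  have hW0 : 0 ≤ W := by positivity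
  set c := min b₀ (min (m / (2 * W + 1)) (1 / (2 * L + 1))) with hc
  refine ⟨c, lt_min hb₀ (lt_min (by positivity) (by positivity)), (min_le_left _ _).trans hb₀',
    fun b₁ b₂ h0 h12 h2c Λ₁ hΛ₁ Λ₂ hΛ₂ hC₁ hC₂ hle z hz n η hn hdef => ?_⟩
  have k1 : b₂ < b₀ := h2c.trans_le (min_le_left _ _)
  have k2 : b₂ * (2 * W + 1) < m := (lt_div_iff₀ (by positivity)).1
    (h2c.trans_le ((min_le_right _ _).trans (min_le_left _ _)))
  have k3 : b₂ * (2 * L + 1) < 1 := (lt_div_iff₀ (by positivity)).1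
    (h2c.trans_le ((min_le_right _ _).trans (min_le_right _ _)))
  have hb1 : b₂ ≤ 1 / 1000 := by linarith
  have hbI₁ : b₁ ∈ Icc (0 : ℝ) (1 / 1000) := ⟨h0.le, by linarith⟩
  have hbI₂ : b₂ ∈ Icc (0 : ℝ) (1 / 1000) := ⟨by linarith, hb1⟩
  have hη := hflow b₁ ⟨h0, h12.trans k1⟩ Λ₁ hΛ₁ hC₁ z hz n η hn hdef
  obtain ⟨p1, p2, p3, p4⟩ := hB z hz
  set Δ := b₂ - b₁ with hΔ
  have hΔ0 : 0 < Δ := by rw [hΔ]; linarith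
  have hΔb : Δ ≤ b₂ := by rw [hΔ]; linarith
  have hb2 : 0 < b₂ := h0.trans h12
  have hKb : K * b₁ ≤ K * b₂ := mul_le_mul_of_nonneg_left h12.le hK
  have hAb : A * b₁ ≤ A * b₂ := mul_le_mul_of_nonneg_left h12.le hA
  have hKb1 : K * b₂ ≤ K := mul_le_of_le_one_right hK (by linarith)
  have hAb1 : A * b₂ ≤ A := mul_le_of_le_one_right hA (by linarith)
  have hn1 : |n| ≤ B + K + A := by
    have := abs_add_le (n - profile z) (profile z)
    rw [sub_add_cancel] at this
    linarith
  have hη1 : |η| ≤ B + K + A := by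
    have := abs_add_le (η - profileFlow z) (profileFlow z)
    rw [sub_add_cancel] at this
    linarith
  have hΔ1 : |Δ| ≤ 1 := by rw [abs_of_pos hΔ0]; linarith
  have m1 := mem_paramBox (B := 2 * (B + K + A)) hbI₁ hΛ₁ hz (hn1.trans (by linarith))
    (hη1.trans (by linarith))
  have m2 := mem_paramBox (B := 2 * (B + K + A)) hbI₂ hΛ₂ hz
    (abs_add_mul_le hn1 hΔ1 (p3.trans (by linarith)))
    (abs_add_mul_le hη1 hΔ1 (p4.trans (by linarith)))
  have m0 := mem_paramBox (B := 2 * (B + K + A)) ⟨le_rfl, by norm_num⟩ baseEigenvalue_mem hz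
    (p1.trans (by linarith)) (p2.trans (by linarith))
  have hΔρ : |Δ * corrector z| ≤ Δ * B := by rw [abs_mul, abs_of_pos hΔ0]; gcongr
  have hΔρ' : |Δ * correctorFlow z| ≤ Δ * B := by rw [abs_mul, abs_of_pos hΔ0]; gcongr
  have hΔB : Δ * B ≤ b₂ * B := by gcongr
  have hBb : 0 ≤ b₂ * B := by positivity
  have hCb : 0 ≤ C * b₂ := by positivity
  have hKb0 : 0 ≤ K * b₂ := by positivity
  have hAb0 : 0 ≤ A * b₂ := by positivity
  have l20 := (hLip _ m2 _ m0).trans (mul_le_mul_of_nonneg_left (dist_param_le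
    (δ := b₂ * (1 + C + K + A + B)) (by rw [sub_zero, abs_of_pos hb2]; linarith)
    (by linarith)
    (by
      have e : n + Δ * corrector z - profile z = (n - profile z) + Δ * corrector z := by ring
      rw [e]; exact (abs_add_le _ _).trans (by linarith))
    (by
      have e : η + Δ * correctorFlow z - profileFlow z = (η - profileFlow z) + Δ * correctorFlow z := by
        ring
      rw [e]; exact (abs_add_le _ _).trans (by linarith))) hL)
  have hΔB0 : 0 ≤ Δ * B := by positivity
  have l21 := (hLip _ m2 _ m1).trans (mul_le_mul_of_nonneg_left (dist_param_le
    (δ := Δ * (1 + B) + (Λ₂ - Λ₁)) (by rw [← hΔ, abs_of_pos hΔ0]; linarith)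
    (by rw [abs_of_nonneg (by linarith)]; linarith)
    (by rw [add_sub_cancel_left]; linarith) (by rw [add_sub_cancel_left]; linarith)) hL)
  dsimp only at l20 l21
  rw [defect_eq (baseStiff_ne_zero hbI₁ hz)] at hdef
  rw [defect_eq (baseStiff_ne_zero hbI₂ hz)]
  -- This is the rate of change of the defect when `b` grows and the trial function follows
  -- `corrector` while `Λ` is kept fixed. It equals `eigenvalueSlope`, which is strictly negative.
  have hr : correctorFlow z + 2 * profile z * corrector z +
      defectSlope 0 baseEigenvalue z (profile z) (profileFlow z) = -m := by
    rw [correctorFlow, hm]; ring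
  generalize defectSlope b₂ Λ₂ z (n + Δ * corrector z) (η + Δ * correctorFlow z) = E₂ at *
  generalize defectSlope b₁ Λ₁ z n η = E₁ at *
  generalize defectSlope 0 baseEigenvalue z (profile z) (profileFlow z) = E₀ at *
  -- The exact equation at `b₁` is subtracted, so every term carries a factor `Δ = b₂ - b₁` or `Λ₂ -
  -- Λ₁`. The leading terms `-m Δ` and `-(Λ₂ - Λ₁)` dominate for small `b₂`, however small `Δ` is.
  have key : η + Δ * correctorFlow z + (n + Δ * corrector z) ^ 2 - (2 * z ^ 2 - 1) - Λ₂ + b₂ * E₂ =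
      Δ * (-m + 2 * ((n - profile z) * corrector z) + Δ * corrector z * corrector z + (E₂ - E₀)) -
        (Λ₂ - Λ₁) + b₁ * (E₂ - E₁) := by
    rw [← hr]
    have : b₂ = b₁ + Δ := by rw [hΔ]; ring
    rw [this]
    linear_combination hdef
  rw [key]
  have t1 : (n - profile z) * corrector z ≤ K * b₂ * B := by
    refine (le_abs_self _).trans ?_
    rw [abs_mul]
    exact mul_le_mul (hn.trans hKb) p3 (abs_nonneg _) hKb0
  have t2 : Δ * corrector z * corrector z ≤ b₂ * B * B := by
    refine (le_abs_self _).trans ?_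
    rw [abs_mul]
    exact mul_le_mul (hΔρ.trans hΔB) p3 (abs_nonneg _) hBb
  have t3 := (le_abs_self _).trans l20
  have t4 : b₁ * (E₂ - E₁) ≤ b₂ * (L * (Δ * (1 + B) + (Λ₂ - Λ₁))) :=
    (mul_le_mul_of_nonneg_left ((le_abs_self _).trans l21) h0.le).trans
      (mul_le_mul_of_nonneg_right h12.le ((abs_nonneg _).trans l21))
  clear_value W m Δ c
  have t5 : -m + 2 * ((n - profile z) * corrector z) + Δ * corrector z * corrector z + (E₂ - E₀) +
      b₂ * (L * (1 + B)) ≤ -m + b₂ * W := by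
    rw [hW]; linarith
  have t6 : -m + b₂ * W < 0 := by linarith [mul_nonneg hb2.le hW0]
  have t7 : b₂ * L * (Λ₂ - Λ₁) ≤ 1 * (Λ₂ - Λ₁) := by
    refine mul_le_mul_of_nonneg_right ?_ (by linarith)
    linarith
  have t8 := mul_neg_of_pos_of_neg hΔ0 (t5.trans_lt t6)
  linarith

end PiKink
end

/-! ### Trial functions on the kink and the expansion of the largest eigenvalue. -/

noncomputable section
namespace PiKink

/-- The coordinate `cos (u / 2)`, frozen on the right half line. -/
def halfCos (u : ℝ → ℝ) (x : ℝ) : ℝ := cos (u (min x 0) / 2)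

/-- The logarithmic derivative in `x` of a function of the coordinate `z` whose logarithmic
derivative along the flow is `N`. -/
def trial (b : ℝ) (u N : ℝ → ℝ) (x : ℝ) : ℝ := √(speedSq b (halfCos u x)) * N (halfCos u x)

/-- A bounded differentiable function of the coordinate `z` with flow derivative `η`. -/
structure TrialFunction (N η : ℝ → ℝ) : Prop where
  contOn : ContinuousOn N (Ico (√2 / 2) 1)
  deriv : ∀ z ∈ Ioo (√2 / 2) 1, ∃ n', HasDerivAt N n' z ∧ -((1 - z ^ 2) * n') = η z
  bounded : ∃ K : ℝ, ∀ z ∈ Ico (√2 / 2) 1, |N z| ≤ K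

theorem TrialFunction.add_mul {N η N' η' : ℝ → ℝ} (h : TrialFunction N η) (h' : TrialFunction N' η')
    (t : ℝ) : TrialFunction (fun z => N z + t * N' z) (fun z => η z + t * η' z) := by
  refine ⟨h.contOn.add (h'.contOn.const_mul t), fun z hz => ?_, ?_⟩
  · obtain ⟨m, h1, h2⟩ := h.deriv z hz
    obtain ⟨m', h1', h2'⟩ := h'.deriv z hz
    exact ⟨m + t * m', h1.add (h1'.const_mul t), by rw [← h2, ← h2']; ring⟩
  · obtain ⟨K, hK⟩ := h.bounded
    obtain ⟨K', hK'⟩ := h'.bounded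
    refine ⟨K + |t| * K', fun z hz => (abs_add_le _ _).trans (add_le_add (hK z hz) ?_)⟩
    rw [abs_mul]
    exact mul_le_mul_of_nonneg_left (hK' z hz) (abs_nonneg t)

theorem trialFunction_profile : TrialFunction profile profileFlow := by
  have h := half_sqrt_two_bounds
  obtain ⟨B, -, hB⟩ := exists_profile_bounds
  exact ⟨continuousOn_profile.mono Ico_subset_Icc_self,
    fun z hz => hasDerivAt_profile (by linarith [hz.1]),
    B, fun z hz => (hB z (Ico_subset_Icc_self hz)).1⟩

theorem trialFunction_corrector : TrialFunction corrector correctorFlow := by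
  have h := half_sqrt_two_bounds
  obtain ⟨B, -, hB⟩ := exists_profile_bounds
  exact ⟨continuousOn_corrector.mono Ico_subset_Icc_self,
    fun z hz => hasDerivAt_corrector (by linarith [hz.1]),
    B, fun z hz => (hB z (Ico_subset_Icc_self hz)).2.2.1⟩

theorem trialFunction_two_sub : TrialFunction (fun z => 2 - z) (fun z => 1 - z ^ 2) := by
  have h := half_sqrt_two_bounds
  refine ⟨by fun_prop, fun z hz => ⟨-1, (hasDerivAt_id z).const_sub 2, by ring⟩, 2, fun z hz => ?_⟩
  rw [abs_le]
  constructor <;> linarith [hz.1, hz.2]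

section QuarterTurn

variable {b σ Λ : ℝ} {u p v w : ℝ → ℝ} (hb : 0 < b) (hb' : b ≤ 1 / 1000) (o : QuarterTurn b σ u p)

theorem halfCos_of_le {x : ℝ} (hx : x ≤ 0) : halfCos u x = cos (u x / 2) := by
  rw [halfCos, min_eq_left hx]

include o in
theorem QuarterTurn.halfCos_mem (x : ℝ) : halfCos u x ∈ Ico (√2 / 2) 1 :=
  o.mem_Ico (min_le_right _ _)

variable {N η : ℝ → ℝ} (hN : TrialFunction N η)

include hb hb' o hN in
theorem QuarterTurn.continuous_trial : Continuous (trial b u N) := by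
  have h0 : 0 ≤ √2 / 2 := by positivity
  have hc : Continuous (halfCos u) := o.continuous_cos.comp (continuous_id.min continuous_const)
  refine Continuous.mul ?_ (hN.contOn.comp_continuous hc o.halfCos_mem)
  refine (continuousOn_sqrt_speedSq hb.le hb').comp_continuous hc fun x => ?_
  exact ⟨by linarith [(o.halfCos_mem x).1], (o.halfCos_mem x).2.le⟩

include hb hb' o hN in
theorem QuarterTurn.exists_abs_trial_le : ∃ K : ℝ, ∀ x, |trial b u N x| ≤ K := by
  obtain ⟨K, hK⟩ := hN.bounded
  refine ⟨2 * K, fun x => ?_⟩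
  have h := sqrt_speedSq_bounds hb.le hb' (sq_le_one_of_mem (o.halfCos_mem x))
  rw [trial, abs_mul, abs_of_nonneg (Real.sqrt_nonneg _)]
  exact mul_le_mul (by linarith) (hK _ (o.halfCos_mem x)) (abs_nonneg _) zero_le_two

include o in
theorem QuarterTurn.trial_zero : trial b u N 0 = √(speedSq b (√2 / 2)) * N (√2 / 2) := by
  rw [trial, halfCos_of_le le_rfl, o.cos_zero]

include o in
theorem QuarterTurn.exists_trial_nonneg (h1 : ∀ᶠ z in 𝓝 1, 0 ≤ N z) :
    ∃ y ≤ 0, ∀ x ≤ y, 0 ≤ trial b u N x := by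
  obtain ⟨y, hy⟩ := eventually_atBot.1 ((o.tendsto_cos.eventually h1).and (eventually_le_atBot 0))
  refine ⟨y, (hy y le_rfl).2, fun x hx => ?_⟩
  rw [trial, halfCos_of_le (hy x hx).2]
  exact mul_nonneg (Real.sqrt_nonneg _) (hy x hx).1

include hb hb' o hN in
theorem QuarterTurn.exists_hasDerivAt_trial (Λ : ℝ) : ∃ d : ℝ → ℝ, ∀ x < 0,
    HasDerivAt (fun x => stiff b Λ (u x) * trial b u N x) (d x) x ∧
    d x + stiff b Λ (u x) * trial b u N x ^ 2 - pot b 0 Λ (u x) (p x) =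
      defect b Λ (halfCos u x) (N (halfCos u x)) (η (halfCos u x)) := by
  have h : ∀ x : ℝ, ∃ d : ℝ, x < 0 →
      HasDerivAt (fun x => stiff b Λ (u x) * trial b u N x) d x ∧
      d + stiff b Λ (u x) * trial b u N x ^ 2 - pot b 0 Λ (u x) (p x) =
        defect b Λ (halfCos u x) (N (halfCos u x)) (η (halfCos u x)) := by
    intro x
    by_cases hx : x < 0
    · obtain ⟨n', h1, h2⟩ := hN.deriv _ (o.mem_Ioo hx)
      obtain ⟨d, h3, h4⟩ := o.hasDerivAt_trial hb hb' hx Λ h1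
      refine ⟨d, fun _ => ⟨h3.congr_of_eventuallyEq ?_, ?_⟩⟩
      · filter_upwards [Iio_mem_nhds hx] with y hy
        rw [trial, halfCos_of_le (le_of_lt hy)]
      · rw [trial, halfCos_of_le hx.le, h4, h2]
    · exact ⟨0, fun h => absurd h hx⟩
  choose d hd using h
  exact ⟨d, hd⟩

include hb hb' o hN in
theorem QuarterTurn.le_trial (hΛ : -1 ≤ Λ)
    (hv : Decaying (fun x => stiff b Λ (u x)) (fun x => pot b 0 Λ (u x) (p x)) v w)
    (hpos : ∀ x ≤ 0, 0 ≤ v x) (h1 : ∀ᶠ z in 𝓝 1, 0 ≤ N z)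
    (hdef : ∀ z ∈ Icc (√2 / 2) 1, 0 ≤ defect b Λ z (N z) (η z)) :
    ∀ x ≤ 0, w x ≤ trial b u N x * v x := by
  obtain ⟨K, hK⟩ := o.exists_abs_trial_le hb hb' hN
  obtain ⟨y, hy, hy0⟩ := o.exists_trial_nonneg (b := b) h1
  obtain ⟨d, hd⟩ := o.exists_hasDerivAt_trial hb hb' hN Λ
  refine hv.le_of_riccati (stiffness_stiff hb hb' o.cont_u hΛ) hpos
    (o.continuous_trial hb hb' hN) hy (fun x _ => hK x) hy0 (fun x hx => (hd x hx).1)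
    fun x hx => ?_
  have := hdef _ (Ico_subset_Icc_self (o.halfCos_mem x))
  linarith [(hd x hx).2]

include hb hb' o hN in
theorem QuarterTurn.trial_le (hΛ : -1 ≤ Λ)
    (hv : Decaying (fun x => stiff b Λ (u x)) (fun x => pot b 0 Λ (u x) (p x)) v w)
    (hpos : ∀ x ≤ 0, 0 ≤ v x) (h1 : ∀ᶠ z in 𝓝 1, 0 ≤ N z)
    (hdef : ∀ z ∈ Icc (√2 / 2) 1, defect b Λ z (N z) (η z) ≤ 0) :
    ∀ x ≤ 0, trial b u N x * v x ≤ w x := by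
  obtain ⟨K, hK⟩ := o.exists_abs_trial_le hb hb' hN
  obtain ⟨y, hy, hy0⟩ := o.exists_trial_nonneg (b := b) h1
  obtain ⟨d, hd⟩ := o.exists_hasDerivAt_trial hb hb' hN Λ
  refine hv.ge_of_riccati (stiffness_stiff hb hb' o.cont_u hΛ) hpos
    (o.continuous_trial hb hb' hN) hy (fun x _ => hK x) hy0 (fun x hx => (hd x hx).1)
    fun x hx => ?_
  have := hdef _ (Ico_subset_Icc_self (o.halfCos_mem x))
  linarith [(hd x hx).2]

end QuarterTurn

section Kink

variable {a Λ : ℝ} {φ : ℝ → ℝ} (hb : 0 < a ^ 2 / 12) (hb' : a ^ 2 / 12 ≤ 1 / 1000)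

theorem IsKinkThrough.quarterTurn_left (hφ : IsKinkThrough a 0 (π / 2) φ) :
    QuarterTurn (a ^ 2 / 12) 1 φ (deriv φ) :=
  ⟨hφ.left, Or.inl rfl, by rw [hφ.zero, one_mul], fun x hx => by
    rw [one_mul, ← hφ.zero]; exact hφ.strictMono hx⟩

theorem IsKinkThrough.quarterTurn_right (hφ : IsKinkThrough a 0 (π / 2) φ) :
    QuarterTurn (a ^ 2 / 12) (-1) (fun x => φ (-x) - π) (fun x => -deriv φ (-x)) :=
  ⟨hφ.right, Or.inr rfl, by rw [neg_zero, hφ.zero]; ring, fun x hx => by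
    have := hφ.strictMono (neg_pos.2 hx)
    rw [hφ.zero] at this
    linarith⟩

-- The speed factor at the junction is common to both halves, so the matching condition reduces to
-- the sum of the trial values. The defect may vanish at `z = √2/2`, since Picone's identity needs
-- strictness only for `x < 0`.
include hb hb' in
theorem not_mem_eigenvalues_of_defect_neg (hφ : IsKinkThrough a 0 (π / 2) φ) (hΛ : -1 ≤ Λ)
    {N η N' η' : ℝ → ℝ} (hN : TrialFunction N η) (hN' : TrialFunction N' η')
    (hd : ∀ z ∈ Ico (√2 / 2) 1, z ≠ √2 / 2 → defect (a ^ 2 / 12) Λ z (N z) (η z) < 0)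
    (hd' : ∀ z ∈ Ico (√2 / 2) 1, z ≠ √2 / 2 → defect (a ^ 2 / 12) Λ z (N' z) (η' z) < 0)
    (hsum : 0 ≤ N (√2 / 2) + N' (√2 / 2)) : Λ ∉ eigenvalues a 0 φ := by
  have oL := hφ.quarterTurn_left
  have oR := hφ.quarterTurn_right
  obtain ⟨K, hK⟩ := oL.exists_abs_trial_le hb hb' hN
  obtain ⟨K', hK'⟩ := oR.exists_abs_trial_le hb hb' hN'
  obtain ⟨e, he⟩ := oL.exists_hasDerivAt_trial hb hb' hN Λ
  obtain ⟨e', he'⟩ := oR.exists_hasDerivAt_trial hb hb' hN' Λ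
  refine not_mem_eigenvalues hb hb' hφ.isPiKink hΛ (K := max K K')
    (oL.continuous_trial hb hb' hN).continuousOn (oR.continuous_trial hb hb' hN').continuousOn
    (fun x _ => (hK x).trans (le_max_left _ _)) (fun x _ => (hK' x).trans (le_max_right _ _))
    (fun x hx => (he x hx).1) (fun x hx => (he' x hx).1) (fun x hx => ?_) (fun x hx => ?_) ?_
  · have := hd _ (oL.halfCos_mem x) (by rw [halfCos_of_le hx.le]; exact (oL.mem_Ioo hx).1.ne')
    linarith [(he x hx).2]
  · have := hd' _ (oR.halfCos_mem x) (by rw [halfCos_of_le hx.le]; exact (oR.mem_Ioo hx).1.ne')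
    linarith [(he' x hx).2]
  · rw [oL.trial_zero, oR.trial_zero, ← mul_add]
    exact mul_nonneg (Real.sqrt_nonneg _) hsum

-- Without forcing `π/2` is a zero of the junction function, and no first zero lies before it. Since
-- `0 < gammaCr a`, the junction is transversal.
include hb hb' in
theorem IsType1Kink.isKinkThrough (hφ : IsType1Kink a 0 φ) :
    IsKinkThrough a 0 (π / 2) φ ∧ 0 < junctionDeriv (a ^ 2 / 12) 0 (π / 2) := by
  obtain ⟨d, hd, hk⟩ := hφ.exists_isKinkThrough hb hb' ⟨le_rfl, (gammaCr_pos hb hb').le⟩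
  have hπ := pi_pos
  have e : d = π / 2 := by
    refine le_antisymm ?_ hd.mem.1
    by_contra hlt
    push Not at hlt
    have := hd.neg (π / 2) (by positivity) hlt
    simp [junction] at this
  subst e
  exact ⟨hk, hd.deriv_pos hb hb' le_rfl (gammaCr_pos hb hb') (isGreatest_gammaCr hb hb').1⟩

theorem continuousAt_profile_one : ContinuousAt profile 1 := by
  obtain ⟨n, h, -⟩ := hasDerivAt_profile (z := 1) one_pos
  exact h.continuousAt

theorem quarter_le_profile_one : 1 / 4 ≤ profile 1 := by
  have h := half_sqrt_two_bounds
  have := profile_ge (z := 1) ⟨by linarith, le_rfl⟩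
  linarith

theorem rate_sq_bounds : 19 / 100 ≤ rate ^ 2 ∧ rate ^ 2 ≤ 1 / 4 := by
  have h5 : 2 < √5 := by rw [Real.lt_sqrt] <;> norm_num
  have h5' : √5 < 224 / 100 := by rw [Real.sqrt_lt'] <;> norm_num
  rw [rate_sq]
  constructor <;> linarith

/-- The expansion of the largest eigenvalue at vanishing forcing. -/
theorem exists_eigenvalue_expansion : ∃ K b₀ : ℝ, 0 ≤ K ∧ 0 < b₀ ∧ b₀ ≤ 1 / 1000 ∧
    ∀ a : ℝ, a ^ 2 / 12 ∈ Ioo 0 b₀ → ∀ φ : ℝ → ℝ, IsKinkThrough a 0 (π / 2) φ →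
    0 < junctionDeriv (a ^ 2 / 12) 0 (π / 2) → ∃ Λ ∈ Icc (-1) 0,
    |Λ - (baseEigenvalue + eigenvalueSlope * (a ^ 2 / 12))| ≤ K * (a ^ 2 / 12) ^ 2 ∧
    IsGreatest (eigenvalues a 0 φ) Λ ∧ ∃ v w v' w' : ℝ → ℝ, GroundState a 0 Λ φ v w v' w' := by
  obtain ⟨K, b₀, hK, hb₀, hb₀', hexp⟩ := exists_defect_expansion
  obtain ⟨B, hB1, hB⟩ := exists_profile_bounds
  refine ⟨2 * K + 1, min b₀ (1 / (1000 * (B + K))), by linarith, lt_min hb₀ (by positivity),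
    (min_le_left _ _).trans hb₀', fun a ha φ hφ hj => ?_⟩
  set b := a ^ 2 / 12 with hbdef
  have hb := ha.1
  have hbb : b < b₀ := ha.2.trans_le (min_le_left _ _)
  have hb' : b ≤ 1 / 1000 := by linarith
  have hbK : b * (1000 * (B + K)) < 1 :=
    (lt_div_iff₀ (by positivity)).1 (ha.2.trans_le (min_le_right _ _))
  have hbB : b * B ≤ 1 / 1000 := by linarith [mul_nonneg hb.le hK]
  have hbK2 : (2 * K + 1) * b ^ 2 ≤ 3 / 1000 := by
    have : b * (b * K) ≤ 1 * (1 / 1000) := by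
      refine mul_le_mul (by linarith) ?_ (by positivity) zero_le_one
      linarith [mul_nonneg hb.le (zero_le_one.trans hB1)]
    have : b * b ≤ 1 * (1 / 1000) := by gcongr; linarith
    linarith
  have hrate := rate_sq_bounds
  have hslope : b * eigenvalueSlope ≤ 0 ∧ -(2 / 1000) ≤ b * eigenvalueSlope := by
    have h1 := eigenvalueSlope_neg
    have h2 : -2 ≤ eigenvalueSlope := by rw [eigenvalueSlope]; linarith
    constructor <;> nlinarith
  have hbase : baseEigenvalue = rate ^ 2 - 1 := rfl
  set N : ℝ → ℝ := fun z => profile z + b * corrector z with hN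
  set η : ℝ → ℝ := fun z => profileFlow z + b * correctorFlow z with hη
  have hT : TrialFunction N η := trialFunction_profile.add_mul trialFunction_corrector b
  have hN0 : N (√2 / 2) = 0 := by rw [hN]; simp [profile_half, corrector_half]
  have hN1 : ∀ᶠ z in 𝓝 1, 0 ≤ N z := by
    have hc : ContinuousAt N 1 := by
      obtain ⟨n, h, -⟩ := hasDerivAt_corrector (z := 1) one_pos
      exact continuousAt_profile_one.add (h.continuousAt.const_mul b)
    have h1 : 0 < N 1 := by
      have h2 := quarter_le_profile_one
      have h3 : |b * corrector 1| ≤ b * B := by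
        rw [abs_mul, abs_of_pos hb]
        exact mul_le_mul_of_nonneg_left
          (hB 1 ⟨by linarith [half_sqrt_two_bounds.2], le_rfl⟩).2.2.1 hb.le
      rw [hN]
      beta_reduce
      linarith [(abs_le.1 h3).1]
    filter_upwards [hc.eventually (lt_mem_nhds h1)] with z hz using hz.le
  -- A shift by `(2 K + 1) b²` suffices: half of it survives the Lipschitz loss, and `(2 K + 1) / 2`
  -- exceeds `K`. So the same function `N` is a subsolution here and a supersolution above the
  -- mirrored value.
  set Λ₁ := baseEigenvalue + b * eigenvalueSlope - (2 * K + 1) * b ^ 2 with hΛ₁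
  have hsq : 0 < (2 * K + 1) * b ^ 2 := by positivity
  have hsqK : 0 ≤ K * b ^ 2 := by positivity
  have hΛ₁m : Λ₁ ∈ Icc (-1) 0 := by constructor <;> linarith [hslope.1, hslope.2]
  have hlow : ∀ z ∈ Icc (√2 / 2) 1, 0 ≤ defect b Λ₁ z (N z) (η z) := by
    intro z hz
    have h := hexp b ⟨hb, hbb⟩ Λ₁ hΛ₁m z hz
    have e : Λ₁ - baseEigenvalue - b * eigenvalueSlope = -((2 * K + 1) * b ^ 2) := by
      rw [hΛ₁]; ring
    rw [e, abs_neg, abs_of_pos hsq] at h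
    have h' := (abs_le.1 h).1
    have : (0 : ℝ) < b ^ 2 := by positivity
    linarith
  obtain ⟨Λ, hΛ, hg, hgs⟩ := exists_isGreatest_of_barrier hb hb' le_rfl zero_lt_one hφ hj hΛ₁m.1
    (by linarith [hslope.1]) (by rw [arcsin_zero, Real.cos_zero]; linarith [hslope.2]) (m := 0)
    (m' := 0) (by norm_num)
    (fun v w hv hpos => by
      have := hφ.quarterTurn_left.le_trial hb hb' hT hΛ₁m.1 hv hpos hN1 hlow 0 le_rfl
      rwa [hφ.quarterTurn_left.trial_zero, hN0, mul_zero] at this)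
    (fun v w hv hpos => by
      have := hφ.quarterTurn_right.le_trial hb hb' hT hΛ₁m.1 hv hpos hN1 hlow 0 le_rfl
      rwa [hφ.quarterTurn_right.trial_zero, hN0, mul_zero] at this)
  have hΛm : Λ ∈ Icc (-1) 0 := ⟨hΛ₁m.1.trans hΛ.1, hΛ.2.le⟩
  refine ⟨Λ, hΛm, ?_, hg, hgs⟩
  rw [abs_le]
  constructor
  · linarith [hΛ.1]
  · by_contra hcon
    push Not at hcon
    have hneg : ∀ z ∈ Ico (√2 / 2) 1, z ≠ √2 / 2 → defect b Λ z (N z) (η z) < 0 := by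
      intro z hz _
      have h := hexp b ⟨hb, hbb⟩ Λ hΛm z (Ico_subset_Icc_self hz)
      have e : (2 * K + 1) * b ^ 2 < Λ - baseEigenvalue - b * eigenvalueSlope := by linarith
      rw [abs_of_pos (hsq.trans e)] at h
      have h' := (abs_le.1 h).2
      have : (0 : ℝ) < b ^ 2 := by positivity
      linarith
    exact not_mem_eigenvalues_of_defect_neg hb hb' hφ hΛm.1 hT hT hneg hneg
      (by rw [hN0]; norm_num) hg.1

end Kink

end PiKink
end

/-! ### Strict monotonicity of the largest eigenvalue at vanishing forcing. -/

noncomputable section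
namespace PiKink

section QuarterTurn

variable {b σ Λ : ℝ} {u p v w : ℝ → ℝ} (hb : 0 < b) (hb' : b ≤ 1 / 1000) (o : QuarterTurn b σ u p)

include o in
theorem QuarterTurn.exists_cos_eq {z : ℝ} (hz : z ∈ Ico (√2 / 2) 1) :
    ∃ x ≤ 0, cos (u x / 2) = z := by
  obtain ⟨y, hy, hy0⟩ := ((o.tendsto_cos.eventually (lt_mem_nhds hz.2)).and
    (eventually_le_atBot 0)).exists
  obtain ⟨x, hx, hxz⟩ := intermediate_value_Icc' hy0 o.continuous_cos.continuousOn
    (show z ∈ Icc (cos (u 0 / 2)) (cos (u y / 2)) from ⟨by rw [o.cos_zero]; exact hz.1, hy.le⟩)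
  exact ⟨x, hx.2, hxz⟩

/-- The travel time from the junction in the coordinate `z`. -/
def travelTime (b z : ℝ) : ℝ := -∫ t in (√2 / 2)..z, ((1 - t ^ 2) * √(speedSq b t))⁻¹

theorem travelTime_half (b : ℝ) : travelTime b (√2 / 2) = 0 := by simp [travelTime]

include hb hb' in
theorem hasDerivAt_travelTime {z : ℝ} (hz : z ∈ Ico (√2 / 2) 1) :
    HasDerivAt (travelTime b) (-((1 - z ^ 2) * √(speedSq b z))⁻¹) z := by
  have h0 := half_sqrt_two_bounds
  have hc : ContinuousOn (fun t => ((1 - t ^ 2) * √(speedSq b t))⁻¹) (Ioo (-1) 1) := by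
    refine ContinuousOn.inv₀ (ContinuousOn.mul (by fun_prop)
      ((continuousOn_sqrt_speedSq hb.le hb').mono Ioo_subset_Icc_self)) fun t ht => ?_
    have ht2 : t ^ 2 < 1 := by nlinarith [ht.1, ht.2]
    have := (sqrt_speedSq_bounds hb.le hb' ht2.le).1
    exact mul_ne_zero (by linarith) (by linarith)
  have hz' : z ∈ Ioo (-1 : ℝ) 1 := ⟨by linarith [hz.1], hz.2⟩
  refine (intervalIntegral.integral_hasDerivAt_right ?_
    (hc.stronglyMeasurableAtFilter isOpen_Ioo z hz') (hc.continuousAt (isOpen_Ioo.mem_nhds hz'))).neg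
  refine (hc.mono ?_).intervalIntegrable
  rw [uIcc_of_le hz.1]
  exact fun t ht => ⟨by linarith [ht.1], ht.2.trans_lt hz.2⟩

-- Along the orbit the derivative of this composition is `1`, so `travelTime` inverts the coordinate
-- `z`. It depends on `b` only, and it allows a ground state to be regarded as a function of `z` and
-- transplanted to a kink with a different `b`.
include hb hb' o in
theorem QuarterTurn.travelTime_cos {x : ℝ} (hx : x ≤ 0) : travelTime b (cos (u x / 2)) = x := by
  rcases hx.eq_or_lt with rfl | hlt
  · rw [o.cos_zero, travelTime_half]
  have hcont : ContinuousOn (fun y => travelTime b (cos (u y / 2)) - y) (Icc x 0) := by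
    refine ContinuousOn.sub (fun y hy => ?_) continuousOn_id
    exact (ContinuousAt.comp (f := fun y => cos (u y / 2)) (x := y)
      (hasDerivAt_travelTime hb hb' (o.mem_Ico hy.2)).continuousAt
      o.continuous_cos.continuousAt).continuousWithinAt
  obtain ⟨c, hc, hs⟩ := exists_hasDerivAt_eq_slope _ (fun _ => 0) hlt hcont fun y hy => by
    have h1 := (hasDerivAt_travelTime hb hb' (o.mem_Ico hy.2.le)).comp y (o.hasDerivAt hb hb' hy.2)
    refine (h1.sub (hasDerivAt_id y)).congr_deriv ?_
    have h2 := o.mem_Ioo hy.2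
    have h3 := half_sqrt_two_bounds
    have h4 : cos (u y / 2) ^ 2 < 1 := by nlinarith [h2.1, h2.2]
    have := (sqrt_speedSq_bounds hb.le hb' h4.le).1
    have : (1 - cos (u y / 2) ^ 2) * √(speedSq b (cos (u y / 2))) ≠ 0 :=
      mul_ne_zero (by linarith) (by linarith)
    rw [neg_mul_neg, inv_mul_cancel₀ this, sub_self]
  rw [o.cos_zero, travelTime_half, eq_comm, div_eq_zero_iff] at hs
  rcases hs with h | h <;> linarith

include hb hb' o in
theorem QuarterTurn.travelTime_spec {z : ℝ} (hz : z ∈ Ico (√2 / 2) 1) :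
    travelTime b z ≤ 0 ∧ cos (u (travelTime b z) / 2) = z := by
  obtain ⟨x, hx, rfl⟩ := o.exists_cos_eq hz
  rw [o.travelTime_cos hb hb' hx]
  exact ⟨hx, rfl⟩

include hb hb' o in
theorem QuarterTurn.travelTime_neg {z : ℝ} (hz : z ∈ Ioo (√2 / 2) 1) : travelTime b z < 0 := by
  obtain ⟨h1, h2⟩ := o.travelTime_spec hb hb' ⟨hz.1.le, hz.2⟩
  refine lt_of_le_of_ne h1 fun h => ?_
  rw [h, o.cos_zero] at h2
  exact hz.1.ne h2

/-- The logarithmic derivative of a solution as a function of the coordinate `z`. -/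
def logDerivProfile (b : ℝ) (v w : ℝ → ℝ) (z : ℝ) : ℝ :=
  w (travelTime b z) / v (travelTime b z) * (√(speedSq b z))⁻¹

variable (hv : Decaying (fun x => stiff b Λ (u x)) (fun x => pot b 0 Λ (u x) (p x)) v w)
  (hpos : ∀ x ≤ 0, 0 < v x)

include hb hb' o in
theorem QuarterTurn.sqrt_mul_logDerivProfile {x : ℝ} (hx : x ≤ 0) :
    √(speedSq b (cos (u x / 2))) * logDerivProfile b v w (cos (u x / 2)) = w x / v x := by
  have := (sqrt_speedSq_bounds hb.le hb' (o.sq_le_one hx)).1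
  have h0 : √(speedSq b (cos (u x / 2))) ≠ 0 := by linarith
  rw [logDerivProfile, o.travelTime_cos hb hb' hx]
  field_simp

include hb hb' o hv hpos in
theorem QuarterTurn.hasDerivAt_logDeriv (hΛ : -1 ≤ Λ) {x : ℝ} (hx : x < 0) :
    ∃ d, HasDerivAt (fun x => w x / v x) d x ∧
    HasDerivAt (fun x => stiff b Λ (u x) * (w x / v x))
      (pot b 0 Λ (u x) (p x) - stiff b Λ (u x) * (w x / v x) ^ 2) x := by
  have hS : ∀ y ≤ 0, stiff b Λ (u y) ≠ 0 := fun y hy =>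
    ((stiffness_stiff hb hb' o.cont_u hΛ).pos y hy).ne'
  have hv0 := (hpos x hx.le).ne'
  have h1 := (hv.hasDeriv_flux x hx).div (hv.hasDeriv x hx) hv0
  have h2 : HasDerivAt (fun x => stiff b Λ (u x) * (w x / v x))
      (pot b 0 Λ (u x) (p x) - stiff b Λ (u x) * (w x / v x) ^ 2) x := by
    refine (h1.congr_deriv ?_).congr_of_eventuallyEq (.of_forall fun y => ?_)
    · field_simp
    · simp only [Pi.div_apply]; ring
  refine ⟨_, (h2.div (hasDerivAt_stiff (b := b) (Λ := Λ) (o.deriv_u x hx)) (hS x hx.le)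
    ).congr_of_eventuallyEq ?_, h2⟩
  filter_upwards [Iio_mem_nhds hx] with y hy
  have := hS y (le_of_lt hy)
  simp only [Pi.div_apply]
  field_simp

include hb hb' o hv hpos in
/-- The logarithmic derivative of a positive solution solves the Riccati equation. -/
theorem QuarterTurn.trialFunction_logDerivProfile (hΛ : -1 ≤ Λ)
    (hbd : ∃ K : ℝ, ∀ z ∈ Ico (√2 / 2) 1, |logDerivProfile b v w z| ≤ K) :
    ∃ η : ℝ → ℝ, TrialFunction (logDerivProfile b v w) η ∧
      ∀ z ∈ Ioo (√2 / 2) 1, defect b Λ z (logDerivProfile b v w z) (η z) = 0 := by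
  have h0 : 0 ≤ √2 / 2 := by positivity
  have hinv : ∀ z ∈ Ico (√2 / 2) 1, √(speedSq b z) ≠ 0 := fun z hz => by
    linarith [(sqrt_speedSq_bounds hb.le hb' (sq_le_one_of_mem hz)).1]
  have hd : ∀ z ∈ Ioo (√2 / 2) 1, ∃ n', HasDerivAt (logDerivProfile b v w) n' z := fun z hz => by
    have hz' := Ioo_subset_Ico_self hz
    obtain ⟨d, h1, -⟩ := o.hasDerivAt_logDeriv hb hb' hv hpos hΛ (o.travelTime_neg hb hb' hz)
    have hz2 := sq_le_one_of_mem hz'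
    have hG := ((hasDerivAt_speedSq hb.le hb' hz2).sqrt
      (by linarith [(speedSq_bounds hb.le hb' hz2).1])).inv (hinv z hz')
    exact ⟨_, (h1.comp z (hasDerivAt_travelTime hb hb' hz')).mul hG⟩
  refine ⟨fun z => -((1 - z ^ 2) * deriv (logDerivProfile b v w) z), ⟨?_, fun z hz => ?_, hbd⟩,
    fun z hz => ?_⟩
  · have hX : ContinuousOn (travelTime b) (Ico (√2 / 2) 1) := fun z hz =>
      (hasDerivAt_travelTime hb hb' hz).continuousAt.continuousWithinAt
    have hm : MapsTo (travelTime b) (Ico (√2 / 2) 1) (Iic 0) := fun z hz =>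
      (o.travelTime_spec hb hb' hz).1
    refine ContinuousOn.mul (ContinuousOn.div (hv.contOn_deriv.comp hX hm) (hv.contOn.comp hX hm)
      fun z hz => (hpos _ (hm hz)).ne') (ContinuousOn.inv₀ ?_ hinv)
    exact (continuousOn_sqrt_speedSq hb.le hb').mono fun z hz => ⟨by linarith [hz.1], hz.2.le⟩
  · obtain ⟨n', h⟩ := hd z hz
    exact ⟨n', h, by rw [h.deriv]⟩
  · obtain ⟨n', h⟩ := hd z hz
    have hx := o.travelTime_neg hb hb' hz
    have hc := (o.travelTime_spec hb hb' (Ioo_subset_Ico_self hz)).2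
    generalize travelTime b z = x at hx hc
    subst hc
    obtain ⟨d, h1, h2⟩ := o.hasDerivAt_trial hb hb' hx Λ h
    obtain ⟨-, -, h3⟩ := o.hasDerivAt_logDeriv hb hb' hv hpos hΛ hx
    have h4 : HasDerivAt (fun x => stiff b Λ (u x) * (w x / v x)) d x := by
      refine h1.congr_of_eventuallyEq ?_
      filter_upwards [Iio_mem_nhds hx] with y hy
      rw [o.sqrt_mul_logDerivProfile hb hb' (le_of_lt hy)]
    rw [o.sqrt_mul_logDerivProfile hb hb' hx.le, h4.unique h3] at h2
    beta_reduce
    rw [h.deriv, ← h2]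
    ring

end QuarterTurn

/-- The logarithmic derivatives of the ground states are close to the unperturbed profile. -/
theorem exists_logDerivProfile_bound (C : ℝ) (hC : 0 ≤ C) : ∃ K b₀ : ℝ, 0 ≤ K ∧ 0 < b₀ ∧
    b₀ ≤ 1 / 1000 ∧ ∀ b ∈ Ioo 0 b₀, ∀ Λ ∈ Icc (-1) 0, |Λ - baseEigenvalue| ≤ C * b →
    ∀ (σ : ℝ) (u p v w : ℝ → ℝ), QuarterTurn b σ u p →
    Decaying (fun x => stiff b Λ (u x)) (fun x => pot b 0 Λ (u x) (p x)) v w →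
    (∀ x ≤ 0, 0 < v x) → ∀ z ∈ Ico (√2 / 2) 1, |logDerivProfile b v w z - profile z| ≤ K * b := by
  obtain ⟨K, b₀, hK, hb₀, hb₀', hbar⟩ := exists_defect_barriers C hC
  refine ⟨2 * K, min b₀ (1 / (8 * K + 1)), by linarith, lt_min hb₀ (by positivity),
    (min_le_left _ _).trans hb₀', fun b hb Λ hΛ hΛC σ u p v w o hv hpos z hz => ?_⟩
  have hb0 := hb.1
  have hbb : b < b₀ := hb.2.trans_le (min_le_left _ _)
  have hb' : b ≤ 1 / 1000 := by linarith
  have hbK : b * (8 * K + 1) < 1 := (lt_div_iff₀ (by positivity)).1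
    (hb.2.trans_le (min_le_right _ _))
  have hKb : 0 ≤ K * b := by positivity
  -- The comparison theorems need trial functions that are nonnegative near `x = -∞`; `profile 1 ≥
  -- 1/4` leaves room for a perturbation of size `1/8`.
  have near : ∀ t : ℝ, |t| ≤ 1 / 8 → ∀ᶠ z in 𝓝 1, 0 ≤ profile z + t * (2 - z) := fun t ht => by
    have hc : ContinuousAt (fun z => profile z + t * (2 - z)) 1 :=
      continuousAt_profile_one.add (by fun_prop)
    have h1 : 0 < (fun z => profile z + t * (2 - z)) 1 := by
      beta_reduce
      linarith [quarter_le_profile_one, (abs_le.1 ht).1]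
    filter_upwards [hc.eventually (lt_mem_nhds h1)] with z hz using hz.le
  obtain ⟨hx, hcos⟩ := o.travelTime_spec hb0 hb' hz
  have hup := o.le_trial hb0 hb' (trialFunction_profile.add_mul trialFunction_two_sub (K * b)) hΛ.1
    hv (fun x hx => (hpos x hx).le) (near _ (by rw [abs_of_nonneg hKb]; linarith))
    (fun z hz => (hbar b ⟨hb0, hbb⟩ Λ hΛ hΛC z hz).1) _ hx
  have hlo := o.trial_le hb0 hb' (trialFunction_profile.add_mul trialFunction_two_sub (-(K * b))) hΛ.1
    hv (fun x hx => (hpos x hx).le) (near _ (by rw [abs_neg, abs_of_nonneg hKb]; linarith))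
    (fun z hz => (hbar b ⟨hb0, hbb⟩ Λ hΛ hΛC z hz).2) _ hx
  rw [trial, halfCos_of_le hx, hcos] at hup hlo
  have hg := (sqrt_speedSq_bounds hb0.le hb' (sq_le_one_of_mem hz)).1
  have hg0 : 0 < √(speedSq b z) := by linarith
  rw [← div_le_iff₀ (hpos _ hx)] at hup
  rw [← le_div_iff₀ (hpos _ hx)] at hlo
  rw [← div_le_iff₀' hg0] at hup
  rw [← le_div_iff₀' hg0] at hlo
  have hz0 := half_sqrt_two_bounds
  have hzK : K * b * (2 - z) ≤ K * b * 2 := mul_le_mul_of_nonneg_left (by linarith [hz.1]) hKb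
  rw [logDerivProfile, ← div_eq_mul_inv, abs_le]
  constructor <;> linarith

/-- Ground states for different parameters at vanishing forcing. -/
theorem exists_greatest_lt (C : ℝ) (hC : 0 ≤ C) : ∃ b₀ : ℝ, 0 < b₀ ∧ b₀ ≤ 1 / 1000 ∧
    ∀ a₁ a₂ : ℝ, 0 < a₁ ^ 2 / 12 → a₁ ^ 2 / 12 < a₂ ^ 2 / 12 → a₂ ^ 2 / 12 < b₀ →
    ∀ φ₁ φ₂ : ℝ → ℝ, IsKinkThrough a₁ 0 (π / 2) φ₁ → IsKinkThrough a₂ 0 (π / 2) φ₂ →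
    ∀ Λ₁ ∈ Icc (-1) 0, ∀ Λ₂ ∈ Icc (-1) 0, |Λ₁ - baseEigenvalue| ≤ C * (a₁ ^ 2 / 12) →
    |Λ₂ - baseEigenvalue| ≤ C * (a₂ ^ 2 / 12) →
    (∃ v w v' w' : ℝ → ℝ, GroundState a₁ 0 Λ₁ φ₁ v w v' w') → Λ₂ ∈ eigenvalues a₂ 0 φ₂ →
    Λ₂ < Λ₁ := by
  obtain ⟨K, b₀, hK, hb₀, hb₀', hprof⟩ := exists_logDerivProfile_bound C hC
  obtain ⟨b₁, hb₁, hb₁', hneg⟩ := exists_defect_neg K C hK hC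
  obtain ⟨B, -, hB⟩ := exists_profile_bounds
  refine ⟨min b₀ b₁, lt_min hb₀ hb₁, (min_le_left _ _).trans hb₀', ?_⟩
  rintro a₁ a₂ h0 h12 h2 φ₁ φ₂ hφ₁ hφ₂ Λ₁ hΛ₁ Λ₂ hΛ₂ hC₁ hC₂ ⟨v, w, v', w', g⟩ hmem
  by_contra hle
  push Not at hle
  have h2l := h2.trans_le (min_le_left _ _)
  have h2r := h2.trans_le (min_le_right _ _)
  have hb' : a₁ ^ 2 / 12 ≤ 1 / 1000 := by linarith
  have hm : a₁ ^ 2 / 12 ∈ Ioo 0 b₀ := ⟨h0, h12.trans h2l⟩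
  have oL := hφ₁.quarterTurn_left
  have oR := hφ₁.quarterTurn_right
  have cL := hprof _ hm Λ₁ hΛ₁ hC₁ 1 _ _ v w oL g.left g.pos_left
  have cR := hprof _ hm Λ₁ hΛ₁ hC₁ (-1) _ _ v' w' oR g.right g.pos_right
  have bd : ∀ n : ℝ → ℝ, (∀ z ∈ Ico (√2 / 2) 1, |n z - profile z| ≤ K * (a₁ ^ 2 / 12)) →
      ∃ K' : ℝ, ∀ z ∈ Ico (√2 / 2) 1, |n z| ≤ K' := fun n hn =>
    ⟨K * (a₁ ^ 2 / 12) + B, fun z hz => by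
      have h3 := abs_add_le (n z - profile z) (profile z)
      rw [sub_add_cancel] at h3
      linarith [hn z hz, (hB z (Ico_subset_Icc_self hz)).1]⟩
  obtain ⟨η, tL, dL⟩ := oL.trialFunction_logDerivProfile h0 hb' g.left g.pos_left hΛ₁.1 (bd _ cL)
  obtain ⟨η', tR, dR⟩ := oR.trialFunction_logDerivProfile h0 hb' g.right g.pos_right hΛ₁.1 (bd _ cR)
  set Δ := a₂ ^ 2 / 12 - a₁ ^ 2 / 12 with hΔ
  -- The trial functions at `a₂` are the exact logarithmic derivatives of the ground state at `a₁`
  -- plus `Δ * corrector`; if `Λ₂ ≥ Λ₁`, their defect is strictly negative.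
  refine not_mem_eigenvalues_of_defect_neg (h0.trans h12) (by linarith) hφ₂ hΛ₂.1
    (tL.add_mul trialFunction_corrector Δ) (tR.add_mul trialFunction_corrector Δ)
    (fun z hz hne => hneg _ _ h0 h12 h2r Λ₁ hΛ₁ Λ₂ hΛ₂ hC₁ hC₂ hle z (Ico_subset_Icc_self hz) _ _
      (cL z hz) (dL z ⟨lt_of_le_of_ne hz.1 hne.symm, hz.2⟩))
    (fun z hz hne => hneg _ _ h0 h12 h2r Λ₁ hΛ₁ Λ₂ hΛ₂ hC₁ hC₂ hle z (Ico_subset_Icc_self hz) _ _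
      (cR z hz) (dR z ⟨lt_of_le_of_ne hz.1 hne.symm, hz.2⟩)) ?_ hmem
  -- At the junction the corrections vanish and the logarithmic derivatives of the matched ground
  -- state cancel, so the sum condition holds with equality.
  rw [corrector_half, logDerivProfile, logDerivProfile, travelTime_half, ← g.eq, mul_zero, add_zero,
    add_zero, ← add_mul, ← add_div, g.sum, zero_div, zero_mul]

end PiKink
end

/-! ### The closed form of the slope and the assembly. -/

noncomputable section
namespace PiKink

/-- Numerator and denominator share the factor `(1 + √5) (99 - 70 √2)`, which is nonzero because
`99² = 9801` and `70² · 2 = 9800`. -/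
theorem Lambda1_eq : Lambda1 = -7 * √5 / 240 := by
  have h2 : √2 ^ 2 = 2 := Real.sq_sqrt (by norm_num)
  have h5 : √5 ^ 2 = 5 := Real.sq_sqrt (by norm_num)
  have h10 : √10 = √2 * √5 := by rw [← Real.sqrt_mul (by norm_num)]; norm_num
  have e : -70 * √10 - 350 * √2 + 495 + 99 * √5 = √5 * (1 + √5) * (99 - 70 * √2) := by
    rw [h10]; linear_combination (70 * √2 - 99) * h5
  have n5 : 0 < √5 := by positivity
  have n2 : 99 - 70 * √2 ≠ 0 := by
    intro h
    nlinarith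
  have n1 : 1 + √5 ≠ 0 := by positivity
  rw [Lambda1, e]
  field_simp
  linear_combination (-24576 * 7 * (99 - 70 * √2) * -1) * h5

theorem eigenvalueSlope_eq : eigenvalueSlope = 12 * Lambda1 := by
  rw [eigenvalueSlope, rate_sq, Lambda1_eq]; ring

theorem baseEigenvalue_eq : baseEigenvalue = -(√5 + 1) / 4 := by
  rw [baseEigenvalue, rate_sq]; ring

theorem abs_Lambda1_sub_lt : |Lambda1 - (-0.0652)| < 0.00005 := by
  have h1 : 2.236 < √5 := by rw [Real.lt_sqrt] <;> norm_num
  have h2 : √5 < 2.2361 := by rw [Real.sqrt_lt'] <;> norm_num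
  rw [Lambda1_eq, abs_lt]
  constructor <;> linarith

/-- The largest eigenvalue at vanishing forcing. -/
theorem exists_greatest_eigenvalue : ∃ a₀ : ℝ, 0 < a₀ ∧
    (∀ a ∈ Ioo 0 a₀, 0 < a ^ 2 / 12 ∧ a ^ 2 / 12 ≤ 1 / 1000) ∧ ∃ Λmax : ℝ → ℝ,
    (∀ a ∈ Ioo 0 a₀, ∀ φ : ℝ → ℝ, IsType1Kink a 0 φ →
      IsGreatest (eigenvalues a 0 φ) (Λmax a)) ∧
    StrictAntiOn Λmax (Ioo 0 a₀) ∧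
    ∃ C : ℝ, ∀ a ∈ Ioo 0 a₀, |Λmax a - (-(√5 + 1) / 4 + Lambda1 * a ^ 2)| ≤ C * a ^ 4 := by
  obtain ⟨K, b₀, hK, hb₀, hb₀', hexp⟩ := exists_eigenvalue_expansion
  -- The constant bounds the distance of the eigenvalue from the unperturbed one: `2` covers the
  -- slope and `K` the quadratic error, as `b² ≤ b`.
  obtain ⟨b₁, hb₁, hb₁', hlt⟩ := exists_greatest_lt (2 + K) (by linarith)
  set β := min b₀ b₁ with hβ
  have hβ0 : 0 < β := lt_min hb₀ hb₁
  have hsq : ∀ a ∈ Ioo 0 (min 1 β), 0 < a ^ 2 / 12 ∧ a ^ 2 / 12 < β := fun a ha => by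
    obtain ⟨h0, h1⟩ := ha
    obtain ⟨h2, h3⟩ := lt_min_iff.1 h1
    exact ⟨by positivity, by nlinarith⟩
  have hsq' : ∀ a ∈ Ioo 0 (min 1 β), 0 < a ^ 2 / 12 ∧ a ^ 2 / 12 ≤ 1 / 1000 := fun a ha =>
    ⟨(hsq a ha).1, ((hsq a ha).2.le.trans (min_le_left _ _)).trans hb₀'⟩
  have main : ∀ a : ℝ, ∃ Λ : ℝ, a ∈ Ioo 0 (min 1 β) → Λ ∈ Icc (-1) 0 ∧
      |Λ - (baseEigenvalue + eigenvalueSlope * (a ^ 2 / 12))| ≤ K * (a ^ 2 / 12) ^ 2 ∧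
      ∃ φ : ℝ → ℝ, IsType1Kink a 0 φ ∧ IsGreatest (eigenvalues a 0 φ) Λ ∧
        ∃ v w v' w' : ℝ → ℝ, GroundState a 0 Λ φ v w v' w' := fun a => by
    by_cases ha : a ∈ Ioo 0 (min 1 β)
    · obtain ⟨h1, h2⟩ := hsq' a ha
      obtain ⟨φ, hφ, -⟩ := existsUnique_isType1Kink h1 h2 ⟨le_rfl, (gammaCr_pos h1 h2).le⟩
      obtain ⟨hk, hj⟩ := hφ.isKinkThrough h1 h2
      obtain ⟨Λ, h3, h4, h5, h6⟩ := hexp a ⟨h1, (hsq a ha).2.trans_le (min_le_left _ _)⟩ φ hk hj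
      exact ⟨Λ, fun _ => ⟨h3, h4, φ, hφ, h5, h6⟩⟩
    · exact ⟨0, fun h => absurd h ha⟩
  choose Λmax hΛ using main
  have hnear : ∀ a ∈ Ioo 0 (min 1 β), |Λmax a - baseEigenvalue| ≤ (2 + K) * (a ^ 2 / 12) := by
    intro a ha
    obtain ⟨-, h, -⟩ := hΛ a ha
    obtain ⟨h1, h2⟩ := hsq' a ha
    generalize a ^ 2 / 12 = b at *
    have h3 := eigenvalueSlope_neg
    have h4 : -2 ≤ eigenvalueSlope := by rw [eigenvalueSlope]; linarith [rate_sq_bounds.1]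
    have h5 : -2 * b ≤ eigenvalueSlope * b := mul_le_mul_of_nonneg_right h4 h1.le
    have h6 : eigenvalueSlope * b ≤ 0 := mul_nonpos_of_nonpos_of_nonneg h3.le h1.le
    have h7 : K * b ^ 2 ≤ K * b := mul_le_mul_of_nonneg_left (by nlinarith) hK
    rw [abs_le] at *
    constructor <;> linarith
  refine ⟨min 1 β, lt_min one_pos hβ0, hsq', Λmax, fun a ha φ hφ => ?_,
    fun a₁ ha₁ a₂ ha₂ h12 => ?_, K / 144, fun a ha => ?_⟩
  · obtain ⟨-, -, ψ, hψ, hg, -⟩ := hΛ a ha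
    obtain ⟨h1, h2⟩ := hsq' a ha
    rwa [hφ.eq h1 h2 le_rfl hψ]
  · obtain ⟨m1, -, φ₁, hφ₁, -, g₁⟩ := hΛ a₁ ha₁
    obtain ⟨m2, -, φ₂, hφ₂, g₂, -⟩ := hΛ a₂ ha₂
    obtain ⟨p1, q1⟩ := hsq' a₁ ha₁
    obtain ⟨p2, q2⟩ := hsq' a₂ ha₂
    refine hlt a₁ a₂ p1 ?_ ((hsq a₂ ha₂).2.trans_le (min_le_right _ _)) φ₁ φ₂
      (hφ₁.isKinkThrough p1 q1).1 (hφ₂.isKinkThrough p2 q2).1 _ m1 _ m2 (hnear a₁ ha₁)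
      (hnear a₂ ha₂) g₁ g₂.1
    have := ha₁.1
    gcongr
  · obtain ⟨-, h, -⟩ := hΛ a ha
    rw [eigenvalueSlope_eq, baseEigenvalue_eq] at h
    have e1 : 12 * Lambda1 * (a ^ 2 / 12) = Lambda1 * a ^ 2 := by ring
    have e2 : K * (a ^ 2 / 12) ^ 2 = K / 144 * a ^ 4 := by ring
    rwa [e1, e2] at h

end PiKink
end

theorem lemma4p5 :
    |PiKink.Lambda1 - (-0.0652)| < 0.00005 ∧
    ∃ a₀ : ℝ, 0 < a₀ ∧
      (∀ a ∈ Ioo 0 a₀, 0 < PiKink.gammaCr a ∧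
        ∀ γ ∈ Icc 0 (PiKink.gammaCr a), ∃! φ : ℝ → ℝ, PiKink.IsType1Kink a γ φ) ∧
      (∀ a ∈ Ioo 0 a₀, ∀ γ ∈ Ico 0 (PiKink.gammaCr a), ∀ φ : ℝ → ℝ,
        PiKink.IsType1Kink a γ φ →
          ∃ Λ : ℝ, IsGreatest (PiKink.eigenvalues a γ φ) Λ ∧ Λ < 0) ∧
      (∀ a ∈ Ioo 0 a₀, ∀ φ : ℝ → ℝ, PiKink.IsType1Kink a (PiKink.gammaCr a) φ →
          IsGreatest (PiKink.eigenvalues a (PiKink.gammaCr a) φ) 0) ∧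
      ∃ Λmax : ℝ → ℝ,
        (∀ a ∈ Ioo 0 a₀, ∀ φ : ℝ → ℝ, PiKink.IsType1Kink a 0 φ →
          IsGreatest (PiKink.eigenvalues a 0 φ) (Λmax a)) ∧
        StrictAntiOn Λmax (Ioo 0 a₀) ∧
        ∃ C : ℝ, ∀ a ∈ Ioo 0 a₀,
          |Λmax a - (-(√5 + 1) / 4 + PiKink.Lambda1 * a ^ 2)| ≤ C * a ^ 4 := by
  obtain ⟨a₀, ha₀, hb, hΛ⟩ := PiKink.exists_greatest_eigenvalue
  exact ⟨PiKink.abs_Lambda1_sub_lt, a₀, ha₀,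
    fun a ha => ⟨PiKink.gammaCr_pos (hb a ha).1 (hb a ha).2,
      fun γ hγ => PiKink.existsUnique_isType1Kink (hb a ha).1 (hb a ha).2 hγ⟩,
    fun a ha γ hγ φ hφ => PiKink.exists_isGreatest_neg (hb a ha).1 (hb a ha).2 hγ hφ,
    fun a ha φ hφ => PiKink.isGreatest_zero_of_critical (hb a ha).1 (hb a ha).2 hφ, hΛ⟩
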